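/- **Theorem 6.2.** Let $p\ge 3$ be a prime, let $F$ be a finite extension of $\mathbb{Q}_p$ with ramification index $e$ and residue field $\overline F$, and let $p^w$ be the largest power of $p$ dividing $e$. Let $D$ be a finite-dimensional central division algebra over $F$ of degree $d$ (so $\dim_F D=d^2$), with ring of integers $O_D$ and a uniformizer $\pi$, and assume that $(p,d,|\overline F|)\neq(3,2,3)$. Let $G=SL_1(D)$ be the group of elements of reduced norm $1$ in $D$. For $k\ge 0$ let $$\mathfrak g_k=\{x\in\pi^kO_D:\ \mathrm{Trd}(x)=0\},$$ a Lie algebra over $\mathbb{Z}_p$ with bracket $[x,y]=xy-yx$, on which $G$ acts by $u^g=g^{-1}ug$; for $m\ge k$, $\mathfrak g_m$ is an ideal of $\mathfrak g_k$. Let $\mathfrak a=\mathbb{Z}/p^s\mathbb{Z}$ for some $s$, considered as an abelian $\mathbb{Z}_p$-Lie algebra with trivial $G$-action. For a $\mathbb{Z}_p$-Lie algebra $\mathfrak h$ let $H^2(\mathfrak h,\mathfrak a)$ be the group of equivalence classes of central extensions $0\to\mathfrak a\to\widehat{\mathfrak h}\to\mathfrak h\to0$ of $\mathbb{Z}_p$-Lie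 algebras under the Baer sum; restriction to a subalgebra and inflation from a quotient algebra are given by pullback of extensions. If $G$ acts on $\mathfrak h$ by Lie algebra automorphisms, a class is called $G$-equivariant if it is represented by an extension such that $G$ acts on $\widehat{\mathfrak h}$ by Lie algebra automorphisms compatible with the given action on $\mathfrak h$ and with the trivial action on $\mathfrak a$. Let $n\equiv l\equiv 1 \pmod d$ with $l>2n$, let $c\in H^2(\mathfrak g_n,\mathfrak a)$ be $G$-equivariant, and let $c_1$ be the restriction of $c$ to $\mathfrak g_l$. Then $c_1$ has order at most $p^{w+1}$ in $H^2(\mathfrak g_l,\mathfrak a)$. Furthermore, for every $m\ge l+(w+1)de$ there exists $c_2\in H^2(\mathfrak g_l/\mathfrak g_m,\mathfrak a)$ of order at most $p^{w+1}$ whose inflation to $\mathfrak g_l$ is $c_1$. -/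

import Mathlib

universe u v w

section CentralExtensions

variable (R : Type w) [CommRing R] (A : Type v) [AddCommGroup A] [Module R A]
  (H : Type u) [LieRing H] [LieAlgebra R H]

/-- A central extension `0 → A → L → H → 0` of Lie algebras over `R`, where the `R`-module `A` is
regarded as an abelian Lie algebra (that `incl` respects brackets follows from `central`). -/
structure CentralExtension where
  L : Type (max u v)
  [lieRing : LieRing L]
  [lieAlgebra : LieAlgebra R L]
  incl : A →ₗ[R] L
  proj : L →ₗ⁅R⁆ H
  incl_injective : Function.Injective incl
  proj_surjective : Function.Surjective proj
  exact : ∀ x : L, proj x = 0 ↔ ∃ a, incl a = x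
  central : ∀ (a : A) (x : L), ⁅incl a, x⁆ = 0

attribute [instance] CentralExtension.lieRing CentralExtension.lieAlgebra

namespace CentralExtension

variable {R A H}

lemma proj_incl (E : CentralExtension R A H) (a : A) : E.proj (E.incl a) = 0 :=
  (E.exact _).2 ⟨a, rfl⟩

lemma central' (E : CentralExtension R A H) (a : A) (x : E.L) : ⁅x, E.incl a⁆ = 0 := by
  rw [← lie_skew, E.central, neg_zero]

/-- Equivalence of central extensions: an isomorphism of the middle terms which is the identity on
`A` and on `H`. -/
def Equivalent (E₁ E₂ : CentralExtension R A H) : Prop :=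
  ∃ α : E₁.L ≃ₗ⁅R⁆ E₂.L, (∀ a, α (E₁.incl a) = E₂.incl a) ∧ ∀ x, E₂.proj (α x) = E₁.proj x

/-- A homomorphism of extensions which is the identity on `A` and on `H` is an equivalence. -/
lemma equivalent_of_hom {E₁ E₂ : CentralExtension R A H} (α : E₁.L →ₗ⁅R⁆ E₂.L)
    (h₁ : ∀ a, α (E₁.incl a) = E₂.incl a) (h₂ : ∀ x, E₂.proj (α x) = E₁.proj x) :
    Equivalent E₁ E₂ := by
  have hb : Function.Bijective α := by
    constructor
    · rw [injective_iff_map_eq_zero]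
      intro x hx
      have hp : E₁.proj x = 0 := by rw [← h₂, hx, map_zero]
      obtain ⟨a, rfl⟩ := (E₁.exact x).1 hp
      rw [h₁] at hx
      rw [E₂.incl_injective (hx.trans (map_zero _).symm), map_zero]
    · intro y
      obtain ⟨x, hx⟩ := E₁.proj_surjective (E₂.proj y)
      have hp : E₂.proj (y - α x) = 0 := by rw [map_sub, h₂, hx, sub_self]
      obtain ⟨a, ha⟩ := (E₂.exact _).1 hp
      exact ⟨x + E₁.incl a, by rw [map_add, h₁, ha]; abel⟩
  exact ⟨LieEquiv.ofBijective α hb, h₁, h₂⟩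

/-- Two extensions admitting a common cover `T`, compatible with the inclusions and the
projections, are equivalent. -/
lemma equivalent_of_cover {E₁ E₂ : CentralExtension R A H} {T : Type*} [LieRing T]
    [LieAlgebra R T] (s : T →ₗ⁅R⁆ E₁.L) (t : T →ₗ⁅R⁆ E₂.L) (hs : Function.Surjective s)
    (hst : ∀ z, s z = 0 → t z = 0) (hp : ∀ z, E₂.proj (t z) = E₁.proj (s z))
    (hi : ∀ a, ∃ z, s z = E₁.incl a ∧ t z = E₂.incl a) : Equivalent E₁ E₂ := by
  have key : ∀ z z', s z = s z' → t z = t z' := by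
    intro z z' h
    rw [← sub_eq_zero, ← map_sub]
    exact hst _ (by rw [map_sub, h, sub_self])
  choose g hg using hs
  have hgt : ∀ z, t (g (s z)) = t z := fun z => key _ _ (hg _)
  let α : E₁.L →ₗ⁅R⁆ E₂.L :=
    { toFun := fun x => t (g x)
      map_add' := fun x y => by
        rw [← map_add]; exact key _ _ (by rw [hg, map_add, hg, hg])
      map_smul' := fun r x => by
        rw [RingHom.id_apply, ← map_smul]; exact key _ _ (by rw [hg, map_smul, hg])
      map_lie' := fun {x y} => by
        rw [← LieHom.map_lie]; exact key _ _ (by rw [hg, LieHom.map_lie, hg, hg]) }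
  refine equivalent_of_hom α (fun a => ?_) (fun x => ?_)
  · obtain ⟨z, hz, hz'⟩ := hi a
    change t (g _) = _
    rw [← hz, hgt, hz']
  · change E₂.proj (t (g x)) = _
    rw [hp, hg]

lemma Equivalent.refl (E : CentralExtension R A H) : Equivalent E E :=
  ⟨LieEquiv.refl, fun _ => rfl, fun _ => rfl⟩

lemma Equivalent.symm {E₁ E₂ : CentralExtension R A H} (h : Equivalent E₁ E₂) :
    Equivalent E₂ E₁ := by
  obtain ⟨α, h₁, h₂⟩ := h
  refine ⟨α.symm, fun a => ?_, fun x => ?_⟩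
  · rw [← h₁, LieEquiv.symm_apply_apply]
  · rw [← h₂, LieEquiv.apply_symm_apply]

lemma Equivalent.trans {E₁ E₂ E₃ : CentralExtension R A H} (h : Equivalent E₁ E₂)
    (h' : Equivalent E₂ E₃) : Equivalent E₁ E₃ := by
  obtain ⟨α, h₁, h₂⟩ := h
  obtain ⟨β, h₃, h₄⟩ := h'
  exact ⟨α.trans β, fun a => by rw [LieEquiv.trans_apply, h₁, h₃],
    fun x => by rw [LieEquiv.trans_apply, h₄, h₂]⟩

variable (R A H) in
instance setoid : Setoid (CentralExtension R A H) where
  r := Equivalent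
  iseqv := ⟨Equivalent.refl, Equivalent.symm, Equivalent.trans⟩

/-! ### Pullback -/

section Pullback

variable {K : Type u} [LieRing K] [LieAlgebra R K]

/-- The fibre product `{(x, y) ∈ L × K : φ(x) = f(y)}`. -/
def fibreProduct {L : Type*} [LieRing L] [LieAlgebra R L] {K' : Type*} [LieRing K']
    [LieAlgebra R K'] (φ : L →ₗ⁅R⁆ H) (f : K' →ₗ⁅R⁆ H) : LieSubalgebra R (L × K') where
  carrier := {z | φ z.1 = f z.2}
  add_mem' := by
    intro a b ha hb
    simp only [Set.mem_ofPred_eq, Prod.fst_add, Prod.snd_add, map_add] at *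
    rw [ha, hb]
  zero_mem' := by simp
  smul_mem' := by
    intro c x hx
    simp only [Set.mem_ofPred_eq, Prod.smul_fst, Prod.smul_snd, map_smul] at *
    rw [hx]
  lie_mem' := by
    intro a b ha hb
    change φ a.1 = f a.2 at ha
    change φ b.1 = f b.2 at hb
    change φ ⁅a.1, b.1⁆ = f ⁅a.2, b.2⁆
    rw [LieHom.map_lie, LieHom.map_lie, ha, hb]

/-- The pullback of a central extension of `H` along a homomorphism `f : K → H`. -/
def pullback (f : K →ₗ⁅R⁆ H) (E : CentralExtension R A H) : CentralExtension R A K where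
  L := fibreProduct E.proj f
  incl :=
    { toFun := fun a => ⟨(E.incl a, 0), by
        change E.proj (E.incl a) = f 0
        rw [E.proj_incl, map_zero]⟩
      map_add' := fun a b => by ext <;> simp
      map_smul' := fun r a => by ext <;> simp }
  proj := (LieHom.snd R E.L K).comp (fibreProduct E.proj f).incl
  incl_injective := fun a b h => E.incl_injective (congrArg (fun z => z.1.1) h)
  proj_surjective := fun y => by
    obtain ⟨x, hx⟩ := E.proj_surjective (f y)
    exact ⟨⟨(x, y), hx⟩, rfl⟩
  exact := by
    rintro ⟨⟨x, y⟩, h⟩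
    change E.proj x = f y at h
    constructor
    · intro hy
      change y = 0 at hy
      subst hy
      rw [map_zero] at h
      obtain ⟨a, rfl⟩ := (E.exact x).1 h
      exact ⟨a, rfl⟩
    · rintro ⟨a, ha⟩
      exact (congrArg (fun z => z.1.2) ha).symm
  central := by
    rintro a ⟨⟨x, y⟩, h⟩
    apply Subtype.ext
    change ((⁅E.incl a, x⁆, ⁅(0 : K), y⁆) : E.L × K) = 0
    rw [E.central, zero_lie]
    rfl

lemma pullback_congr (f : K →ₗ⁅R⁆ H) {E₁ E₂ : CentralExtension R A H} (h : Equivalent E₁ E₂) :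
    Equivalent (pullback f E₁) (pullback f E₂) := by
  obtain ⟨α, h₁, h₂⟩ := h
  refine equivalent_of_hom (E₁ := pullback f E₁) (E₂ := pullback f E₂)
    { toFun := fun z => ⟨(α z.1.1, z.1.2), by
        change E₂.proj (α z.1.1) = f z.1.2
        rw [h₂]; exact z.2⟩
      map_add' := fun a b => Subtype.ext (Prod.ext (map_add α _ _) rfl)
      map_smul' := fun r a => Subtype.ext (Prod.ext (map_smul α _ _) rfl)
      map_lie' := fun {a b} => Subtype.ext (Prod.ext (LieEquiv.map_lie α _ _) rfl) } ?_ ?_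
  · intro a
    exact Subtype.ext (Prod.ext (h₁ a) rfl)
  · intro x
    rfl

end Pullback

/-! ### Baer sum -/

/-- The ideal `{(ι₁(a), -ι₂(a)) : a ∈ A}` of the fibre product of two central extensions. -/
def baerIdeal (E₁ E₂ : CentralExtension R A H) :
    LieIdeal R (fibreProduct E₁.proj E₂.proj) where
  carrier := {z | ∃ a, z.1 = (E₁.incl a, -E₂.incl a)}
  add_mem' := by
    rintro x y ⟨a, ha⟩ ⟨b, hb⟩
    refine ⟨a + b, ?_⟩
    change x.1 + y.1 = _
    rw [ha, hb, map_add, map_add, neg_add]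
    rfl
  zero_mem' := ⟨0, by rw [map_zero, map_zero, neg_zero]; rfl⟩
  smul_mem' := by
    rintro r x ⟨a, ha⟩
    refine ⟨r • a, ?_⟩
    change r • x.1 = _
    rw [ha, map_smul, map_smul, ← smul_neg]
    rfl
  lie_mem := by
    rintro x y ⟨a, ha⟩
    refine ⟨0, ?_⟩
    change ((⁅x.1.1, y.1.1⁆, ⁅x.1.2, y.1.2⁆) : E₁.L × E₂.L) = _
    rw [ha, lie_neg, E₁.central', E₂.central', map_zero, map_zero]

/-- The projection from the fibre product of two extensions onto its quotient. -/
def baerMk (E₁ E₂ : CentralExtension R A H) :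
    fibreProduct E₁.proj E₂.proj →ₗ⁅R⁆ fibreProduct E₁.proj E₂.proj ⧸ baerIdeal E₁ E₂ where
  toFun := fun z => LieSubmodule.Quotient.mk z
  map_add' := fun _ _ => rfl
  map_smul' := fun _ _ => rfl
  map_lie' := fun {_ _} => rfl

lemma baerMk_surjective (E₁ E₂ : CentralExtension R A H) : Function.Surjective (baerMk E₁ E₂) :=
  Quot.mk_surjective

lemma baerMk_eq_zero (E₁ E₂ : CentralExtension R A H) (z) :
    baerMk E₁ E₂ z = 0 ↔ ∃ a, z.1 = (E₁.incl a, -E₂.incl a) :=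
  LieSubmodule.Quotient.mk_eq_zero'

/-- The map induced on the quotient by the common projection `(x₁, x₂) ↦ φ₁(x₁) = φ₂(x₂)`. -/
def baerProj (E₁ E₂ : CentralExtension R A H) :
    (fibreProduct E₁.proj E₂.proj ⧸ baerIdeal E₁ E₂) →ₗ⁅R⁆ H where
  toLinearMap := (baerIdeal E₁ E₂).toSubmodule.liftQ
    (E₁.proj.toLinearMap ∘ₗ LinearMap.fst R E₁.L E₂.L ∘ₗ
      (fibreProduct E₁.proj E₂.proj).toSubmodule.subtype) (by
        rintro z ⟨a, ha⟩
        change E₁.proj z.1.1 = 0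
        rw [ha]
        exact E₁.proj_incl a)
  map_lie' := by
    intro x y
    obtain ⟨x, rfl⟩ := baerMk_surjective E₁ E₂ x
    obtain ⟨y, rfl⟩ := baerMk_surjective E₁ E₂ y
    exact LieHom.map_lie E₁.proj x.1.1 y.1.1

/-- The Baer sum of two central extensions. -/
def baerSum (E₁ E₂ : CentralExtension R A H) : CentralExtension R A H where
  L := fibreProduct E₁.proj E₂.proj ⧸ baerIdeal E₁ E₂
  incl :=
    { toFun := fun a => baerMk E₁ E₂ ⟨(E₁.incl a, 0), by
        change E₁.proj (E₁.incl a) = E₂.proj 0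
        rw [E₁.proj_incl, map_zero]⟩
      map_add' := fun a b => by
        rw [← map_add]
        exact congrArg _ (Subtype.ext (Prod.ext (map_add _ _ _) (add_zero _).symm))
      map_smul' := fun r a => by
        rw [← map_smul]
        exact congrArg _ (Subtype.ext (Prod.ext (map_smul _ _ _) (smul_zero _).symm)) }
  proj := baerProj E₁ E₂
  incl_injective := by
    rw [injective_iff_map_eq_zero]
    intro a ha
    obtain ⟨b, hb⟩ := (baerMk_eq_zero E₁ E₂ _).1 ha
    have h₁ : E₁.incl a = E₁.incl b := congrArg Prod.fst hb
    have h₂ : (0 : E₂.L) = -E₂.incl b := congrArg Prod.snd hb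
    rw [E₁.incl_injective h₁]
    exact E₂.incl_injective (by rw [map_zero, ← neg_eq_zero, ← h₂])
  proj_surjective := fun h => by
    obtain ⟨x, hx⟩ := E₁.proj_surjective h
    obtain ⟨y, hy⟩ := E₂.proj_surjective h
    exact ⟨baerMk E₁ E₂ ⟨(x, y), hx.trans hy.symm⟩, hx⟩
  exact := by
    intro z
    obtain ⟨⟨⟨x, y⟩, h⟩, rfl⟩ := baerMk_surjective E₁ E₂ z
    change E₁.proj x = E₂.proj y at h
    constructor
    · intro hx
      change E₁.proj x = 0 at hx
      obtain ⟨a, rfl⟩ := (E₁.exact x).1 hx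
      obtain ⟨b, rfl⟩ := (E₂.exact y).1 (h.symm.trans hx)
      refine ⟨a + b, ?_⟩
      change baerMk E₁ E₂ _ = baerMk E₁ E₂ _
      rw [← sub_eq_zero, ← map_sub, baerMk_eq_zero]
      refine ⟨b, ?_⟩
      change ((E₁.incl (a + b) - E₁.incl a, 0 - E₂.incl b) : E₁.L × E₂.L) = _
      rw [map_add, add_sub_cancel_left, zero_sub]
    · rintro ⟨a, ha⟩
      rw [← ha]
      exact E₁.proj_incl a
  central := by
    intro a z
    obtain ⟨⟨⟨x, y⟩, h⟩, rfl⟩ := baerMk_surjective E₁ E₂ z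
    change ⁅baerMk E₁ E₂ _, baerMk E₁ E₂ _⁆ = 0
    rw [← LieHom.map_lie, baerMk_eq_zero]
    refine ⟨0, ?_⟩
    change ((⁅E₁.incl a, x⁆, ⁅(0 : E₂.L), y⁆) : E₁.L × E₂.L) = _
    rw [E₁.central, zero_lie, map_zero, map_zero, neg_zero]

/-- To give an equivalence from a Baer sum, it suffices to give a map on the fibre product. -/
lemma baerSum_equivalent_of {E₁ E₂ E₃ : CentralExtension R A H}
    (f : fibreProduct E₁.proj E₂.proj →ₗ⁅R⁆ E₃.L)
    (hp : ∀ z, E₃.proj (f z) = E₁.proj z.1.1)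
    (hi : ∀ z a b, z.1 = (E₁.incl a, E₂.incl b) → f z = E₃.incl (a + b)) :
    Equivalent (baerSum E₁ E₂) E₃ := by
  refine equivalent_of_cover (E₁ := baerSum E₁ E₂) (baerMk E₁ E₂) f (baerMk_surjective E₁ E₂)
    ?_ hp ?_
  · intro z hz
    obtain ⟨a, ha⟩ := (baerMk_eq_zero E₁ E₂ z).1 hz
    rw [hi z a (-a) (by rw [ha, map_neg]), add_neg_cancel, map_zero]
  · intro a
    refine ⟨⟨(E₁.incl a, 0), by
        change E₁.proj (E₁.incl a) = E₂.proj 0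
        rw [E₁.proj_incl, map_zero]⟩, rfl, ?_⟩
    rw [hi _ a 0 (Prod.ext rfl (map_zero E₂.incl).symm), add_zero]

lemma baerMk_incl (E₁ E₂ : CentralExtension R A H) (z : fibreProduct E₁.proj E₂.proj) (a b : A)
    (h : z.1 = (E₁.incl a, E₂.incl b)) : baerMk E₁ E₂ z = (baerSum E₁ E₂).incl (a + b) := by
  change _ = baerMk E₁ E₂ _
  rw [← sub_eq_zero, ← map_sub, baerMk_eq_zero]
  refine ⟨-b, ?_⟩
  change z.1 - (E₁.incl (a + b), (0 : E₂.L)) = _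
  rw [h, map_add, map_neg, map_neg, neg_neg]
  ext <;> simp

lemma baerSum_congr {E₁ E₁' E₂ E₂' : CentralExtension R A H} (h : Equivalent E₁ E₁')
    (h' : Equivalent E₂ E₂') : Equivalent (baerSum E₁ E₂) (baerSum E₁' E₂') := by
  obtain ⟨α, h₁, h₂⟩ := h
  obtain ⟨β, h₃, h₄⟩ := h'
  let f : fibreProduct E₁.proj E₂.proj →ₗ⁅R⁆ fibreProduct E₁'.proj E₂'.proj :=
    { toFun := fun z => ⟨(α z.1.1, β z.1.2), by
        change E₁'.proj (α z.1.1) = E₂'.proj (β z.1.2)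
        rw [h₂, h₄]; exact z.2⟩
      map_add' := fun a b => Subtype.ext (Prod.ext (map_add α _ _) (map_add β _ _))
      map_smul' := fun r a => Subtype.ext (Prod.ext (map_smul α _ _) (map_smul β _ _))
      map_lie' := fun {a b} => Subtype.ext
        (Prod.ext (LieEquiv.map_lie α _ _) (LieEquiv.map_lie β _ _)) }
  refine baerSum_equivalent_of (E₃ := baerSum E₁' E₂') ((baerMk E₁' E₂').comp f) ?_ ?_
  · intro z
    exact h₂ z.1.1
  · intro z a b hz
    refine baerMk_incl _ _ _ _ _ ?_
    change (α z.1.1, β z.1.2) = _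
    rw [hz, h₁, h₃]

lemma baerSum_comm (E₁ E₂ : CentralExtension R A H) :
    Equivalent (baerSum E₁ E₂) (baerSum E₂ E₁) := by
  let f : fibreProduct E₁.proj E₂.proj →ₗ⁅R⁆ fibreProduct E₂.proj E₁.proj :=
    { toFun := fun z => ⟨(z.1.2, z.1.1), z.2.symm⟩
      map_add' := fun a b => rfl
      map_smul' := fun r a => rfl
      map_lie' := fun {a b} => rfl }
  refine baerSum_equivalent_of (E₃ := baerSum E₂ E₁) ((baerMk E₂ E₁).comp f) ?_ ?_
  · intro z
    exact z.2.symm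
  · intro z a b hz
    rw [add_comm]
    refine baerMk_incl _ _ _ _ _ ?_
    change (z.1.2, z.1.1) = _
    rw [hz]

lemma baerSum_assoc (E₁ E₂ E₃ : CentralExtension R A H) :
    Equivalent (baerSum (baerSum E₁ E₂) E₃) (baerSum E₁ (baerSum E₂ E₃)) := by
  let T := fibreProduct (E₁.proj.comp ((LieHom.fst R E₁.L E₂.L).comp
    (fibreProduct E₁.proj E₂.proj).incl)) E₃.proj
  let s : T →ₗ⁅R⁆ (baerSum (baerSum E₁ E₂) E₃).L :=
    (baerMk (baerSum E₁ E₂) E₃).comp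
      { toFun := fun z => ⟨(baerMk E₁ E₂ z.1.1, z.1.2), z.2⟩
        map_add' := fun a b => rfl
        map_smul' := fun r a => rfl
        map_lie' := fun {a b} => rfl }
  have hq : ∀ z : T, E₂.proj z.1.1.1.2 = E₃.proj z.1.2 := fun z =>
    (Eq.symm z.1.1.2).trans z.2
  let t : T →ₗ⁅R⁆ (baerSum E₁ (baerSum E₂ E₃)).L :=
    (baerMk E₁ (baerSum E₂ E₃)).comp
      { toFun := fun z => ⟨(z.1.1.1.1, baerMk E₂ E₃ ⟨(z.1.1.1.2, z.1.2), hq z⟩), z.1.1.2⟩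
        map_add' := fun a b => rfl
        map_smul' := fun r a => rfl
        map_lie' := fun {a b} => rfl }
  refine equivalent_of_cover s t ?_ ?_ ?_ ?_
  · intro x
    obtain ⟨⟨⟨x, y⟩, h⟩, rfl⟩ := baerMk_surjective (baerSum E₁ E₂) E₃ x
    obtain ⟨x, rfl⟩ := baerMk_surjective E₁ E₂ x
    exact ⟨⟨(x, y), h⟩, rfl⟩
  · rintro ⟨⟨⟨⟨x₁, x₂⟩, h⟩, x₃⟩, h'⟩ hz
    obtain ⟨a, ha⟩ := (baerMk_eq_zero (baerSum E₁ E₂) E₃ _).1 hz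
    have ha₁ : baerMk E₁ E₂ ⟨(x₁, x₂), h⟩ = (baerSum E₁ E₂).incl a := congrArg Prod.fst ha
    have ha₂ : x₃ = -E₃.incl a := congrArg Prod.snd ha
    change _ = baerMk E₁ E₂ _ at ha₁
    rw [← sub_eq_zero, ← map_sub, baerMk_eq_zero] at ha₁
    obtain ⟨b, hb⟩ := ha₁
    have hb₁ : x₁ - E₁.incl a = E₁.incl b := congrArg Prod.fst hb
    have hb₂ : x₂ - 0 = -E₂.incl b := congrArg Prod.snd hb
    rw [sub_zero] at hb₂
    rw [sub_eq_iff_eq_add] at hb₁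
    refine (baerMk_eq_zero E₁ (baerSum E₂ E₃) _).2 ⟨b + a, ?_⟩
    change (x₁, baerMk E₂ E₃ _) = _
    rw [baerMk_incl E₂ E₃ _ (-b) (-a) (by
      change (x₂, x₃) = _
      rw [ha₂, hb₂, map_neg, map_neg]), hb₁, ← neg_add]
    exact Prod.ext (map_add E₁.incl b a).symm (map_neg (baerSum E₂ E₃).incl (b + a))
  · intro z
    rfl
  · intro a
    refine ⟨⟨(⟨(E₁.incl a, 0), ?_⟩, 0), ?_⟩, rfl, ?_⟩
    · change E₁.proj (E₁.incl a) = E₂.proj 0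
      rw [E₁.proj_incl, map_zero]
    · change E₁.proj (E₁.incl a) = E₃.proj 0
      rw [E₁.proj_incl, map_zero]
    · rfl

/-- The Lie algebra `H ⊕ A` with bracket `[(h₁, a₁), (h₂, a₂)] = ([h₁, h₂], 0)`. -/
def SplitCarrier (A : Type v) (H : Type u) : Type (max u v) := H × A

instance : AddCommGroup (SplitCarrier A H) := inferInstanceAs (AddCommGroup (H × A))
instance : Module R (SplitCarrier A H) := inferInstanceAs (Module R (H × A))

instance : LieRing (SplitCarrier A H) where
  bracket x y := (⁅x.1, y.1⁆, 0)
  add_lie x y z := Prod.ext (add_lie x.1 y.1 z.1) (add_zero _).symm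
  lie_add x y z := Prod.ext (lie_add x.1 y.1 z.1) (add_zero _).symm
  lie_self x := Prod.ext (lie_self x.1) rfl
  leibniz_lie x y z := Prod.ext (leibniz_lie x.1 y.1 z.1) (add_zero _).symm

instance : LieAlgebra R (SplitCarrier A H) where
  lie_smul r x y := Prod.ext (lie_smul r x.1 y.1) (smul_zero _).symm

variable (R A H) in
/-- The split extension `H ⊕ A`. -/
def split : CentralExtension R A H where
  L := SplitCarrier A H
  incl := LinearMap.inr R H A
  proj := { LinearMap.fst R H A with map_lie' := fun {_ _} => rfl }
  incl_injective := LinearMap.inr_injective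
  proj_surjective := fun h => ⟨(h, 0), rfl⟩
  exact := by
    rintro ⟨h, a⟩
    constructor
    · intro hh
      change h = 0 at hh
      exact ⟨a, by rw [hh]; rfl⟩
    · rintro ⟨b, hb⟩
      exact (congrArg Prod.fst hb).symm
  central := fun a x => Prod.ext (zero_lie x.1) rfl

lemma split_baerSum (E : CentralExtension R A H) : Equivalent (baerSum (split R A H) E) E := by
  refine baerSum_equivalent_of
    { toFun := fun z => z.1.2 + E.incl z.1.1.2
      map_add' := fun x y => by
        change x.1.2 + y.1.2 + E.incl (x.1.1.2 + y.1.1.2) = _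
        rw [map_add]; abel
      map_smul' := fun r x => by
        change r • x.1.2 + E.incl (r • x.1.1.2) = _
        rw [map_smul, ← smul_add]; rfl
      map_lie' := fun {x y} => by
        change ⁅x.1.2, y.1.2⁆ + E.incl 0 = ⁅x.1.2 + _, y.1.2 + _⁆
        rw [map_zero, add_zero, add_lie, lie_add, lie_add, E.central, E.central, E.central',
          add_zero, add_zero, add_zero] } ?_ ?_
  · intro z
    change E.proj (z.1.2 + E.incl z.1.1.2) = _
    rw [map_add, E.proj_incl, add_zero]
    exact z.2.symm
  · intro z a b hz
    change z.1.2 + E.incl z.1.1.2 = _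
    rw [hz, map_add, add_comm]
    rfl

/-- The inverse of a central extension: the same extension with the inclusion `a ↦ -ι(a)`. -/
def neg (E : CentralExtension R A H) : CentralExtension R A H where
  L := E.L
  incl := -E.incl
  proj := E.proj
  incl_injective := fun a b h => E.incl_injective (neg_injective h)
  proj_surjective := E.proj_surjective
  exact := fun x => by
    rw [E.exact]
    constructor
    · rintro ⟨a, rfl⟩; exact ⟨-a, by simp⟩
    · rintro ⟨a, rfl⟩; exact ⟨-a, by simp⟩
  central := fun a x => by
    rw [LinearMap.neg_apply, neg_lie, E.central, neg_zero]

lemma neg_congr {E₁ E₂ : CentralExtension R A H} (h : Equivalent E₁ E₂) :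
    Equivalent (neg E₁) (neg E₂) := by
  obtain ⟨α, h₁, h₂⟩ := h
  refine ⟨α, fun a => ?_, h₂⟩
  change α (-E₁.incl a) = -E₂.incl a
  rw [map_neg, h₁]

lemma neg_baerSum (E : CentralExtension R A H) :
    Equivalent (baerSum (neg E) E) (split R A H) := by
  let p : fibreProduct (neg E).proj E.proj → E.L := fun z => z.1.1
  let q : fibreProduct (neg E).proj E.proj → E.L := fun z => z.1.2
  have hex : ∀ z, ∃ a, E.incl a = q z - p z := by
    intro z
    refine (E.exact _).1 ?_
    rw [map_sub, sub_eq_zero]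
    exact z.2.symm
  choose g hg using hex
  refine baerSum_equivalent_of
    { toFun := fun z => (E.proj (p z), g z)
      map_add' := fun x y => Prod.ext (map_add E.proj _ _) (E.incl_injective (by
        change E.incl (g _) = E.incl (g _ + g _)
        rw [map_add, hg, hg, hg]
        change q x + q y - (p x + p y) = _
        abel))
      map_smul' := fun r x => Prod.ext (map_smul E.proj _ _) (E.incl_injective (by
        change E.incl (g _) = E.incl (r • g _)
        rw [map_smul, hg, hg]
        exact (smul_sub r (q x) (p x)).symm))
      map_lie' := fun {x y} => Prod.ext (LieHom.map_lie E.proj _ _) (E.incl_injective (by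
        change E.incl (g _) = E.incl 0
        rw [hg, map_zero]
        change ⁅q x, q y⁆ - ⁅p x, p y⁆ = 0
        have hx : q x = p x + E.incl (g x) := by rw [hg]; abel
        have hy : q y = p y + E.incl (g y) := by rw [hg]; abel
        rw [hx, hy, add_lie, lie_add, lie_add, E.central, E.central, E.central']
        abel)) } ?_ ?_
  · intro z
    rfl
  · intro z a b hz
    have h₁ : p z = -E.incl a := congrArg Prod.fst hz
    have h₂ : q z = E.incl b := congrArg Prod.snd hz
    refine Prod.ext ?_ (E.incl_injective ?_)
    · change E.proj (p z) = 0
      rw [h₁, map_neg, E.proj_incl, neg_zero]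
    · change E.incl (g z) = E.incl (a + b)
      rw [hg, h₁, h₂, map_add]
      abel

end CentralExtension

/-- The second cohomology group `H²(H, A)` of the Lie algebra `H` over `R` with coefficients in the
trivial module `A`: equivalence classes of central extensions of `H` by `A`. -/
def LieH2 : Type (max (max u v + 1) w) := Quotient (CentralExtension.setoid R A H)

namespace LieH2

open CentralExtension

variable {R A H}

/-- The class of a central extension. -/
def mk (E : CentralExtension R A H) : LieH2 R A H := Quotient.mk _ E

/-- The addition is the Baer sum. -/
instance : Add (LieH2 R A H) := ⟨Quotient.map₂ baerSum fun _ _ h _ _ h' => baerSum_congr h h'⟩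
instance : Zero (LieH2 R A H) := ⟨mk (split R A H)⟩
instance : Neg (LieH2 R A H) := ⟨Quotient.map neg fun _ _ h => neg_congr h⟩

instance : AddGroup (LieH2 R A H) := AddGroup.ofLeftAxioms
  (by
    rintro ⟨a⟩ ⟨b⟩ ⟨c⟩
    exact Quotient.sound (baerSum_assoc a b c))
  (by
    rintro ⟨a⟩
    exact Quotient.sound (split_baerSum a))
  (by
    rintro ⟨a⟩
    exact Quotient.sound (neg_baerSum a))

instance : AddCommGroup (LieH2 R A H) where
  add_comm := by
    rintro ⟨a⟩ ⟨b⟩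
    exact Quotient.sound (baerSum_comm a b)

/-- The map `H²(H, A) → H²(K, A)` induced by a homomorphism `f : K → H`. -/
def pullback {K : Type u} [LieRing K] [LieAlgebra R K] (f : K →ₗ⁅R⁆ H) :
    LieH2 R A H → LieH2 R A K :=
  Quotient.map (CentralExtension.pullback f) fun _ _ h => pullback_congr f h

/-- The restriction `H²(N', A) → H²(N, A)` for Lie subalgebras `N ⊆ N'`. For an extension
`φ : L → N'` the pullback along the inclusion of `N` is the extension `φ⁻¹(N) → N`. -/
def restrict {M : Type u} [LieRing M] [LieAlgebra R M] {N N' : LieSubalgebra R M} (h : N ≤ N') :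
    LieH2 R A N' → LieH2 R A N :=
  pullback (LieSubalgebra.inclusion h)

/-- The quotient homomorphism `H → H/I`. -/
def quotientMap (I : LieIdeal R H) : H →ₗ⁅R⁆ H ⧸ I where
  toFun := fun x => LieSubmodule.Quotient.mk x
  map_add' := fun _ _ => rfl
  map_smul' := fun _ _ => rfl
  map_lie' := fun {_ _} => rfl

/-- The inflation `H²(H/I, A) → H²(H, A)`, for an ideal `I` of `H`. -/
def inflate (I : LieIdeal R H) : LieH2 R A (H ⧸ I) → LieH2 R A H :=
  pullback (quotientMap I)

end LieH2

/-- An action of a group `G` on a Lie algebra by Lie algebra automorphisms. -/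
structure LieAction (G : Type*) [Group G] (R : Type*) [CommRing R] (L : Type*) [LieRing L]
    [LieAlgebra R L] where
  act : G → L →ₗ⁅R⁆ L
  one_act : ∀ x, act 1 x = x
  mul_act : ∀ g h x, act (g * h) x = act g (act h x)

variable {R A H}

/-- For a group `G` acting on `H`, and trivially on `A`, a central extension of `H` by `A` is
`G`-equivariant if there is an action of `G` on its middle term by Lie algebra automorphisms which
is compatible with the actions on `A` and on `H`. -/
def CentralExtension.IsEquivariant {G : Type*} [Group G] (ρ : LieAction G R H)
    (E : CentralExtension R A H) : Prop :=
  ∃ τ : LieAction G R E.L, (∀ g a, τ.act g (E.incl a) = E.incl a) ∧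
    ∀ g x, E.proj (τ.act g x) = ρ.act g (E.proj x)

/-- A class in `H²(H, A)` is `G`-equivariant if it is the class of a `G`-equivariant extension. -/
def LieH2.IsEquivariant {G : Type*} [Group G] (ρ : LieAction G R H) (c : LieH2 R A H) : Prop :=
  ∃ E : CentralExtension R A H, E.IsEquivariant ρ ∧ LieH2.mk E = c

end CentralExtensions

set_option linter.unusedSectionVars false

attribute [local instance] LieRing.ofAssociativeRing LieAlgebra.ofAssociativeAlgebra

section DivisionAlgebras

variable (p : ℕ) [Fact p.Prime]

section AbsoluteValue

variable {D : Type*} [DivisionRing D] [Algebra ℚ_[p] D]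

/-- For a finite-dimensional division algebra `D` over `ℚ_p`, the absolute value
`|x| = |N_{D/ℚ_p}(x)|_p` of `D` (a power of the one extending the absolute value of `ℚ_p`), where
`N_{D/ℚ_p}(x)` is the determinant of the left multiplication by `x`. -/
noncomputable def divAbs (x : D) : ℝ := ‖Algebra.norm ℚ_[p] x‖

lemma divAbs_mul (x y : D) : divAbs p (x * y) = divAbs p x * divAbs p y := by
  rw [divAbs, map_mul, norm_mul]; rfl

lemma divAbs_one : divAbs p (1 : D) = 1 := by rw [divAbs, map_one, norm_one]

lemma divAbs_nonneg (x : D) : 0 ≤ divAbs p x := norm_nonneg _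

lemma divAbs_pow (x : D) (n : ℕ) : divAbs p (x ^ n) = divAbs p x ^ n := by
  rw [divAbs, map_pow, norm_pow]; rfl

variable [FiniteDimensional ℚ_[p] D]

lemma divAbs_zero : divAbs p (0 : D) = 0 := by
  rw [divAbs, Algebra.norm_zero, norm_zero]

lemma divAbs_eq_zero {x : D} : divAbs p x = 0 ↔ x = 0 := by
  constructor
  · intro h
    by_contra hx
    have h1 : divAbs p x * divAbs p x⁻¹ = 1 := by
      rw [← divAbs_mul, mul_inv_cancel₀ hx, divAbs_one]
    rw [h, zero_mul] at h1
    exact zero_ne_one h1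
  · rintro rfl
    exact divAbs_zero p

lemma divAbs_algebraMap (c : ℚ_[p]) :
    divAbs p (algebraMap ℚ_[p] D c) = ‖c‖ ^ Module.finrank ℚ_[p] D := by
  rw [divAbs, Algebra.norm_algebraMap, norm_pow]

/-- The homomorphism `ℚ_p[X]/(minpoly x) → D`, `X ↦ x`. -/
noncomputable def adjoinRootHom (x : D) : AdjoinRoot (minpoly ℚ_[p] x) →ₐ[ℚ_[p]] D :=
  Ideal.Quotient.liftₐ _ (Polynomial.aeval x) (by
    intro a ha
    obtain ⟨b, rfl⟩ := Ideal.mem_span_singleton.1 ha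
    rw [map_mul, minpoly.aeval, zero_mul])

lemma adjoinRootHom_root (x : D) :
    adjoinRootHom p x (AdjoinRoot.root (minpoly ℚ_[p] x)) = x := by
  change Polynomial.aeval x Polynomial.X = x
  rw [Polynomial.aeval_X]

lemma divAbs_eq_coeff (x : D) :
    ∃ m : ℕ, 0 < m ∧ divAbs p x = ‖(minpoly ℚ_[p] x).coeff 0‖ ^ m := by
  have hx : IsIntegral ℚ_[p] x := Algebra.IsIntegral.isIntegral x
  have : Fact (Irreducible (minpoly ℚ_[p] x)) := ⟨minpoly.irreducible hx⟩
  set K := AdjoinRoot (minpoly ℚ_[p] x) with hK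
  let φ := adjoinRootHom p x
  let : Module K D := Module.compHom D (φ : K →+* D)
  have hsmul : ∀ (k : K) (d : D), k • d = φ k * d := fun _ _ => rfl
  have : IsScalarTower ℚ_[p] K D := ⟨fun r k d => by
    rw [hsmul, hsmul, map_smul, smul_mul_assoc]⟩
  let pb := AdjoinRoot.powerBasis (minpoly.ne_zero hx)
  have : FiniteDimensional ℚ_[p] K := pb.finite
  have : FiniteDimensional K D := FiniteDimensional.right ℚ_[p] K D
  let k : K := AdjoinRoot.root (minpoly ℚ_[p] x)
  have hk : φ k = x := adjoinRootHom_root p x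
  have h1 : Algebra.lmul ℚ_[p] D x = (k • (LinearMap.id : D →ₗ[K] D)).restrictScalars ℚ_[p] := by
    ext d
    change x * d = φ k * d
    rw [hk]
  refine ⟨Module.finrank K D, Module.finrank_pos, ?_⟩
  have h2 : Algebra.norm ℚ_[p] x = Algebra.norm ℚ_[p] (k ^ Module.finrank K D) := by
    rw [Algebra.norm_apply, h1, LinearMap.det_restrictScalars, LinearMap.det_smul,
      LinearMap.det_id, mul_one]
  have h3 : minpoly ℚ_[p] k = minpoly ℚ_[p] x := by
    rw [← minpoly.algHom_eq φ (RingHom.injective (φ : K →+* D)) k, hk]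
  have h4 : ‖Algebra.norm ℚ_[p] k‖ = ‖(minpoly ℚ_[p] x).coeff 0‖ := by
    have := Algebra.PowerBasis.norm_gen_eq_coeff_zero_minpoly pb
    rw [show pb.gen = k from AdjoinRoot.powerBasis_gen _, h3] at this
    rw [this, norm_mul, norm_pow, norm_neg, norm_one, one_pow, one_mul]
  rw [divAbs, h2, map_pow, norm_pow, h4]

lemma divAbs_le_one_iff (x : D) : divAbs p x ≤ 1 ↔ ‖(minpoly ℚ_[p] x).coeff 0‖ ≤ 1 := by
  obtain ⟨m, hm, h⟩ := divAbs_eq_coeff p x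
  rw [h, pow_le_one_iff_of_nonneg (norm_nonneg _) hm.ne']

lemma divAbs_one_add_le {x : D} (h : divAbs p x ≤ 1) : divAbs p (1 + x) ≤ 1 := by
  have hx : IsIntegral ℚ_[p] x := Algebra.IsIntegral.isIntegral x
  have : Fact (Irreducible (minpoly ℚ_[p] x)) := ⟨minpoly.irreducible hx⟩
  set K := AdjoinRoot (minpoly ℚ_[p] x) with hK
  let φ := adjoinRootHom p x
  let k : K := AdjoinRoot.root (minpoly ℚ_[p] x)
  have hk : φ k = x := adjoinRootHom_root p x
  have : FiniteDimensional ℚ_[p] K := (AdjoinRoot.powerBasis (minpoly.ne_zero hx)).finite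
  have hm : ∀ y : K, minpoly ℚ_[p] (φ y) = minpoly ℚ_[p] y := fun y =>
    minpoly.algHom_eq φ (RingHom.injective (φ : K →+* D)) y
  have hs : ∀ y : K, spectralNorm ℚ_[p] K y ≤ 1 ↔ divAbs p (φ y) ≤ 1 := by
    intro y
    have hd : 0 < (minpoly ℚ_[p] y).natDegree :=
      minpoly.natDegree_pos (Algebra.IsIntegral.isIntegral y)
    have hd' : (0 : ℝ) < 1 / (minpoly ℚ_[p] y).natDegree := by positivity
    rw [divAbs_le_one_iff, hm, spectralNorm.spectralNorm_eq_norm_coeff_zero_rpow]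
    constructor
    · intro h
      by_contra hcon
      exact absurd h (not_le.2 (Real.one_lt_rpow (not_le.1 hcon) hd'))
    · intro h
      exact Real.rpow_le_one (norm_nonneg _) h hd'.le
  have h1 : spectralNorm ℚ_[p] K (1 + k) ≤ 1 := by
    refine (isNonarchimedean_spectralNorm 1 k).trans (max_le ?_ ?_)
    · exact spectralNorm_one.le
    · rw [hs, hk]; exact h
  rw [hs, map_add, map_one, hk] at h1
  exact h1

lemma divAbs_add_le (x y : D) : divAbs p (x + y) ≤ max (divAbs p x) (divAbs p y) := by
  wlog hxy : divAbs p x ≤ divAbs p y generalizing x y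
  · rw [add_comm, max_comm]
    exact this y x (le_of_not_ge hxy)
  rcases eq_or_ne y 0 with rfl | hy
  · rw [add_zero]; exact le_max_left _ _
  have hy' : 0 < divAbs p y :=
    lt_of_le_of_ne (divAbs_nonneg p y) fun h => hy ((divAbs_eq_zero p).1 h.symm)
  have h1 : divAbs p (x * y⁻¹) ≤ 1 := by
    have h2 : divAbs p (x * y⁻¹) * divAbs p y = divAbs p x := by
      rw [← divAbs_mul, mul_assoc, inv_mul_cancel₀ hy, mul_one]
    by_contra hcon
    have := mul_lt_mul_of_pos_right (not_le.1 hcon) hy'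
    rw [h2, one_mul] at this
    exact absurd hxy (not_le.2 this)
  have h3 : x + y = (1 + x * y⁻¹) * y := by
    rw [add_mul, one_mul, mul_assoc, inv_mul_cancel₀ hy, mul_one, add_comm]
  rw [h3, divAbs_mul]
  refine le_max_of_le_right ?_
  exact mul_le_of_le_one_left (divAbs_nonneg p y) (divAbs_one_add_le p h1)

lemma divAbs_neg (x : D) : divAbs p (-x) = divAbs p x := by
  have h : divAbs p (-1 : D) = 1 := by
    have h1 : divAbs p (-1 : D) ^ 2 = 1 := by rw [← divAbs_pow, neg_one_sq, divAbs_one]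
    exact (pow_eq_one_iff_of_nonneg (divAbs_nonneg p _) two_ne_zero).1 h1
  rw [← neg_one_mul, divAbs_mul, h, one_mul]

end AbsoluteValue

section Integers

variable (D : Type*) [DivisionRing D] [Algebra ℚ_[p] D] [FiniteDimensional ℚ_[p] D]

/-- The ring of integers `O_D = {x : |x| ≤ 1}`. -/
def ringOfInt : Subring D where
  carrier := {x | divAbs p x ≤ 1}
  mul_mem' := by
    intro a b ha hb
    change divAbs p (a * b) ≤ 1
    rw [divAbs_mul]
    exact mul_le_one₀ ha (divAbs_nonneg p b) hb
  one_mem' := (divAbs_one p).le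
  add_mem' := fun ha hb => (divAbs_add_le p _ _).trans (max_le ha hb)
  zero_mem' := by
    change divAbs p 0 ≤ 1
    rw [divAbs_zero]; exact zero_le_one
  neg_mem' := by
    intro x hx
    change divAbs p (-x) ≤ 1
    rw [divAbs_neg]; exact hx

/-- The maximal ideal `𝔪_D = {x : |x| < 1}` of `O_D`. -/
def maxIdeal : Ideal (ringOfInt p D) where
  carrier := {x | divAbs p (x : D) < 1}
  add_mem' := fun ha hb => (divAbs_add_le p _ _).trans_lt (max_lt ha hb)
  zero_mem' := by
    change divAbs p (0 : D) < 1
    rw [divAbs_zero]; exact zero_lt_one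
  smul_mem' := by
    intro c x hx
    change divAbs p ((c : D) * x) < 1
    rw [divAbs_mul]
    exact mul_lt_one_of_nonneg_of_lt_one_right c.2 (divAbs_nonneg p _) hx

/-- A uniformizer of `D`: an element `π` with `𝔪_D = π O_D`. -/
structure DivUniformizer where
  val : D
  mem_iff : ∀ x : D, divAbs p x < 1 ↔ ∃ y ∈ ringOfInt p D, x = val * y

end Integers

section LocalField

variable (F : Type*) [Field F] [Algebra ℚ_[p] F] [FiniteDimensional ℚ_[p] F]

/-- The ramification index of `F/ℚ_p`: the largest `k` with `p ∈ 𝔪_F ^ k`. -/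
noncomputable def ramIndex : ℕ :=
  sSup {k : ℕ | ((p : ℕ) : ringOfInt p F) ∈ maxIdeal p F ^ k}

/-- The number of elements of the residue field `O_F/𝔪_F`. -/
noncomputable def residueCard : ℕ := Nat.card (ringOfInt p F ⧸ maxIdeal p F)

end LocalField

section Reduced

variable (F : Type*) [Field F] (D : Type*) [DivisionRing D] [Algebra F D]

/-- The degree of a central division algebra `D` over `F`: the square root of its dimension. -/
noncomputable def divDegree : ℕ := Nat.sqrt (Module.finrank F D)

/-- A splitting of a central division algebra `D` of degree `d` over `F`: an `F`-algebra
homomorphism `φ : D → M_d(F̄)`. Such `φ` exist, and any two of them are conjugate. The reduced trace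
of `x` is `tr φ(x)`, the reduced norm of `x` is `det φ(x)`. -/
abbrev DivSplitting : Type _ :=
  D →ₐ[F] Matrix (Fin (divDegree F D)) (Fin (divDegree F D)) (AlgebraicClosure F)

/-- The `F`-subspace of elements of `D` of reduced trace zero. -/
def trdZero : Submodule F D where
  carrier := {x | ∀ φ : DivSplitting F D, (φ x).trace = 0}
  add_mem' := by
    intro a b ha hb φ
    rw [map_add, Matrix.trace_add, ha φ, hb φ, add_zero]
  zero_mem' := by
    intro φ
    rw [map_zero, Matrix.trace_zero]
  smul_mem' := by
    intro c x hx φ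
    rw [map_smul, Matrix.trace_smul, hx φ, smul_zero]

/-- The group `SL₁(D)` of elements of `D` of reduced norm one. -/
def SL1 : Subgroup Dˣ where
  carrier := {g | ∀ φ : DivSplitting F D, (φ (g : D)).det = 1}
  mul_mem' := by
    intro a b ha hb φ
    rw [Units.val_mul, map_mul, Matrix.det_mul, ha φ, hb φ, one_mul]
  one_mem' := by
    intro φ
    rw [Units.val_one, map_one, Matrix.det_one]
  inv_mem' := by
    intro x hx φ
    have h : (φ (x : D)).det * (φ ((x⁻¹ : Dˣ) : D)).det = 1 := by
      rw [← Matrix.det_mul, ← map_mul, Units.mul_inv, map_one, Matrix.det_one]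
    rwa [hx φ, one_mul] at h

end Reduced

section CongruenceAlgebras

variable (F : Type*) [Field F] {D : Type u} [DivisionRing D] [Algebra F D]
  [Algebra ℚ_[p] D] [FiniteDimensional ℚ_[p] D]

variable {p}

lemma DivUniformizer.val_ne_zero (π : DivUniformizer p D) : π.val ≠ 0 := by
  intro h
  have hp : divAbs p (algebraMap ℚ_[p] D (p : ℚ_[p])) < 1 := by
    rw [divAbs_algebraMap]
    exact pow_lt_one₀ (norm_nonneg _) Padic.norm_p_lt_one Module.finrank_pos.ne'
  obtain ⟨y, -, hy⟩ := (π.mem_iff _).1 hp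
  rw [h, zero_mul, map_eq_zero] at hy
  exact (Nat.cast_ne_zero.2 (Fact.out : p.Prime).ne_zero) hy

lemma DivUniformizer.divAbs_le_one (π : DivUniformizer p D) : divAbs p π.val ≤ 1 :=
  ((π.mem_iff _).2 ⟨1, one_mem _, (mul_one _).symm⟩).le

/-- The `ℤ_p`-submodule `π^n O_D` of `D`. -/
def primePow [Algebra ℤ_[p] D] [IsScalarTower ℤ_[p] ℚ_[p] D] (π : DivUniformizer p D) (n : ℕ) :
    Submodule ℤ_[p] D where
  carrier := {x | ∃ y ∈ ringOfInt p D, x = π.val ^ n * y}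
  add_mem' := by
    rintro _ _ ⟨y, hy, rfl⟩ ⟨z, hz, rfl⟩
    exact ⟨y + z, add_mem hy hz, (mul_add _ _ _).symm⟩
  zero_mem' := ⟨0, zero_mem _, (mul_zero _).symm⟩
  smul_mem' := by
    rintro c _ ⟨y, hy, rfl⟩
    refine ⟨c • y, ?_, (mul_smul_comm _ _ _).symm⟩
    rw [← IsScalarTower.algebraMap_smul ℚ_[p] c y, Algebra.smul_def]
    refine mul_mem ?_ hy
    change divAbs p _ ≤ 1
    rw [divAbs_algebraMap]
    exact pow_le_one₀ (norm_nonneg _) (PadicInt.norm_le_one c)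

variable [Algebra ℤ_[p] D] [IsScalarTower ℤ_[p] ℚ_[p] D]

lemma mem_primePow {π : DivUniformizer p D} {n : ℕ} {x : D} :
    x ∈ primePow π n ↔ divAbs p x ≤ divAbs p π.val ^ n := by
  constructor
  · rintro ⟨y, hy, rfl⟩
    rw [divAbs_mul, divAbs_pow]
    exact mul_le_of_le_one_right (pow_nonneg (divAbs_nonneg p _) n) hy
  · intro h
    have hπ : π.val ^ n ≠ 0 := pow_ne_zero n π.val_ne_zero
    refine ⟨(π.val ^ n)⁻¹ * x, ?_, by rw [← mul_assoc, mul_inv_cancel₀ hπ, one_mul]⟩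
    change divAbs p _ ≤ 1
    have hpos : 0 < divAbs p (π.val ^ n) :=
      lt_of_le_of_ne (divAbs_nonneg p _) fun h0 => hπ ((divAbs_eq_zero p).1 h0.symm)
    rw [← divAbs_pow] at h
    have h1 : divAbs p (π.val ^ n) * divAbs p ((π.val ^ n)⁻¹ * x) = divAbs p x := by
      rw [← divAbs_mul, ← mul_assoc, mul_inv_cancel₀ hπ, one_mul]
    rw [← h1] at h
    exact le_of_mul_le_mul_left (by rwa [mul_one]) hpos

lemma primePow_mul_mem {π : DivUniformizer p D} {m n : ℕ} {x y : D} (hx : x ∈ primePow π m)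
    (hy : y ∈ primePow π n) : x * y ∈ primePow π n ∧ y * x ∈ primePow π n := by
  rw [mem_primePow] at *
  have h1 : divAbs p x ≤ 1 := hx.trans (pow_le_one₀ (divAbs_nonneg p _) π.divAbs_le_one)
  rw [mem_primePow, divAbs_mul, divAbs_mul]
  exact ⟨(mul_le_of_le_one_left (divAbs_nonneg p _) h1).trans hy,
    (mul_le_of_le_one_right (divAbs_nonneg p _) h1).trans hy⟩

lemma lie_mem_primePow {π : DivUniformizer p D} {m n : ℕ} {x y : D} (hx : x ∈ primePow π m)
    (hy : y ∈ primePow π n) : ⁅x, y⁆ ∈ primePow π n :=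
  sub_mem (primePow_mul_mem hx hy).1 (primePow_mul_mem hx hy).2


lemma lie_mem_trdZero (x y : D) : ⁅x, y⁆ ∈ trdZero F D := by
  intro φ
  change (φ (x * y - y * x)).trace = 0
  rw [map_sub, map_mul, map_mul, Matrix.trace_sub, Matrix.trace_mul_comm, sub_self]

variable [Algebra ℚ_[p] F] [IsScalarTower ℚ_[p] F D]

lemma smul_mem_trdZero (c : ℤ_[p]) {x : D} (hx : x ∈ trdZero F D) : c • x ∈ trdZero F D := by
  rw [← IsScalarTower.algebraMap_smul ℚ_[p] c x,
    ← IsScalarTower.algebraMap_smul F (algebraMap ℤ_[p] ℚ_[p] c) x]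
  exact Submodule.smul_mem _ _ hx

/-- The Lie algebra `𝔤_n = {x ∈ π^n O_D : Trd(x) = 0}` over `ℤ_p`, with the bracket
`[x, y] = xy - yx`. -/
def gAlg (π : DivUniformizer p D) (n : ℕ) : LieSubalgebra ℤ_[p] D where
  carrier := {x | x ∈ primePow π n ∧ x ∈ trdZero F D}
  add_mem' := fun ha hb => ⟨add_mem ha.1 hb.1, add_mem ha.2 hb.2⟩
  zero_mem' := ⟨zero_mem _, zero_mem _⟩
  smul_mem' := fun c _ hx => ⟨Submodule.smul_mem _ c hx.1, smul_mem_trdZero F c hx.2⟩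
  lie_mem' := fun ha hb => ⟨lie_mem_primePow ha.1 hb.1, lie_mem_trdZero F _ _⟩

lemma gAlg_antitone (π : DivUniformizer p D) {m n : ℕ} (h : m ≤ n) :
    gAlg F π n ≤ gAlg F π m := by
  rintro x ⟨hx, hx'⟩
  refine ⟨?_, hx'⟩
  rw [mem_primePow] at *
  exact hx.trans (pow_le_pow_of_le_one (divAbs_nonneg p _) π.divAbs_le_one h)

/-- The ideal `𝔤_m ∩ 𝔤_l` of `𝔤_l`, which is `𝔤_m` if `m ≥ l`. -/
def gIdeal (π : DivUniformizer p D) (l m : ℕ) : LieIdeal ℤ_[p] (gAlg F π l) where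
  carrier := {x | (x : D) ∈ gAlg F π m}
  add_mem' := fun {_ _} ha hb => (gAlg F π m).add_mem ha hb
  zero_mem' := (gAlg F π m).zero_mem
  smul_mem' := fun c _ hx => (gAlg F π m).smul_mem c hx
  lie_mem := fun {x _} hy => ⟨lie_mem_primePow x.2.1 hy.1, lie_mem_trdZero F _ _⟩

/-- The action of `G = SL₁(D)` on `𝔤_n` by conjugation, `g · u = g u g⁻¹` (this is the right action
`u^g = g⁻¹ u g`, turned into a left action). -/
def conjAction (π : DivUniformizer p D) (n : ℕ) :
    LieAction (SL1 F D) ℤ_[p] (gAlg F π n) where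
  act g :=
    { toFun := fun u => ⟨((g : Dˣ) : D) * u * ((g⁻¹ : SL1 F D) : Dˣ), by
        have hg : divAbs p ((g : Dˣ) : D) * divAbs p (((g⁻¹ : SL1 F D) : Dˣ) : D) = 1 := by
          rw [← divAbs_mul]
          change divAbs p (((g : Dˣ) : D) * (((g : Dˣ)⁻¹ : Dˣ) : D)) = 1
          rw [Units.mul_inv, divAbs_one]
        constructor
        · have hu := u.2.1
          rw [mem_primePow] at hu ⊢
          rwa [divAbs_mul, divAbs_mul, mul_right_comm, hg, one_mul]
        · intro φ
          rw [map_mul, Matrix.trace_mul_comm, ← map_mul, ← mul_assoc]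
          change (φ ((((g : Dˣ)⁻¹ : Dˣ) : D) * ((g : Dˣ) : D) * u)).trace = 0
          rw [Units.inv_mul, one_mul]
          exact u.2.2 φ⟩
      map_add' := fun x y => Subtype.ext (by
        change _ * ((x : D) + (y : D)) * _ = _ * (x : D) * _ + _ * (y : D) * _
        rw [mul_add, add_mul])
      map_smul' := fun c x => Subtype.ext (by
        change _ * (c • (x : D)) * _ = c • (_ * (x : D) * _)
        rw [mul_smul_comm, smul_mul_assoc])
      map_lie' := fun {x y} => Subtype.ext (by
        have hg : ((((g⁻¹ : SL1 F D) : Dˣ) : D)) * ((g : Dˣ) : D) = 1 := by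
          change ((((g : Dˣ)⁻¹ : Dˣ) : D)) * ((g : Dˣ) : D) = 1
          rw [Units.inv_mul]
        set a : D := ((g : Dˣ) : D)
        set b : D := (((g⁻¹ : SL1 F D) : Dˣ) : D)
        change a * ((x : D) * y - y * x) * b = a * x * b * (a * y * b) - a * y * b * (a * x * b)
        have key : ∀ u v : D, a * u * b * (a * v * b) = a * (u * v) * b := by
          intro u v
          calc a * u * b * (a * v * b) = a * u * (b * a) * v * b := by simp only [mul_assoc]
            _ = a * (u * v) * b := by rw [hg, mul_one]; simp only [mul_assoc]
        rw [key, key, mul_sub, sub_mul]) }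
  one_act := fun x => Subtype.ext (by
    change ((1 : Dˣ) : D) * (x : D) * ((1⁻¹ : Dˣ) : D) = x
    rw [inv_one, Units.val_one, one_mul, mul_one])
  mul_act := fun g h x => Subtype.ext (by
    change (((g : Dˣ) * (h : Dˣ) : Dˣ) : D) * (x : D) * ((((g : Dˣ) * (h : Dˣ))⁻¹ : Dˣ) : D) =
      ((g : Dˣ) : D) * (((h : Dˣ) : D) * (x : D) * (((h : Dˣ)⁻¹ : Dˣ) : D)) *
        (((g : Dˣ)⁻¹ : Dˣ) : D)
    rw [mul_inv_rev, Units.val_mul, Units.val_mul]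
    simp only [mul_assoc])

end CongruenceAlgebras

/-- The `ℤ_p`-module `ℤ/p^sℤ`. -/
abbrev CyclicMod (s : ℕ) : Type := ℤ_[p] ⧸ Ideal.span {(p : ℤ_[p]) ^ s}

end DivisionAlgebras

section CentralExtensionLemmas

variable {R : Type w} [CommRing R] {A : Type v} [AddCommGroup A] [Module R A]
  {H : Type u} [LieRing H] [LieAlgebra R H]

namespace CentralExtension

/-- A central extension with a section that is a homomorphism of Lie algebras is split. -/
lemma split_equivalent (E : CentralExtension R A H) (σ : H →ₗ⁅R⁆ E.L)
    (hσ : ∀ h, E.proj (σ h) = h) : Equivalent (split R A H) E := by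
  refine equivalent_of_hom (E₁ := split R A H) (E₂ := E)
    { toFun := fun x => σ x.1 + E.incl x.2
      map_add' := fun x y => by
        change σ (x.1 + y.1) + E.incl (x.2 + y.2) = _
        rw [map_add, map_add]; abel
      map_smul' := fun r x => by
        change σ (r • x.1) + E.incl (r • x.2) = _
        rw [map_smul, map_smul, ← smul_add]; rfl
      map_lie' := fun {x y} => by
        change σ ⁅x.1, y.1⁆ + E.incl 0 = ⁅σ x.1 + _, σ y.1 + _⁆
        rw [map_zero, add_zero, add_lie, lie_add, lie_add, E.central, E.central, E.central',
          add_zero, add_zero, add_zero, LieHom.map_lie] } ?_ ?_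
  · intro a
    change σ 0 + E.incl a = _
    rw [map_zero, zero_add]
  · intro x
    change E.proj (σ x.1 + E.incl x.2) = x.1
    rw [map_add, hσ, E.proj_incl, add_zero]

/-- The multiple `k • [E]` is the class of an extension to which `E` maps, by a homomorphism
over `H` that restricts to multiplication by `k` on `A`. -/
lemma exists_nsmul_mk (E : CentralExtension R A H) (k : ℕ) :
    ∃ (E' : CentralExtension R A H) (f : E.L →ₗ⁅R⁆ E'.L), k • LieH2.mk E = LieH2.mk E' ∧
      (∀ x, E'.proj (f x) = E.proj x) ∧ ∀ a, f (E.incl a) = E'.incl (k • a) := by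
  induction k with
  | zero =>
    refine ⟨split R A H,
      { toFun := fun x => (E.proj x, 0)
        map_add' := fun x y => Prod.ext (map_add _ _ _) (add_zero _).symm
        map_smul' := fun r x => Prod.ext (map_smul _ _ _) (smul_zero _).symm
        map_lie' := fun {x y} => Prod.ext (LieHom.map_lie _ _ _) rfl }, zero_nsmul _,
      fun _ => rfl, fun a => ?_⟩
    refine Prod.ext (E.proj_incl a) ?_
    change (0 : A) = 0 • a
    rw [zero_nsmul]
  | succ k ih =>
    obtain ⟨E', f, h, hf, hfa⟩ := ih
    refine ⟨baerSum E' E, (baerMk E' E).comp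
      { toFun := fun x => ⟨(f x, x), hf x⟩
        map_add' := fun x y => Subtype.ext (Prod.ext (map_add _ _ _) rfl)
        map_smul' := fun r x => Subtype.ext (Prod.ext (map_smul _ _ _) rfl)
        map_lie' := fun {x y} => Subtype.ext (Prod.ext (LieHom.map_lie _ _ _) rfl) }, ?_, hf, ?_⟩
    · rw [succ_nsmul, h]; rfl
    · intro a
      rw [succ_nsmul]
      exact baerMk_incl E' E _ _ _ (Prod.ext (hfa a) rfl)

/-- If multiplication by `k` on `A` extends to a linear map on the middle term that vanishes on
brackets, then `k` annihilates the class of the extension. -/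
lemma nsmul_mk_eq_zero (E : CentralExtension R A H) (k : ℕ) (t : E.L →ₗ[R] A)
    (ht : ∀ a, t (E.incl a) = k • a) (ht' : ∀ x y : E.L, t ⁅x, y⁆ = 0) : k • LieH2.mk E = 0 := by
  obtain ⟨E', f, h, hf, hfa⟩ := exists_nsmul_mk E k
  rw [h]
  let g : E.L →ₗ[R] E'.L := f.toLinearMap - E'.incl ∘ₗ t
  have hg : ∀ x, g x = f x - E'.incl (t x) := fun _ => rfl
  have hg0 : ∀ x y, E.proj x = E.proj y → g x = g y := by
    intro x y hxy
    obtain ⟨a, ha⟩ := (E.exact (x - y)).1 (by rw [map_sub, hxy, sub_self])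
    rw [← sub_eq_zero, ← map_sub, ← ha, hg, hfa, ht, sub_self]
  choose s hs using E.proj_surjective
  let σ : H →ₗ⁅R⁆ E'.L :=
    { toFun := fun h => g (s h)
      map_add' := fun x y => by
        rw [← map_add]; exact hg0 _ _ (by rw [hs, map_add, hs, hs])
      map_smul' := fun r x => by
        rw [RingHom.id_apply, ← map_smul]; exact hg0 _ _ (by rw [hs, map_smul, hs])
      map_lie' := fun {x y} => by
        rw [hg0 _ ⁅s x, s y⁆ (by rw [hs, LieHom.map_lie, hs, hs]), hg, hg, hg, ht', map_zero,
          sub_zero, LieHom.map_lie, sub_lie, lie_sub, lie_sub, E'.central, E'.central,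
          E'.central', sub_zero, sub_zero, sub_zero] }
  refine (Quotient.sound (split_equivalent E' σ fun h => ?_)).symm
  change E'.proj (g (s h)) = h
  rw [hg, map_sub, hf, E'.proj_incl, sub_zero, hs]

/-- If multiplication by `k` on `A` extends to a linear map on the middle term that vanishes on
brackets, and the ideal `I` consists of `k`-multiples in the
`k`-torsion-free Lie algebra `H`, then the class of the extension is
inflated from a class on the quotient by `I` which is annihilated by `k`. -/
lemma exists_inflate_eq (E : CentralExtension R A H) (k : ℕ) (t : E.L →ₗ[R] A)
    (ht : ∀ a, t (E.incl a) = k • a) (ht' : ∀ x y : E.L, t ⁅x, y⁆ = 0) (I : LieIdeal R H)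
    (hI : ∀ x ∈ I, ∃ y, x = k • y)
    (hH : ∀ h : H, k • h = 0 → h = 0) :
    ∃ c : LieH2 R A (H ⧸ I), k • c = 0 ∧ LieH2.inflate I c = LieH2.mk E := by
  let g : E.L →ₗ[R] E.L := k • LinearMap.id - E.incl ∘ₗ t
  have hg : ∀ x, g x = k • x - E.incl (t x) := fun _ => rfl
  have hga : ∀ a, g (E.incl a) = 0 := fun a => by rw [hg, ht, map_nsmul, sub_self]
  have hgp : ∀ x, E.proj (g x) = k • E.proj x := fun x => by
    rw [hg, map_sub, E.proj_incl, sub_zero, map_nsmul]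
  have htg : ∀ x, t (g x) = 0 := fun x => by rw [hg, map_sub, map_nsmul, ht, sub_self]
  let N : LieIdeal R E.L :=
    { carrier := {z | ∃ x, z = g x ∧ E.proj z ∈ I}
      add_mem' := by
        rintro _ _ ⟨x, rfl, hx⟩ ⟨y, rfl, hy⟩
        exact ⟨x + y, (map_add _ _ _).symm, by rw [map_add]; exact add_mem hx hy⟩
      zero_mem' := ⟨0, (map_zero _).symm, by rw [map_zero]; exact zero_mem _⟩
      smul_mem' := by
        rintro r _ ⟨x, rfl, hx⟩
        exact ⟨r • x, (map_smul _ _ _).symm, by rw [map_smul]; exact I.smul_mem r hx⟩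
      lie_mem := by
        rintro y _ ⟨x, rfl, hx⟩
        refine ⟨⁅y, x⁆, ?_, ?_⟩
        · rw [hg, hg, ht', map_zero, sub_zero, lie_sub, E.central', sub_zero, lie_nsmul]
        · rw [LieHom.map_lie]; exact I.lie_mem hx }
  have hN : ∀ z, z ∈ N ↔ ∃ x, z = g x ∧ E.proj z ∈ I := fun z => Iff.rfl
  have hNa : ∀ a, E.incl a ∈ N → a = 0 := by
    intro a ha
    obtain ⟨x, hx, -⟩ := (hN _).1 ha
    have hpx : k • E.proj x = 0 := by rw [← hgp, ← hx, E.proj_incl]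
    obtain ⟨b, rfl⟩ := (E.exact x).1 (hH _ hpx)
    exact E.incl_injective (by rw [hx, hga, map_zero])
  let q : E.L →ₗ⁅R⁆ E.L ⧸ N := LieH2.quotientMap N
  have hq : ∀ z, q z = 0 ↔ z ∈ N := fun z => LieSubmodule.Quotient.mk_eq_zero'
  have hqs : Function.Surjective q := Quot.mk_surjective
  have hqI : ∀ z : H, LieH2.quotientMap I z = 0 ↔ z ∈ I := fun z =>
    LieSubmodule.Quotient.mk_eq_zero'
  let P : (E.L ⧸ N) →ₗ⁅R⁆ (H ⧸ I) :=
    { toLinearMap := N.toSubmodule.liftQ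
        ((LieH2.quotientMap I).toLinearMap ∘ₗ E.proj.toLinearMap) (by
          rintro z ⟨x, -, hz⟩
          exact (hqI _).2 hz)
      map_lie' := by
        intro x y
        obtain ⟨x, rfl⟩ := hqs x
        obtain ⟨y, rfl⟩ := hqs y
        exact LieHom.map_lie ((LieH2.quotientMap I).comp E.proj) x y }
  have hP : ∀ z, P (q z) = LieH2.quotientMap I (E.proj z) := fun _ => rfl
  let E₂ : CentralExtension R A (H ⧸ I) :=
    { L := E.L ⧸ N
      incl := q.toLinearMap ∘ₗ E.incl
      proj := P
      incl_injective := by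
        rw [injective_iff_map_eq_zero]
        exact fun a ha => hNa a ((hq _).1 ha)
      proj_surjective := fun h => by
        obtain ⟨h, rfl⟩ := Quot.mk_surjective h
        obtain ⟨x, rfl⟩ := E.proj_surjective h
        exact ⟨q x, rfl⟩
      exact := by
        intro z
        obtain ⟨z, rfl⟩ := hqs z
        rw [hP, hqI]
        constructor
        · intro hz
          obtain ⟨y, hy⟩ := hI _ hz
          obtain ⟨x, rfl⟩ := E.proj_surjective y
          obtain ⟨a, ha⟩ := (E.exact (z - g x)).1 (by rw [map_sub, hy, hgp, sub_self])
          refine ⟨a, ?_⟩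
          change q (E.incl a) = q z
          rw [← sub_eq_zero, ← map_sub, hq, ha, sub_sub_cancel_left, ← map_neg, hN]
          exact ⟨-x, rfl, by rw [hgp, map_neg, smul_neg, ← hy]; exact neg_mem hz⟩
        · rintro ⟨a, ha⟩
          change q (E.incl a) = q z at ha
          rw [eq_comm, ← sub_eq_zero, ← map_sub, hq, hN] at ha
          obtain ⟨x, -, hx⟩ := ha
          rwa [map_sub, E.proj_incl, sub_zero] at hx
      central := by
        intro a z
        obtain ⟨z, rfl⟩ := hqs z
        change ⁅q (E.incl a), q z⁆ = 0
        rw [← LieHom.map_lie, E.central, map_zero] }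
  let t₂ : E₂.L →ₗ[R] A := N.toSubmodule.liftQ t (by
    rintro z ⟨x, rfl, -⟩
    exact htg x)
  have ht₂ : ∀ z, t₂ (q z) = t z := fun _ => rfl
  refine ⟨LieH2.mk E₂, nsmul_mk_eq_zero E₂ k t₂ (fun a => ht a) ?_, ?_⟩
  · intro x y
    obtain ⟨x, rfl⟩ := hqs x
    obtain ⟨y, rfl⟩ := hqs y
    change t₂ ⁅q x, q y⁆ = 0
    rw [← LieHom.map_lie, ht₂, ht']
  · refine Quotient.sound (Equivalent.symm ?_)
    exact equivalent_of_hom (E₁ := E) (E₂ := pullback (LieH2.quotientMap I) E₂)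
      { toFun := fun x => ⟨(q x, E.proj x), rfl⟩
        map_add' := fun x y => Subtype.ext (Prod.ext (map_add _ _ _) (map_add _ _ _))
        map_smul' := fun r x => Subtype.ext (Prod.ext (map_smul _ _ _) (map_smul _ _ _))
        map_lie' := fun {x y} =>
          Subtype.ext (Prod.ext (LieHom.map_lie _ _ _) (LieHom.map_lie _ _ _)) }
      (fun a => Subtype.ext (Prod.ext rfl (E.proj_incl a))) (fun x => rfl)

/-- The cocycle of a central extension with respect to a linear section `s`: the element of `A`
measuring the failure of `s` to respect the brackets of `u` and `v`. -/
lemma exists_cocycle (E : CentralExtension R A H) (s : H →ₗ[R] E.L)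
    (hs : ∀ h, E.proj (s h) = h) :
    ∃ f : H →ₗ[R] H →ₗ[R] A, ∃ r : E.L →ₗ[R] A,
      (∀ u v, E.incl (f u v) = ⁅s u, s v⁆ - s ⁅u, v⁆) ∧ (∀ u, f u u = 0) ∧
      (∀ u v w, f ⁅u, v⁆ w + f ⁅v, w⁆ u + f ⁅w, u⁆ v = 0) ∧
      (∀ a, r (E.incl a) = a) ∧ ∀ x y, r ⁅x, y⁆ = f (E.proj x) (E.proj y) := by
  have hr : ∀ x, ∃ a, E.incl a = x - s (E.proj x) := fun x =>
    (E.exact _).1 (by rw [map_sub, hs, sub_self])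
  choose r₀ hr₀ using hr
  let r : E.L →ₗ[R] A :=
    { toFun := r₀
      map_add' := fun x y => E.incl_injective (by
        rw [map_add, hr₀, hr₀, hr₀, map_add, map_add]; abel)
      map_smul' := fun c x => E.incl_injective (by
        rw [map_smul, hr₀, hr₀, map_smul, map_smul, smul_sub]; rfl) }
  have hr : ∀ x, E.incl (r x) = x - s (E.proj x) := hr₀
  have hri : ∀ a, r (E.incl a) = a := fun a => E.incl_injective (by
    rw [hr, E.proj_incl, map_zero, sub_zero])
  have hrl : ∀ x y, r ⁅x, y⁆ = r ⁅s (E.proj x), s (E.proj y)⁆ := by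
    intro x y
    have hx : x = s (E.proj x) + E.incl (r x) := by rw [hr]; abel
    have hy : y = s (E.proj y) + E.incl (r y) := by rw [hr]; abel
    conv_lhs => rw [hx, hy]
    rw [add_lie, lie_add, lie_add, E.central, E.central, E.central', add_zero, add_zero, add_zero]
  have hrs : ∀ h, r (s h) = 0 := fun h => E.incl_injective (by rw [hr, hs, sub_self, map_zero])
  let f : H →ₗ[R] H →ₗ[R] A := LinearMap.mk₂ R (fun u v => r ⁅s u, s v⁆)
    (fun u u' v => by rw [map_add, add_lie, map_add])
    (fun c u v => by rw [map_smul, smul_lie, map_smul])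
    (fun u v v' => by rw [map_add, lie_add, map_add])
    (fun c u v => by rw [map_smul, lie_smul, map_smul])
  have hf : ∀ u v, f u v = r ⁅s u, s v⁆ := fun _ _ => rfl
  have hff : ∀ x y, r ⁅x, y⁆ = f (E.proj x) (E.proj y) := fun x y => by rw [hf, hrl]
  refine ⟨f, r, fun u v => ?_, fun u => ?_, fun u v w => ?_, hri, hff⟩
  · rw [hf, hr, LieHom.map_lie, hs, hs]
  · rw [hf, lie_self, map_zero]
  · have h : ∀ u v w, f ⁅u, v⁆ w = r ⁅⁅s u, s v⁆, s w⁆ := fun u v w => by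
      rw [hff, LieHom.map_lie, hs, hs, hs]
    rw [h, h, h, ← map_add, ← map_add]
    have := lie_jacobi (s w) (s u) (s v)
    rw [← lie_skew, ← lie_skew ⁅s v, s w⁆, ← lie_skew ⁅s w, s u⁆, ← neg_add, ← neg_add,
      this, neg_zero, map_zero]

end CentralExtension
end CentralExtensionLemmas

section GradedCocycles

open Finset

variable {O A : Type*} [CommRing O] [AddCommGroup A]

/-- The trace `∑_{i < d} σ^i(w)` of `w` with respect to an automorphism `σ` with `σ^d = 1`. -/
def cyclicTrace (σ : RingAut O) (d : ℕ) (w : O) : O := ∑ i ∈ range d, (σ ^ i) w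

lemma RingAut.pow_apply_eq {σ : RingAut O} {d : ℕ} (hσ : σ ^ d = 1) {a b : ℕ}
    (h : a ≡ b [MOD d]) : σ ^ a = σ ^ b := by
  have key : ∀ k, σ ^ k = σ ^ (k % d) := fun k => by
    conv_lhs => rw [← Nat.div_add_mod k d, pow_add, pow_mul, hσ, one_pow, one_mul]
  rw [key a, key b, h]

lemma RingAut.pow_eq_one_of_dvd {σ : RingAut O} {d : ℕ} (hσ : σ ^ d = 1) {a : ℕ} (h : d ∣ a) :
    σ ^ a = 1 := by
  obtain ⟨k, rfl⟩ := h
  rw [pow_mul, hσ, one_pow]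

lemma cyclicTrace_add (σ : RingAut O) (d : ℕ) (w v : O) :
    cyclicTrace σ d (w + v) = cyclicTrace σ d w + cyclicTrace σ d v := by
  simp only [cyclicTrace, map_add, sum_add_distrib]

lemma cyclicTrace_neg (σ : RingAut O) (d : ℕ) (w : O) :
    cyclicTrace σ d (-w) = -cyclicTrace σ d w := by
  simp only [cyclicTrace, map_neg, sum_neg_distrib]

lemma cyclicTrace_sub (σ : RingAut O) (d : ℕ) (w v : O) :
    cyclicTrace σ d (w - v) = cyclicTrace σ d w - cyclicTrace σ d v := by
  rw [sub_eq_add_neg, cyclicTrace_add, cyclicTrace_neg, sub_eq_add_neg]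

lemma cyclicTrace_pow {σ : RingAut O} {d : ℕ} (hσ : σ ^ d = 1) (b : ℕ) (w : O) :
    cyclicTrace σ d ((σ ^ b) w) = cyclicTrace σ d w := by
  induction b with
  | zero => rfl
  | succ b ih =>
    rw [← ih, cyclicTrace, cyclicTrace]
    have h : ∀ i, (σ ^ i) ((σ ^ (b + 1)) w) = (σ ^ (i + 1)) ((σ ^ b) w) := fun i => by
      rw [← RingAut.mul_apply, ← RingAut.mul_apply, ← pow_add, ← pow_add]
      congr 2; ring
    simp only [h]
    have h2 := sum_range_succ (fun i => (σ ^ i) ((σ ^ b) w)) d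
    rw [sum_range_succ'] at h2
    rw [hσ, pow_zero] at h2
    exact add_right_cancel h2

lemma sum_inv_pow {σ : RingAut O} {d : ℕ} (hσ : σ ^ d = 1) (w : O) :
    ∑ i ∈ range d, (σ⁻¹ ^ i) w = cyclicTrace σ d w := by
  rw [← cyclicTrace_pow hσ 1, cyclicTrace, ← sum_range_reflect]
  refine sum_congr rfl fun i hi => ?_
  rw [mem_range] at hi
  rw [← RingAut.mul_apply, ← pow_add, inv_pow]
  congr 1
  rw [inv_eq_iff_mul_eq_one, ← pow_add, show d - 1 - i + (i + 1) = d by omega, hσ]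

/-- A homogeneous element of degree `a ≥ n`, whose coefficient has trace zero if `d ∣ a`. -/
def Adm (σ : RingAut O) (d n a : ℕ) (w : O) : Prop :=
  n ≤ a ∧ (d ∣ a → cyclicTrace σ d w = 0)

/-- The values `f a b w v` of an alternating `2`-cocycle at `wπ^a` and `vπ^b`, where
`(wπ^a)(vπ^b) = wσ^a(v)π^(a+b)`, which is homogeneous for the grading modulo `d`. -/
structure GradedCocycle (σ : RingAut O) (d n : ℕ) (f : ℕ → ℕ → O → O → A) : Prop where
  pow_eq_one : σ ^ d = 1
  add_left : ∀ {a b w w' v}, Adm σ d n a w → Adm σ d n a w' → Adm σ d n b v →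
    f a b (w + w') v = f a b w v + f a b w' v
  antisymm : ∀ {a b w v}, Adm σ d n a w → Adm σ d n b v → f a b w v = -f b a v w
  jacobi : ∀ {a b c u v w}, Adm σ d n a u → Adm σ d n b v → Adm σ d n c w →
    f (a + b) c (u * (σ ^ a) v - v * (σ ^ b) u) w + f (b + c) a (v * (σ ^ b) w - w * (σ ^ c) v) u +
      f (c + a) b (w * (σ ^ c) u - u * (σ ^ a) w) v = 0
  eq_zero : ∀ {a b w v}, Adm σ d n a w → Adm σ d n b v → ¬d ∣ a + b → f a b w v = 0
  balanced : ∀ {a b} {w v : O} (c), n ≤ a → n ≤ b → ¬d ∣ a → d ∣ a + b →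
    f a b (c * w) v = f a b w ((σ ^ b) c * v)

namespace GradedCocycle

variable {σ : RingAut O} {d n : ℕ} {f : ℕ → ℕ → O → O → A}

lemma adm_of_not_dvd {a : ℕ} (ha : n ≤ a) (h : ¬d ∣ a) (w : O) : Adm σ d n a w :=
  ⟨ha, fun h' => absurd h' h⟩

lemma nsmul (hf : GradedCocycle σ d n f) (k : ℕ) :
    GradedCocycle σ d n (fun a b w v => k • f a b w v) where
  pow_eq_one := hf.pow_eq_one
  add_left h₁ h₂ h₃ := by rw [hf.add_left h₁ h₂ h₃, smul_add]
  antisymm h₁ h₂ := by rw [hf.antisymm h₁ h₂, smul_neg]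
  jacobi h₁ h₂ h₃ := by rw [← smul_add, ← smul_add, hf.jacobi h₁ h₂ h₃, smul_zero]
  eq_zero h₁ h₂ h := by rw [hf.eq_zero h₁ h₂ h, smul_zero]
  balanced c h₁ h₂ h₃ h₄ := by rw [hf.balanced c h₁ h₂ h₃ h₄]

lemma not_dvd_right {a b : ℕ} (ha : ¬d ∣ a) (h : d ∣ a + b) : ¬d ∣ b := fun hb =>
  ha ((Nat.dvd_add_left hb).1 h)

lemma eq_one (hf : GradedCocycle σ d n f) {a b : ℕ} (ha : n ≤ a) (hb : n ≤ b) (had : ¬d ∣ a)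
    (h : d ∣ a + b) (w v : O) : f a b w v = f a b (w * (σ ^ a) v) 1 := by
  rw [mul_comm, hf.balanced _ ha hb had h, ← RingAut.mul_apply, ← pow_add, add_comm b a,
    RingAut.pow_eq_one_of_dvd hf.pow_eq_one h, RingAut.one_apply, mul_one]

lemma one_antisymm (hf : GradedCocycle σ d n f) {a b : ℕ} (ha : n ≤ a) (hb : n ≤ b) (had : ¬d ∣ a)
    (h : d ∣ a + b) (w : O) : f a b w 1 = -f b a ((σ ^ b) w) 1 := by
  have hbd := not_dvd_right had h
  rw [hf.antisymm (adm_of_not_dvd ha had _) (adm_of_not_dvd hb hbd _),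
    hf.eq_one hb ha hbd (by rwa [add_comm]), one_mul]

lemma one_add (hf : GradedCocycle σ d n f) {a b : ℕ} (ha : n ≤ a) (hb : n ≤ b) (had : ¬d ∣ a)
    (h : d ∣ a + b) (w v : O) : f a b (w + v) 1 = f a b w 1 + f a b v 1 :=
  hf.add_left (adm_of_not_dvd ha had _) (adm_of_not_dvd ha had _)
    (adm_of_not_dvd hb (not_dvd_right had h) _)

/-- The map `w ↦ f a b w 1` as a homomorphism. -/
def hom (hf : GradedCocycle σ d n f) {a b : ℕ} (ha : n ≤ a) (hb : n ≤ b) (had : ¬d ∣ a)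
    (h : d ∣ a + b) : O →+ A := AddMonoidHom.mk' (fun w => f a b w 1) (hf.one_add ha hb had h)

lemma one_sub (hf : GradedCocycle σ d n f) {a b : ℕ} (ha : n ≤ a) (hb : n ≤ b) (had : ¬d ∣ a)
    (h : d ∣ a + b) (w v : O) : f a b (w - v) 1 = f a b w 1 - f a b v 1 :=
  map_sub (hf.hom ha hb had h) w v

lemma one_sum (hf : GradedCocycle σ d n f) {a b : ℕ} (ha : n ≤ a) (hb : n ≤ b) (had : ¬d ∣ a)
    (h : d ∣ a + b) {ι : Type*} (s : Finset ι) (w : ι → O) :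
    f a b (∑ i ∈ s, w i) 1 = ∑ i ∈ s, f a b (w i) 1 :=
  map_sum (hf.hom ha hb had h) w s

lemma one_zero (hf : GradedCocycle σ d n f) {a b : ℕ} (ha : n ≤ a) (hb : n ≤ b) (had : ¬d ∣ a)
    (h : d ∣ a + b) : f a b 0 1 = 0 :=
  map_zero (hf.hom ha hb had h)

/-- The effect of shifting the degrees by `dm`, from the Jacobi identity for an element `x` of
degree `dm`. -/
lemma shift (hf : GradedCocycle σ d n f) {a b m : ℕ} (ha : n ≤ a) (hb : n ≤ b) (hm : n ≤ d * m)
    (had : ¬d ∣ a) (h : d ∣ a + b) {x : O} (hx : cyclicTrace σ d x = 0) (y : O) :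
    f (a + d * m) b ((x - (σ ^ a) x) * y) 1 - f a (b + d * m) ((x - (σ ^ a) x) * y) 1 =
      f (d * m) (a + b) x (y - (σ ^ b) y) := by
  have hbd := not_dvd_right had h
  have hσ : ∀ z, (σ ^ (d * m)) z = z := fun z => by
    rw [RingAut.pow_eq_one_of_dvd hf.pow_eq_one (dvd_mul_right d m), RingAut.one_apply]
  have hσab : (σ ^ a) ((σ ^ b) x) = x := by
    rw [← RingAut.mul_apply, ← pow_add, RingAut.pow_eq_one_of_dvd hf.pow_eq_one h,
      RingAut.one_apply]
  have hx' : Adm σ d n (d * m) x := ⟨hm, fun _ => hx⟩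
  have h1 := hf.jacobi hx' (adm_of_not_dvd ha had y) (adm_of_not_dvd hb hbd 1)
  rw [hσ, hσ, map_one, mul_one, mul_one, one_mul, one_mul] at h1
  have had' : ¬d ∣ b + d * m := fun h' => hbd ((Nat.dvd_add_left (dvd_mul_right d m)).1 h')
  have hdab : d ∣ a + (b + d * m) := by rw [← add_assoc]; exact dvd_add h (dvd_mul_right _ _)
  rw [hf.antisymm (a := a + b) ⟨by omega, fun _ => by
      rw [cyclicTrace_sub, cyclicTrace_pow hf.pow_eq_one, sub_self]⟩ hx',
    hf.antisymm (a := b + d * m) (adm_of_not_dvd (by omega) had' _) (adm_of_not_dvd ha had y),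
    hf.eq_one ha (by omega) had hdab, map_sub, hσab] at h1
  rw [show x * y - y * (σ ^ a) x = (x - (σ ^ a) x) * y by ring, add_comm (d * m) a,
    show y * (x - (σ ^ a) x) = (x - (σ ^ a) x) * y by ring] at h1
  rw [sub_eq_iff_eq_add, ← sub_eq_zero, ← h1]
  abel

lemma sub_eq_const {g : ℕ → A} {k L : ℕ}
    (hg : ∀ m α β, k ≤ m → α + m ≤ L → β + m ≤ L → g (α + m) - g α = g (β + m) - g β)
    (hL : 2 * k ≤ L) {α β : ℕ} (hα : α < L) (hβ : β < L) :
    g (α + 1) - g α = g (β + 1) - g β := by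
  have key : ∀ α, α < L → g (α + 1) - g α = (g (0 + (k + 1)) - g 0) - (g (0 + k) - g 0) ∨ L = 0 :=
      by
    intro α hα
    by_cases h : α + 1 + k ≤ L
    · left
      rw [hg (k + 1) 0 α (by omega) (by omega) (by omega),
        hg k 0 (α + 1) le_rfl (by omega) (by omega), show α + (k + 1) = α + 1 + k by ring]
      abel
    · by_cases hk : L = 0
      · exact Or.inr hk
      left
      have hαk : α = (α - k) + k := by omega
      rw [hg (k + 1) 0 (α - k) (by omega) (by omega) (by omega),
        hg k 0 (α - k) le_rfl (by omega) (by omega), ← add_assoc, ← hαk]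
      abel
  rcases key α hα with h1 | h1 <;> rcases key β hβ with h2 | h2 <;> first | omega | rw [h1, h2]

/-- The difference `f (a + d) b y 1 - f a (b + d) y 1` depends only on `a + b`, for
`a ≡ 1 (mod d)`. -/
lemma succ_sub_const (hf : GradedCocycle σ d n f) (hd : 2 ≤ d) {m₀ : ℕ} (hn : n + d = d * m₀ + 1)
    (hu : ∃ x, cyclicTrace σ d x = 0 ∧ IsUnit (x - σ x)) {S α β : ℕ} (hS : d ∣ S)
    (hS₀ : 2 * n + 2 * (d * m₀) ≤ S) (hα : n + d * (α + 1) + n ≤ S)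
    (hβ : n + d * (β + 1) + n ≤ S) (y : O) :
    f (n + d * (α + 1)) (S - (n + d * (α + 1))) y 1 - f (n + d * α) (S - (n + d * α)) y 1 =
      f (n + d * (β + 1)) (S - (n + d * (β + 1))) y 1 - f (n + d * β) (S - (n + d * β)) y 1 := by
  obtain ⟨x, hx, u, hu⟩ := hu
  have hnd : ∀ k, n + d * k ≡ 1 [MOD d] := fun k => by
    have h1 : n + d ≡ 1 [MOD d] := by rw [hn]; simp [Nat.ModEq]
    have h2 : n + d * k ≡ n + d [MOD d] := by simp [Nat.ModEq]
    exact h2.trans h1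
  have hndvd : ∀ k, ¬d ∣ n + d * k := fun k h => by
    have := (Nat.modEq_zero_iff_dvd.2 h).symm.trans (hnd k)
    have := (Nat.modEq_iff_dvd' (by omega)).1 this
    have := Nat.le_of_dvd (by omega) this
    omega
  have hmul : ∀ p q : ℕ, p < q → d * p + d ≤ d * q := fun p q h => by
    rw [← Nat.mul_succ]; exact Nat.mul_le_mul_left d h
  set L := (S - 2 * n) / d with hL
  have hLle : ∀ k, k ≤ L ↔ n + d * k + n ≤ S := fun k => by
    rw [hL, Nat.le_div_iff_mul_le (by omega), mul_comm]; omega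
  refine sub_eq_const (g := fun k => f (n + d * k) (S - (n + d * k)) y 1) (k := m₀) (L := L) ?_ ?_
    ((hLle _).2 hα) ((hLle _).2 hβ)
  · have key : ∀ m α, m₀ ≤ m → α + m ≤ L →
        f (n + d * (α + m)) (S - (n + d * (α + m))) y 1 - f (n + d * α) (S - (n + d * α)) y 1 =
        f (d * m) (S - d * m) x (↑u⁻¹ * y - σ⁻¹ (↑u⁻¹ * y)) := by
      intro m α hm hα
      rw [hLle, mul_add] at hα
      have hm' : d * m₀ ≤ d * m := Nat.mul_le_mul_left d hm
      have hdS : d ∣ n + d * α + (S - (n + d * α + d * m)) := by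
        rw [show n + d * α + (S - (n + d * α + d * m)) = S - d * m by omega]
        exact Nat.dvd_sub hS (dvd_mul_right _ _)
      have h1 := hf.shift (a := n + d * α) (b := S - (n + d * α + d * m)) (m := m) (by omega)
        (by omega) (by omega) (hndvd _) hdS hx (↑u⁻¹ * y)
      rw [RingAut.pow_apply_eq hf.pow_eq_one (hnd α), pow_one, ← hu, ← mul_assoc, u.mul_inv,
        one_mul] at h1
      have hb : σ ^ (S - (n + d * α + d * m)) = σ⁻¹ := by
        rw [eq_inv_iff_mul_eq_one, ← pow_succ]
        refine RingAut.pow_eq_one_of_dvd hf.pow_eq_one (Nat.modEq_zero_iff_dvd.1 ?_)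
        refine Nat.ModEq.trans ?_ (Nat.modEq_zero_iff_dvd.2 hdS)
        rw [add_comm]
        exact Nat.ModEq.add_right _ (hnd α).symm
      rw [hb] at h1
      rw [mul_add, ← add_assoc, ← show n + d * α + (S - (n + d * α + d * m)) = S - d * m by omega,
        ← h1, show S - (n + d * α + d * m) + d * m = S - (n + d * α) by omega]
    intro m α β hm hα hβ
    rw [key m α hm hα, key m β hm hβ]
  · rw [hLle, mul_left_comm]; omega

/-- Cocycle relation between the values on three nontrivial weights. -/
lemma one_add_weights (hf : GradedCocycle σ d n f) {a₁ a₂ b : ℕ} (h₁ : n ≤ a₁) (h₂ : n ≤ a₂)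
    (hb : n ≤ b) (hd₁ : ¬d ∣ a₁) (hd₂ : ¬d ∣ a₂) (hd₁₂ : ¬d ∣ a₁ + a₂) (h : d ∣ a₁ + a₂ + b)
    (hu : ∃ x, IsUnit (x - (σ ^ (a₁ + a₂)) x)) (Y : O) :
    f (a₁ + a₂) b Y 1 = f a₁ (a₂ + b) Y 1 + f a₂ (b + a₁) ((σ ^ (a₂ + b)) Y) 1 := by
  have hbd : ¬d ∣ b := not_dvd_right hd₁₂ h
  have had : ∀ {a} (ha : n ≤ a) (hda : ¬d ∣ a) (w : O), Adm σ d n a w := adm_of_not_dvd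
  have hcancel : ∀ {i j : ℕ}, d ∣ i + j → ∀ z, (σ ^ i) ((σ ^ j) z) = z := fun hij z => by
    rw [← RingAut.mul_apply, ← pow_add, RingAut.pow_eq_one_of_dvd hf.pow_eq_one hij,
      RingAut.one_apply]
  have hcomp : ∀ {i j k : ℕ}, i + j ≡ k [MOD d] → ∀ z, (σ ^ i) ((σ ^ j) z) = (σ ^ k) z :=
    fun hij z => by
      rw [← RingAut.mul_apply, ← pow_add, RingAut.pow_apply_eq hf.pow_eq_one hij]
  have e₁ : d ∣ a₁ + (a₂ + b) := by rwa [← add_assoc]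
  have e₂ : d ∣ a₂ + (b + a₁) := by rwa [add_comm b, ← add_assoc, add_comm a₂]
  have d₁ : ¬d ∣ a₂ + b := not_dvd_right hd₁ e₁
  have d₂ : ¬d ∣ b + a₁ := not_dvd_right hd₂ e₂
  let X : O → A := fun A => f (a₁ + a₂) b A 1 - f a₁ (a₂ + b) A 1 -
    f a₂ (b + a₁) ((σ ^ (a₂ + b)) A) 1
  let X' : O → A := fun B => f (a₁ + a₂) b B 1 - f a₂ (b + a₁) B 1 -
    f a₁ (a₂ + b) ((σ ^ (b + a₁)) B) 1
  have key : ∀ w v, X (w * (σ ^ a₁) v) = X' (v * (σ ^ a₂) w) := by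
    intro w v
    have h1 := hf.jacobi (had h₁ hd₁ w) (had h₂ hd₂ v) (had hb hbd 1)
    rw [hf.one_sub (by omega) hb hd₁₂ h, map_one, map_one, one_mul, one_mul, mul_one, mul_one,
      hf.antisymm (had (a := a₂ + b) (by omega) d₁ _) (had h₁ hd₁ _),
      hf.eq_one h₁ (by omega) hd₁ e₁, hf.antisymm (had (a := b + a₁) (by omega) d₂ _) (had h₂ hd₂ _),
      hf.eq_one h₂ (by omega) hd₂ e₂, map_sub, map_sub, mul_sub, mul_sub,
      hf.one_sub h₁ (by omega) hd₁ e₁, hf.one_sub h₂ (by omega) hd₂ e₂] at h1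
    have t₁ : (σ ^ (a₂ + b)) (w * (σ ^ a₁) v) = v * (σ ^ a₂) ((σ ^ b) w) := by
      rw [map_mul, hcancel (by rwa [add_comm]), hcomp (k := a₂ + b) rfl, mul_comm]
    have t₂ : (σ ^ (b + a₁)) (v * (σ ^ a₂) w) = w * (σ ^ a₁) ((σ ^ b) v) := by
      rw [map_mul, hcancel (by rwa [add_comm]), hcomp (k := b + a₁) (by rw [add_comm]), mul_comm]
    change f _ _ _ _ - f _ _ _ _ - f _ _ _ _ = f _ _ _ _ - f _ _ _ _ - f _ _ _ _
    rw [t₁, t₂, ← sub_eq_zero, ← h1]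
    abel
  have hX'sub : ∀ y z, X' (y - z) = X' y - X' z := fun y z => by
    change f _ _ _ _ - f _ _ _ _ - f _ _ _ _ = f _ _ _ _ - f _ _ _ _ - f _ _ _ _ -
      (f _ _ _ _ - f _ _ _ _ - f _ _ _ _)
    rw [map_sub, hf.one_sub (by omega) hb hd₁₂ h, hf.one_sub h₁ (by omega) hd₁ e₁,
      hf.one_sub h₂ (by omega) hd₂ e₂]
    abel
  have hX1 : ∀ w, X w = X' ((σ ^ a₂) w) := fun w => by
    have := key w 1
    rwa [map_one, mul_one, one_mul] at this
  have hX' : ∀ y, X' y = 0 := by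
    obtain ⟨x, u, hu⟩ := hu
    intro y
    have h1 : X' (x * (σ ^ a₂) ((σ ^ (a₁ + b)) (↑u⁻¹ * y))) = X' ((σ ^ a₂)
        ((σ ^ (a₁ + b)) (↑u⁻¹ * y)) * (σ ^ (a₁ + a₂)) x) := by
      rw [← key, hX1, map_mul, hcomp (j := a₁) (k := a₁ + a₂) (by rw [add_comm])]
    rw [hcancel (by rwa [← add_assoc, add_comm a₂]), ← sub_eq_zero, ← hX'sub] at h1
    rw [← h1]
    congr 1
    rw [mul_comm, ← mul_sub, ← hu, mul_comm, ← mul_assoc, u.mul_inv, one_mul]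
  have h1 := hX1 Y
  rw [hX'] at h1
  change f _ _ _ _ - f _ _ _ _ - f _ _ _ _ = 0 at h1
  rw [sub_sub, sub_eq_zero] at h1
  exact h1

end GradedCocycle
end GradedCocycles

section GradedCocycles

open Finset

variable {O A : Type*} [CommRing O] [AddCommGroup A]

/-- The hypotheses under which a graded cocycle is a coboundary in high degrees: there are enough
units, the additive form of Hilbert's theorem 90 holds, and `f (a + d) b y 1 = f a (b + d) y 1` for
`a ≡ 1 (mod d)` in high total degree. -/
structure GradedCocycle.Periodic (σ : RingAut O) (d n m₀ : ℕ) (f : ℕ → ℕ → O → O → A)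
    (H : O →+ O) : Prop extends GradedCocycle σ d n f where
  two_le : 2 ≤ d
  n_add : n + d = d * m₀ + 1
  exists_unit : ∀ a, ¬d ∣ a → ∃ x, cyclicTrace σ d x = 0 ∧ IsUnit (x - (σ ^ a) x)
  sub_inv_apply : ∀ x, cyclicTrace σ d x = 0 → H x - σ⁻¹ (H x) = x
  exists_trace_eq_one : ∃ y, cyclicTrace σ d y = 1
  periodic : ∀ {a b : ℕ} (y : O), a ≡ 1 [MOD d] → n ≤ a → n ≤ b → d ∣ a + d + b →
    2 * n + 2 * (d * m₀) ≤ a + d + b → f (a + d) b y 1 = f a (b + d) y 1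

namespace GradedCocycle.Periodic

variable {σ : RingAut O} {d n m₀ : ℕ} {f : ℕ → ℕ → O → O → A} {H : O →+ O}

lemma not_dvd_of_modEq_one {d : ℕ} (hd : 2 ≤ d) {a : ℕ} (ha : a ≡ 1 [MOD d]) : ¬d ∣ a := by
  intro h
  have h1 := (Nat.modEq_zero_iff_dvd.2 h).symm.trans ha
  have h2 := (Nat.modEq_iff_dvd' (by omega)).1 h1
  have := Nat.le_of_dvd (by omega) h2
  omega

lemma n_modEq (hf : Periodic σ d n m₀ f H) : n ≡ 1 [MOD d] := by
  have h1 : n + d ≡ 1 [MOD d] := by rw [hf.n_add]; simp [Nat.ModEq]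
  exact (show n ≡ n + d [MOD d] by simp [Nat.ModEq]).trans h1

lemma one_eq (hf : Periodic σ d n m₀ f H) {a b a' b' : ℕ} (ha : a ≡ 1 [MOD d])
    (ha' : a' ≡ 1 [MOD d]) (hna : n ≤ a) (hnb : n ≤ b) (hna' : n ≤ a') (hnb' : n ≤ b')
    (h : a + b = a' + b') (hdvd : d ∣ a + b) (hS : 2 * n + 2 * (d * m₀) ≤ a + b) (y : O) :
    f a b y 1 = f a' b' y 1 := by
  wlog hle : a ≤ a' generalizing a b a' b'
  · exact (this ha' ha hna' hnb' hna hnb h.symm (h ▸ hdvd) (h ▸ hS) (le_of_not_ge hle)).symm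
  obtain ⟨k, hk⟩ := (Nat.modEq_iff_dvd' hle).1 (ha.trans ha'.symm)
  obtain rfl : a' = a + d * k := by omega
  obtain rfl : b = b' + d * k := by omega
  clear hle hk
  induction k generalizing b' with
  | zero => rfl
  | succ k ih =>
    have e : a + (b' + d * (k + 1)) = a + d * k + d + b' := by ring
    have hd : a + d * k ≡ 1 [MOD d] := by simpa [Nat.ModEq] using ha
    rw [mul_add, mul_one, ← add_assoc, ← add_assoc, hf.periodic y hd (by omega) hnb' (e ▸ hdvd)
      (e ▸ hS), show b' + d * k + d = b' + d + d * k by ring]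
    have e' : a + (b' + d + d * k) = a + (b' + d * (k + 1)) := by ring
    exact ih (b' := b' + d) (by omega) hd (by omega) (by omega) (by rwa [e']) (by rwa [e'])
      (by ring)

lemma weight_zero (hf : Periodic σ d n m₀ f H) {m M : ℕ} (hm : n ≤ d * m) (hM : 2 * n ≤ M)
    (hdM : d ∣ M) (hS : 2 * n + 2 * (d * m₀) ≤ d * m + M) {x x' : O}
    (hx : cyclicTrace σ d x = 0) (hx' : cyclicTrace σ d x' = 0) : f (d * m) M x x' = 0 := by
  have hd := hf.two_le
  have hn1 := hf.n_modEq
  have e : n + (M - n) = M := by omega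
  have h1 := hf.shift (a := n) (b := M - n) le_rfl (by omega) hm (not_dvd_of_modEq_one hd hn1)
    (by rwa [e]) hx (H x')
  have hb : σ ^ (M - n) = σ⁻¹ := by
    rw [eq_inv_iff_mul_eq_one, ← pow_succ]
    refine RingAut.pow_eq_one_of_dvd hf.pow_eq_one (Nat.modEq_zero_iff_dvd.1 ?_)
    refine Nat.ModEq.trans ?_ (Nat.modEq_zero_iff_dvd.2 (e.symm ▸ hdM))
    rw [add_comm]
    exact Nat.ModEq.add_right _ hn1.symm
  rw [hb, hf.sub_inv_apply _ hx', e, hf.one_eq (a := n + d * m) (b := M - n) (a' := n)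
    (b' := M - n + d * m) (by simpa [Nat.ModEq] using hn1) hn1 (by omega) (by omega) le_rfl
    (by omega) (by ring) (by
      rw [show n + d * m + (M - n) = M + d * m by omega]
      exact dvd_add hdM (dvd_mul_right _ _)) (by omega), sub_self] at h1
  exact h1.symm

lemma one_shift (hf : Periodic σ d n m₀ f H) {a b m : ℕ} (ha : n ≤ a) (hb : n ≤ b)
    (hm : n ≤ d * m) (had : ¬d ∣ a) (h : d ∣ a + b)
    (hS : 2 * n + 2 * (d * m₀) ≤ a + b + d * m) (y : O) :
    f (a + d * m) b y 1 = f a (b + d * m) y 1 := by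
  obtain ⟨x, hx, u, hu⟩ := hf.exists_unit a had
  have h1 := hf.shift ha hb hm had h hx (↑u⁻¹ * y)
  rw [← hu, ← mul_assoc, u.mul_inv, one_mul, hf.weight_zero hm (by omega) h (by omega) hx (by
    rw [cyclicTrace_sub, cyclicTrace_pow hf.pow_eq_one, sub_self])] at h1
  exact sub_eq_zero.1 h1

lemma one_weight (hf : Periodic σ d n m₀ f H) {S : ℕ} (hdS : d ∣ S)
    (hS : 2 * n + 2 * (d * m₀) ≤ S) (i : ℕ) (hi : i + 1 < d) (Y : O) :
    f (n + i) (S - (n + i)) Y 1 = ∑ j ∈ range (i + 1), f n (S - n) ((σ⁻¹ ^ j) Y) 1 := by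
  have hd := hf.two_le
  have hn := hf.n_add
  have hn1 := hf.n_modEq
  induction i generalizing Y with
  | zero => rw [zero_add, range_one, sum_singleton]; rfl
  | succ i ih =>
    have hnd : ∀ k, k + 1 < d → ¬d ∣ n + k := fun k hk h => by
      have h1 : n + k ≡ 1 + k [MOD d] := Nat.ModEq.add_right _ hn1
      have h2 := (Nat.modEq_zero_iff_dvd.2 h).symm.trans h1
      have := Nat.le_of_dvd (by omega) ((Nat.modEq_iff_dvd' (by omega)).1 h2)
      omega
    set b := S - (n + (i + 1)) - d * m₀ with hb
    have e₁ : n + (i + 1) + b + d * m₀ = S := by omega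
    have hdb : d ∣ n + (i + 1) + b := (Nat.dvd_add_left (dvd_mul_right d m₀)).1 (e₁ ▸ hdS)
    have h1 := hf.one_shift (a := n + (i + 1)) (b := b) (m := m₀) (by omega) (by omega) (by omega)
      (hnd _ hi) hdb (by omega) Y
    rw [show b + d * m₀ = S - (n + (i + 1)) by omega,
      show n + (i + 1) + d * m₀ = (n + d) + (n + i) by omega] at h1
    have hnd1 : n + d ≡ 1 [MOD d] := by simpa [Nat.ModEq] using hn1
    have e₂ : n + d + (n + i) + b = S := by omega
    have hdni : ¬d ∣ n + d + (n + i) := fun h => hnd _ hi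
      ((Nat.dvd_add_left (dvd_mul_right d m₀)).1 (by
        rwa [show n + (i + 1) + d * m₀ = (n + d) + (n + i) by omega]))
    obtain ⟨x, -, hx⟩ := hf.exists_unit _ hdni
    have hσ : σ ^ (n + i + b) = σ⁻¹ := by
      rw [eq_inv_iff_mul_eq_one, ← pow_succ]
      refine RingAut.pow_eq_one_of_dvd hf.pow_eq_one ?_
      rwa [show n + i + b + 1 = n + (i + 1) + b by omega]
    rw [← h1, hf.one_add_weights (by omega) (by omega) (by omega) (not_dvd_of_modEq_one hd hnd1)
      (hnd _ (by omega)) hdni (e₂.symm ▸ hdS) ⟨x, hx⟩, hσ,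
      show b + (n + d) = S - (n + i) by omega, ih (by omega), sum_range_succ' _ (i + 1),
      hf.one_eq (a := n + d) (b := n + i + b) (a' := n) (b' := S - n) hnd1 hn1 (by omega) (by omega)
        le_rfl (by omega) (by omega) (by rwa [show n + d + (n + i + b) = S by omega])
        (by omega), add_comm]
    rfl

lemma one_fixed (hf : Periodic σ d n m₀ f H) {S : ℕ} (hdS : d ∣ S)
    (hS : 2 * n + 2 * (d * m₀) ≤ S) {w : O} (hw : σ⁻¹ w = w) : f n (S - n) w 1 = 0 := by
  have hd := hf.two_le
  have hn := hf.n_add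
  have hn1 := hf.n_modEq
  have hsum : ∀ Y, ∑ j ∈ range d, f n (S - n) ((σ⁻¹ ^ j) Y) 1 = 0 := by
    intro Y
    have h1 := hf.one_weight hdS hS (d - 2) (by omega) (σ⁻¹ Y)
    have e : n + (d - 2) + (S - (n + (d - 2))) = S := by omega
    have hnd : ¬d ∣ n + (d - 2) := fun h => by
      have h1 : n + (d - 2) ≡ 1 + (d - 2) [MOD d] := Nat.ModEq.add_right _ hn1
      have h2 := (Nat.modEq_zero_iff_dvd.2 h).symm.trans h1
      have := Nat.le_of_dvd (by omega) ((Nat.modEq_iff_dvd' (by omega)).1 h2)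
      omega
    have hb : S - (n + (d - 2)) ≡ 1 [MOD d] := by
      have h2 : n + (d - 2) + 1 ≡ 0 [MOD d] := by
        rw [show n + (d - 2) + 1 = d * m₀ by omega]; simp [Nat.ModEq]
      have h3 : n + (d - 2) + (S - (n + (d - 2))) ≡ 0 [MOD d] := by
        rw [e]; exact Nat.modEq_zero_iff_dvd.2 hdS
      exact Nat.ModEq.add_left_cancel' _ (h3.trans h2.symm)
    rw [hf.one_antisymm (by omega) (by omega) hnd (e.symm ▸ hdS),
      RingAut.pow_apply_eq hf.pow_eq_one hb, pow_one, ← RingAut.mul_apply, mul_inv_cancel,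
      RingAut.one_apply, show d - 2 + 1 = d - 1 by omega,
      hf.one_eq (a := S - (n + (d - 2))) (b := n + (d - 2)) (a' := n) (b' := S - n) hb hn1
        (by omega) (by omega) le_rfl (by omega) (by omega) (by rwa [add_comm, e])
        (by omega), neg_eq_iff_add_eq_zero, add_comm] at h1
    rw [show d = d - 1 + 1 by omega, sum_range_succ', ← h1]
    rfl
  obtain ⟨y, hy⟩ := hf.exists_trace_eq_one
  have hwj : ∀ j, (σ⁻¹ ^ j) w = w := fun j => by
    induction j with
    | zero => rfl
    | succ j ih => rw [pow_succ, RingAut.mul_apply, hw, ih]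
  have h1 := hsum (y * w)
  rw [← hf.one_sum le_rfl (by omega) (not_dvd_of_modEq_one hd hn1)
    (by rwa [show n + (S - n) = S by omega])] at h1
  simp only [map_mul, hwj] at h1
  rwa [← sum_mul, sum_inv_pow hf.pow_eq_one, hy, one_mul] at h1

/-- In high degrees a periodic graded cocycle is a coboundary. -/
theorem eq_coboundary (hf : Periodic σ d n m₀ f H) {l a b : ℕ} (hl : n + d * m₀ ≤ l) {w v : O}
    (hw : Adm σ d l a w) (hv : Adm σ d l b v) (hab : d ∣ a + b) :
    f a b w v =
      f (a + b - (d * m₀ - 1)) (d * m₀ - 1) (H (w * (σ ^ a) v - v * (σ ^ b) w)) 1 := by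
  have hd := hf.two_le
  have hn := hf.n_add
  have hn1 := hf.n_modEq
  have hla := hw.1
  have hlb := hv.1
  have hS : a + b - (d * m₀ - 1) ≡ 1 [MOD d] := by
    have h2 : d * m₀ - 1 + (a + b - (d * m₀ - 1)) ≡ 0 [MOD d] := by
      rw [show d * m₀ - 1 + (a + b - (d * m₀ - 1)) = a + b by omega]
      exact Nat.modEq_zero_iff_dvd.2 hab
    have h3 : d * m₀ - 1 + 1 ≡ 0 [MOD d] := by
      rw [show d * m₀ - 1 + 1 = d * m₀ by omega]; simp [Nat.ModEq]
    exact Nat.ModEq.add_left_cancel' _ (h2.trans h3.symm)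
  have eS : a + b - (d * m₀ - 1) + (d * m₀ - 1) = a + b := by omega
  by_cases had : d ∣ a
  · have hbd : d ∣ b := (Nat.dvd_add_right had).1 hab
    obtain ⟨m, rfl⟩ := had
    rw [hf.weight_zero (by omega) (by omega) hbd (by omega) (hw.2 (dvd_mul_right _ _)) (hv.2 hbd),
      RingAut.pow_eq_one_of_dvd hf.pow_eq_one hbd,
      RingAut.pow_eq_one_of_dvd hf.pow_eq_one (dvd_mul_right d m), RingAut.one_apply,
      RingAut.one_apply, mul_comm w v, sub_self, map_zero, hf.one_zero (by omega) (by omega)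
        (not_dvd_of_modEq_one hd hS) (eS.symm ▸ hab)]
  · set i := (a - n) % d with hi
    set t := (a - n) / d with ht
    have hat : a = n + i + d * t := by
      have : i + d * t = a - n := Nat.mod_add_div (a - n) d
      omega
    have hid : i < d := Nat.mod_lt _ (by omega)
    have hid' : i + 1 < d := by
      by_contra hcon
      refine had ⟨m₀ + t, ?_⟩
      rw [mul_add]; omega
    have htm : m₀ ≤ t := by
      by_contra hcon
      have : d * (t + 1) ≤ d * m₀ := Nat.mul_le_mul_left d (by omega)
      rw [mul_add] at this
      omega
    have hdt : d * m₀ ≤ d * t := Nat.mul_le_mul_left d htm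
    set Y := w * (σ ^ a) v with hY
    have hdni : ¬d ∣ n + i := fun h => had (hat ▸ dvd_add h (dvd_mul_right _ _))
    have hdnib : d ∣ n + i + b := (Nat.dvd_add_left (dvd_mul_right d t)).1 (by
      rwa [show n + i + b + d * t = a + b by omega])
    have h1 : f a b w v = ∑ j ∈ range (i + 1), f n (a + b - n) ((σ⁻¹ ^ j) Y) 1 := by
      rw [hf.eq_one (by omega) (by omega) had hab, hat, hf.one_shift (by omega) (by omega)
        (by omega) hdni hdnib (by omega), ← hat, show b + d * t = a + b - (n + i) by omega,
        hf.one_weight hab (by omega) i hid']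
    have hσb : σ ^ b = σ⁻¹ ^ (i + 1) := by
      rw [inv_pow, eq_inv_iff_mul_eq_one, ← pow_add]
      refine RingAut.pow_eq_one_of_dvd hf.pow_eq_one (Nat.modEq_zero_iff_dvd.1 ?_)
      have h3 : 1 + i + b ≡ n + i + b [MOD d] := Nat.ModEq.add_right _ (Nat.ModEq.add_right _
        hn1.symm)
      rw [show b + (i + 1) = 1 + i + b by ring]
      exact h3.trans (Nat.modEq_zero_iff_dvd.2 hdnib)
    have hYb : v * (σ ^ b) w = (σ⁻¹ ^ (i + 1)) Y := by
      rw [← hσb, hY, map_mul, ← RingAut.mul_apply, ← pow_add,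
        RingAut.pow_eq_one_of_dvd hf.pow_eq_one (a := b + a) (by rwa [add_comm]),
        RingAut.one_apply, mul_comm]
    set Z := ∑ j ∈ range (i + 1), (σ⁻¹ ^ j) Y with hZ
    have hYZ : Y - v * (σ ^ b) w = Z - σ⁻¹ Z := by
      rw [hYb, hZ, map_sum]
      have h4 := sum_range_succ' (fun j => (σ⁻¹ ^ j) Y) (i + 1)
      rw [sum_range_succ] at h4
      have h5 : ∀ j, σ⁻¹ ((σ⁻¹ ^ j) Y) = (σ⁻¹ ^ (j + 1)) Y := fun j => by
        rw [← RingAut.mul_apply, ← pow_succ']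
      simp only [h5]
      rw [pow_zero, RingAut.one_apply] at h4
      rw [sub_eq_sub_iff_add_eq_add, add_comm Y, ← h4]
    have hn1S : n + (a + b - n) = a + b := by omega
    have htr : cyclicTrace σ d (Z - σ⁻¹ Z) = 0 := by
      have h6 := cyclicTrace_pow hf.pow_eq_one 1 (σ⁻¹ Z)
      rw [pow_one, ← RingAut.mul_apply, mul_inv_cancel, RingAut.one_apply] at h6
      rw [cyclicTrace_sub, h6, sub_self]
    have h7 := hf.sub_inv_apply _ htr
    have h8 : f n (a + b - n) (H (Z - σ⁻¹ Z) - Z) 1 = 0 := by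
      refine hf.one_fixed hab (by omega) ?_
      rw [map_sub, ← sub_eq_zero]
      rw [← sub_eq_zero] at h7
      rw [← neg_eq_zero, ← h7]
      abel
    rw [h1, hYZ, hf.one_eq (a := a + b - (d * m₀ - 1)) (a' := n) (b' := a + b - n) hS hn1 (by omega)
      (by omega) le_rfl (by omega) (by omega) (by rwa [eS]) (by omega),
      ← hf.one_sum le_rfl (by omega) (not_dvd_of_modEq_one hd hn1) (by rwa [hn1S])]
    rw [hf.one_sub le_rfl (by omega) (not_dvd_of_modEq_one hd hn1) (by rwa [hn1S])] at h8
    exact (sub_eq_zero.1 h8).symm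

end GradedCocycle.Periodic
end GradedCocycles

section DigitSums

open Finset

lemma digits_unique {q d : ℕ} {a b : ℕ → ℕ} (ha : ∀ t < d, a t < q) (hb : ∀ t < d, b t < q)
    (h : ∑ t ∈ range d, a t * q ^ t = ∑ t ∈ range d, b t * q ^ t) : ∀ t < d, a t = b t := by
  induction d generalizing a b with
  | zero => intro t ht; omega
  | succ d ih =>
    have key : ∀ a : ℕ → ℕ, ∑ t ∈ range (d + 1), a t * q ^ t =
        a 0 + q * ∑ t ∈ range d, a (t + 1) * q ^ t := fun a => by
      rw [sum_range_succ', mul_sum, pow_zero, mul_one, add_comm]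
      congr 1
      exact sum_congr rfl fun t _ => by ring
    rw [key, key] at h
    have h0 : a 0 = b 0 := by
      have := congrArg (· % q) h
      simpa [Nat.add_mul_mod_self_left, Nat.mod_eq_of_lt (ha 0 (by omega)),
        Nat.mod_eq_of_lt (hb 0 (by omega))] using this
    have hq : 0 < q := (Nat.zero_le _).trans_lt (ha 0 (by omega))
    rw [h0] at h
    have h' := Nat.eq_of_mul_eq_mul_left hq (Nat.add_left_cancel h)
    intro t ht
    cases t with
    | zero => exact h0
    | succ t =>
      exact ih (fun t ht => ha (t + 1) (by omega)) (fun t ht => hb (t + 1) (by omega)) h' t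
        (by omega)

lemma sum_indicator_pow {q d x P : ℕ} (hx : x < d) :
    ∑ t ∈ range d, (if t = x then P else 0) * q ^ t = P * q ^ x := by
  simp [ite_mul, hx]

/-- The sum `1 + q + ⋯ + q^(d-1)` divides `(P q^x + q^y) - (P q^i + q^j)` only for trivial
reasons. -/
lemma eq_of_add_eq_mul_geom {q d P k x y i j : ℕ} (hP : 1 ≤ P) (hPq : 3 * P ≤ q) (hd : 2 ≤ d)
    (hdq : ¬(d = 2 ∧ q = 3)) (hx : x < d) (hy : y < d) (hi : i < d) (hj : j < d) (hxi : x ≠ i)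
    (hyj : y ≠ j)
    (h : P * q ^ x + q ^ y = k * ∑ t ∈ range d, q ^ t + (P * q ^ i + q ^ j)) :
    P = 1 ∧ x = j ∧ y = i := by
  have hq : 0 < q := by omega
  have hpow : ∀ t < d, q ^ t ≤ q ^ (d - 1) := fun t ht => Nat.pow_le_pow_right hq (by omega)
  have hN : q ^ (d - 1) < ∑ t ∈ range d, q ^ t := by
    obtain ⟨d, rfl⟩ : ∃ e, d = e + 2 := ⟨d - 2, by omega⟩
    rw [sum_range_succ, show d + 2 - 1 = d + 1 by omega, lt_add_iff_pos_left]
    exact sum_pos (fun t _ => pow_pos hq t) ⟨0, by simp⟩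
  have hk : k ≤ P := by
    by_contra hcon
    have h1 : (P + 1) * ∑ t ∈ range d, q ^ t ≤ k * ∑ t ∈ range d, q ^ t :=
      Nat.mul_le_mul_right _ (by omega)
    have h2 : (P + 1) * q ^ (d - 1) < (P + 1) * ∑ t ∈ range d, q ^ t :=
      Nat.mul_lt_mul_of_pos_left hN (by omega)
    have h3 : P * q ^ x ≤ P * q ^ (d - 1) := Nat.mul_le_mul_left _ (hpow x hx)
    have h4 := hpow y hy
    rw [add_mul P, one_mul] at h2
    omega
  have hA : ∑ t ∈ range d, ((if t = x then P else 0) + (if t = y then 1 else 0)) * q ^ t =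
      P * q ^ x + q ^ y := by
    simp only [add_mul]
    rw [sum_add_distrib, sum_indicator_pow hx, sum_indicator_pow hy, one_mul]
  have hB : ∑ t ∈ range d, (k + (if t = i then P else 0) + (if t = j then 1 else 0)) * q ^ t =
      k * ∑ t ∈ range d, q ^ t + (P * q ^ i + q ^ j) := by
    simp only [add_mul]
    rw [sum_add_distrib, sum_add_distrib, sum_indicator_pow hi, sum_indicator_pow hj, one_mul,
      mul_sum, add_assoc]
  by_cases hbad : ∀ t < d, k + (if t = i then P else 0) + (if t = j then 1 else 0) < q
  · have hdig := digits_unique (a := fun t => (if t = x then P else 0) + (if t = y then 1 else 0))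
      (fun t _ => by split_ifs <;> omega) hbad (by rw [hA, hB, h])
    have h1 := hdig i hi
    have h2 := hdig x hx
    simp only [if_neg hxi, if_neg hxi.symm, if_true] at h1 h2
    split_ifs at h1 h2 <;> omega
  · exfalso
    push Not at hbad
    obtain ⟨t, ht, hbad⟩ := hbad
    have h3 : q = 3 ∧ P = 1 ∧ k = 1 ∧ i = j := by
      split_ifs at hbad <;> omega
    obtain ⟨rfl, rfl, rfl, rfl⟩ := h3
    have hd3 : 3 ≤ d := by omega
    rw [one_mul, one_mul, one_mul] at h
    by_cases hi' : i + 1 < d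
    · have hB' : ∑ t ∈ range d, (if t = i then 0 else if t = i + 1 then 2 else 1) * 3 ^ t =
          ∑ t ∈ range d, 3 ^ t + (3 ^ i + 3 ^ i) := by
        have e : ∀ t, (if t = i then 0 else if t = i + 1 then 2 else 1) * 3 ^ t +
            (if t = i then 1 else 0) * 3 ^ t = 3 ^ t + (if t = i + 1 then 1 else 0) * 3 ^ t := by
          intro t
          split_ifs <;> omega
        have := sum_congr (rfl : range d = range d) fun t _ => e t
        rw [sum_add_distrib, sum_add_distrib, sum_indicator_pow hi, sum_indicator_pow hi',
          pow_succ] at this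
        omega
      have hdig := digits_unique (q := 3)
        (a := fun t => (if t = x then 1 else 0) + (if t = y then 1 else 0))
        (b := fun t => if t = i then 0 else if t = i + 1 then 2 else 1)
        (fun t _ => by split_ifs <;> omega)
        (fun t _ => by split_ifs <;> omega) (by rw [hA, hB', one_mul, h])
      have h1 := hdig (i + 1) hi'
      simp only [Nat.add_eq_left, one_ne_zero, if_false, if_true] at h1
      have h2 : ∃ t < d, t ≠ i ∧ t ≠ i + 1 := by
        by_cases h0 : i = 0
        · exact ⟨2, by omega, by omega, by omega⟩
        · exact ⟨0, by omega, by omega, by omega⟩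
      obtain ⟨t, ht, h3, h4⟩ := h2
      have h5 := hdig t ht
      simp only [if_neg h3, if_neg h4] at h5
      split_ifs at h1 h5 <;> omega
    · have : i = d - 1 := by omega
      subst this
      have h1 := hpow x hx
      have h2 := hpow y hy
      omega

lemma modEq_of_geom_dvd {q d P X Y I J : ℕ} (hP : 1 ≤ P) (hPq : 3 * P ≤ q) (hd : 2 ≤ d)
    (hdq : ¬(d = 2 ∧ q = 3)) (hXI : ¬X ≡ I [MOD d]) (hYJ : ¬Y ≡ J [MOD d])
    (h : ((∑ t ∈ range d, q ^ t : ℕ) : ℤ) ∣ (P * q ^ X + q ^ Y) - (P * q ^ I + q ^ J)) :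
    P = 1 ∧ X ≡ J [MOD d] ∧ Y ≡ I [MOD d] := by
  set N := ∑ t ∈ range d, q ^ t with hN
  have hqN : (q : ℤ) ^ d ≡ 1 [ZMOD N] := by
    rw [Int.modEq_comm, Int.modEq_iff_dvd, hN]
    push_cast
    exact ⟨q - 1, (geom_sum_mul (q : ℤ) d).symm⟩
  have hred : ∀ s : ℕ, (q : ℤ) ^ s ≡ (q : ℤ) ^ (s % d) [ZMOD N] := fun s => by
    conv_lhs => rw [← Nat.div_add_mod s d, pow_add, pow_mul]
    simpa using (hqN.pow (s / d)).mul_right ((q : ℤ) ^ (s % d))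
  have hlt : ∀ s, s % d < d := fun s => Nat.mod_lt _ (by omega)
  have h1 : (P * q ^ (I % d) + q ^ (J % d) : ℤ) ≡ P * q ^ (X % d) + q ^ (Y % d) [ZMOD N] :=
    ((((hred I).symm.mul_left P).add (hred J).symm).trans (Int.modEq_iff_dvd.2 h)).trans
      (((hred X).mul_left P).add (hred Y))
  obtain ⟨k, hk⟩ := Int.modEq_iff_dvd.1 h1
  rcases le_total 0 k with hk0 | hk0
  · lift k to ℕ using hk0
    have h2 : P * q ^ (X % d) + q ^ (Y % d) = k * N + (P * q ^ (I % d) + q ^ (J % d)) := by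
      zify
      linarith
    exact eq_of_add_eq_mul_geom hP hPq hd hdq (hlt X) (hlt Y) (hlt I) (hlt J) hXI hYJ h2
  · obtain ⟨k, rfl⟩ : ∃ k' : ℕ, k = -k' := ⟨k.natAbs, by omega⟩
    have h2 : P * q ^ (I % d) + q ^ (J % d) = k * N + (P * q ^ (X % d) + q ^ (Y % d)) := by
      zify
      linarith
    obtain ⟨h3, h4, h5⟩ := eq_of_add_eq_mul_geom hP hPq hd hdq (hlt I) (hlt J) (hlt X) (hlt Y)
      (fun h => hXI h.symm) (fun h => hYJ h.symm) h2
    exact ⟨h3, h5.symm, h4.symm⟩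

/-- The parameters `q = p^g`, `d` and `r` of a finite field with `q^d` elements and its automorphism
`x ↦ x^(q^r)`, of order `d`. -/
structure FrobeniusData (p g d r : ℕ) : Prop where
  prime : p.Prime
  three_le : 3 ≤ p
  g_pos : 0 < g
  two_le : 2 ≤ d
  coprime : r.Coprime d
  ne : ¬(d = 2 ∧ p ^ g = 3)

namespace FrobeniusData

variable {p g d r : ℕ}

lemma geom_dvd (h : FrobeniusData p g d r) {M : ℤ}
    (hM : ((((p ^ g) ^ d - 1 : ℕ)) : ℤ) ∣ (((p ^ g) ^ r - 1 : ℕ) : ℤ) * M) :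
    ((∑ t ∈ range d, (p ^ g) ^ t : ℕ) : ℤ) ∣ M := by
  set q := p ^ g with hq
  have hp := h.prime.two_le
  have hq2 : 2 ≤ q := hp.trans (Nat.le_self_pow h.g_pos.ne' p)
  have hgeom : ∀ k, (q ^ k - 1 : ℕ) = (∑ t ∈ range k, q ^ t) * (q - 1) := fun k => by
    have := Nat.geomSum_eq hq2 k
    rw [this, Nat.div_mul_cancel]
    simpa using Nat.sub_dvd_pow_sub_pow q 1 k
  have hgcd : (∑ t ∈ range r, q ^ t).Coprime (∑ t ∈ range d, q ^ t) := by
    have h1 := Nat.pow_sub_one_gcd_pow_sub_one q r d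
    rw [hgeom r, hgeom d, Nat.gcd_mul_right, h.coprime.gcd_eq_one, pow_one] at h1
    exact Nat.eq_of_mul_eq_mul_right (by omega) (h1.trans (one_mul _).symm)
  rw [hgeom r, hgeom d] at hM
  push_cast at hM
  rw [mul_right_comm] at hM
  have hq0 : ((q - 1 : ℕ) : ℤ) ≠ 0 := by
    have : q - 1 ≠ 0 := by omega
    exact_mod_cast this
  have h2 := Int.dvd_of_mul_dvd_mul_right hq0 hM
  refine IsCoprime.dvd_of_dvd_mul_left ?_ (by push_cast; exact h2)
  rw [isCoprime_comm]
  exact_mod_cast Nat.isCoprime_iff_coprime.2 hgcd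

variable {k : Type*} [Field k]

/-- The unit `χ_a = ζ / σ^a(ζ)` with `ζ = σ(w) / w`, where `σ(x) = x^(q^r)`. -/
def chi (p g r : ℕ) (w : kˣ) (a : ℕ) : kˣ :=
  w ^ ((p ^ g) ^ r - 1) / (w ^ ((p ^ g) ^ r - 1)) ^ ((p ^ g) ^ r) ^ a

lemma exists_decomp (h : FrobeniusData p g d r) (t : ℕ) :
    ∃ P s u, t = g * s + u ∧ u < g ∧ P = p ^ u ∧ p ^ t = P * (p ^ g) ^ s ∧ 1 ≤ P ∧
      3 * P ≤ p ^ g := by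
  refine ⟨p ^ (t % g), t / g, t % g, (Nat.div_add_mod t g).symm, Nat.mod_lt _ h.g_pos, rfl, ?_,
    Nat.one_le_pow _ _ h.prime.pos, ?_⟩
  · rw [← pow_mul, ← pow_add, add_comm, Nat.div_add_mod]
  · calc 3 * p ^ (t % g) ≤ p * p ^ (t % g) := Nat.mul_le_mul_right _ h.three_le
      _ = p ^ (t % g + 1) := by rw [pow_succ, mul_comm]
      _ ≤ p ^ g := Nat.pow_le_pow_right h.prime.pos (Nat.mod_lt _ h.g_pos)

lemma chi_pow_eq (h : FrobeniusData p g d r) {w : kˣ} (hw : orderOf w = (p ^ g) ^ d - 1) {a t : ℕ}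
    (ha : ¬d ∣ a) (hχ : chi p g r w a ^ p ^ t = chi p g r w a) : g * d ∣ t := by
  set q := p ^ g with hq
  have hM : ((((p ^ g) ^ d - 1 : ℕ)) : ℤ) ∣ (((p ^ g) ^ r - 1 : ℕ) : ℤ) *
      ((p ^ t * q ^ (r * a) + 1) - (p ^ t + q ^ (r * a))) := by
    have h1 : w ^ (((q ^ r - 1 : ℕ) : ℤ) * ((p ^ t * q ^ (r * a) + 1) - (p ^ t + q ^ (r * a)))) =
        (chi p g r w a ^ p ^ t)⁻¹ * chi p g r w a := by
      rw [chi, ← hq]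
      generalize q ^ r - 1 = e
      rw [div_pow, inv_div, ← zpow_natCast w e]
      simp only [← zpow_natCast, ← zpow_mul, ← zpow_add, div_eq_mul_inv, ← zpow_neg]
      congr 1
      push_cast
      ring
    rw [hχ, inv_mul_cancel] at h1
    rw [← hw]
    exact orderOf_dvd_iff_zpow_eq_one.2 h1
  obtain ⟨P, s, u, rfl, hu, hP, hPs, hP1, hPq⟩ := h.exists_decomp t
  have h2 := h.geom_dvd hM
  have h3 := modEq_of_geom_dvd (X := s + r * a) (Y := 0) (I := s) (J := r * a) hP1 hPq h.two_le h.ne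
    (fun h' => ha (h.coprime.symm.dvd_of_dvd_mul_left (Nat.modEq_zero_iff_dvd.1
      (Nat.ModEq.add_left_cancel' s h'))))
    (fun h' => ha (h.coprime.symm.dvd_of_dvd_mul_left (Nat.modEq_zero_iff_dvd.1 h'.symm))) (by
      convert h2 using 1
      have h4 : (p : ℤ) ^ (g * s + u) = P * q ^ s := by exact_mod_cast hPs
      rw [h4, pow_add]
      push_cast
      rw [hq]
      push_cast
      ring)
  obtain ⟨h4, h5, h6⟩ := h3
  have hu0 : u = 0 := by
    by_contra hu0
    have := Nat.one_lt_pow hu0 h.prime.one_lt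
    omega
  rw [hu0, add_zero]
  exact Nat.mul_dvd_mul_left g (Nat.modEq_zero_iff_dvd.1 h6.symm)

lemma dvd_of_chi_pow_mul_eq_one (h : FrobeniusData p g d r) {w : kˣ}
    (hw : orderOf w = (p ^ g) ^ d - 1) {a b t : ℕ} (ha : ¬d ∣ a) (hb : ¬d ∣ b)
    (hχ : chi p g r w a ^ p ^ t * chi p g r w b = 1) : d ∣ a + b := by
  set q := p ^ g with hq
  have hM : ((((p ^ g) ^ d - 1 : ℕ)) : ℤ) ∣ (((p ^ g) ^ r - 1 : ℕ) : ℤ) *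
      ((p ^ t * q ^ (r * a) + q ^ (r * b)) - (p ^ t + 1)) := by
    have h1 : w ^ (((q ^ r - 1 : ℕ) : ℤ) * ((p ^ t * q ^ (r * a) + q ^ (r * b)) - (p ^ t + 1))) =
        (chi p g r w a ^ p ^ t * chi p g r w b)⁻¹ := by
      rw [chi, chi, ← hq]
      generalize q ^ r - 1 = e
      rw [mul_inv, div_pow, inv_div, inv_div, ← zpow_natCast w e]
      simp only [← zpow_natCast, ← zpow_mul, ← zpow_add, div_eq_mul_inv, ← zpow_neg]
      congr 1
      push_cast
      ring
    rw [hχ, inv_one] at h1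
    rw [← hw]
    exact orderOf_dvd_iff_zpow_eq_one.2 h1
  obtain ⟨P, s, u, rfl, hu, hP, hPs, hP1, hPq⟩ := h.exists_decomp t
  have h2 := h.geom_dvd hM
  have h3 := modEq_of_geom_dvd (X := s + r * a) (Y := r * b) (I := s) (J := 0) hP1 hPq h.two_le h.ne
    (fun h' => ha (h.coprime.symm.dvd_of_dvd_mul_left (Nat.modEq_zero_iff_dvd.1
      (Nat.ModEq.add_left_cancel' s h'))))
    (fun h' => hb (h.coprime.symm.dvd_of_dvd_mul_left (Nat.modEq_zero_iff_dvd.1 h'))) (by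
      convert h2 using 1
      have h4 : (p : ℤ) ^ (g * s + u) = P * q ^ s := by exact_mod_cast hPs
      rw [h4, pow_add]
      push_cast
      rw [hq]
      push_cast
      ring)
  obtain ⟨-, h5, h6⟩ := h3
  have h7 : r * (a + b) ≡ 0 [MOD d] := by
    rw [mul_add, add_comm]
    exact (Nat.ModEq.add_right (r * a) h6).trans h5
  exact h.coprime.symm.dvd_of_dvd_mul_left (Nat.modEq_zero_iff_dvd.1 h7)

end FrobeniusData
end DigitSums

section FiniteFields

open Finset Polynomial

lemma charP_of_natCast_eq_zero {k : Type*} [Field k] {p : ℕ} (hp : p.Prime) (h : (p : k) = 0) :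
    CharP k p :=
  ringChar.of_eq (CharP.ringChar_of_prime_eq_zero hp h)

/-- A common root of all integral polynomials vanishing at `y` is a Frobenius conjugate of `y`. -/
lemma exists_eq_pow_of_forall_aeval {k : Type*} [Field k] [Finite k] {p : ℕ} [hp : Fact p.Prime]
    [CharP k p] {x y : k} (h : ∀ G : ℤ[X], aeval y G = 0 → aeval x G = 0) :
    ∃ t : ℕ, x = y ^ p ^ t := by
  let := ZMod.algebra k p
  obtain ⟨G, hG⟩ := Polynomial.map_surjective (Int.castRingHom (ZMod p))
    (ZMod.ringHom_surjective _) (minpoly (ZMod p) y)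
  have key : ∀ z : k, aeval z G = aeval z (minpoly (ZMod p) y) := fun z => by
    rw [← hG, aeval_def, aeval_def, eval₂_map]
    congr 1
    exact RingHom.ext_int _ _
  have h1 : aeval x (minpoly (ZMod p) y) = 0 := by
    rw [← key]
    exact h G (by rw [key, minpoly.aeval])
  obtain ⟨τ, hτ⟩ := minpoly.exists_algEquiv_of_root (Algebra.IsAlgebraic.isAlgebraic y) h1
  obtain ⟨n, hn⟩ := (FiniteField.bijective_frobeniusAlgEquivOfAlgebraic_pow (ZMod p) k).2 τ⁻¹
  refine ⟨n, ?_⟩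
  have h2 : x = τ⁻¹ y := by rw [← hτ, AlgEquiv.aut_inv, AlgEquiv.symm_apply_apply]
  rw [h2, ← hn]
  change (FiniteField.frobeniusAlgEquivOfAlgebraic (ZMod p) k ^ (n : ℕ)) y = _
  rw [AlgEquiv.coe_pow, FiniteField.coe_frobeniusAlgEquivOfAlgebraic_iterate, ZMod.card]

lemma subring_eq_top_of_mem {k : Type*} [Field k] [Finite k] {p m : ℕ} [hp : Fact p.Prime]
    [CharP k p] (hk : Nat.card k = p ^ m) {x : k} (hx : ∀ t, x ^ p ^ t = x → m ∣ t) (S : Subring k)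
    (hS : x ∈ S) : S = ⊤ := by
  classical
  let : Fintype S := Fintype.ofFinite S
  let : Field S := (Finite.isDomain_to_isField S).toField
  have : CharP S p := charP_of_natCast_eq_zero hp.out (Subtype.ext (by simp))
  obtain ⟨n, -, hn⟩ := FiniteField.card S p
  have h1 : (⟨x, hS⟩ : S) ^ p ^ (n : ℕ) = ⟨x, hS⟩ := by rw [← hn, FiniteField.pow_card]
  have h2 := Nat.le_of_dvd n.pos (hx n (congrArg Subtype.val h1))
  have h3 : Nat.card k ≤ Nat.card S := by
    rw [hk, Nat.card_eq_fintype_card, hn]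
    exact Nat.pow_le_pow_right hp.out.pos h2
  have h4 : (S : Set k) = Set.univ := by
    refine Set.eq_of_subset_of_ncard_le (Set.subset_univ _) ?_ (Set.toFinite _)
    rw [Set.ncard_univ]
    exact h3
  exact SetLike.coe_injective h4

end FiniteFields

section Residues

open Finset Polynomial

variable {O k A : Type*} [CommRing O] [Field k] [AddCommGroup A]

/-- An automorphism `σ` of an unramified ring of integers `O` with residue field `k` of order `q^d`,
and a root of unity `ω` generating `k` with `σ(ω) = ω^(q^r)`, where `q = p^g`. -/
structure ResidueData (p g d r : ℕ) (σ : RingAut O) (ρ : O →+* k) (ω : Oˣ) : Prop extends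
    FrobeniusData p g d r where
  map_prime : ρ (p : O) = 0
  dvd_of_map_eq_zero : ∀ {x}, ρ x = 0 → (p : O) ∣ x
  isUnit_of_map_ne_zero : ∀ {x}, ρ x ≠ 0 → IsUnit x
  card : Nat.card k = (p ^ g) ^ d
  orderOf_map : orderOf (Units.map (ρ : O →* k) ω) = (p ^ g) ^ d - 1
  apply_eq : σ ω = ω ^ (p ^ g) ^ r
  pow_eq_one : σ ^ d = 1

namespace ResidueData

variable {p g d r : ℕ} {σ : RingAut O} {ρ : O →+* k} {ω : Oˣ}

lemma charP (h : ResidueData p g d r σ ρ ω) : CharP k p :=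
  charP_of_natCast_eq_zero h.prime (by rw [← map_natCast ρ, h.map_prime])

lemma finite (h : ResidueData p g d r σ ρ ω) : Finite k :=
  Nat.finite_of_card_ne_zero (by
    rw [h.card]
    exact pow_ne_zero _ (pow_ne_zero _ h.prime.ne_zero))

lemma pow_apply (h : ResidueData p g d r σ ρ ω) (a : ℕ) :
    (σ ^ a) (ω : O) = ω ^ ((p ^ g) ^ r) ^ a := by
  induction a with
  | zero => simp
  | succ a ih => rw [pow_succ', RingAut.mul_apply, ih, map_pow, h.apply_eq, ← pow_mul, pow_succ']

/-- The unit `χ_a` of `O`. -/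
def chi (p g r : ℕ) (ω : Oˣ) (a : ℕ) : Oˣ :=
  ω ^ ((p ^ g) ^ r - 1) / (ω ^ ((p ^ g) ^ r - 1)) ^ ((p ^ g) ^ r) ^ a

lemma map_chi (p g r : ℕ) (ω : Oˣ) (ρ : O →+* k) (a : ℕ) :
    ρ (chi p g r ω a) = FrobeniusData.chi p g r (Units.map (ρ : O →* k) ω) a := by
  have : Units.map (ρ : O →* k) (chi p g r ω a) =
      FrobeniusData.chi p g r (Units.map (ρ : O →* k) ω) a := by
    simp only [chi, FrobeniusData.chi, _root_.map_div, map_pow]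
  exact congrArg Units.val this

lemma dvd_of_fixed (h : ResidueData p g d r σ ρ ω) {a : ℕ}
    (ha : Units.map (ρ : O →* k) ω ^ ((p ^ g) ^ r) ^ a = Units.map (ρ : O →* k) ω) : d ∣ a := by
  by_contra hda
  have h1 : FrobeniusData.chi p g r (Units.map (ρ : O →* k) ω) a = 1 := by
    rw [FrobeniusData.chi, pow_right_comm _ _ (((p ^ g) ^ r) ^ a), ha, div_self']
  have h2 := h.chi_pow_eq h.orderOf_map (t := 1) hda (by rw [h1, one_pow])
  have h3 := h.two_le
  have h4 : d ∣ 1 := (dvd_mul_left d g).trans h2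
  have := Nat.le_of_dvd one_pos h4
  omega

lemma map_pow_apply (h : ResidueData p g d r σ ρ ω) (a j : ℕ) :
    ρ ((σ ^ a) ((ω : O) ^ j)) = (((Units.map (ρ : O →* k) ω ^ ((p ^ g) ^ r) ^ a : kˣ) : k)) ^ j := by
  rw [map_pow, h.pow_apply, map_pow, map_pow]
  simp

lemma exists_unit (h : ResidueData p g d r σ ρ ω) {a : ℕ} (ha : ¬d ∣ a) :
    ∃ x, cyclicTrace σ d x = 0 ∧ IsUnit (x - (σ ^ a) x) := by
  have htr : ∀ x, cyclicTrace σ d (x - σ x) = 0 := fun x => by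
    have := cyclicTrace_pow h.pow_eq_one 1 x
    rw [pow_one] at this
    rw [cyclicTrace_sub, this, sub_self]
  by_contra hcon
  push Not at hcon
  set w := Units.map (ρ : O →* k) ω with hw
  have key : ∀ j : ℕ, ((w : k) ^ j - ((w ^ ((p ^ g) ^ r) ^ 1 : kˣ) : k) ^ j) -
      (((w ^ ((p ^ g) ^ r) ^ a : kˣ) : k) ^ j - ((w ^ ((p ^ g) ^ r) ^ (a + 1) : kˣ) : k) ^ j) = 0 := by
    intro j
    have h1 := hcon _ (htr ((ω : O) ^ j))
    by_contra h2
    apply h1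
    apply h.isUnit_of_map_ne_zero
    rw [map_sub (σ ^ a), ← RingAut.mul_apply, ← pow_succ, map_sub, map_sub, map_sub,
      h.map_pow_apply, h.map_pow_apply]
    have h3 := h.map_pow_apply 1 j
    rw [pow_one σ] at h3
    rw [h3, map_pow]
    exact h2
  have h1 := key 1
  have h2 := key 2
  have hp2 : (2 : k) ≠ 0 := by
    have := h.charP
    intro h0
    have h3 : ((2 : ℕ) : k) = 0 := by exact_mod_cast h0
    rw [CharP.cast_eq_zero_iff k p] at h3
    have := Nat.le_of_dvd two_pos h3
    have := h.three_le
    omega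
  simp only [pow_one] at h1
  set u : k := (w : k)
  set B := ((w ^ ((p ^ g) ^ r) : kˣ) : k) with hB
  set C := ((w ^ ((p ^ g) ^ r) ^ a : kˣ) : k) with hC
  set E := ((w ^ ((p ^ g) ^ r) ^ (a + 1) : kˣ) : k) with hE
  rw [pow_one, ← hB] at h2
  have hE' : E = B + C - u := by linear_combination h1
  have h3 : 2 * ((u - B) * (u - C)) = 0 := by
    rw [hE'] at h2
    linear_combination h2
  rcases mul_eq_zero.1 ((mul_eq_zero.1 h3).resolve_left hp2) with h4 | h4
  · have h5 : w ^ ((p ^ g) ^ r) ^ 1 = w := by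
      rw [pow_one]
      exact Units.ext (sub_eq_zero.1 h4).symm
    have := Nat.le_of_dvd one_pos (h.dvd_of_fixed h5)
    have := h.two_le
    omega
  · exact ha (h.dvd_of_fixed (Units.ext (sub_eq_zero.1 h4).symm))

lemma exists_trace_eq_one (h : ResidueData p g d r σ ρ ω) : ∃ y, cyclicTrace σ d y = 1 := by
  set w := Units.map (ρ : O →* k) ω with hw
  obtain ⟨j, hj⟩ : ∃ j : ℕ, ρ (cyclicTrace σ d ((ω : O) ^ j)) ≠ 0 := by
    by_contra hcon
    push Not at hcon
    let θ : Fin d → k := fun i => ((w ^ ((p ^ g) ^ r) ^ (i : ℕ) : kˣ) : k)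
    have hθ : Function.Injective θ := by
      have key : ∀ i j : Fin d, i ≤ j → θ i = θ j → i = j := by
        intro i j hij hθ
        have h1 : w ^ ((p ^ g) ^ r) ^ (i : ℕ) = w ^ ((p ^ g) ^ r) ^ (j : ℕ) := Units.ext hθ
        obtain ⟨c, hc⟩ := Nat.exists_eq_add_of_le (show (i : ℕ) ≤ j from hij)
        have h2 : (w ^ ((p ^ g) ^ r) ^ c) ^ ((p ^ g) ^ r) ^ (i : ℕ) =
            w ^ ((p ^ g) ^ r) ^ (i : ℕ) := by
          rw [h1, hc, ← pow_mul, ← pow_add, add_comm]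
        have h3 : w ^ ((p ^ g) ^ r) ^ c = w := by
          have := h.charP
          have := Fact.mk h.prime
          have h4 : (((p ^ g) ^ r) ^ (i : ℕ)) = p ^ (g * r * i) := by rw [pow_mul, pow_mul]
          rw [h4] at h2
          refine Units.ext (iterateFrobenius_inj k p (g * r * i) ?_)
          simpa [iterateFrobenius_def] using congrArg Units.val h2
        have h5 := h.dvd_of_fixed h3
        have : c = 0 := Nat.eq_zero_of_dvd_of_lt h5 (by omega)
        exact Fin.ext (by omega)
      intro i j hij
      rcases le_total i j with h1 | h1
      · exact key i j h1 hij
      · exact (key j i h1 hij.symm).symm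
    have hli := (linearIndependent_monoidHom (Multiplicative ℕ) k).comp
      (fun i => powersHom k (θ i)) ((powersHom k).injective.comp hθ)
    have h0 := Fintype.linearIndependent_iff.1 hli (fun _ => 1) (by
      ext j
      have h1 := hcon j.toAdd
      rw [cyclicTrace, map_sum, Finset.sum_range] at h1
      simp only [h.map_pow_apply] at h1
      simpa [θ, hw] using h1) ⟨0, by have := h.two_le; omega⟩
    exact one_ne_zero h0
  obtain ⟨u, hu⟩ := h.isUnit_of_map_ne_zero hj
  have hfix : ∀ i, (σ ^ i) (u : O) = u := fun i => by
    rw [hu]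
    conv_rhs => rw [← cyclicTrace_pow h.pow_eq_one i]
    rw [cyclicTrace, cyclicTrace, map_sum]
    refine sum_congr rfl fun t _ => ?_
    rw [← RingAut.mul_apply, ← RingAut.mul_apply, ← pow_add, ← pow_add, add_comm]
  refine ⟨(↑u⁻¹ : O) * (ω : O) ^ j, ?_⟩
  have hfix' : ∀ i, (σ ^ i) (↑u⁻¹ : O) = (↑u⁻¹ : O) := fun i => by
    have h1 : (σ ^ i) (u : O) * (σ ^ i) (↑u⁻¹ : O) = 1 := by rw [← map_mul, u.mul_inv, map_one]
    rw [hfix] at h1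
    exact (Units.inv_eq_of_mul_eq_one_right h1).symm
  rw [cyclicTrace]
  simp only [map_mul, hfix']
  rw [← mul_sum]
  have e : ∑ i ∈ range d, (σ ^ i) (ω : O) ^ j = u := by
    rw [hu, cyclicTrace]
    exact sum_congr rfl fun i _ => (map_pow _ _ _).symm
  simp only [map_pow, e, u.inv_mul]

section Bilinear

variable (β : O →+ O →+ A) {s : ℕ}

/-- The ring of pairs `(c, c')` such that multiplication by `c'` is adjoint to that by `c`. -/
def adjointPairs : Subring (O × O) where
  carrier := {c | ∀ w v, β (c.1 * w) v = β w (c.2 * v)}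
  mul_mem' := by
    intro a b ha hb w v
    rw [Prod.fst_mul, Prod.snd_mul, mul_assoc, ha, hb, ← mul_assoc, mul_comm b.2]
  one_mem' := fun w v => by rw [Prod.fst_one, Prod.snd_one, one_mul, one_mul]
  add_mem' := by
    intro a b ha hb w v
    rw [Prod.fst_add, Prod.snd_add, add_mul, add_mul, map_add, map_add, AddMonoidHom.add_apply,
      ha, hb]
  zero_mem' := fun w v => by simp
  neg_mem' := by
    intro a ha w v
    rw [Prod.fst_neg, Prod.snd_neg, neg_mul, neg_mul, map_neg, map_neg, AddMonoidHom.neg_apply, ha]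

variable {β}

lemma mem_adjointPairs {c : O × O} :
    c ∈ adjointPairs β ↔ ∀ w v, β (c.1 * w) v = β w (c.2 * v) := Iff.rfl

lemma map_pow_prime_mul (hA : ∀ x : A, p ^ s • x = 0) (w v : O) :
    β w ((p : O) ^ s * v) = 0 := by
  have : (p : O) ^ s * v = p ^ s • v := by rw [nsmul_eq_mul, Nat.cast_pow]
  rw [this, map_nsmul, hA]

lemma bilinear_eq_zero (h : ResidueData p g d r σ ρ ω) (hA : ∀ x : A, p ^ s • x = 0) {a b : ℕ}
    (ha : ¬d ∣ a) (hb : ¬d ∣ b) (hab : ¬d ∣ a + b)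
    (hβ : ∀ w v, β (chi p g r ω a * w) (chi p g r ω b * v) = β w v) : β = 0 := by
  have := h.charP
  have := h.finite
  have := Fact.mk h.prime
  have hmem : (((chi p g r ω a : Oˣ) : O), (((chi p g r ω b)⁻¹ : Oˣ) : O)) ∈ adjointPairs β := by
    intro w v
    conv_rhs => rw [← hβ]
    rw [← mul_assoc (_ : O) _ v, Units.mul_inv, one_mul]
  have hG : ∀ G : ℤ[X], (aeval ((chi p g r ω a : Oˣ) : O) G,
      aeval (((chi p g r ω b)⁻¹ : Oˣ) : O) G) ∈ adjointPairs β := by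
    intro G
    have h1 : (aeval ((chi p g r ω a : Oˣ) : O) G, aeval (((chi p g r ω b)⁻¹ : Oˣ) : O) G) =
        aeval (((chi p g r ω a : Oˣ) : O), (((chi p g r ω b)⁻¹ : Oˣ) : O)) G := by
      set z : O × O := (((chi p g r ω a : Oˣ) : O), (((chi p g r ω b)⁻¹ : Oˣ) : O))
      exact Prod.ext (Polynomial.aeval_algHom_apply (AlgHom.fst ℤ O O) z G)
        (Polynomial.aeval_algHom_apply (AlgHom.snd ℤ O O) z G)
    rw [h1]
    clear h1
    induction G using Polynomial.induction_on' with
    | add G G' h1 h2 => rw [map_add]; exact add_mem h1 h2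
    | monomial n c =>
      rw [aeval_monomial]
      refine mul_mem ?_ (pow_mem hmem n)
      rw [eq_intCast]
      exact intCast_mem _ c
  by_contra hne
  have hroot : ∀ G : ℤ[X], aeval (ρ ((chi p g r ω b)⁻¹ : Oˣ)) G = 0 →
      aeval (ρ (chi p g r ω a)) G = 0 := by
    intro G h0
    by_contra h1
    have e : ∀ x : O, aeval (ρ x) G = ρ (aeval x G) := fun x =>
      Polynomial.aeval_algHom_apply ρ.toIntAlgHom x G
    rw [e] at h0 h1
    obtain ⟨y, hy⟩ := h.dvd_of_map_eq_zero h0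
    obtain ⟨u, hu⟩ := h.isUnit_of_map_ne_zero h1
    apply hne
    ext w v
    have h2 := mem_adjointPairs.1 (pow_mem (hG G) s) (↑(u ^ s)⁻¹ * w) v
    simp only [Prod.pow_fst, Prod.pow_snd, hy, ← hu] at h2
    rw [← mul_assoc, ← Units.val_pow_eq_pow_val, Units.mul_inv, one_mul, mul_pow, mul_assoc,
      map_pow_prime_mul hA] at h2
    simpa using h2
  obtain ⟨t, ht⟩ := exists_eq_pow_of_forall_aeval hroot
  refine hab ?_
  rw [add_comm]
  refine h.dvd_of_chi_pow_mul_eq_one h.orderOf_map (t := t) hb ha ?_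
  have e1 : Units.map (ρ : O →* k) (chi p g r ω a) =
      (Units.map (ρ : O →* k) (chi p g r ω b))⁻¹ ^ p ^ t := by
    rw [← map_inv]
    exact Units.ext (by simpa using ht)
  have e2 : ∀ c, Units.map (ρ : O →* k) (chi p g r ω c) =
      FrobeniusData.chi p g r (Units.map (ρ : O →* k) ω) c := fun c =>
    Units.ext (map_chi p g r ω ρ c)
  rw [e2, e2] at e1
  rw [e1, inv_pow, mul_inv_cancel]

lemma bilinear_balanced (h : ResidueData p g d r σ ρ ω) (hA : ∀ x : A, p ^ s • x = 0) {a b : ℕ}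
    (ha : ¬d ∣ a) (hab : d ∣ a + b)
    (hβ : ∀ w v, β (chi p g r ω a * w) (chi p g r ω b * v) = β w v) (c w v : O) :
    β (c * w) v = β w ((σ ^ b) c * v) := by
  have := h.charP
  have := h.finite
  have := Fact.mk h.prime
  let C : Subring O := (adjointPairs β).comap ((RingHom.id O).prod (σ ^ b : RingAut O))
  have hC : ∀ {c}, c ∈ C ↔ ∀ w v, β (c * w) v = β w ((σ ^ b) c * v) := Iff.rfl
  suffices hT : C = ⊤ from hC.1 (hT ▸ Subring.mem_top c) w v
  have hσab : ∀ x, (σ ^ b) ((σ ^ a) x) = x := fun x => by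
    rw [← RingAut.mul_apply, ← pow_add, add_comm, RingAut.pow_eq_one_of_dvd h.pow_eq_one hab,
      RingAut.one_apply]
  have hσω : ∀ n : ℕ, Units.map ((σ ^ n : RingAut O) : O →* O) ω = ω ^ ((p ^ g) ^ r) ^ n :=
    fun n => Units.ext (by simpa using h.pow_apply n)
  have hχ : (σ ^ b) (chi p g r ω a : O) = ((chi p g r ω b)⁻¹ : Oˣ) := by
    have e1 : ∀ c, chi p g r ω c = ω ^ ((p ^ g) ^ r - 1) /
        Units.map ((σ ^ c : RingAut O) : O →* O) (ω ^ ((p ^ g) ^ r - 1)) := fun c => by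
      rw [chi, map_pow, hσω, pow_right_comm _ _ (((p ^ g) ^ r) ^ c)]
    have e2 : Units.map ((σ ^ b : RingAut O) : O →* O) (chi p g r ω a) = (chi p g r ω b)⁻¹ := by
      rw [e1, e1, inv_div, _root_.map_div]
      congr 1
      exact Units.ext (hσab _)
    exact congrArg Units.val e2
  have h1 : (chi p g r ω a : O) ∈ C := by
    rw [hC]
    intro w v
    rw [hχ]
    conv_rhs => rw [← hβ]
    rw [← mul_assoc (_ : O) _ v, Units.mul_inv, one_mul]
  have h2 : C.map ρ = ⊤ := by
    refine subring_eq_top_of_mem (p := p) (m := g * d) (by rw [h.card, pow_mul])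
      (x := ρ (chi p g r ω a)) ?_ _ ⟨_, h1, rfl⟩
    intro t ht
    rw [map_chi] at ht
    exact h.chi_pow_eq h.orderOf_map ha (Units.ext (by simpa using ht))
  have h3 : ∀ x, ∃ c ∈ C, ∃ y, x = c + p * y := fun x => by
    obtain ⟨c, hc, hcx⟩ : ρ x ∈ C.map ρ := h2 ▸ Subring.mem_top _
    obtain ⟨y, hy⟩ := h.dvd_of_map_eq_zero (x := x - c) (by rw [map_sub, hcx, sub_self])
    exact ⟨c, hc, y, by rw [← hy]; ring⟩
  have h4 : ∀ n : ℕ, ∀ x, ∃ c ∈ C, ∃ y, x = c + p ^ n * y := by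
    intro n
    induction n with
    | zero => exact fun x => ⟨0, zero_mem _, x, by simp⟩
    | succ n ih =>
      intro x
      obtain ⟨c, hc, y, rfl⟩ := ih x
      obtain ⟨c', hc', y', rfl⟩ := h3 y
      exact ⟨c + p ^ n * c', add_mem hc (mul_mem (pow_mem (natCast_mem C p) n) hc'), y', by ring⟩
  refine eq_top_iff.2 fun x _ => ?_
  obtain ⟨c, hc, y, rfl⟩ := h4 s x
  refine add_mem hc ?_
  rw [hC]
  intro w v
  have e : (p : O) ^ s * y * w = p ^ s • (y * w) := by
    rw [nsmul_eq_mul, Nat.cast_pow, mul_assoc]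
  rw [map_mul (σ ^ b), map_pow (σ ^ b), map_natCast (σ ^ b), mul_assoc _ _ v, map_pow_prime_mul hA, e, map_nsmul,
    AddMonoidHom.nsmul_apply, hA]

lemma isUnit_chi_sub_one (h : ResidueData p g d r σ ρ ω) {b : ℕ} (hb : ¬d ∣ b) :
    IsUnit ((chi p g r ω b : O) - 1) := by
  apply h.isUnit_of_map_ne_zero
  intro h0
  rw [map_sub, map_one, map_chi, sub_eq_zero] at h0
  have h1 : FrobeniusData.chi p g r (Units.map (ρ : O →* k) ω) b = 1 := Units.ext h0
  have h2 := h.chi_pow_eq h.orderOf_map (t := 1) hb (by rw [h1, one_pow])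
  have h3 := h.two_le
  have := Nat.le_of_dvd one_pos ((dvd_mul_left d g).trans h2)
  omega

lemma chi_of_dvd (h : ResidueData p g d r σ ρ ω) {a : ℕ} (ha : d ∣ a) : chi p g r ω a = 1 := by
  have h1 : ω ^ ((p ^ g) ^ r) ^ a = ω := Units.ext (by
    rw [Units.val_pow_eq_pow_val, ← h.pow_apply, RingAut.pow_eq_one_of_dvd h.pow_eq_one ha,
      RingAut.one_apply])
  rw [chi, pow_right_comm _ _ (((p ^ g) ^ r) ^ a), h1, div_self']

end Bilinear

end ResidueData

end Residues

section HilbertNinety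

open Finset

variable {O : Type*} [CommRing O]

/-- An additive section of `1 - τ` on the kernel of the trace, for `τ` of order `d` and `y` of
trace one. -/
def hilbertNinety (τ : O →+* O) (d : ℕ) (y : O) : O →+ O where
  toFun x := ∑ j ∈ range d, (∑ i ∈ range j, (τ ^ i) x) * (τ ^ j) y
  map_zero' := by simp
  map_add' x x' := by simp only [map_add, sum_add_distrib, add_mul]

lemma hilbertNinety_sub_apply {τ : O →+* O} {d : ℕ} {x y : O} (hy : ∑ i ∈ range d, (τ ^ i) y = 1)
    (hτ : (τ ^ d) y = y) (hx : ∑ i ∈ range d, (τ ^ i) x = 0) :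
    hilbertNinety τ d y x - τ (hilbertNinety τ d y x) = x := by
  have h1 : ∀ (i : ℕ) z, τ ((τ ^ i) z) = (τ ^ (i + 1)) z := fun i z => by rw [pow_succ']; rfl
  have h2 : ∀ j, τ (∑ i ∈ range j, (τ ^ i) x) = ∑ i ∈ range (j + 1), (τ ^ i) x - x := fun j => by
    rw [sum_range_succ', map_sum]
    simp only [h1, pow_zero]
    exact (add_sub_cancel_right _ x).symm
  have h3 : ∑ j ∈ range d, (τ ^ (j + 1)) y = 1 := by
    have := sum_range_succ (fun j => (τ ^ j) y) d
    rw [sum_range_succ', hy, hτ] at this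
    simpa using this
  have h4 : τ (hilbertNinety τ d y x) = hilbertNinety τ d y x - x := by
    change τ (∑ j ∈ range d, (∑ i ∈ range j, (τ ^ i) x) * (τ ^ j) y) =
      ∑ j ∈ range d, (∑ i ∈ range j, (τ ^ i) x) * (τ ^ j) y - x
    rw [map_sum]
    simp only [map_mul, h2, h1, sub_mul]
    rw [sum_sub_distrib, ← mul_sum, h3, mul_one]
    have := sum_range_succ (fun j => (∑ i ∈ range j, (τ ^ i) x) * (τ ^ j) y) d
    rw [sum_range_succ', hx, zero_mul, add_zero] at this
    simp only [range_zero, sum_empty, zero_mul, add_zero] at this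
    rw [this]
  rw [h4, sub_sub_cancel]

end HilbertNinety

section NormedDivision

open Finset Filter Topology

variable {D : Type u} [NormedDivisionRing D] [IsUltrametricDist D]

lemma conj_pow₀ {x : D} (hx : x ≠ 0) (y : D) (i : ℕ) : (x * y * x⁻¹) ^ i = x * y ^ i * x⁻¹ := by
  induction i with
  | zero => simp [hx]
  | succ i ih => rw [pow_succ, ih, pow_succ]; simp only [mul_assoc, inv_mul_cancel_left₀ hx]

variable (D) in
/-- The ring of elements of norm at most one. -/
def unitBall : Subring D where
  carrier := {x | ‖x‖ ≤ 1}
  mul_mem' := fun {a b} ha hb => by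
    change ‖a * b‖ ≤ 1
    rw [norm_mul]
    exact mul_le_one₀ ha (norm_nonneg _) hb
  one_mem' := norm_one.le
  add_mem' := fun {a b} ha hb =>
    (IsUltrametricDist.norm_add_le_max a b).trans (max_le ha hb)
  zero_mem' := by
    change ‖(0 : D)‖ ≤ 1
    rw [norm_zero]
    exact zero_le_one
  neg_mem' := fun {x} hx => by
    change ‖-x‖ ≤ 1
    rwa [norm_neg]

lemma norm_add_lt {x y : D} {c : ℝ} (hx : ‖x‖ < c) (hy : ‖y‖ < c) : ‖x + y‖ < c :=
  (IsUltrametricDist.norm_add_le_max x y).trans_lt (max_lt hx hy)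

lemma norm_add_le_of_le_max {x y : D} {c : ℝ} (hx : ‖x‖ ≤ c) (hy : ‖y‖ ≤ c) : ‖x + y‖ ≤ c :=
  (IsUltrametricDist.norm_add_le_max x y).trans (max_le hx hy)

lemma norm_sub_le_of_le_max {x y : D} {c : ℝ} (hx : ‖x‖ ≤ c) (hy : ‖y‖ ≤ c) : ‖x - y‖ ≤ c := by
  rw [sub_eq_add_neg]
  exact norm_add_le_of_le_max hx (by rwa [norm_neg])

lemma norm_sum_le_of_forall {ι : Type*} {s : Finset ι} {f : ι → D} {c : ℝ} (hc : 0 ≤ c)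
    (h : ∀ i ∈ s, ‖f i‖ ≤ c) : ‖∑ i ∈ s, f i‖ ≤ c :=
  IsUltrametricDist.norm_sum_le_of_forall_le_of_nonneg hc h

lemma norm_eq_of_sub_lt {x y : D} (h : ‖x - y‖ < ‖y‖) : ‖x‖ = ‖y‖ := by
  have := IsUltrametricDist.norm_add_eq_max_of_norm_ne_norm h.ne
  rwa [sub_add_cancel, max_eq_right h.le] at this

variable (D) in
/-- The ideal of elements of norm less than one. -/
def openBall : Ideal (unitBall D) where
  carrier := {x | ‖(x : D)‖ < 1}
  add_mem' := fun {a b} ha hb => norm_add_lt (x := (a : D)) ha hb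
  zero_mem' := by
    change ‖(0 : D)‖ < 1
    rw [norm_zero]
    exact zero_lt_one
  smul_mem' := fun c x hx => by
    change ‖(c : D) * x‖ < 1
    rw [norm_mul]
    exact mul_lt_one_of_nonneg_of_lt_one_right c.2 (norm_nonneg _) hx

instance : (openBall D).IsTwoSided where
  mul_mem_of_left := fun {a} b ha => by
    change ‖(a : D) * b‖ < 1
    rw [norm_mul]
    exact mul_lt_one_of_nonneg_of_lt_one_left (norm_nonneg _) ha b.2

lemma exists_residueField [ProperSpace D] : ∃ (k : Type u) (_ : Field k) (_ : Finite k)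
    (ρ : unitBall D →+* k), Function.Surjective ρ ∧ ∀ x : unitBall D, ρ x = 0 ↔ ‖(x : D)‖ < 1 := by
  have hz : ∀ x : unitBall D, Ideal.Quotient.mk (openBall D) x = 0 ↔ ‖(x : D)‖ < 1 := fun x =>
    Ideal.Quotient.eq_zero_iff_mem
  have hfin : Finite (unitBall D ⧸ openBall D) := by
    obtain ⟨t, ht, htf, hcov⟩ := (isCompact_closedBall (0 : D) 1).finite_cover_balls one_pos
    have hfi : Finite t := htf
    have hsub : ∀ x : t, ‖(x : D)‖ ≤ 1 := fun x => by simpa using ht x.2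
    refine Finite.of_surjective
      (fun x : t => Ideal.Quotient.mk (openBall D) ⟨x, hsub x⟩) fun y => ?_
    obtain ⟨y, rfl⟩ := Ideal.Quotient.mk_surjective y
    have hy : (y : D) ∈ Metric.closedBall (0 : D) 1 := by
      rw [mem_closedBall_zero_iff]
      exact y.2
    obtain ⟨x, hx, hxy⟩ := Set.mem_iUnion₂.1 (hcov hy)
    refine ⟨⟨x, hx⟩, ?_⟩
    rw [← sub_eq_zero, ← map_sub, hz]
    rw [Metric.mem_ball, dist_comm, dist_eq_norm] at hxy
    exact hxy
  have hnt : Nontrivial (unitBall D ⧸ openBall D) := by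
    refine ⟨⟨1, 0, fun h => ?_⟩⟩
    rw [← map_one (Ideal.Quotient.mk (openBall D)), hz] at h
    simp at h
  have hdom : IsDomain (unitBall D ⧸ openBall D) := by
    have : NoZeroDivisors (unitBall D ⧸ openBall D) := ⟨fun {a b} h => by
      obtain ⟨a, rfl⟩ := Ideal.Quotient.mk_surjective a
      obtain ⟨b, rfl⟩ := Ideal.Quotient.mk_surjective b
      rw [← map_mul, hz] at h
      rw [hz, hz]
      by_contra hcon
      push Not at hcon
      change ‖(a : D) * b‖ < 1 at h
      rw [norm_mul] at h
      exact absurd (one_le_mul_of_one_le_of_one_le hcon.1 hcon.2) (not_le.2 h)⟩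
    exact NoZeroDivisors.to_isDomain _
  exact ⟨unitBall D ⧸ openBall D, (Finite.isDomain_to_isField _).toField, hfin,
    Ideal.Quotient.mk _, Ideal.Quotient.mk_surjective, hz⟩

variable {p : ℕ} [hp : Fact p.Prime] [NormedAlgebra ℚ_[p] D]

variable (p D) in
lemma norm_natCast_prime : ‖(p : D)‖ = (p : ℝ)⁻¹ := by
  have : (p : D) = algebraMap ℚ_[p] D p := by rw [map_natCast]
  rw [this, norm_algebraMap', Padic.norm_p]

variable (p D) in
lemma norm_natCast_prime_lt_one : ‖(p : D)‖ < 1 := by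
  rw [norm_natCast_prime]
  exact inv_lt_one_of_one_lt₀ (by exact_mod_cast hp.out.one_lt)

variable (p D) in
lemma natCast_prime_ne_zero : (p : D) ≠ 0 := by
  rw [← norm_ne_zero_iff, norm_natCast_prime]
  exact inv_ne_zero (by exact_mod_cast hp.out.ne_zero)

lemma norm_pow_sub_pow_le {u v : D} (h : Commute u v) (hu : ‖u‖ ≤ 1) (hv : ‖v‖ ≤ 1) {c : ℝ}
    (huv : ‖u - v‖ ≤ c) (hpc : ‖(p : D)‖ ≤ c) : ‖u ^ p - v ^ p‖ ≤ c * ‖u - v‖ := by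
  have hc : 0 ≤ c := (norm_nonneg _).trans hpc
  rw [← h.geom_sum₂_mul, norm_mul]
  refine mul_le_mul_of_nonneg_right ?_ (norm_nonneg _)
  have hpow : ∀ i, ‖u ^ i - v ^ i‖ ≤ c := fun i => by
    rw [← h.geom_sum₂_mul, norm_mul]
    refine (mul_le_of_le_one_left (norm_nonneg _) ?_).trans huv
    refine norm_sum_le_of_forall zero_le_one fun j _ => ?_
    rw [norm_mul, norm_pow, norm_pow]
    exact mul_le_one₀ (pow_le_one₀ (norm_nonneg _) hu) (pow_nonneg (norm_nonneg _) _)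
      (pow_le_one₀ (norm_nonneg _) hv)
  have e : ∑ i ∈ range p, u ^ i * v ^ (p - 1 - i) =
      ∑ i ∈ range p, (u ^ i - v ^ i) * v ^ (p - 1 - i) + p * v ^ (p - 1) := by
    rw [← nsmul_eq_mul]
    conv_rhs => rw [← card_range p, ← sum_const, card_range, ← sum_add_distrib]
    refine sum_congr rfl fun i hi => ?_
    rw [mem_range] at hi
    rw [sub_mul, ← pow_add, show i + (p - 1 - i) = p - 1 by omega, sub_add_cancel]
  rw [e]
  refine norm_add_le_of_le_max (norm_sum_le_of_forall hc fun i _ => ?_) ?_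
  · rw [norm_mul, norm_pow]
    exact (mul_le_of_le_one_right (norm_nonneg _) (pow_le_one₀ (norm_nonneg _) hv)).trans (hpow i)
  · rw [norm_mul, norm_pow]
    exact (mul_le_of_le_one_right (norm_nonneg _) (pow_le_one₀ (norm_nonneg _) hv)).trans hpc

lemma norm_pow_pow_sub_le {u v : D} (h : Commute u v) (hu : ‖u‖ ≤ 1) (hv : ‖v‖ ≤ 1) {c : ℝ}
    (huv : ‖u - v‖ ≤ c) (hpc : ‖(p : D)‖ ≤ c) (hc : c ≤ 1) (m : ℕ) :
    ‖u ^ p ^ m - v ^ p ^ m‖ ≤ c ^ (m + 1) := by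
  have hc0 : 0 ≤ c := (norm_nonneg _).trans hpc
  induction m with
  | zero => simpa using huv
  | succ m ih =>
    rw [pow_succ, pow_mul, pow_mul]
    refine (norm_pow_sub_pow_le (p := p) (h.pow_pow _ _) ?_ ?_
      (ih.trans ?_) hpc).trans ?_
    · rw [norm_pow]; exact pow_le_one₀ (norm_nonneg _) hu
    · rw [norm_pow]; exact pow_le_one₀ (norm_nonneg _) hv
    · exact (pow_le_pow_of_le_one hc0 hc (Nat.le_add_left 1 m)).trans (pow_one c).le
    · rw [pow_succ' c (m + 1)]
      exact mul_le_mul_of_nonneg_left ih hc0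

lemma exists_teichmuller [CompleteSpace D] {x : D} (hx : ‖x‖ ≤ 1) {s : ℕ} (hs : 0 < s)
    (h : ‖x ^ p ^ s - x‖ < 1) : ∃ ω, ω ^ p ^ s = ω ∧ ‖ω - x‖ < 1 := by
  set c := max ‖(p : D)‖ ‖x ^ p ^ s - x‖ with hc
  have hc1 : c < 1 := max_lt (norm_natCast_prime_lt_one D p) h
  have hc0 : 0 ≤ c := (norm_nonneg _).trans (le_max_left _ _)
  let a : ℕ → D := fun n => x ^ p ^ (s * n)
  have hstep : ∀ n, ‖a (n + 1) - a n‖ ≤ c * c ^ n := fun n => by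
    have := norm_pow_pow_sub_le (p := p) (u := x ^ p ^ s) (v := x) ((Commute.refl x).pow_left _)
      (by rw [norm_pow]; exact pow_le_one₀ (norm_nonneg _) hx) hx (le_max_right _ _)
      (le_max_left _ _) hc1.le (s * n)
    rw [← pow_mul, ← pow_add] at this
    have e : a (n + 1) = x ^ p ^ (s + s * n) := by simp only [a]; congr 2; ring
    rw [e]
    refine this.trans ?_
    rw [pow_succ, mul_comm]
    exact mul_le_mul_of_nonneg_left
      (pow_le_pow_of_le_one hc0 hc1.le (Nat.le_mul_of_pos_left n hs)) hc0
  obtain ⟨ω, hω⟩ := cauchySeq_tendsto_of_complete (cauchySeq_of_le_geometric c c hc1 (f := a)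
    (fun n => by rw [dist_eq_norm, norm_sub_rev]; exact hstep n))
  refine ⟨ω, ?_, ?_⟩
  · have h1 : Tendsto (fun n => a n ^ p ^ s) atTop (𝓝 (ω ^ p ^ s)) := hω.pow _
    have h2 : Tendsto (fun n => a (n + 1)) atTop (𝓝 ω) := hω.comp (tendsto_add_atTop_nat 1)
    refine tendsto_nhds_unique h1 (h2.congr fun n => ?_)
    simp only [a]
    rw [← pow_mul, ← pow_add]
    congr 2
  · have h1 : ∀ n, ‖a n - x‖ ≤ c := fun n => by
      induction n with
      | zero => simpa [a] using hc0
      | succ n ih =>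
        have := norm_add_le_of_le_max ((hstep n).trans
          (mul_le_of_le_one_right hc0 (pow_le_one₀ hc0 hc1.le))) ih
        rwa [sub_add_sub_cancel] at this
    have h2 : Tendsto (fun n => ‖a n - x‖) atTop (𝓝 ‖ω - x‖) := (hω.sub_const x).norm
    exact (le_of_tendsto' h2 h1).trans_lt hc1

/-- A root of unity `ω` of order `q^d - 1` generating the residue field, and a uniformizer `π` with
`π ω π⁻¹ = ω^(q^r)`, where `r` is prime to `d`. -/
structure IsTeich (q d r : ℕ) (ω π : D) : Prop where
  one_lt : 1 < q
  pos : 0 < d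
  coprime : r.Coprime d
  pow_eq_one : ω ^ (q ^ d - 1) = 1
  ne_zero : π ≠ 0
  norm_lt_one : ‖π‖ < 1
  norm_le : ∀ x : D, ‖x‖ < 1 → ‖x‖ ≤ ‖π‖
  mul_eq : π * ω = ω ^ q ^ r * π
  lt_or_exists : ∀ x : D, ‖x‖ ≤ 1 → ‖x‖ < 1 ∨ ∃ i : ℕ, ‖x - ω ^ i‖ < 1
  norm_sub_one : ∀ i, ¬q ^ d - 1 ∣ i → ‖ω ^ i - 1‖ = 1
  norm_natCast : ‖((q ^ d - 1 : ℕ) : D)‖ = 1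

lemma exists_frobenius_exponent {k : Type*} [Field k] [Finite k] [CharP k p] (φ : k →+* k) :
    ∃ b : ℕ, ∀ x, φ x = x ^ p ^ b := by
  let := ZMod.algebra k p
  let ψ : k →ₐ[ZMod p] k :=
    { φ with
      commutes' := fun c => RingHom.congr_fun
        (Subsingleton.elim (φ.comp (algebraMap (ZMod p) k)) (algebraMap (ZMod p) k)) c }
  have hb : Function.Bijective ψ :=
    Finite.injective_iff_bijective.1 (RingHom.injective φ)
  obtain ⟨n, hn⟩ := (FiniteField.bijective_frobeniusAlgEquivOfAlgebraic_pow (ZMod p) k).2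
    (AlgEquiv.ofBijective ψ hb)
  refine ⟨n, fun x => ?_⟩
  change AlgEquiv.ofBijective ψ hb x = _
  rw [← hn]
  change (FiniteField.frobeniusAlgEquivOfAlgebraic (ZMod p) k ^ (n : ℕ)) x = _
  rw [AlgEquiv.coe_pow, FiniteField.coe_frobeniusAlgEquivOfAlgebraic_iterate, ZMod.card]

theorem exists_isTeich [ProperSpace D] {π₀ : D} (h0 : π₀ ≠ 0) (h1 : ‖π₀‖ < 1)
    (hle : ∀ x : D, ‖x‖ < 1 → ‖x‖ ≤ ‖π₀‖) :
    ∃ (g d r : ℕ) (ω π : D), 0 < g ∧ ‖π‖ = ‖π₀‖ ∧ IsTeich (p ^ g) d r ω π := by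
  obtain ⟨k, _, _, ρ, hρ, hker⟩ := exists_residueField (D := D)
  have hker' : ∀ x y : unitBall D, ρ x = ρ y ↔ ‖(x : D) - y‖ < 1 := fun x y => by
    rw [← sub_eq_zero, ← map_sub, hker]; rfl
  have hchar : CharP k p := charP_of_natCast_eq_zero hp.out (by
    rw [← map_natCast ρ, hker]
    simpa using norm_natCast_prime_lt_one D p)
  let : Fintype k := Fintype.ofFinite k
  obtain ⟨⟨D₀, hD₀⟩, -, hcard⟩ := FiniteField.card k p
  change Fintype.card k = p ^ D₀ at hcard
  classical
  obtain ⟨g, hg⟩ := IsCyclic.exists_generator (α := kˣ)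
  have hord : orderOf g = p ^ D₀ - 1 := by
    rw [orderOf_eq_card_of_forall_mem_zpowers hg, Nat.card_eq_fintype_card, Fintype.card_units,
      hcard]
  obtain ⟨x, hx⟩ := hρ g
  obtain ⟨ω, hω, hωx⟩ := exists_teichmuller (p := p) x.2 hD₀ (by
    have : ρ (x ^ p ^ D₀) = ρ x := by rw [map_pow, ← hcard, FiniteField.pow_card]
    exact (hker' _ _).1 this)
  have hx1 : ‖(x : D)‖ = 1 := by
    refine le_antisymm x.2 (not_lt.1 fun h => ?_)
    rw [← hker, hx] at h
    exact g.ne_zero h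
  have hω1 : ‖ω‖ = 1 := by rw [norm_eq_of_sub_lt (hωx.trans_eq hx1.symm), hx1]
  have hω0 : ω ≠ 0 := by rw [← norm_ne_zero_iff, hω1]; exact one_ne_zero
  have hQ : 1 < p ^ D₀ := Nat.one_lt_pow hD₀.ne' hp.out.one_lt
  have hωN : ω ^ (p ^ D₀ - 1) = 1 := by
    have h2 : ω ^ (p ^ D₀ - 1) * ω = 1 * ω := by
      rw [← pow_succ, Nat.sub_add_cancel hQ.le, hω, one_mul]
    exact mul_right_cancel₀ hω0 h2
  set ω' : unitBall D := ⟨ω, hω1.le⟩ with hω'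
  have hρω : ρ ω' = g := by rw [← hx, hker']; exact hωx
  have hn0 : ‖π₀‖ ≠ 0 := norm_ne_zero_iff.2 h0
  let φ : unitBall D →+* unitBall D :=
    { toFun := fun x => ⟨π₀ * x * π₀⁻¹, by
        change ‖π₀ * x * π₀⁻¹‖ ≤ 1
        rw [norm_mul, norm_mul, norm_inv, mul_comm ‖π₀‖, mul_assoc, mul_inv_cancel₀ hn0, mul_one]
        exact x.2⟩
      map_one' := Subtype.ext (by simp [h0])
      map_mul' := fun x y => Subtype.ext (by
        change π₀ * ((x : D) * y) * π₀⁻¹ = π₀ * x * π₀⁻¹ * (π₀ * y * π₀⁻¹)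
        simp only [mul_assoc, inv_mul_cancel_left₀ h0])
      map_zero' := Subtype.ext (by simp)
      map_add' := fun x y => Subtype.ext (by
        change π₀ * ((x : D) + y) * π₀⁻¹ = π₀ * x * π₀⁻¹ + π₀ * y * π₀⁻¹
        rw [mul_add, add_mul]) }
  obtain ⟨b, hb⟩ : ∃ b : ℕ, ∀ x, ρ (φ x) = ρ x ^ p ^ b := by
    have hkk : ∀ x, ρ x = 0 → (ρ.comp φ) x = 0 := fun x hx => by
      rw [hker] at hx
      rw [RingHom.comp_apply, hker]
      change ‖π₀ * x * π₀⁻¹‖ < 1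
      rwa [norm_mul, norm_mul, norm_inv, mul_comm ‖π₀‖, mul_assoc, mul_inv_cancel₀ hn0, mul_one]
    let ψ : k →+* k := RingHom.liftOfSurjective ρ hρ ⟨ρ.comp φ, hkk⟩
    obtain ⟨b, hb⟩ := exists_frobenius_exponent (p := p) ψ
    refine ⟨b, fun x => ?_⟩
    rw [← hb]
    exact (RingHom.liftOfRightInverse_comp_apply _ _ _ ⟨ρ.comp φ, hkk⟩ x).symm
  have hconj : ‖π₀ * ω * π₀⁻¹ - ω ^ p ^ b‖ < 1 := by
    have := (hker' (φ ω') (ω' ^ p ^ b)).1 (by rw [hb, map_pow])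
    exact this
  set N := p ^ D₀ - 1 with hN
  set v : D := ω ^ p ^ b with hv
  have hv0 : v ≠ 0 := pow_ne_zero _ hω0
  have hvn : ‖v‖ = 1 := by rw [hv, norm_pow, hω1, one_pow]
  have hvN : v ^ N = 1 := by rw [hv, ← pow_mul, mul_comm, pow_mul, hωN, one_pow]
  set π : D := ∑ i ∈ range N, v⁻¹ ^ i * π₀ * ω ^ i with hπ
  have hterm : ∀ i, ‖v⁻¹ ^ i * π₀ * ω ^ i - π₀‖ < ‖π₀‖ := fun i => by
    have e : v⁻¹ ^ i * π₀ * ω ^ i - π₀ = v⁻¹ ^ i * ((π₀ * ω * π₀⁻¹) ^ i - v ^ i) * π₀ := by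
      rw [conj_pow₀ h0, mul_sub, sub_mul, inv_pow, inv_mul_cancel₀ (pow_ne_zero i hv0), one_mul]
      simp only [mul_assoc, inv_mul_cancel₀ h0, mul_one]
    rw [e, norm_mul, norm_mul, norm_pow, norm_inv, hvn, inv_one, one_pow, one_mul]
    refine mul_lt_of_lt_one_left ((norm_nonneg _).lt_of_ne' hn0) ?_
    have := (hker' (φ ω' ^ i) ((ω' ^ p ^ b) ^ i)).1 (by
      rw [map_pow, map_pow, hb, map_pow])
    exact this
  have hNn : ‖(N : D)‖ = 1 := by
    have h2 : ‖(N : D) - (-1)‖ < ‖(-1 : D)‖ := by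
      rw [norm_neg, norm_one, sub_neg_eq_add]
      have h3 : (N : D) + 1 = (p : D) ^ D₀ := by
        rw [← Nat.cast_one (R := D), ← Nat.cast_add, hN, Nat.sub_add_cancel hQ.le, Nat.cast_pow]
      rw [h3, norm_pow]
      exact pow_lt_one₀ (norm_nonneg _) (norm_natCast_prime_lt_one D p) hD₀.ne'
    rw [norm_eq_of_sub_lt h2, norm_neg, norm_one]
  have hππ : ‖π - N * π₀‖ < ‖π₀‖ := by
    have e : π - N * π₀ = ∑ i ∈ range N, (v⁻¹ ^ i * π₀ * ω ^ i - π₀) := by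
      rw [sum_sub_distrib, sum_const, card_range, nsmul_eq_mul]
    rw [e]
    have hne : (range N).Nonempty := ⟨0, by rw [mem_range]; omega⟩
    obtain ⟨i, -, hi⟩ := IsUltrametricDist.exists_norm_finsetSum_le_of_nonempty hne
      (fun i => v⁻¹ ^ i * π₀ * ω ^ i - π₀)
    exact hi.trans_lt (hterm i)
  have hπn : ‖π‖ = ‖π₀‖ := by
    have h2 : ‖(N : D) * π₀‖ = ‖π₀‖ := by rw [norm_mul, hNn, one_mul]
    rw [norm_eq_of_sub_lt (hππ.trans_eq h2.symm), h2]
  obtain ⟨r, d, hcop, hbr, hDd⟩ := Nat.exists_coprime b D₀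
  have hg0 : 0 < b.gcd D₀ := Nat.gcd_pos_of_pos_right b hD₀
  have hd0 : 0 < d := Nat.pos_of_ne_zero fun h => by rw [h, zero_mul] at hDd; omega
  have hQd : (p ^ b.gcd D₀) ^ d = p ^ D₀ := by rw [← pow_mul, mul_comm, ← hDd]
  have hbd : (p ^ b.gcd D₀) ^ r = p ^ b := by rw [← pow_mul, mul_comm, ← hbr]
  refine ⟨b.gcd D₀, d, r, ω, π, hg0, hπn, Nat.one_lt_pow hg0.ne' hp.out.one_lt, hd0, hcop,
    by rwa [hQd], ?_, hπn ▸ h1, fun x hx => hπn ▸ hle x hx, ?_, ?_, ?_,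
    by rwa [hQd]⟩
  · rw [← norm_ne_zero_iff, hπn]; exact hn0
  · rw [hbd, ← hv]
    have h2 : v⁻¹ * (π * ω) = π := by
      have h3 : v⁻¹ * (π * ω) = ∑ i ∈ range N, v⁻¹ ^ (i + 1) * π₀ * ω ^ (i + 1) := by
        rw [hπ, sum_mul, mul_sum]
        refine sum_congr rfl fun i _ => ?_
        rw [pow_succ', pow_succ]
        simp only [mul_assoc]
      have h4 := sum_range_succ (fun i => v⁻¹ ^ i * π₀ * ω ^ i) N
      rw [sum_range_succ'] at h4
      rw [h3]
      simp only [inv_pow v N, hvN, hωN, inv_one, pow_zero] at h4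
      exact add_right_cancel h4
    calc π * ω = v * (v⁻¹ * (π * ω)) := (mul_inv_cancel_left₀ hv0 _).symm
      _ = v * π := by rw [h2]
  · intro y hy
    by_cases h2 : ρ ⟨y, hy⟩ = 0
    · exact Or.inl ((hker _).1 h2)
    · right
      obtain ⟨i, hi⟩ := (mem_powers_iff_mem_zpowers.2 (hg (Units.mk0 _ h2)))
      refine ⟨i, ?_⟩
      have h3 : ρ ⟨y, hy⟩ = ρ (ω' ^ i) := by
        rw [map_pow, hρω, ← Units.val_pow_eq_pow_val]
        exact congrArg Units.val hi.symm
      exact (hker' _ _).1 h3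
  · intro i hi
    rw [hQd] at hi
    refine le_antisymm (norm_sub_le_of_le_max ?_ norm_one.le) (not_lt.1 fun h2 => hi ?_)
    · rw [norm_pow, hω1, one_pow]
    · have h3 : ρ (ω' ^ i) = ρ 1 := (hker' _ _).2 h2
      rw [map_pow, hρω, map_one, ← Units.val_pow_eq_pow_val] at h3
      rw [← hN, ← hord]
      exact orderOf_dvd_of_pow_eq_one (Units.ext h3)

end NormedDivision

section TeichArithmetic

open Finset Filter Topology

variable {D : Type u} [NormedDivisionRing D] [IsUltrametricDist D]

/-- The projection of `D` onto the centralizer of an element `ω` with `ω^N = 1`, by averaging. -/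
def weightZero (ω : D) (N : ℕ) : D →+ D where
  toFun x := (N : D)⁻¹ * ∑ i ∈ range N, ω ^ i * x * ω⁻¹ ^ i
  map_zero' := by simp
  map_add' x y := by simp only [mul_add, add_mul, sum_add_distrib]

lemma weightZero_apply (ω : D) (N : ℕ) (x : D) :
    weightZero ω N x = (N : D)⁻¹ * ∑ i ∈ range N, ω ^ i * x * ω⁻¹ ^ i := rfl

lemma weightZero_mul {ω w : D} (N : ℕ) (hw : Commute w ω) (x : D) :
    weightZero ω N (w * x) = w * weightZero ω N x := by
  rw [weightZero_apply, weightZero_apply, ← mul_assoc w,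
    ((Nat.commute_cast w N).inv_right₀).eq, mul_assoc _ w, mul_sum _ _ w]
  congr 1
  refine sum_congr rfl fun i _ => ?_
  rw [← mul_assoc, ← (hw.pow_right i).eq]
  simp only [mul_assoc]

lemma weightZero_mul' {ω w : D} (N : ℕ) (hw : Commute w ω) (x : D) :
    weightZero ω N (x * w) = weightZero ω N x * w := by
  rw [weightZero_apply, weightZero_apply, mul_assoc, sum_mul]
  congr 1
  refine sum_congr rfl fun i _ => ?_
  rw [mul_assoc (ω ^ i * x), ← (hw.inv_right₀.pow_right i).eq]
  simp only [mul_assoc]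

namespace IsTeich

variable {q d r : ℕ} {ω π : D}

lemma one_lt_pow (h : IsTeich q d r ω π) : 1 < q ^ d := Nat.one_lt_pow h.pos.ne' h.one_lt

lemma card_pos (h : IsTeich q d r ω π) : 0 < q ^ d - 1 := Nat.sub_pos_of_lt h.one_lt_pow

lemma norm_root (h : IsTeich q d r ω π) : ‖ω‖ = 1 := by
  have h1 := congrArg norm h.pow_eq_one
  rw [norm_pow, norm_one] at h1
  exact (pow_eq_one_iff_of_nonneg (norm_nonneg _) h.card_pos.ne').1 h1

lemma root_ne_zero (h : IsTeich q d r ω π) : ω ≠ 0 := by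
  rw [← norm_ne_zero_iff, h.norm_root]
  exact one_ne_zero

lemma norm_pos (h : IsTeich q d r ω π) : 0 < ‖π‖ := norm_pos_iff.2 h.ne_zero

lemma natCast_ne_zero (h : IsTeich q d r ω π) : ((q ^ d - 1 : ℕ) : D) ≠ 0 := by
  rw [← norm_ne_zero_iff, h.norm_natCast]
  exact one_ne_zero

lemma dvd_of_pow_eq_one (h : IsTeich q d r ω π) {i : ℕ} (hi : ω ^ i = 1) : q ^ d - 1 ∣ i := by
  by_contra hcon
  have := h.norm_sub_one i hcon
  rw [hi, sub_self, norm_zero] at this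
  exact zero_ne_one this

lemma pow_mul_root (h : IsTeich q d r ω π) (a : ℕ) : π ^ a * ω = ω ^ (q ^ r) ^ a * π ^ a := by
  induction a with
  | zero => simp
  | succ a ih =>
    have key : ∀ j : ℕ, π * ω ^ j = ω ^ (q ^ r * j) * π := fun j => by
      induction j with
      | zero => simp
      | succ j ihj =>
        rw [pow_succ, ← mul_assoc, ihj, mul_assoc, h.mul_eq, ← mul_assoc, ← pow_add, mul_add,
          mul_one]
    rw [pow_succ', mul_assoc, ih, ← mul_assoc, key, mul_assoc, ← pow_succ', ← pow_succ']

lemma root_pow_eq_iff (h : IsTeich q d r ω π) (a : ℕ) : ω ^ (q ^ r) ^ a = ω ↔ d ∣ a := by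
  have hq := h.one_lt
  have hQ : 0 < (q ^ r) ^ a := pow_pos (pow_pos (by omega) _) _
  have h0 : ω ^ (q ^ r) ^ a = ω ↔ q ^ d - 1 ∣ q ^ (r * a) - 1 := by
    rw [pow_mul]
    constructor
    · intro h1
      refine h.dvd_of_pow_eq_one (mul_right_cancel₀ h.root_ne_zero ?_)
      rw [← pow_succ, Nat.sub_add_cancel hQ, h1, one_mul]
    · rintro ⟨k, hk⟩
      rw [← Nat.sub_add_cancel hQ, hk, pow_succ, pow_mul, h.pow_eq_one, one_pow, one_mul]
  rw [h0]
  constructor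
  · intro h1
    have h2 := Nat.pow_sub_one_gcd_pow_sub_one q d (r * a)
    rw [Nat.gcd_eq_left h1] at h2
    have h3 : 0 < q ^ d := pow_pos (by omega) _
    have h4 : 0 < q ^ d.gcd (r * a) := pow_pos (by omega) _
    have h5 : d = d.gcd (r * a) := Nat.pow_right_injective (a := q) (by omega) (show q ^ d = q ^ d.gcd (r * a) by omega)
    exact h.coprime.symm.dvd_of_dvd_mul_left (h5 ▸ Nat.gcd_dvd_right d (r * a))
  · rintro ⟨k, rfl⟩
    rw [mul_left_comm, pow_mul]
    simpa using Nat.sub_dvd_pow_sub_pow (q ^ d) 1 (r * k)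

lemma commute_pow (h : IsTeich q d r ω π) {a : ℕ} (ha : d ∣ a) : Commute (π ^ a) ω := by
  rw [commute_iff_eq, h.pow_mul_root, (h.root_pow_eq_iff a).2 ha]

lemma exists_zpow_mul_root (h : IsTeich q d r ω π) (a : ℤ) :
    ∃ k : ℕ, π ^ a * ω = ω ^ k * π ^ a ∧ (ω ^ k = ω ↔ (d : ℤ) ∣ a) := by
  obtain ⟨a', t, hat⟩ : ∃ (a' : ℕ) (t : ℤ), a = a' + d * t :=
    ⟨(a % d).toNat, a / d, by
      rw [Int.toNat_of_nonneg (Int.emod_nonneg _ (by exact_mod_cast h.pos.ne'))]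
      exact (Int.emod_add_mul_ediv a d).symm⟩
  have hc : Commute (π ^ ((d : ℤ) * t)) ω := by
    rw [zpow_mul, zpow_natCast]
    exact (h.commute_pow dvd_rfl).zpow_left₀ t
  refine ⟨(q ^ r) ^ a', ?_, ?_⟩
  · rw [hat, zpow_add₀ h.ne_zero, mul_assoc, hc.eq, ← mul_assoc, zpow_natCast, h.pow_mul_root,
      mul_assoc]
  · rw [h.root_pow_eq_iff, hat, dvd_add_left (dvd_mul_right _ _), Int.natCast_dvd_natCast]

lemma commute_weightZero (h : IsTeich q d r ω π) (x : D) :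
    Commute (weightZero ω (q ^ d - 1) x) ω := by
  have h1 : ω * weightZero ω (q ^ d - 1) x * ω⁻¹ = weightZero ω (q ^ d - 1) x := by
    rw [weightZero_apply, ← mul_assoc, ← ((Nat.cast_commute (q ^ d - 1) ω).inv_left₀).eq,
      mul_assoc _ ω, mul_assoc]
    congr 1
    rw [mul_sum, sum_mul]
    have h2 := sum_range_succ (fun i => ω ^ i * x * ω⁻¹ ^ i) (q ^ d - 1)
    rw [sum_range_succ', inv_pow ω (q ^ d - 1), h.pow_eq_one] at h2
    simp only [inv_one, pow_zero] at h2
    rw [← add_right_cancel h2]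
    refine sum_congr rfl fun i _ => ?_
    rw [pow_succ', pow_succ]
    simp only [mul_assoc]
  rw [commute_iff_eq]
  conv_lhs => rw [← h1]
  rw [mul_assoc, inv_mul_cancel₀ h.root_ne_zero, mul_one]

lemma weightZero_of_commute (h : IsTeich q d r ω π) {x : D} (hx : Commute x ω) :
    weightZero ω (q ^ d - 1) x = x := by
  have h1 : ∀ i, ω ^ i * x * ω⁻¹ ^ i = x := fun i => by
    rw [← (hx.pow_right i).eq, inv_pow, mul_inv_cancel_right₀ (pow_ne_zero i h.root_ne_zero)]
  rw [weightZero_apply]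
  simp only [h1, sum_const, card_range, nsmul_eq_mul]
  rw [inv_mul_cancel_left₀ h.natCast_ne_zero]

lemma norm_weightZero_le (h : IsTeich q d r ω π) (x : D) :
    ‖weightZero ω (q ^ d - 1) x‖ ≤ ‖x‖ := by
  rw [weightZero_apply, norm_mul, norm_inv, h.norm_natCast, inv_one, one_mul]
  refine norm_sum_le_of_forall (norm_nonneg _) fun i _ => ?_
  rw [norm_mul, norm_mul, norm_pow, norm_pow, norm_inv, h.norm_root, inv_one, one_pow, one_mul,
    mul_one]

lemma weightZero_eq_zero (h : IsTeich q d r ω π) {x : D} {k : ℕ} (hx : x * ω = ω ^ k * x)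
    (hk : ω ^ k ≠ ω) : weightZero ω (q ^ d - 1) x = 0 := by
  have h0 := h.root_ne_zero
  have h1 : ∀ i, ω ^ i * x * ω⁻¹ ^ i = (ω * (ω ^ k)⁻¹) ^ i * x := fun i => by
    have hc : Commute ω (ω ^ k)⁻¹ := ((Commute.refl ω).pow_right k).inv_right₀
    have h2 : x * ω⁻¹ = (ω ^ k)⁻¹ * x := by
      rw [← mul_right_inj' (pow_ne_zero k h0), mul_inv_cancel_left₀ (pow_ne_zero k h0), ← mul_assoc,
        ← hx, mul_inv_cancel_right₀ h0]
    have h3 : x * ω⁻¹ ^ i = (ω ^ k)⁻¹ ^ i * x := by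
      induction i with
      | zero => simp
      | succ i ih => rw [pow_succ, ← mul_assoc, ih, mul_assoc, h2, ← mul_assoc, ← pow_succ]
    rw [mul_assoc, h3, hc.mul_pow, mul_assoc]
  rw [weightZero_apply]
  simp only [h1]
  rw [← sum_mul]
  have h2 : ω * (ω ^ k)⁻¹ ≠ 1 := fun h3 => hk (by
    rw [mul_inv_eq_one₀ (pow_ne_zero k h0)] at h3
    exact h3.symm)
  have h3 := geom_sum_mul (ω * (ω ^ k)⁻¹) (q ^ d - 1)
  have hc : Commute ω (ω ^ k)⁻¹ := ((Commute.refl ω).pow_right k).inv_right₀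
  rw [hc.mul_pow, inv_pow, ← pow_mul, mul_comm k, pow_mul, h.pow_eq_one, one_pow, inv_one, mul_one,
    sub_self] at h3
  rw [(mul_eq_zero.1 h3).resolve_right (sub_ne_zero.2 h2), zero_mul, mul_zero]

lemma weightZero_mul_zpow (h : IsTeich q d r ω π) {w : D} (hw : Commute w ω) {a : ℤ}
    (ha : ¬(d : ℤ) ∣ a) : weightZero ω (q ^ d - 1) (w * π ^ a) = 0 := by
  obtain ⟨k, hk, hk'⟩ := h.exists_zpow_mul_root a
  rw [weightZero_mul _ hw, h.weightZero_eq_zero hk fun h1 => ha (hk'.1 h1), mul_zero]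

lemma commute_zpow (h : IsTeich q d r ω π) {a : ℤ} (ha : (d : ℤ) ∣ a) : Commute (π ^ a) ω := by
  obtain ⟨k, hk, hk'⟩ := h.exists_zpow_mul_root a
  rw [commute_iff_eq, hk, hk'.2 ha]

lemma weightZero_mul_zpow_of_dvd (h : IsTeich q d r ω π) {w : D} (hw : Commute w ω) {a : ℤ}
    (ha : (d : ℤ) ∣ a) : weightZero ω (q ^ d - 1) (w * π ^ a) = w * π ^ a :=
  h.weightZero_of_commute (hw.mul_left (h.commute_zpow ha))

/-- The leading term of an element of `D`. -/
lemma exists_leading (h : IsTeich q d r ω π) {u : D} {a : ℤ} (hu : ‖u‖ ≤ ‖π‖ ^ a) :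
    ∃ c : D, (c = 0 ∨ ∃ i : ℕ, c = ω ^ i) ∧ ‖u - c * π ^ a‖ ≤ ‖π‖ ^ (a + 1) := by
  have h0 := h.norm_pos
  have hpi : ‖u * (π ^ a)⁻¹‖ ≤ 1 := by
    rw [norm_mul, norm_inv, norm_zpow, ← div_eq_mul_inv, div_le_one (zpow_pos h0 a)]
    exact hu
  have key : ∀ c : D, ‖u * (π ^ a)⁻¹ - c‖ < 1 → ‖u - c * π ^ a‖ ≤ ‖π‖ ^ (a + 1) := fun c hc => by
    have h1 := h.norm_le _ hc
    have h2 : u - c * π ^ a = (u * (π ^ a)⁻¹ - c) * π ^ a := by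
      rw [sub_mul, inv_mul_cancel_right₀ (zpow_ne_zero a h.ne_zero)]
    rw [h2, norm_mul, norm_zpow, zpow_add₀ h0.ne', zpow_one, mul_comm]
    exact mul_le_mul_of_nonneg_left h1 (zpow_pos h0 a).le
  rcases h.lt_or_exists _ hpi with h1 | ⟨i, hi⟩
  · exact ⟨0, Or.inl rfl, key 0 (by rwa [sub_zero])⟩
  · exact ⟨ω ^ i, Or.inr ⟨i, rfl⟩, key _ hi⟩

lemma exists_norm_le_zpow (h : IsTeich q d r ω π) (u : D) : ∃ a : ℤ, ‖u‖ ≤ ‖π‖ ^ a := by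
  obtain ⟨n, hn⟩ := pow_unbounded_of_one_lt ‖u‖ ((one_lt_inv₀ h.norm_pos).2 h.norm_lt_one)
  exact ⟨-n, by rw [zpow_neg, zpow_natCast, ← inv_pow]; exact hn.le⟩

lemma tendsto_zpow (h : IsTeich q d r ω π) (a : ℤ) :
    Tendsto (fun M : ℕ => ‖π‖ ^ (a + M)) atTop (𝓝 0) := by
  have h1 := (tendsto_pow_atTop_nhds_zero_of_lt_one (norm_nonneg π) h.norm_lt_one).const_mul
    (‖π‖ ^ a)
  rw [mul_zero] at h1
  refine h1.congr fun M => ?_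
  rw [zpow_add₀ h.norm_pos.ne', zpow_natCast]

/-- A bounded additive map is determined by its values at the elements `ω^i π^a`. -/
lemma eq_zero_of_forall (h : IsTeich q d r ω π) (E : D →+ D) {C : ℝ} (hC : 0 ≤ C)
    (hE : ∀ x, ‖E x‖ ≤ C * ‖x‖)
    (hE' : ∀ (i : ℕ) (a : ℤ), E (ω ^ i * π ^ a) = 0) (u : D) : E u = 0 := by
  obtain ⟨a, ha⟩ := h.exists_norm_le_zpow u
  have key : ∀ M : ℕ, ∃ u' : D, ‖u'‖ ≤ ‖π‖ ^ (a + M) ∧ E u = E u' := fun M => by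
    induction M with
    | zero => exact ⟨u, by simpa using ha, rfl⟩
    | succ M ih =>
      obtain ⟨u', hu', hE1⟩ := ih
      obtain ⟨c, hc, hcu⟩ := h.exists_leading hu'
      refine ⟨u' - c * π ^ (a + M), by push_cast; rw [← add_assoc]; exact hcu, ?_⟩
      rw [map_sub, hE1]
      rcases hc with rfl | ⟨i, rfl⟩
      · simp
      · rw [hE', sub_zero]
  have h1 : ∀ M : ℕ, ‖E u‖ ≤ C * ‖π‖ ^ (a + M) := fun M => by
    obtain ⟨u', hu', hE1⟩ := key M
    rw [hE1]
    exact (hE u').trans (mul_le_mul_of_nonneg_left hu' hC)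
  have h2 := (h.tendsto_zpow a).const_mul C
  rw [mul_zero] at h2
  have h3 := ge_of_tendsto' h2 h1
  exact norm_eq_zero.1 (le_antisymm h3 (norm_nonneg _))

lemma commute_of_forall (h : IsTeich q d r ω π) {y : D} (hω : Commute y ω) (hπ : Commute y π)
    (u : D) : Commute y u := by
  have h1 := h.eq_zero_of_forall (AddMonoidHom.mulLeft y - AddMonoidHom.mulRight y)
    (C := ‖y‖) (norm_nonneg _) (fun x => ?_) (fun i a => ?_) u
  · exact sub_eq_zero.1 h1
  · exact norm_sub_le_of_le_max (norm_mul y x).le ((norm_mul x y).trans (mul_comm _ _)).le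
  · exact sub_eq_zero.2 ((hω.pow_right i).mul_right (hπ.zpow_right₀ a)).eq

lemma commute_uniformizer_pow (h : IsTeich q d r ω π) (u : D) : Commute (π ^ d) u :=
  h.commute_of_forall (h.commute_pow dvd_rfl) ((Commute.refl π).pow_left d) u

lemma commute_uniformizer_zpow (h : IsTeich q d r ω π) {a : ℤ} (ha : (d : ℤ) ∣ a) (u : D) :
    Commute (π ^ a) u := by
  obtain ⟨k, rfl⟩ := ha
  rw [zpow_mul, zpow_natCast]
  exact (h.commute_uniformizer_pow u).zpow_left₀ k

/-- The centralizer of `ω` is commutative. -/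
lemma commute_of_commute_root (h : IsTeich q d r ω π) {x y : D} (hx : Commute x ω)
    (hy : Commute y ω) : Commute x y := by
  have h1 := h.eq_zero_of_forall
    (((AddMonoidHom.mulLeft y - AddMonoidHom.mulRight y)).comp (weightZero ω (q ^ d - 1)))
    (C := ‖y‖) (norm_nonneg _) (fun x => ?_) (fun i a => ?_) x
  · rw [AddMonoidHom.comp_apply, h.weightZero_of_commute hx] at h1
    exact (sub_eq_zero.1 h1).symm
  · have h2 := mul_le_mul_of_nonneg_left (h.norm_weightZero_le x) (norm_nonneg y)
    exact norm_sub_le_of_le_max ((norm_mul _ _).trans_le h2)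
      (((norm_mul _ _).trans (mul_comm _ _)).trans_le h2)
  · have hωi : Commute (ω ^ i) ω := (Commute.refl ω).pow_left i
    rw [AddMonoidHom.comp_apply]
    by_cases ha : (d : ℤ) ∣ a
    · rw [h.weightZero_mul_zpow_of_dvd hωi ha]
      exact sub_eq_zero.2 ((hy.pow_right i).mul_right (h.commute_uniformizer_zpow ha y).symm).eq
    · rw [h.weightZero_mul_zpow hωi ha, map_zero]

/-- The decomposition of `D` into weight spaces. -/
lemma sum_weightZero (h : IsTeich q d r ω π) (u : D) :
    ∑ i ∈ range d, π ^ i * weightZero ω (q ^ d - 1) (π⁻¹ ^ i * u) = u := by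
  let E : D →+ D := ∑ i ∈ range d, (AddMonoidHom.mulLeft (π ^ i)).comp
    ((weightZero ω (q ^ d - 1)).comp (AddMonoidHom.mulLeft (π⁻¹ ^ i))) - AddMonoidHom.id D
  have hE : ∀ u, E u = ∑ i ∈ range d, π ^ i * weightZero ω (q ^ d - 1) (π⁻¹ ^ i * u) - u :=
    fun u => by
      simp only [E, AddMonoidHom.sub_apply, AddMonoidHom.finsetSum_apply]
      rfl
  rw [← sub_eq_zero, ← hE]
  refine h.eq_zero_of_forall E (C := 1) zero_le_one (fun x => ?_) (fun i a => ?_) u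
  · rw [hE, one_mul]
    refine norm_sub_le_of_le_max (norm_sum_le_of_forall (norm_nonneg _) fun i _ => ?_) le_rfl
    rw [norm_mul]
    refine (mul_le_mul_of_nonneg_left (h.norm_weightZero_le _) (norm_nonneg _)).trans ?_
    rw [norm_mul, ← mul_assoc, ← norm_mul, inv_pow, mul_inv_cancel₀ (pow_ne_zero i h.ne_zero),
      norm_one, one_mul]
  · rw [hE, sub_eq_zero]
    have h0 := h.ne_zero
    have hterm : ∀ j : ℕ, ∃ k : ℕ, π⁻¹ ^ j * (ω ^ i * π ^ a) = ω ^ k * π ^ (a - j) := fun j => by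
      obtain ⟨k, hk, -⟩ := h.exists_zpow_mul_root (-j)
      have hk' : ∀ i, π ^ (-j : ℤ) * ω ^ i = (ω ^ k) ^ i * π ^ (-j : ℤ) := fun i => by
        induction i with
        | zero => simp
        | succ i ih => rw [pow_succ, ← mul_assoc, ih, mul_assoc, hk, ← mul_assoc, ← pow_succ]
      refine ⟨k * i, ?_⟩
      rw [inv_pow, ← zpow_natCast, ← zpow_neg, ← mul_assoc, hk', mul_assoc, ← zpow_add₀ h0,
        pow_mul, neg_add_eq_sub]
    set j₀ := (a % d).toNat with hj₀
    have hd : (d : ℤ) ≠ 0 := by exact_mod_cast h.pos.ne'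
    have hj₀' : (j₀ : ℤ) = a % d := Int.toNat_of_nonneg (Int.emod_nonneg a hd)
    have hjd : j₀ < d := by
      have := Int.emod_lt_of_pos a (show (0 : ℤ) < d by exact_mod_cast h.pos)
      omega
    rw [sum_eq_single j₀]
    · obtain ⟨k, hk⟩ := hterm j₀
      have hdvd : (d : ℤ) ∣ a - j₀ := by rw [hj₀']; exact Int.dvd_self_sub_emod
      rw [hk, h.weightZero_mul_zpow_of_dvd ((Commute.refl ω).pow_left k) hdvd, ← hk, inv_pow,
        mul_inv_cancel_left₀ (pow_ne_zero j₀ h0)]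
    · intro j hj hne
      obtain ⟨k, hk⟩ := hterm j
      rw [hk, h.weightZero_mul_zpow ((Commute.refl ω).pow_left k), mul_zero]
      intro hdvd
      apply hne
      rw [mem_range] at hj
      have h1 : a % d = j % d := Int.emod_eq_emod_iff_emod_sub_eq_zero.2
        (Int.emod_eq_zero_of_dvd hdvd)
      rw [Int.emod_eq_of_lt (a := (j : ℤ)) (by omega) (by exact_mod_cast hj)] at h1
      omega
    · intro hj
      exact absurd (mem_range.2 hjd) hj

/-- The norms of elements of weight zero are powers of `‖π^d‖`. -/
lemma norm_le_of_commute (h : IsTeich q d r ω π) {w : D} (hw : Commute w ω) {a : ℤ}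
    (ha : ¬(d : ℤ) ∣ a) (hwa : ‖w‖ ≤ ‖π‖ ^ a) : ‖w‖ ≤ ‖π‖ ^ (a + 1) := by
  obtain ⟨c, hc, hcu⟩ := h.exists_leading hwa
  have hcω : Commute c ω := by
    rcases hc with rfl | ⟨i, rfl⟩
    · exact Commute.zero_left _
    · exact (Commute.refl ω).pow_left i
  have h1 := (h.norm_weightZero_le (w - c * π ^ a)).trans hcu
  rwa [map_sub, h.weightZero_mul_zpow hcω ha, sub_zero, h.weightZero_of_commute hw] at h1

lemma norm_le_of_lt_of_commute (h : IsTeich q d r ω π) {w : D} (hw : Commute w ω) {k : ℤ}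
    (hwk : ‖w‖ < ‖π‖ ^ (d * k)) : ‖w‖ ≤ ‖π‖ ^ (d * (k + 1)) := by
  have h0 := h.norm_pos
  have hlt : ∀ (x : D) (a : ℤ), ‖x‖ < ‖π‖ ^ a → ‖x‖ ≤ ‖π‖ ^ (a + 1) := fun x a hx => by
    have h1 := h.norm_le (x * (π ^ a)⁻¹) (by
      rwa [norm_mul, norm_inv, norm_zpow, ← div_eq_mul_inv, div_lt_one (zpow_pos h0 a)])
    rwa [norm_mul, norm_inv, norm_zpow, ← div_eq_mul_inv, div_le_iff₀ (zpow_pos h0 a),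
      ← zpow_one_add₀ h0.ne', add_comm] at h1
  have key : ∀ j : ℕ, j + 1 ≤ d → ‖w‖ ≤ ‖π‖ ^ (d * k + (j + 1 : ℕ)) := fun j => by
    induction j with
    | zero => intro _; exact_mod_cast hlt w _ hwk
    | succ j ih =>
      intro hj
      have h1 := h.norm_le_of_commute hw (fun hdvd => ?_) (ih (by omega))
      · push_cast at h1 ⊢
        rwa [add_assoc, add_assoc, ← add_assoc (j : ℤ)] at h1
      · rw [dvd_add_right (dvd_mul_right _ _), Int.natCast_dvd_natCast] at hdvd
        have := Nat.le_of_dvd (by omega) hdvd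
        omega
  have h1 := key (d - 1) (by have := h.pos; omega)
  have h2 : (d * k + (d - 1 + 1 : ℕ) : ℤ) = d * (k + 1) := by
    rw [Nat.sub_add_cancel h.pos]; ring
  rwa [h2] at h1

lemma exists_norm_eq_of_commute (h : IsTeich q d r ω π) {w : D} (hw : Commute w ω) (hw0 : w ≠ 0) :
    ∃ k : ℤ, ‖w‖ = ‖π‖ ^ (d * k) := by
  have hd : (0 : ℤ) < d := by exact_mod_cast h.pos
  have h0 := h.norm_pos
  obtain ⟨k, hk⟩ : ∃ k : ℤ, ‖w‖ ≤ ‖π‖ ^ (d * k) := by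
    obtain ⟨a, ha⟩ := h.exists_norm_le_zpow w
    refine ⟨-|a|, ha.trans (zpow_le_zpow_right_of_le_one₀ h0 h.norm_lt_one.le ?_)⟩
    nlinarith [neg_abs_le a, abs_nonneg a]
  by_contra hcon
  push Not at hcon
  have key : ∀ M : ℕ, ‖w‖ ≤ ‖π‖ ^ (d * (k + M)) := fun M => by
    induction M with
    | zero => simpa using hk
    | succ M ih =>
      have := h.norm_le_of_lt_of_commute hw (lt_of_le_of_ne ih (hcon _))
      push_cast
      rwa [← add_assoc]
  have h2 : ‖w‖ ≤ 0 := by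
    refine ge_of_tendsto' (h.tendsto_zpow (d * k)) fun M => (key M).trans ?_
    refine zpow_le_zpow_right_of_le_one₀ h0 h.norm_lt_one.le ?_
    nlinarith
  exact hw0 (norm_eq_zero.1 (le_antisymm h2 (norm_nonneg _)))

end IsTeich

end TeichArithmetic

section UnramifiedRing

open Finset Filter Topology Polynomial

variable {D : Type u} [NormedDivisionRing D] {p : ℕ} [hp : Fact p.Prime] [NormedAlgebra ℚ_[p] D]
  [Algebra ℤ_[p] D] [IsScalarTower ℤ_[p] ℚ_[p] D]

variable (p) in
/-- The ring `ℤ_p[ω]` as a commutative ring. -/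
abbrev UnrRing (ω : D) : Type :=
  ℤ_[p][X] ⧸ RingHom.ker (aeval ω : ℤ_[p][X] →ₐ[ℤ_[p]] D)

namespace UnrRing

variable (p) in
/-- The embedding of `ℤ_p[ω]` into `D`. -/
noncomputable def emb (ω : D) : UnrRing p ω →+* D :=
  RingHom.kerLift (aeval ω : ℤ_[p][X] →ₐ[ℤ_[p]] D).toRingHom

lemma emb_injective (ω : D) : Function.Injective (emb p ω) := RingHom.kerLift_injective _

lemma emb_mk (ω : D) (f : ℤ_[p][X]) : emb p ω (Ideal.Quotient.mk _ f) = aeval ω f := rfl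

variable (p) in
/-- The generator of `ℤ_p[ω]`. -/
noncomputable def gen (ω : D) : UnrRing p ω := Ideal.Quotient.mk _ X

lemma emb_gen (ω : D) : emb p ω (gen p ω) = ω := by
  rw [gen, emb_mk, aeval_X]

lemma norm_algebraMap_padicInt (c : ℤ_[p]) : ‖algebraMap ℤ_[p] D c‖ = ‖c‖ := by
  rw [IsScalarTower.algebraMap_apply ℤ_[p] ℚ_[p] D, norm_algebraMap']
  rfl

lemma continuous_algebraMap_padicInt : Continuous (algebraMap ℤ_[p] D) := by
  have : (algebraMap ℤ_[p] D : ℤ_[p] → D) = algebraMap ℚ_[p] D ∘ algebraMap ℤ_[p] ℚ_[p] := by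
    ext c
    exact IsScalarTower.algebraMap_apply ℤ_[p] ℚ_[p] D c
  rw [this]
  exact (continuous_algebraMap ℚ_[p] D).comp continuous_subtype_val

lemma range_emb {ω : D} {N : ℕ} (hN : 0 < N) (hω : ω ^ N = 1) :
    Set.range (emb p ω) =
      Set.range fun c : Fin N → ℤ_[p] => ∑ i, algebraMap ℤ_[p] D (c i) * ω ^ (i : ℕ) := by
  apply Set.Subset.antisymm
  · rintro _ ⟨x, rfl⟩
    obtain ⟨f, rfl⟩ := Ideal.Quotient.mk_surjective x
    rw [emb_mk]
    induction f using Polynomial.induction_on' with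
    | add f g hf hg =>
      obtain ⟨c, hc⟩ := hf
      obtain ⟨c', hc'⟩ := hg
      refine ⟨c + c', ?_⟩
      rw [map_add, ← hc, ← hc']
      simp only [Pi.add_apply, map_add, add_mul, sum_add_distrib]
    | monomial n a =>
      refine ⟨Pi.single ⟨n % N, Nat.mod_lt _ hN⟩ a, ?_⟩
      simp only []
      rw [sum_eq_single ⟨n % N, Nat.mod_lt _ hN⟩]
      · rw [Pi.single_eq_same, aeval_monomial]
        congr 1
        conv_rhs => rw [← Nat.div_add_mod n N, pow_add, pow_mul, hω, one_pow, one_mul]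
      · intro j _ hj
        rw [Pi.single_eq_of_ne hj, map_zero, zero_mul]
      · simp
  · rintro _ ⟨c, rfl⟩
    refine ⟨Ideal.Quotient.mk _ (∑ i, C (c i) * X ^ (i : ℕ)), ?_⟩
    rw [emb_mk]
    simp

lemma isCompact_range_emb {ω : D} {N : ℕ} (hN : 0 < N) (hω : ω ^ N = 1) :
    IsCompact (Set.range (emb p ω)) := by
  rw [range_emb hN hω]
  refine isCompact_range (continuous_finsetSum _ fun i _ => ?_)
  exact (continuous_algebraMap_padicInt.comp (continuous_apply i)).mul continuous_const

lemma exists_pow_eq {ω : D} {s : ℕ} (hω : ω ^ p ^ s = ω) (x : UnrRing p ω) :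
    ∃ y, x ^ p ^ s = x + p * y := by
  obtain ⟨f, rfl⟩ := Ideal.Quotient.mk_surjective x
  induction f using Polynomial.induction_on' with
  | add f g hf hg =>
    obtain ⟨y, hy⟩ := hf
    obtain ⟨z, hz⟩ := hg
    obtain ⟨t, ht⟩ := exists_add_pow_prime_pow_eq hp.out
      (Ideal.Quotient.mk (RingHom.ker (aeval ω : ℤ_[p][X] →ₐ[ℤ_[p]] D)) f) (Ideal.Quotient.mk _ g) s
    refine ⟨y + z + Ideal.Quotient.mk _ f * Ideal.Quotient.mk _ g * t, ?_⟩
    rw [map_add, ht, hy, hz]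
    ring
  | monomial n a =>
    have h1 : a ^ p ^ s - a ∈ Ideal.span {(p : ℤ_[p])} := by
      rw [← PadicInt.maximalIdeal_eq_span_p, ← PadicInt.ker_toZMod, RingHom.mem_ker, map_sub,
        map_pow, ZMod.pow_card_pow, sub_self]
    obtain ⟨b, hb⟩ := Ideal.mem_span_singleton.1 h1
    have hb' : a ^ p ^ s = a + p * b := by rw [← hb]; ring
    refine ⟨Ideal.Quotient.mk _ (C b * X ^ n), emb_injective ω ?_⟩
    rw [map_pow, map_add, map_mul, emb_mk, emb_mk, aeval_monomial, map_natCast]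
    have hc : Commute (algebraMap ℤ_[p] D a) (ω ^ n) := Algebra.commutes _ _
    rw [hc.mul_pow, ← map_pow, hb', ← pow_mul, mul_comm n, pow_mul, hω, map_mul, aeval_C, map_pow,
      aeval_X, map_add, map_mul, map_natCast, add_mul, mul_assoc]

variable [IsUltrametricDist D]

lemma norm_emb_le {ω : D} (hω : ‖ω‖ = 1) (x : UnrRing p ω) : ‖emb p ω x‖ ≤ 1 := by
  obtain ⟨f, rfl⟩ := Ideal.Quotient.mk_surjective x
  rw [emb_mk, aeval_eq_sum_range]
  refine norm_sum_le_of_forall zero_le_one fun i _ => ?_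
  rw [Algebra.smul_def, norm_mul, norm_pow, hω, one_pow, mul_one, norm_algebraMap_padicInt]
  exact PadicInt.norm_le_one _

lemma emb_commute {ω x : D} (hx : Commute x ω) (y : UnrRing p ω) : Commute (emb p ω y) x := by
  obtain ⟨f, rfl⟩ := Ideal.Quotient.mk_surjective y
  rw [emb_mk]
  induction f using Polynomial.induction_on' with
  | add f g hf hg => rw [map_add]; exact hf.add_left hg
  | monomial n a =>
    rw [aeval_monomial]
    exact (Algebra.commute_algebraMap_left a x).mul_left (hx.symm.pow_left n)

lemma emb_commute_root {ω : D} (y : UnrRing p ω) : Commute (emb p ω y) ω :=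
  emb_commute (Commute.refl ω) y

end UnrRing

namespace IsTeich

open UnrRing

variable [IsUltrametricDist D] {q d r g : ℕ} {ω π : D}

lemma pow_card_eq (h : IsTeich (p ^ g) d r ω π) : ω ^ p ^ (g * d) = ω := by
  rw [pow_mul, ← Nat.sub_add_cancel h.one_lt_pow.le, pow_succ, h.pow_eq_one, one_mul]

lemma isCompact_range (h : IsTeich q d r ω π) : IsCompact (Set.range (emb p ω)) :=
  isCompact_range_emb h.card_pos h.pow_eq_one

/-- The elements of `ℤ_p[ω]` of norm less than one are divisible by `p`. -/
lemma dvd_of_norm_lt_one (h : IsTeich (p ^ g) d r ω π) {x : UnrRing p ω}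
    (hx : ‖emb p ω x‖ < 1) : (p : UnrRing p ω) ∣ x := by
  have hK : IsCompact ((fun z => (p : D) * z) '' Set.range (emb p ω)) :=
    h.isCompact_range.image (continuous_const.mul continuous_id)
  have key : ∀ k : ℕ, ∃ y, x = x ^ (p ^ (g * d)) ^ k + p * y := fun k => by
    induction k with
    | zero => exact ⟨0, by simp⟩
    | succ k ih =>
      obtain ⟨y, hy⟩ := ih
      obtain ⟨z, hz⟩ := exists_pow_eq h.pow_card_eq (x ^ (p ^ (g * d)) ^ k)
      refine ⟨y - z, ?_⟩
      rw [pow_succ, pow_mul, hz, mul_sub]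
      linear_combination hy
  have hQ : 1 < p ^ (g * d) := by rw [pow_mul]; exact h.one_lt_pow
  have hlim : Tendsto (fun k : ℕ => emb p ω x - emb p ω x ^ (p ^ (g * d)) ^ k) atTop
      (𝓝 (emb p ω x - 0)) :=
    tendsto_const_nhds.sub ((tendsto_pow_atTop_nhds_zero_of_norm_lt_one hx).comp
      (tendsto_pow_atTop_atTop_of_one_lt hQ))
  rw [sub_zero] at hlim
  obtain ⟨_, ⟨y, rfl⟩, hy⟩ := hK.isClosed.mem_of_tendsto hlim (Eventually.of_forall fun k => by
    obtain ⟨y, hy⟩ := key k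
    refine ⟨emb p ω y, ⟨y, rfl⟩, ?_⟩
    rw [eq_sub_iff_add_eq']
    conv_rhs => rw [hy]
    simp)
  exact ⟨y, emb_injective ω (by rw [← hy, map_mul, map_natCast])⟩

lemma isUnit_of_norm_eq_one (h : IsTeich (p ^ g) d r ω π)
    {x : UnrRing p ω} (hx : ‖emb p ω x‖ = 1) : IsUnit x := by
  obtain ⟨y, hy⟩ := exists_pow_eq h.pow_card_eq x
  set Q := p ^ (g * d) with hQ
  have hQ1 : 1 < Q := by rw [hQ, pow_mul]; exact h.one_lt_pow
  set u := emb p ω x ^ (Q - 1) with hu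
  have hxu : emb p ω x * (u - 1) = p * emb p ω y := by
    rw [mul_sub, hu, ← pow_succ', Nat.sub_add_cancel hQ1.le, mul_one, ← map_pow, hy, map_add,
      map_mul, map_natCast, add_sub_cancel_left]
  have hu1 : ‖u - 1‖ ≤ ‖(p : D)‖ := by
    rw [← one_mul ‖u - 1‖, ← hx, ← norm_mul, hxu, norm_mul]
    exact mul_le_of_le_one_right (norm_nonneg _) (norm_emb_le h.norm_root y)
  have hun : ‖u‖ ≤ 1 := by rw [hu, norm_pow, hx, one_pow]
  have hlim : Tendsto (fun m : ℕ => u ^ p ^ m) atTop (𝓝 1) := by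
    rw [tendsto_iff_norm_sub_tendsto_zero]
    have h1 : Tendsto (fun m : ℕ => ‖(p : D)‖ ^ (m + 1)) atTop (𝓝 0) :=
      (tendsto_pow_atTop_nhds_zero_of_lt_one (norm_nonneg _)
        (norm_natCast_prime_lt_one D p)).comp (tendsto_add_atTop_nat 1)
    refine squeeze_zero (fun _ => norm_nonneg _) (fun m => ?_) h1
    have := norm_pow_pow_sub_le (p := p) (Commute.one_right u) hun norm_one.le hu1 le_rfl
      (norm_natCast_prime_lt_one D p).le m
    rwa [one_pow] at this
  have hK : IsCompact ((fun z => emb p ω x * z) '' Set.range (emb p ω)) :=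
    h.isCompact_range.image (continuous_const.mul continuous_id)
  obtain ⟨_, ⟨z, rfl⟩, hz⟩ := hK.isClosed.mem_of_tendsto hlim (Eventually.of_forall fun m => by
    refine ⟨emb p ω (x ^ ((Q - 1) * p ^ m - 1)), ⟨_, rfl⟩, ?_⟩
    have h2 : 0 < (Q - 1) * p ^ m := Nat.mul_pos (by omega) (pow_pos hp.out.pos m)
    change emb p ω x * _ = _
    rw [map_pow, ← pow_succ', Nat.sub_add_cancel h2, pow_mul])
  exact IsUnit.of_mul_eq_one z (emb_injective ω (by rw [map_mul, map_one]; exact hz))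

lemma norm_lt_one_of_dvd (h : IsTeich q d r ω π) {x : UnrRing p ω} (hx : (p : UnrRing p ω) ∣ x) :
    ‖emb p ω x‖ < 1 := by
  obtain ⟨y, rfl⟩ := hx
  rw [map_mul, map_natCast, norm_mul]
  exact mul_lt_one_of_nonneg_of_lt_one_left (norm_nonneg _) (norm_natCast_prime_lt_one D p)
    (norm_emb_le h.norm_root y)

lemma exists_norm_eq_pow (h : IsTeich (p ^ g) d r ω π) {x : UnrRing p ω} (hx : x ≠ 0) :
    ∃ m : ℕ, ‖emb p ω x‖ = ‖(p : D)‖ ^ m := by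
  have hx0 : emb p ω x ≠ 0 := fun h0 => hx (emb_injective ω (by rw [h0, map_zero]))
  by_contra hcon
  push Not at hcon
  have hp1 := norm_natCast_prime_lt_one D p
  have hp0 : 0 < ‖(p : D)‖ := norm_pos_iff.2 (natCast_prime_ne_zero D p)
  have key : ∀ m : ℕ, ∃ y, x = p ^ m * y := fun m => by
    induction m with
    | zero => exact ⟨x, by simp⟩
    | succ m ih =>
      obtain ⟨y, rfl⟩ := ih
      have h1 := hcon m
      rw [map_mul, map_pow, map_natCast, norm_mul, norm_pow] at h1
      have h2 : ‖emb p ω y‖ < 1 := lt_of_le_of_ne (norm_emb_le h.norm_root y) fun h3 =>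
        h1 (by rw [h3, mul_one])
      obtain ⟨z, rfl⟩ := h.dvd_of_norm_lt_one h2
      exact ⟨z, by ring⟩
  obtain ⟨m, hm⟩ := exists_pow_lt_of_lt_one (norm_pos_iff.2 hx0) hp1
  obtain ⟨y, rfl⟩ := key m
  rw [map_mul, map_pow, map_natCast, norm_mul, norm_pow] at hm
  exact absurd (mul_le_of_le_one_right (pow_nonneg hp0.le m) (norm_emb_le h.norm_root y))
    (not_le.2 hm)

lemma exists_conj (h : IsTeich q d r ω π) (x : UnrRing p ω) :
    ∃ y, emb p ω y = π * emb p ω x * π⁻¹ := by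
  have hω : π * ω * π⁻¹ = ω ^ q ^ r := by rw [h.mul_eq, mul_inv_cancel_right₀ h.ne_zero]
  obtain ⟨f, rfl⟩ := Ideal.Quotient.mk_surjective x
  induction f using Polynomial.induction_on' with
  | add f g hf hg =>
    obtain ⟨y, hy⟩ := hf
    obtain ⟨z, hz⟩ := hg
    exact ⟨y + z, by rw [map_add, hy, hz, map_add, map_add, mul_add, add_mul]⟩
  | monomial n a =>
    refine ⟨Ideal.Quotient.mk _ (C a * (X ^ q ^ r) ^ n), ?_⟩
    rw [emb_mk, emb_mk, aeval_monomial, map_mul, aeval_C, map_pow, map_pow, aeval_X, ← hω,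
      conj_pow₀ h.ne_zero, ← mul_assoc π, ← Algebra.commutes a π]
    simp only [mul_assoc]

/-- Conjugation by `π` as an endomorphism of `ℤ_p[ω]`. -/
noncomputable def conjHom (h : IsTeich q d r ω π) : UnrRing p ω →+* UnrRing p ω where
  toFun x := (h.exists_conj x).choose
  map_one' := emb_injective ω (by
    rw [(h.exists_conj _).choose_spec, map_one, mul_one, mul_inv_cancel₀ h.ne_zero])
  map_zero' := emb_injective ω (by
    rw [(h.exists_conj _).choose_spec, map_zero, mul_zero, zero_mul])
  map_add' x y := emb_injective ω (by
    rw [(h.exists_conj _).choose_spec, map_add, map_add, (h.exists_conj x).choose_spec,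
      (h.exists_conj y).choose_spec, mul_add, add_mul])
  map_mul' x y := emb_injective ω (by
    rw [(h.exists_conj _).choose_spec, map_mul, map_mul, (h.exists_conj x).choose_spec,
      (h.exists_conj y).choose_spec]
    simp only [mul_assoc, inv_mul_cancel_left₀ h.ne_zero])

lemma emb_conjHom (h : IsTeich q d r ω π) (x : UnrRing p ω) :
    emb p ω (h.conjHom x) = π * emb p ω x * π⁻¹ := (h.exists_conj x).choose_spec

lemma emb_conjHom_pow (h : IsTeich q d r ω π) (n : ℕ) (x : UnrRing p ω) :
    emb p ω ((h.conjHom ^ n) x) = π ^ n * emb p ω x * (π ^ n)⁻¹ := by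
  induction n with
  | zero => simp
  | succ n ih =>
    rw [pow_succ']
    change emb p ω (h.conjHom ((h.conjHom ^ n) x)) = _
    rw [emb_conjHom, ih, pow_succ', mul_inv_rev]
    simp only [mul_assoc]

lemma conjHom_pow_eq_one (h : IsTeich q d r ω π) : (h.conjHom (p := p)) ^ d = 1 := by
  refine RingHom.ext fun x => ?_
  apply emb_injective ω
  rw [emb_conjHom_pow, (h.commute_uniformizer_pow _).eq,
    mul_inv_cancel_right₀ (pow_ne_zero d h.ne_zero)]
  rfl

/-- Conjugation by `π` as an automorphism of `ℤ_p[ω]`. -/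
noncomputable def conjAut (h : IsTeich q d r ω π) : RingAut (UnrRing p ω) :=
  RingEquiv.ofRingHom h.conjHom (h.conjHom ^ (d - 1))
    (by
      have := h.conjHom_pow_eq_one (p := p)
      rw [← mul_pow_sub_one h.pos.ne'] at this
      exact this)
    (by
      have := h.conjHom_pow_eq_one (p := p)
      rw [← pow_sub_one_mul h.pos.ne'] at this
      exact this)

lemma emb_conjAut_pow (h : IsTeich q d r ω π) (n : ℕ) (x : UnrRing p ω) :
    emb p ω ((h.conjAut ^ n) x) = π ^ n * emb p ω x * (π ^ n)⁻¹ := by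
  rw [← emb_conjHom_pow h]
  congr 1
  induction n generalizing x with
  | zero => rfl
  | succ n ih => rw [pow_succ, pow_succ, RingAut.mul_apply, ih]; rfl

lemma emb_conjAut_pow_mul (h : IsTeich q d r ω π) (n : ℕ) (x : UnrRing p ω) :
    emb p ω ((h.conjAut ^ n) x) * π ^ n = π ^ n * emb p ω x := by
  rw [emb_conjAut_pow, inv_mul_cancel_right₀ (pow_ne_zero n h.ne_zero)]

lemma conjAut_pow_eq_one (h : IsTeich q d r ω π) : (h.conjAut (p := p)) ^ d = 1 := by
  ext x
  apply emb_injective ω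
  rw [emb_conjAut_pow, (h.commute_uniformizer_pow _).eq,
    mul_inv_cancel_right₀ (pow_ne_zero d h.ne_zero)]
  rfl

lemma emb_conjAut_inv (h : IsTeich q d r ω π) (x : UnrRing p ω) :
    emb p ω (h.conjAut⁻¹ x) = π⁻¹ * emb p ω x * π := by
  obtain ⟨y, rfl⟩ := (h.conjAut (p := p)).surjective x
  have h1 : h.conjAut⁻¹ (h.conjAut y) = y := by
    rw [← RingAut.mul_apply, inv_mul_cancel, RingAut.one_apply]
  have h2 := h.emb_conjAut_pow 1 y
  rw [pow_one, pow_one] at h2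
  rw [h1, h2]
  simp only [mul_assoc, inv_mul_cancel_left₀ h.ne_zero, inv_mul_cancel₀ h.ne_zero, mul_one]

/-- The root of unity `ω` as a unit of `ℤ_p[ω]`. -/
noncomputable def unit (p : ℕ) [Fact p.Prime] [NormedAlgebra ℚ_[p] D] [Algebra ℤ_[p] D]
    [IsScalarTower ℤ_[p] ℚ_[p] D] (h : IsTeich q d r ω π) : (UnrRing p ω)ˣ :=
  Units.ofPowEqOne (gen p ω) (q ^ d - 1) (emb_injective ω (by
    rw [map_pow, emb_gen, h.pow_eq_one, map_one])) h.card_pos.ne'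

lemma emb_unit (h : IsTeich q d r ω π) : emb p ω (h.unit p) = ω := emb_gen ω

lemma isMaximal (h : IsTeich (p ^ g) d r ω π) : (Ideal.span {(p : UnrRing p ω)}).IsMaximal := by
  rw [Ideal.isMaximal_iff]
  refine ⟨fun h1 => ?_, fun J x hJ hx hxJ => ?_⟩
  · have := h.norm_lt_one_of_dvd (Ideal.mem_span_singleton.1 h1)
    rw [map_one, norm_one] at this
    exact lt_irrefl _ this
  · have h1 : ‖emb p ω x‖ = 1 := le_antisymm (norm_emb_le h.norm_root x) (not_lt.1 fun h2 =>
      hx (Ideal.mem_span_singleton.2 (h.dvd_of_norm_lt_one h2)))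
    exact (Ideal.eq_top_of_isUnit_mem J hxJ (h.isUnit_of_norm_eq_one h1)) ▸ Submodule.mem_top

theorem exists_residueData (h : IsTeich (p ^ g) d r ω π) (hf : FrobeniusData p g d r) :
    ∃ (k : Type) (_ : Field k) (ρ : UnrRing p ω →+* k),
      ResidueData p g d r h.conjAut ρ (h.unit p) := by
  have hmax := h.isMaximal
  let k := UnrRing p ω ⧸ Ideal.span {(p : UnrRing p ω)}
  let : Field k := Ideal.Quotient.field _
  let ρ : UnrRing p ω →+* k := Ideal.Quotient.mk _
  have hρ : ∀ x, ρ x = 0 ↔ (p : UnrRing p ω) ∣ x := fun x => by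
    rw [← Ideal.mem_span_singleton]
    exact Ideal.Quotient.eq_zero_iff_mem
  set w := Units.map (ρ : UnrRing p ω →* k) (h.unit p) with hw
  have hwp : ∀ i, w ^ i = 1 ↔ (p ^ g) ^ d - 1 ∣ i := fun i => by
    have h1 : w ^ i = 1 ↔ ρ ((h.unit p : UnrRing p ω) ^ i - 1) = 0 := by
      rw [map_sub, map_one, sub_eq_zero, map_pow, Units.ext_iff]
      rfl
    rw [h1, hρ]
    constructor
    · intro h2
      by_contra hcon
      have h3 := h.norm_lt_one_of_dvd h2
      rw [map_sub, map_pow, emb_unit, map_one, h.norm_sub_one i hcon] at h3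
      exact lt_irrefl _ h3
    · rintro ⟨t, rfl⟩
      have h2 : ((h.unit p : UnrRing p ω)) ^ ((p ^ g) ^ d - 1) = 1 := emb_injective ω (by
        rw [map_pow, emb_unit, h.pow_eq_one, map_one])
      rw [pow_mul, h2, one_pow, sub_self]
      exact dvd_zero _
  have hord : orderOf w = (p ^ g) ^ d - 1 :=
    Nat.dvd_antisymm (orderOf_dvd_of_pow_eq_one ((hwp _).2 dvd_rfl))
      ((hwp _).1 (pow_orderOf_eq_one w))
  have hgen : ∀ y : kˣ, y ∈ Subgroup.zpowers w := fun y => by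
    obtain ⟨x, hx⟩ := Ideal.Quotient.mk_surjective (y : k)
    rcases h.lt_or_exists _ (norm_emb_le h.norm_root x) with h1 | ⟨i, hi⟩
    · exact absurd (((hρ x).2 (h.dvd_of_norm_lt_one h1)).symm.trans hx).symm y.ne_zero
    · refine ⟨i, Units.ext ?_⟩
      have h2 : ρ (x - (h.unit p : UnrRing p ω) ^ i) = 0 :=
        (hρ _).2 (h.dvd_of_norm_lt_one (by rwa [map_sub, map_pow, emb_unit]))
      rw [map_sub, map_pow, sub_eq_zero] at h2
      have h3 : (y : k) = (w : k) ^ i := hx.symm.trans h2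
      simp [h3]
  have hcardu : Nat.card kˣ = (p ^ g) ^ d - 1 := by
    rw [← hord, orderOf_eq_card_of_forall_mem_zpowers hgen]
  have hfinu : Finite kˣ := Nat.finite_of_card_ne_zero (by rw [hcardu]; exact h.card_pos.ne')
  have hfin : Finite k := by
    have : Finite (Option kˣ) := inferInstance
    refine Finite.of_surjective (fun o : Option kˣ => o.elim (0 : k) (fun y => (y : k))) fun y => ?_
    by_cases hy : y = 0
    · exact ⟨none, hy.symm⟩
    · exact ⟨some (Units.mk0 y hy), rfl⟩
  refine ⟨k, inferInstance, ρ, ?_⟩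
  refine
    { hf with
      map_prime := (hρ _).2 dvd_rfl
      dvd_of_map_eq_zero := fun hx => (hρ _).1 hx
      isUnit_of_map_ne_zero := fun {x} hx => h.isUnit_of_norm_eq_one
        (le_antisymm (norm_emb_le h.norm_root x) (not_lt.1 fun h2 =>
          hx ((hρ _).2 (h.dvd_of_norm_lt_one h2))))
      card := ?_
      orderOf_map := hord
      apply_eq := ?_
      pow_eq_one := h.conjAut_pow_eq_one }
  · have := Nat.card_units k
    rw [hcardu] at this
    have h1 : 0 < Nat.card k := Nat.card_pos
    have := h.one_lt_pow
    omega
  · apply emb_injective ω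
    have h1 := h.emb_conjAut_pow (p := p) 1 (h.unit p)
    rw [pow_one, pow_one, emb_unit, h.mul_eq, mul_inv_cancel_right₀ h.ne_zero] at h1
    rw [h1, map_pow, emb_unit]

end IsTeich

end UnramifiedRing

section WeightZeroExpansion

open Finset Filter Topology UnrRing

variable {D : Type u} [NormedDivisionRing D] [IsUltrametricDist D]

lemma exists_norm_sum_eq {ι : Type*} {f : ι → D} {s : Finset ι}
    (hf : ∀ i ∈ s, ∀ j ∈ s, f i ≠ 0 → f j ≠ 0 → ‖f i‖ = ‖f j‖ → i = j) :
    (∀ i ∈ s, f i = 0) ∨ ∃ i ∈ s, ‖∑ j ∈ s, f j‖ = ‖f i‖ ∧ f i ≠ 0 := by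
  classical
  induction s using Finset.induction_on with
  | empty => left; simp
  | insert a s ha ih =>
    rw [sum_insert ha]
    have hf' := ih fun i hi j hj => hf i (mem_insert_of_mem hi) j (mem_insert_of_mem hj)
    by_cases ha0 : f a = 0
    · rw [ha0, zero_add]
      rcases hf' with h1 | ⟨i, hi, h1⟩
      · left
        intro i hi
        rcases mem_insert.1 hi with rfl | hi
        · exact ha0
        · exact h1 i hi
      · exact Or.inr ⟨i, mem_insert_of_mem hi, h1⟩
    · right
      rcases hf' with h1 | ⟨i, hi, h1, h2⟩
      · exact ⟨a, mem_insert_self _ _, by rw [sum_eq_zero h1, add_zero], ha0⟩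
      · have hne : ‖f a‖ ≠ ‖∑ j ∈ s, f j‖ := fun h3 => ha (by
          rw [h1] at h3
          rwa [hf a (mem_insert_self _ _) i (mem_insert_of_mem hi) ha0 h2 h3])
        rw [IsUltrametricDist.norm_add_eq_max_of_norm_ne_norm hne]
        rcases max_choice ‖f a‖ ‖∑ j ∈ s, f j‖ with h3 | h3
        · exact ⟨a, mem_insert_self _ _, h3, ha0⟩
        · exact ⟨i, mem_insert_of_mem hi, h3.trans h1, h2⟩

lemma norm_le_norm_sum {ι : Type*} {f : ι → D} {s : Finset ι}
    (hf : ∀ i ∈ s, ∀ j ∈ s, f i ≠ 0 → f j ≠ 0 → ‖f i‖ = ‖f j‖ → i = j) {i : ι} (hi : i ∈ s) :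
    ‖f i‖ ≤ ‖∑ j ∈ s, f j‖ := by
  classical
  by_cases h0 : f i = 0
  · rw [h0, norm_zero]; exact norm_nonneg _
  rw [← add_sum_erase s f hi]
  rcases exists_norm_sum_eq (f := f) (s := s.erase i) fun j hj k hk =>
    hf j (mem_of_mem_erase hj) k (mem_of_mem_erase hk) with h1 | ⟨j, hj, h1, h2⟩
  · rw [sum_eq_zero h1, add_zero]
  · have hne : ‖f i‖ ≠ ‖∑ j ∈ s.erase i, f j‖ := fun h3 =>
      ne_of_mem_erase hj (hf i hi j (mem_of_mem_erase hj) h0 h2 (h3.trans h1)).symm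
    rw [IsUltrametricDist.norm_add_eq_max_of_norm_ne_norm hne]
    exact le_max_left _ _

variable {p : ℕ} [hp : Fact p.Prime] [NormedAlgebra ℚ_[p] D]
  [Algebra ℤ_[p] D] [IsScalarTower ℤ_[p] ℚ_[p] D]

variable (D) in
lemma norm_natCast_eq {i : ℕ} (hi : i ≠ 0) : ‖(i : D)‖ = ‖(p : D)‖ ^ padicValNat p i := by
  have h1 : ∀ k : ℕ, ‖(k : D)‖ = ‖(k : ℚ_[p])‖ := fun k => by
    rw [← norm_algebraMap' D (k : ℚ_[p]), map_natCast]
  rw [h1, h1, Padic.norm_p, Padic.norm_eq_zpow_neg_valuation (by exact_mod_cast hi),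
    Padic.valuation_natCast, zpow_neg, zpow_natCast, inv_pow]

namespace IsTeich

variable {q d r g e : ℕ} {ω π : D}

/-- The leading coefficient of an element of weight zero. -/
lemma exists_emb_sub_le (h : IsTeich q d r ω π) {w : D} (hw : Commute w ω) {k : ℤ}
    (hwk : ‖w‖ ≤ ‖π‖ ^ (d * k)) :
    ∃ c : UnrRing p ω, ‖w - emb p ω c * π ^ (d * k)‖ ≤ ‖π‖ ^ (d * (k + 1)) := by
  obtain ⟨c, hc, hcu⟩ := h.exists_leading hwk
  obtain ⟨c, rfl⟩ : ∃ c', emb p ω c' = c := by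
    rcases hc with rfl | ⟨i, rfl⟩
    · exact ⟨0, map_zero _⟩
    · exact ⟨gen p ω ^ i, by rw [map_pow, emb_gen]⟩
  refine ⟨c, h.norm_le_of_lt_of_commute
    (hw.sub_left ((emb_commute_root c).mul_left (h.commute_zpow (dvd_mul_right _ _))))
    (hcu.trans_lt ?_)⟩
  exact zpow_lt_zpow_right_of_lt_one₀ h.norm_pos h.norm_lt_one (lt_add_one _)

/-- The integers of weight zero are free over `ℤ_p[ω]` on the powers of `π^d`. -/
lemma exists_sum_emb (h : IsTeich q d r ω π) (he0 : 0 < e) (he : ‖(p : D)‖ = ‖π‖ ^ (d * e))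
    {w : D} (hw : Commute w ω) (hw1 : ‖w‖ ≤ 1) :
    ∃ c : ℕ → UnrRing p ω, w = ∑ i ∈ range e, emb p ω (c i) * π ^ (d * i) := by
  set K : Set D := (fun x : Fin e → D => ∑ i, x i * π ^ (d * (i : ℕ))) ''
    Set.univ.pi fun _ => Set.range (emb p ω) with hK
  have hKc : IsCompact K := (isCompact_univ_pi fun _ => h.isCompact_range).image
    (continuous_finsetSum _ fun i _ => (continuous_apply i).mul continuous_const)
  have hKs : ∀ z : D, z ∈ K ↔ ∃ c : Fin e → UnrRing p ω,
      ∑ i, emb p ω (c i) * π ^ (d * (i : ℕ)) = z := fun z => by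
    constructor
    · rintro ⟨x, hx, rfl⟩
      choose c hc using fun i => hx i (Set.mem_univ i)
      exact ⟨c, by simp only [hc]⟩
    · rintro ⟨c, rfl⟩
      exact ⟨fun i => emb p ω (c i), fun i _ => ⟨c i, rfl⟩, rfl⟩
  have hstep : ∀ k : ℕ, ∃ z ∈ K, Commute z ω ∧ ‖w - z‖ ≤ ‖π‖ ^ (d * (k : ℤ)) := fun k => by
    induction k with
    | zero =>
      exact ⟨0, (hKs 0).2 ⟨0, by simp⟩, Commute.zero_left _, by simpa using hw1⟩
    | succ k ih =>
      obtain ⟨z, hz, hzω, hwz⟩ := ih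
      obtain ⟨x, hx⟩ : ∃ x : D, Commute x ω ∧ x = (p : D) ^ (k / e) * π ^ (d * (k % e)) :=
        ⟨_, ((Nat.cast_commute p ω).pow_left _).mul_left (h.commute_pow (dvd_mul_right _ _)), rfl⟩
      have hxn : ‖x‖ = ‖π‖ ^ (d * (k : ℤ)) := by
        rw [hx.2, norm_mul, norm_pow, norm_pow, he, ← pow_mul, ← pow_add]
        rw [← zpow_natCast]
        congr 1
        have := Nat.div_add_mod k e
        push_cast
        have h2 : (e : ℤ) * ((k / e : ℕ) : ℤ) + ((k % e : ℕ) : ℤ) = k := by exact_mod_cast this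
        push_cast at h2
        linear_combination (d : ℤ) * h2
      have hx0 : x ≠ 0 := by
        rw [← norm_ne_zero_iff, hxn]
        exact (zpow_pos h.norm_pos _).ne'
      have h1 : ‖(w - z) * x⁻¹‖ ≤ ‖π‖ ^ ((d : ℤ) * 0) := by
        rw [norm_mul, norm_inv, hxn, mul_zero, zpow_zero, ← div_eq_mul_inv,
          div_le_one (zpow_pos h.norm_pos _)]
        exact hwz
      obtain ⟨c, hc⟩ := h.exists_emb_sub_le (p := p)
        ((hw.sub_left hzω).mul_left hx.1.inv_left₀) h1
      rw [mul_zero, zpow_zero, mul_one, zero_add, mul_one] at hc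
      have h2 : emb p ω c * x ∈ K := by
        refine (hKs _).2 ⟨Pi.single ⟨k % e, Nat.mod_lt _ he0⟩ (p ^ (k / e) * c), ?_⟩
        rw [sum_eq_single ⟨k % e, Nat.mod_lt _ he0⟩]
        · rw [Pi.single_eq_same, map_mul, map_pow, map_natCast, hx.2, ← mul_assoc (emb p ω c),
            ((Nat.cast_commute p (emb p ω c)).pow_left _).eq]
        · intro j _ hj
          rw [Pi.single_eq_of_ne hj, map_zero, zero_mul]
        · simp
      obtain ⟨c₁, hc₁⟩ := (hKs _).1 hz
      obtain ⟨c₂, hc₂⟩ := (hKs _).1 h2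
      refine ⟨z + emb p ω c * x, (hKs _).2 ⟨c₁ + c₂, ?_⟩,
        hzω.add_left ((emb_commute_root c).mul_left hx.1), ?_⟩
      · rw [← hc₁, ← hc₂, ← sum_add_distrib]
        exact sum_congr rfl fun i _ => by rw [Pi.add_apply, map_add, add_mul]
      · have h3 : w - (z + emb p ω c * x) = ((w - z) * x⁻¹ - emb p ω c) * x := by
          rw [sub_mul, inv_mul_cancel_right₀ hx0, sub_sub]
        rw [h3, norm_mul, hxn]
        calc _ ≤ ‖π‖ ^ (d : ℤ) * ‖π‖ ^ (d * (k : ℤ)) :=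
              mul_le_mul_of_nonneg_right hc (zpow_pos h.norm_pos _).le
          _ = _ := by
            rw [← zpow_add₀ h.norm_pos.ne']
            push_cast
            congr 1
            ring
  choose z hzK _ hwz using hstep
  have hlim : Tendsto z atTop (𝓝 w) := by
    rw [tendsto_iff_norm_sub_tendsto_zero]
    have h1 := h.tendsto_zpow 0
    refine squeeze_zero (fun _ => norm_nonneg _) (fun k => ?_) h1
    rw [norm_sub_rev]
    refine (hwz k).trans (zpow_le_zpow_right_of_le_one₀ h.norm_pos h.norm_lt_one.le ?_)
    rw [zero_add]
    have : (1 : ℤ) ≤ d := by exact_mod_cast h.pos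
    nlinarith [Int.natCast_nonneg k]
  obtain ⟨c, hc⟩ := (hKs w).1 (hKc.isClosed.mem_of_tendsto hlim (Eventually.of_forall hzK))
  refine ⟨fun i => if hi : i < e then c ⟨i, hi⟩ else 0, ?_⟩
  rw [← hc, Finset.sum_range]
  exact sum_congr rfl fun i _ => by simp only [dif_pos i.2]

/-- An equation for `π^d` over `ℤ_p[ω]`, together with a bound for its different. -/
lemma exists_equation (h : IsTeich (p ^ g) d r ω π) (he0 : 0 < e)
    (he : ‖(p : D)‖ = ‖π‖ ^ (d * e)) :
    ∃ c : ℕ → UnrRing p ω, ∑ i ∈ range (e + 1), emb p ω (c i) * π ^ (d * i) = 0 ∧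
      ‖(p : D) ^ (padicValNat p e + 1)‖ ≤
        ‖∑ i ∈ range (e + 1), emb p ω (i * c i) * π ^ (d * i)‖ := by
  obtain ⟨b, hb⟩ := h.exists_sum_emb he0 he (w := π ^ (d * e)) (h.commute_pow (dvd_mul_right _ _))
    (by rw [norm_pow]; exact pow_le_one₀ (norm_nonneg _) h.norm_lt_one.le)
  set c : ℕ → UnrRing p ω := fun i => if i < e then -b i else 1 with hc
  have hce : c e = 1 := if_neg (lt_irrefl e)
  refine ⟨c, ?_, ?_⟩
  · rw [sum_range_succ, hce, map_one, one_mul, hb, ← sum_add_distrib]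
    refine sum_eq_zero fun i hi => ?_
    have : c i = -b i := if_pos (mem_range.1 hi)
    rw [this, map_neg, neg_mul, neg_add_cancel]
  · have hterm : ∀ i, emb p ω (i * c i) * π ^ (d * i) ≠ 0 →
        i ≠ 0 ∧ ∃ t : ℕ, ‖emb p ω (i * c i) * π ^ (d * i)‖ = ‖π‖ ^ (d * (e * t + i)) := by
      intro i hi
      have hi0 : i ≠ 0 := by rintro rfl; simp at hi
      have hci : c i ≠ 0 := by intro h0; simp [h0] at hi
      obtain ⟨m, hm⟩ := h.exists_norm_eq_pow hci
      refine ⟨hi0, padicValNat p i + m, ?_⟩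
      rw [map_mul, map_natCast, norm_mul, norm_mul, norm_natCast_eq D (p := p) hi0, hm, ← pow_add,
        norm_pow, he, ← pow_mul, ← pow_add]
      congr 1
      ring
    have h1 := norm_le_norm_sum (f := fun i : ℕ => emb p ω (i * c i) * π ^ (d * i))
      (s := range (e + 1)) (fun i hi j hj hi0 hj0 hij => by
        obtain ⟨hi1, t, ht⟩ := hterm i hi0
        obtain ⟨hj1, t', ht'⟩ := hterm j hj0
        rw [mem_range] at hi hj
        rw [ht, ht'] at hij
        have h2 := pow_right_injective₀ h.norm_pos h.norm_lt_one.ne hij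
        have h3 := Nat.eq_of_mul_eq_mul_left h.pos h2
        rcases lt_trichotomy t t' with h4 | h4 | h4
        · obtain ⟨k, rfl⟩ := Nat.exists_eq_add_of_lt h4
          have : e ≤ e * (k + 1) := Nat.le_mul_of_pos_right e (Nat.succ_pos k)
          have : e * (t + k + 1) = e * t + e * (k + 1) := by ring
          omega
        · subst h4; omega
        · obtain ⟨k, rfl⟩ := Nat.exists_eq_add_of_lt h4
          have : e ≤ e * (k + 1) := Nat.le_mul_of_pos_right e (Nat.succ_pos k)
          have : e * (t' + k + 1) = e * t' + e * (k + 1) := by ring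
          omega) (i := e) (mem_range.2 (Nat.lt_succ_self e))
    refine le_trans (le_of_eq ?_) h1
    simp only [hce, mul_one, map_natCast]
    rw [norm_mul, norm_natCast_eq D (p := p) he0.ne', norm_pow, norm_pow, pow_succ, he]

end IsTeich

end WeightZeroExpansion

section LevelCocycles

open Finset UnrRing

/-- An additive alternating `2`-cocycle on an additive group of commutators, invariant under
conjugation by `ζ`. -/
structure LevelCocycle {D A : Type*} [DivisionRing D] [AddCommGroup A] (L : AddSubgroup D) (ζ : D)
    (F : D → D → A) : Prop where
  add_left : ∀ {x x' y}, x ∈ L → x' ∈ L → y ∈ L → F (x + x') y = F x y + F x' y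
  antisymm : ∀ {x y}, x ∈ L → y ∈ L → F x y = -F y x
  jacobi : ∀ {x y z}, x ∈ L → y ∈ L → z ∈ L →
    F (x * y - y * x) z + F (y * z - z * y) x + F (z * x - x * z) y = 0
  conj : ∀ {x y}, x ∈ L → y ∈ L → F (ζ * x * ζ⁻¹) (ζ * y * ζ⁻¹) = F x y

namespace LevelCocycle

variable {D A : Type*} [DivisionRing D] [AddCommGroup A] {L : AddSubgroup D} {ζ : D}
  {F : D → D → A}

lemma add_right (hF : LevelCocycle L ζ F) {x y y' : D} (hx : x ∈ L) (hy : y ∈ L) (hy' : y' ∈ L) :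
    F x (y + y') = F x y + F x y' := by
  rw [hF.antisymm hx (add_mem hy hy'), hF.add_left hy hy' hx, hF.antisymm hx hy,
    hF.antisymm hx hy', neg_add]

/-- The map `x ↦ F x y` as a homomorphism. -/
def homLeft (hF : LevelCocycle L ζ F) {y : D} (hy : y ∈ L) : L →+ A :=
  AddMonoidHom.mk' (fun x => F x y) fun x x' => hF.add_left x.2 x'.2 hy

lemma zero_left (hF : LevelCocycle L ζ F) {y : D} (hy : y ∈ L) : F 0 y = 0 :=
  map_zero (hF.homLeft hy)

lemma zero_right (hF : LevelCocycle L ζ F) {y : D} (hy : y ∈ L) : F y 0 = 0 := by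
  rw [hF.antisymm hy (zero_mem _), hF.zero_left hy, neg_zero]

lemma sum_left (hF : LevelCocycle L ζ F) {y : D} (hy : y ∈ L) {ι : Type*} (s : Finset ι)
    (x : ι → D) (hx : ∀ i, x i ∈ L) : F (∑ i ∈ s, x i) y = ∑ i ∈ s, F (x i) y := by
  have := map_sum (hF.homLeft hy) (fun i => (⟨x i, hx i⟩ : L)) s
  simp only [homLeft, AddMonoidHom.mk'_apply, AddSubgroup.val_finsetSum] at this
  exact this

lemma sum_right (hF : LevelCocycle L ζ F) {y : D} (hy : y ∈ L) {ι : Type*} (s : Finset ι)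
    (x : ι → D) (hx : ∀ i, x i ∈ L) : F y (∑ i ∈ s, x i) = ∑ i ∈ s, F y (x i) := by
  rw [hF.antisymm hy (sum_mem fun i _ => hx i), hF.sum_left hy s x hx, ← sum_neg_distrib]
  exact sum_congr rfl fun i _ => (hF.antisymm hy (hx i)).symm

end LevelCocycle

variable {D : Type u} [NormedDivisionRing D] [IsUltrametricDist D]
variable {p : ℕ} [hp : Fact p.Prime] [NormedAlgebra ℚ_[p] D]

/-- The elements of norm at most `ρ` in a subspace `T`. -/
def level (T : Submodule ℚ_[p] D) (ρ : ℝ) : AddSubgroup D where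
  carrier := {x | x ∈ T ∧ ‖x‖ ≤ max ρ 0}
  add_mem' := fun ha hb => ⟨add_mem ha.1 hb.1, norm_add_le_of_le_max ha.2 hb.2⟩
  zero_mem' := ⟨zero_mem _, by rw [norm_zero]; exact le_max_right _ _⟩
  neg_mem' := fun {x} hx => ⟨neg_mem hx.1, by rw [norm_neg]; exact hx.2⟩

lemma mem_level {T : Submodule ℚ_[p] D} {ρ : ℝ} (hρ : 0 ≤ ρ) {x : D} :
    x ∈ level T ρ ↔ x ∈ T ∧ ‖x‖ ≤ ρ := by
  change x ∈ T ∧ ‖x‖ ≤ max ρ 0 ↔ _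
  rw [max_eq_left hρ]

variable [Algebra ℤ_[p] D] [IsScalarTower ℤ_[p] ℚ_[p] D]

/-- A space of elements of trace zero. -/
structure IsTraceSpace (d : ℕ) (ω π : D) (T : Submodule ℚ_[p] D) : Prop where
  lie_mem : ∀ x y : D, x * y - y * x ∈ T
  sum_conj : ∀ w ∈ T, Commute w ω → ∑ i ∈ range d, π ^ i * w * (π ^ i)⁻¹ = 0

namespace IsTeich

variable {q d r g : ℕ} {ω π : D}

lemma emb_mul_mul (h : IsTeich q d r ω π) (w v : UnrRing p ω) (a b : ℕ) :
    emb p ω w * π ^ a * (emb p ω v * π ^ b) =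
      emb p ω (w * (h.conjAut ^ a) v) * π ^ (a + b) := by
  rw [map_mul, pow_add, mul_assoc, ← mul_assoc (π ^ a), ← h.emb_conjAut_pow_mul]
  simp only [mul_assoc]

lemma norm_emb_mul_le (h : IsTeich q d r ω π) (w : UnrRing p ω) (a : ℕ) :
    ‖emb p ω w * π ^ a‖ ≤ ‖π‖ ^ a := by
  rw [norm_mul, norm_pow]
  exact mul_le_of_le_one_left (pow_nonneg (norm_nonneg _) _) (norm_emb_le h.norm_root w)

lemma commute_conj_inv (h : IsTeich q d r ω π) {x : D} (hx : Commute x ω) (i : ℕ) :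
    Commute (π⁻¹ ^ i * x * π ^ i) ω := by
  have h1 := h.pow_mul_root i
  have h0 : π ^ i ≠ 0 := pow_ne_zero i h.ne_zero
  have h2 : (π ^ i)⁻¹ * ω ^ (q ^ r) ^ i = ω * (π ^ i)⁻¹ := by
    rw [← mul_right_inj' h0, mul_inv_cancel_left₀ h0, ← mul_assoc, h1, mul_inv_cancel_right₀ h0]
  rw [commute_iff_eq, inv_pow, mul_assoc, h1, mul_assoc, ← mul_assoc x, (hx.pow_right _).eq,
    ← mul_assoc, ← mul_assoc, h2]
  simp only [mul_assoc]

section Trace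

variable {T : Submodule ℚ_[p] D}

lemma mem_of_mul_root (_ : IsTeich q d r ω π) (hT : IsTraceSpace d ω π T) {x : D} {k : ℕ}
    (hx : x * ω = ω ^ k * x) (hk : ω ^ k ≠ ω) : x ∈ T := by
  have h0 : ω - ω ^ k ≠ 0 := sub_ne_zero.2 hk.symm
  have hc : Commute (ω - ω ^ k)⁻¹ ω :=
    ((Commute.refl ω).sub_left ((Commute.refl ω).pow_left k)).inv_left₀
  have h1 := hT.lie_mem ω ((ω - ω ^ k)⁻¹ * x)
  rwa [← mul_assoc, ← hc.eq, mul_assoc _ x, hx, mul_assoc, ← mul_sub, ← sub_mul,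
    inv_mul_cancel_left₀ h0] at h1

lemma weightZero_mem (h : IsTeich q d r ω π) (hT : IsTraceSpace d ω π T) {u : D} (hu : u ∈ T) :
    weightZero ω (q ^ d - 1) u ∈ T := by
  have h1 : ((q ^ d - 1 : ℕ) : D) = algebraMap ℚ_[p] D ((q ^ d - 1 : ℕ) : ℚ_[p]) := by
    rw [map_natCast]
  rw [weightZero_apply, h1, ← map_inv₀, ← Algebra.smul_def]
  refine T.smul_mem _ (sum_mem fun i _ => ?_)
  have h2 := add_mem (hT.lie_mem (ω ^ i * u) (ω⁻¹ ^ i)) hu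
  rwa [inv_pow, ← mul_assoc, inv_mul_cancel₀ (pow_ne_zero i h.root_ne_zero), one_mul,
    sub_add_cancel, ← inv_pow] at h2

lemma emb_cyclicTrace (h : IsTeich q d r ω π) (w : UnrRing p ω) :
    emb p ω (cyclicTrace h.conjAut d w) = ∑ i ∈ range d, π ^ i * emb p ω w * (π ^ i)⁻¹ := by
  rw [cyclicTrace, map_sum]
  exact sum_congr rfl fun i _ => h.emb_conjAut_pow i w

lemma conjAut_inv_pow (h : IsTeich q d r ω π) (i : ℕ) (x : UnrRing p ω) :
    (((h.conjAut⁻¹ : RingAut (UnrRing p ω)) : UnrRing p ω →+* UnrRing p ω) ^ i) x =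
      ((h.conjAut⁻¹ : RingAut (UnrRing p ω)) ^ i) x := by
  induction i generalizing x with
  | zero => rfl
  | succ i ih => rw [pow_succ, pow_succ, RingAut.mul_apply, ← ih]; rfl

/-- The additive form of Hilbert's theorem 90 for conjugation by `π`. -/
noncomputable def hilbert (h : IsTeich q d r ω π) (y : UnrRing p ω) :
    UnrRing p ω →+ UnrRing p ω :=
  hilbertNinety ((h.conjAut⁻¹ : RingAut (UnrRing p ω)) : UnrRing p ω →+* UnrRing p ω) d y

lemma hilbert_sub (h : IsTeich q d r ω π) {y x : UnrRing p ω}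
    (hy : cyclicTrace h.conjAut d y = 1) (hx : cyclicTrace h.conjAut d x = 0) :
    h.hilbert y x - h.conjAut⁻¹ (h.hilbert y x) = x := by
  refine hilbertNinety_sub_apply (τ := ((h.conjAut⁻¹ : RingAut (UnrRing p ω)) :
    UnrRing p ω →+* UnrRing p ω)) ?_ ?_ ?_
  · simp only [conjAut_inv_pow]
    rw [sum_inv_pow h.conjAut_pow_eq_one, hy]
  · rw [conjAut_inv_pow, inv_pow, h.conjAut_pow_eq_one, inv_one, RingAut.one_apply]
  · simp only [conjAut_inv_pow]
    rw [sum_inv_pow h.conjAut_pow_eq_one, hx]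

lemma emb_conjAut_inv_pow (h : IsTeich q d r ω π) (i : ℕ) (x : UnrRing p ω) :
    emb p ω ((h.conjAut⁻¹ ^ i) x) = π⁻¹ ^ i * emb p ω x * π ^ i := by
  induction i with
  | zero => simp
  | succ i ih =>
    rw [pow_succ', RingAut.mul_apply, emb_conjAut_inv, ih, pow_succ', pow_succ]
    simp only [mul_assoc]

/-- The extension of `hilbert` to `D`. -/
noncomputable def hilbertExt (_ : IsTeich q d r ω π) (y : UnrRing p ω) : D →+ D where
  toFun x := ∑ j ∈ range d, (∑ i ∈ range j, π⁻¹ ^ i * x * π ^ i) * (π⁻¹ ^ j * emb p ω y * π ^ j)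
  map_zero' := by simp
  map_add' x x' := by simp only [mul_add, add_mul, sum_add_distrib]

lemma hilbertExt_apply (h : IsTeich q d r ω π) (y : UnrRing p ω) (x : D) :
    h.hilbertExt y x =
      ∑ j ∈ range d, (∑ i ∈ range j, π⁻¹ ^ i * x * π ^ i) * (π⁻¹ ^ j * emb p ω y * π ^ j) := rfl

lemma hilbertExt_emb (h : IsTeich q d r ω π) (y x : UnrRing p ω) {a : ℕ} (ha : d ∣ a) :
    h.hilbertExt y (emb p ω x * π ^ a) = emb p ω (h.hilbert y x) * π ^ a := by
  have hc : ∀ z, Commute (π ^ a) z := fun z => by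
    have := h.commute_uniformizer_zpow (a := (a : ℤ)) (by exact_mod_cast ha) z
    rwa [zpow_natCast] at this
  set τ := ((h.conjAut⁻¹ : RingAut (UnrRing p ω)) : UnrRing p ω →+* UnrRing p ω)
  have e : h.hilbert y x = ∑ j ∈ range d, (∑ i ∈ range j, (τ ^ i) x) * (τ ^ j) y := rfl
  rw [e, hilbertExt_apply, map_sum, sum_mul]
  refine sum_congr rfl fun j _ => ?_
  have h1 : ∑ i ∈ range j, π⁻¹ ^ i * (emb p ω x * π ^ a) * π ^ i =
      (∑ i ∈ range j, emb p ω ((τ ^ i) x)) * π ^ a := by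
    rw [sum_mul]
    refine sum_congr rfl fun i _ => ?_
    rw [conjAut_inv_pow, emb_conjAut_inv_pow, ← mul_assoc (π⁻¹ ^ i), mul_assoc _ (π ^ a),
      (hc (π ^ i)).eq, mul_assoc, mul_assoc, mul_assoc]
  rw [h1, map_mul, map_sum, conjAut_inv_pow _ j, emb_conjAut_inv_pow, mul_assoc, (hc _).eq,
    ← mul_assoc]

lemma norm_conj_inv (h : IsTeich q d r ω π) (x : D) (i : ℕ) : ‖π⁻¹ ^ i * x * π ^ i‖ = ‖x‖ := by
  rw [norm_mul, norm_mul, norm_pow, norm_inv, norm_pow, inv_pow, mul_comm _ ‖x‖, mul_assoc,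
    inv_mul_cancel₀ (pow_ne_zero _ h.norm_pos.ne'), mul_one]

lemma norm_hilbertExt_le (h : IsTeich q d r ω π) (y : UnrRing p ω) (x : D) :
    ‖h.hilbertExt y x‖ ≤ ‖x‖ := by
  rw [hilbertExt_apply]
  refine norm_sum_le_of_forall (norm_nonneg _) fun j _ => ?_
  rw [norm_mul, h.norm_conj_inv]
  exact (mul_le_of_le_one_right (norm_nonneg _) (norm_emb_le h.norm_root y)).trans
    (norm_sum_le_of_forall (norm_nonneg _) fun i _ => (h.norm_conj_inv x i).le)

lemma commute_sum {x : D} {ι : Type*} {s : Finset ι} {f : ι → D} (hf : ∀ i ∈ s, Commute (f i) x) :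
    Commute (∑ i ∈ s, f i) x := by
  rw [commute_iff_eq, sum_mul, mul_sum]
  exact sum_congr rfl hf

lemma commute_hilbertExt (h : IsTeich q d r ω π) (y : UnrRing p ω) {x : D} (hx : Commute x ω) :
    Commute (h.hilbertExt y x) ω := by
  rw [hilbertExt_apply]
  exact commute_sum fun j _ => (commute_sum fun i _ => h.commute_conj_inv hx i).mul_left
    (h.commute_conj_inv (emb_commute_root y) j)

lemma mul_zpow_mem (h : IsTeich q d r ω π) (hT : IsTraceSpace d ω π T) {Y : D} (hY : Commute Y ω)
    {a : ℤ} (ha : ¬(d : ℤ) ∣ a) : Y * π ^ a ∈ T := by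
  obtain ⟨k, hk, hk'⟩ := h.exists_zpow_mul_root a
  refine h.mem_of_mul_root hT (k := k) ?_ fun h1 => ha (hk'.1 h1)
  rw [mul_assoc, hk, ← mul_assoc, (hY.pow_right k).eq, mul_assoc]

lemma emb_mul_pow_mem (h : IsTeich q d r ω π) (hT : IsTraceSpace d ω π T) {y : UnrRing p ω}
    (hy : cyclicTrace h.conjAut d y = 1) {n a : ℕ} {w : UnrRing p ω}
    (hw : Adm h.conjAut d n a w) : emb p ω w * π ^ a ∈ level T (‖π‖ ^ n) := by
  rw [mem_level (pow_nonneg (norm_nonneg _) _)]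
  refine ⟨?_, (h.norm_emb_mul_le w a).trans
    (pow_le_pow_of_le_one (norm_nonneg _) h.norm_lt_one.le hw.1)⟩
  by_cases ha : d ∣ a
  · have h1 := h.hilbert_sub hy (hw.2 ha)
    set Y := emb p ω (h.hilbert y w) * π ^ a with hY
    have h2 : emb p ω w * π ^ a = π * (π⁻¹ * Y) - π⁻¹ * Y * π := by
      rw [mul_inv_cancel_left₀ h.ne_zero, hY]
      conv_lhs => rw [← h1, map_sub, emb_conjAut_inv, sub_mul]
      simp only [mul_assoc, ((Commute.refl π).pow_right a).eq]
    rw [h2]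
    exact hT.lie_mem _ _
  · rw [← zpow_natCast]
    exact h.mul_zpow_mem hT (emb_commute_root w) (by rwa [Int.natCast_dvd_natCast])

lemma emb_of_conj_fixed (h : IsTeich q d r ω π) (w : UnrRing p ω) :
    h.conjAut (cyclicTrace h.conjAut d w) = cyclicTrace h.conjAut d w := by
  have h1 := cyclicTrace_pow (h.conjAut_pow_eq_one (p := p)) 1 w
  conv_rhs => rw [← h1]
  rw [cyclicTrace, cyclicTrace, map_sum]
  refine sum_congr rfl fun i _ => ?_
  rw [pow_one, ← RingAut.mul_apply, ← RingAut.mul_apply, ← pow_succ, ← pow_succ']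

/-- The leading term of an element of trace zero can be chosen of trace zero. -/
lemma exists_leading_mem (h : IsTeich (p ^ g) d r ω π) (hT : IsTraceSpace d ω π T)
    {y : UnrRing p ω} (hy : cyclicTrace h.conjAut d y = 1) {u : D} (hu : u ∈ T) {a : ℕ}
    (hua : ‖u‖ ≤ ‖π‖ ^ a) :
    ∃ w : UnrRing p ω, (d ∣ a → cyclicTrace h.conjAut d w = 0) ∧
      ‖u - emb p ω w * π ^ a‖ ≤ ‖π‖ ^ (a + 1) := by
  obtain ⟨c, hc, hcu⟩ := h.exists_leading (u := u) (a := (a : ℤ)) (by rwa [zpow_natCast])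
  obtain ⟨c, rfl⟩ : ∃ c', emb p ω c' = c := by
    rcases hc with rfl | ⟨i, rfl⟩
    · exact ⟨0, map_zero _⟩
    · exact ⟨gen p ω ^ i, by rw [map_pow, emb_gen]⟩
  have hcu' : ‖u - emb p ω c * π ^ a‖ ≤ ‖π‖ ^ (a + 1) := by
    rw [zpow_natCast] at hcu
    exact_mod_cast hcu
  by_cases ha : d ∣ a
  swap
  · exact ⟨c, fun h1 => absurd h1 ha, hcu'⟩
  have hca : Commute (emb p ω c * π ^ a) ω := (emb_commute_root c).mul_left (h.commute_pow ha)
  set u₀ := weightZero ω ((p ^ g) ^ d - 1) u with hu₀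
  have h1 := hT.sum_conj u₀ (h.weightZero_mem hT hu) (h.commute_weightZero u)
  have h2 : ‖emb p ω c * π ^ a - u₀‖ ≤ ‖π‖ ^ (a + 1) := by
    have := (h.norm_weightZero_le (u - emb p ω c * π ^ a)).trans hcu'
    rwa [map_sub, h.weightZero_of_commute hca, norm_sub_rev] at this
  set t := cyclicTrace h.conjAut d c with ht
  have h3 : emb p ω t * π ^ a =
      ∑ i ∈ range d, π ^ i * (emb p ω c * π ^ a - u₀) * (π ^ i)⁻¹ := by
    simp only [mul_sub, sub_mul]
    rw [sum_sub_distrib, h1, sub_zero, ht, emb_cyclicTrace, sum_mul]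
    refine sum_congr rfl fun i _ => ?_
    have hc : Commute (π ^ a) (π ^ i)⁻¹ := ((Commute.refl π).pow_pow a i).inv_right₀
    rw [mul_assoc, ← hc.eq]
    simp only [mul_assoc]
  have h4 : ‖emb p ω t * π ^ a‖ ≤ ‖π‖ ^ (a + 1) := by
    rw [h3]
    refine norm_sum_le_of_forall (pow_nonneg (norm_nonneg _) _) fun i _ => ?_
    rw [norm_mul, norm_mul, norm_inv, mul_comm ‖π ^ i‖, mul_assoc, mul_inv_cancel₀, mul_one]
    · exact h2
    · exact norm_ne_zero_iff.2 (pow_ne_zero i h.ne_zero)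
  refine ⟨c - y * t, fun _ => ?_, ?_⟩
  · have hfix : ∀ i, (h.conjAut ^ i) t = t := fun i => by
      induction i with
      | zero => rfl
      | succ i ih => rw [pow_succ, RingAut.mul_apply, ht, h.emb_of_conj_fixed, ← ht, ih]
    have h5 : cyclicTrace h.conjAut d (y * t) = cyclicTrace h.conjAut d y * t := by
      rw [cyclicTrace, cyclicTrace, sum_mul]
      exact sum_congr rfl fun i _ => by rw [map_mul, hfix]
    rw [cyclicTrace_sub, h5, hy, one_mul, ← ht, sub_self]
  · have h5 : u - emb p ω (c - y * t) * π ^ a =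
        (u - emb p ω c * π ^ a) + emb p ω y * (emb p ω t * π ^ a) := by
      rw [map_sub, map_mul, sub_mul, mul_assoc]
      abel
    rw [h5]
    refine norm_add_le_of_le_max hcu' ?_
    rw [norm_mul]
    exact (mul_le_of_le_one_left (norm_nonneg _) (norm_emb_le h.norm_root y)).trans h4

variable {A : Type*} [AddCommGroup A]

/-- An additive map vanishing on homogeneous elements and on `p^s`-multiples vanishes. -/
lemma level_eq_zero (h : IsTeich (p ^ g) d r ω π) (hT : IsTraceSpace d ω π T)
    {y : UnrRing p ω} (hy : cyclicTrace h.conjAut d y = 1) {e s l : ℕ}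
    (he : ‖(p : D)‖ = ‖π‖ ^ (d * e)) (hA : ∀ x : A, p ^ s • x = 0)
    (E : level T (‖π‖ ^ l) →+ A)
    (hE : ∀ a w (hw : Adm h.conjAut d l a w), E ⟨_, h.emb_mul_pow_mem hT hy hw⟩ = 0)
    (u : level T (‖π‖ ^ l)) : E u = 0 := by
  have hpos : ∀ k : ℕ, 0 ≤ ‖π‖ ^ k := pow_nonneg (norm_nonneg _)
  have key : ∀ M : ℕ, ∃ u' : level T (‖π‖ ^ l), ‖(u' : D)‖ ≤ ‖π‖ ^ (l + M) ∧ E u = E u' :=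
    fun M => by
      induction M with
      | zero => exact ⟨u, ((mem_level (hpos l)).1 u.2).2, rfl⟩
      | succ M ih =>
        obtain ⟨u', hu', hE1⟩ := ih
        obtain ⟨w, hw, hwu⟩ := h.exists_leading_mem hT hy ((mem_level (hpos l)).1 u'.2).1 hu'
        have hadm : Adm h.conjAut d l (l + M) w := ⟨Nat.le_add_right l M, hw⟩
        refine ⟨u' - ⟨_, h.emb_mul_pow_mem hT hy hadm⟩, hwu, ?_⟩
        rw [map_sub, hE _ _ hadm, sub_zero, hE1]
  obtain ⟨u', hu', hE1⟩ := key (d * e * s)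
  have hps : (p : D) ^ s ≠ 0 := pow_ne_zero s (natCast_prime_ne_zero D p)
  have hmem : ((p : D) ^ s)⁻¹ * u' ∈ level T (‖π‖ ^ l) := by
    rw [mem_level (hpos l)]
    constructor
    · have h1 : ((p : D) ^ s)⁻¹ = algebraMap ℚ_[p] D ((p : ℚ_[p]) ^ s)⁻¹ := by
        rw [map_inv₀, map_pow, map_natCast]
      rw [h1, ← Algebra.smul_def]
      exact T.smul_mem _ ((mem_level (hpos l)).1 u'.2).1
    · rw [norm_mul, norm_inv, norm_pow, he, ← pow_mul, mul_comm, ← div_eq_mul_inv,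
        div_le_iff₀ (pow_pos h.norm_pos _), ← pow_add]
      exact hu'
  have h2 : u' = p ^ s • (⟨_, hmem⟩ : level T (‖π‖ ^ l)) := by
    apply Subtype.ext
    rw [AddSubgroup.coe_nsmul, nsmul_eq_mul, Nat.cast_pow, mul_inv_cancel_left₀ hps]
  rw [hE1, h2, map_nsmul, hA]

end Trace

end IsTeich

end LevelCocycles

section HomogeneousParts

open Finset UnrRing

variable {D : Type u} [NormedDivisionRing D] [IsUltrametricDist D]
variable {p : ℕ} [hp : Fact p.Prime] [NormedAlgebra ℚ_[p] D]
variable [Algebra ℤ_[p] D] [IsScalarTower ℤ_[p] ℚ_[p] D]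
variable {A : Type*} [AddCommGroup A]

/-- The values of `F` at homogeneous elements. -/
noncomputable def homogeneousPart (ω π : D) (F : D → D → A) (a b : ℕ) (w v : UnrRing p ω) : A :=
  F (emb p ω w * π ^ a) (emb p ω v * π ^ b)

namespace IsTeich

variable {d r g e s n : ℕ} {ω π : D} {T : Submodule ℚ_[p] D} {F : D → D → A}
  {k : Type*} [Field k]

lemma conj_emb_mul_pow (h : IsTeich (p ^ g) d r ω π) (w : UnrRing p ω) (a : ℕ) :
    ω ^ ((p ^ g) ^ r - 1) * (emb p ω w * π ^ a) * (ω ^ ((p ^ g) ^ r - 1))⁻¹ =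
      emb p ω (((ResidueData.chi p g r (h.unit p) a : (UnrRing p ω)ˣ) : UnrRing p ω) * w) * π ^ a := by
  set E := (p ^ g) ^ r - 1
  set B := ((p ^ g) ^ r) ^ a with hB
  have h0 := h.root_ne_zero
  have hpow : ∀ j : ℕ, π ^ a * ω ^ j = (ω ^ j) ^ B * π ^ a := fun j => by
    induction j with
    | zero => simp
    | succ j ih =>
      rw [pow_succ, ← mul_assoc, ih, mul_assoc, h.pow_mul_root, ← hB, ← mul_assoc,
        ((Commute.refl ω).pow_left j).mul_pow]
  have h1 : π ^ a * (ω ^ E)⁻¹ = ((ω ^ E) ^ B)⁻¹ * π ^ a := by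
    rw [mul_inv_eq_iff_eq_mul₀ (pow_ne_zero _ h0), mul_assoc, hpow, inv_mul_cancel_left₀]
    exact pow_ne_zero _ (pow_ne_zero _ h0)
  have h2 : emb p ω (ResidueData.chi p g r (h.unit p) a : (UnrRing p ω)ˣ) =
      ω ^ E * ((ω ^ E) ^ B)⁻¹ := by
    have h3 : (ResidueData.chi p g r (h.unit p) a) * ((h.unit p) ^ E) ^ B = h.unit p ^ E := by
      rw [ResidueData.chi, div_mul_cancel]
    have h4 := congrArg (fun u : (UnrRing p ω)ˣ => emb p ω u) h3
    simp only [Units.val_mul, Units.val_pow_eq_pow_val, map_mul, map_pow, emb_unit] at h4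
    exact (eq_mul_inv_iff_mul_eq₀ (pow_ne_zero _ (pow_ne_zero _ h0))).2 h4
  have hc : Commute (emb p ω w) ((ω ^ E) ^ B)⁻¹ :=
    (((emb_commute_root w).pow_right E).pow_right B).inv_right₀
  rw [map_mul, h2, mul_assoc, mul_assoc, h1, ← mul_assoc (emb p ω w), hc.eq]
  simp only [mul_assoc]

variable {ρ : UnrRing p ω →+* k} {y : UnrRing p ω}

lemma homogeneousPart_conj (h : IsTeich (p ^ g) d r ω π) (hT : IsTraceSpace d ω π T)
    (hy : cyclicTrace h.conjAut d y = 1)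
    (hF : LevelCocycle (level T (‖π‖ ^ n)) (ω ^ ((p ^ g) ^ r - 1)) F) {a b : ℕ}
    {w v : UnrRing p ω} (hw : Adm h.conjAut d n a w) (hv : Adm h.conjAut d n b v) :
    homogeneousPart ω π F a b (((ResidueData.chi p g r (h.unit p) a : (UnrRing p ω)ˣ) : UnrRing p ω) * w)
      (((ResidueData.chi p g r (h.unit p) b : (UnrRing p ω)ˣ) : UnrRing p ω) * v) =
        homogeneousPart ω π F a b w v := by
  have := hF.conj (h.emb_mul_pow_mem hT hy hw) (h.emb_mul_pow_mem hT hy hv)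
  rwa [h.conj_emb_mul_pow, h.conj_emb_mul_pow] at this

lemma homogeneousPart_add_left (h : IsTeich (p ^ g) d r ω π) (hT : IsTraceSpace d ω π T)
    (hy : cyclicTrace h.conjAut d y = 1) {ζ : D}
    (hF : LevelCocycle (level T (‖π‖ ^ n)) ζ F) {a b : ℕ}
    {w w' v : UnrRing p ω} (hw : Adm h.conjAut d n a w) (hw' : Adm h.conjAut d n a w')
    (hv : Adm h.conjAut d n b v) : homogeneousPart ω π F a b (w + w') v =
      homogeneousPart ω π F a b w v + homogeneousPart ω π F a b w' v := by
  have := hF.add_left (h.emb_mul_pow_mem hT hy hw) (h.emb_mul_pow_mem hT hy hw')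
    (h.emb_mul_pow_mem hT hy hv)
  rwa [← add_mul, ← map_add] at this

lemma homogeneousPart_add_right (h : IsTeich (p ^ g) d r ω π) (hT : IsTraceSpace d ω π T)
    (hy : cyclicTrace h.conjAut d y = 1) {ζ : D}
    (hF : LevelCocycle (level T (‖π‖ ^ n)) ζ F) {a b : ℕ}
    {w w' v : UnrRing p ω} (hw : Adm h.conjAut d n a w) (hw' : Adm h.conjAut d n a w')
    (hv : Adm h.conjAut d n b v) : homogeneousPart ω π F b a v (w + w') =
      homogeneousPart ω π F b a v w + homogeneousPart ω π F b a v w' := by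
  have := hF.add_right (h.emb_mul_pow_mem hT hy hv) (h.emb_mul_pow_mem hT hy hw)
    (h.emb_mul_pow_mem hT hy hw')
  rwa [← add_mul, ← map_add] at this

/-- The pairing between two weight spaces of nonzero weight. -/
noncomputable def weightPairing (h : IsTeich (p ^ g) d r ω π) (hT : IsTraceSpace d ω π T)
    (hy : cyclicTrace h.conjAut d y = 1) {ζ : D}
    (hF : LevelCocycle (level T (‖π‖ ^ n)) ζ F) {a b : ℕ} (ha : n ≤ a) (hb : n ≤ b)
    (had : ¬d ∣ a) (hbd : ¬d ∣ b) : UnrRing p ω →+ UnrRing p ω →+ A :=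
  AddMonoidHom.mk' (fun w => AddMonoidHom.mk' (fun v => homogeneousPart ω π F a b w v)
      fun _ _ => h.homogeneousPart_add_right hT hy hF ⟨hb, fun h' => absurd h' hbd⟩
        ⟨hb, fun h' => absurd h' hbd⟩ ⟨ha, fun h' => absurd h' had⟩)
    fun _ _ => AddMonoidHom.ext fun _ => h.homogeneousPart_add_left hT hy hF
      ⟨ha, fun h' => absurd h' had⟩ ⟨ha, fun h' => absurd h' had⟩ ⟨hb, fun h' => absurd h' hbd⟩

theorem gradedCocycle (h : IsTeich (p ^ g) d r ω π)
    (R : ResidueData p g d r h.conjAut ρ (h.unit p)) (hT : IsTraceSpace d ω π T)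
    (hy : cyclicTrace h.conjAut d y = 1) (hA : ∀ x : A, p ^ s • x = 0)
    (hF : LevelCocycle (level T (‖π‖ ^ n)) (ω ^ ((p ^ g) ^ r - 1)) F) :
    GradedCocycle h.conjAut d n (homogeneousPart (p := p) ω π F) := by
  have hanti : ∀ {a b} {w v : UnrRing p ω}, Adm h.conjAut d n a w → Adm h.conjAut d n b v →
      homogeneousPart ω π F a b w v = -homogeneousPart ω π F b a v w := fun hw hv =>
    hF.antisymm (h.emb_mul_pow_mem hT hy hw) (h.emb_mul_pow_mem hT hy hv)
  have hzero : ∀ {a b} {w v : UnrRing p ω}, Adm h.conjAut d n a w → Adm h.conjAut d n b v →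
      d ∣ a → ¬d ∣ b → homogeneousPart ω π F a b w v = 0 := by
    intro a b w v hw hv had hbd
    have hadm : ∀ v : UnrRing p ω, Adm h.conjAut d n b v := fun v =>
      ⟨hv.1, fun h' => absurd h' hbd⟩
    obtain ⟨c, hc⟩ := R.isUnit_chi_sub_one hbd
    have key : ∀ v', homogeneousPart ω π F a b w ((c : UnrRing p ω) * v') = 0 := fun v' => by
      have h1 := h.homogeneousPart_conj hT hy hF hw (hadm v')
      rw [R.chi_of_dvd had, Units.val_one, one_mul] at h1
      have h2 := h.homogeneousPart_add_right hT hy hF (hadm ((c : UnrRing p ω) * v')) (hadm v') hw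
      rw [hc, sub_mul, one_mul, sub_add_cancel, h1, right_eq_add] at h2
      rw [hc, sub_mul, one_mul]
      exact h2
    have := key (↑c⁻¹ * v)
    rwa [← mul_assoc, c.mul_inv, one_mul] at this
  refine
    { pow_eq_one := h.conjAut_pow_eq_one
      add_left := fun hw hw' hv => h.homogeneousPart_add_left hT hy hF hw hw' hv
      antisymm := hanti
      jacobi := fun {a b c u v w} hu hv hw => ?_
      eq_zero := fun {a b w v} hw hv hab => ?_
      balanced := fun {a b w v} c ha hb had hab => ?_ }
  · have := hF.jacobi (h.emb_mul_pow_mem hT hy hu) (h.emb_mul_pow_mem hT hy hv)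
      (h.emb_mul_pow_mem hT hy hw)
    simp only [h.emb_mul_mul] at this
    rw [add_comm b a, add_comm c b, add_comm a c, ← sub_mul, ← sub_mul, ← sub_mul, ← map_sub,
      ← map_sub, ← map_sub] at this
    exact this
  · by_cases had : d ∣ a
    · exact hzero hw hv had fun hbd => hab (dvd_add had hbd)
    · by_cases hbd : d ∣ b
      · rw [hanti hw hv, hzero hv hw hbd had, neg_zero]
      · have := R.bilinear_eq_zero hA had hbd hab
          (β := h.weightPairing hT hy hF hw.1 hv.1 had hbd) fun w v =>
            h.homogeneousPart_conj hT hy hF ⟨hw.1, fun h' => absurd h' had⟩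
              ⟨hv.1, fun h' => absurd h' hbd⟩
        exact DFunLike.congr_fun (DFunLike.congr_fun this w) v
  · have hbd : ¬d ∣ b := GradedCocycle.not_dvd_right had hab
    exact R.bilinear_balanced hA had hab (β := h.weightPairing hT hy hF ha hb had hbd)
      (fun w v => h.homogeneousPart_conj hT hy hF ⟨ha, fun h' => absurd h' had⟩
        ⟨hb, fun h' => absurd h' hbd⟩) c w v

section Defect

variable {m₀ : ℕ}

/-- The failure of `F` to depend only on the total degree. -/
noncomputable def defect (ω π : D) (F : D → D → A) (d n S : ℕ) (z : UnrRing p ω) : A :=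
  homogeneousPart ω π F (n + d) (S - (n + d)) z 1 - homogeneousPart ω π F n (S - n) z 1

lemma not_dvd_of_add_eq (hd : 2 ≤ d) (hn : n + d = d * m₀ + 1) {a α : ℕ} (ha : a = n + d * α) :
    ¬d ∣ a := by
  rw [ha]
  intro h1
  have h2 : d ∣ n := (Nat.dvd_add_left (dvd_mul_right d α)).1 h1
  have h3 : d ∣ d * m₀ + 1 := hn ▸ dvd_add h2 dvd_rfl
  have h4 : d ∣ 1 := (Nat.dvd_add_right (dvd_mul_right d m₀)).1 h3
  have := Nat.le_of_dvd one_pos h4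
  omega

lemma succ_sub_eq_defect (h : IsTeich (p ^ g) d r ω π)
    (R : ResidueData p g d r h.conjAut ρ (h.unit p))
    (hG : GradedCocycle h.conjAut d n (homogeneousPart (p := p) ω π F))
    (hn : n + d = d * m₀ + 1) {S : ℕ} (hS : d ∣ S) (hS₀ : 2 * n + 2 * (d * m₀) ≤ S) {α : ℕ}
    (hα : n + d * (α + 1) + n ≤ S) (z : UnrRing p ω) :
    homogeneousPart ω π F (n + d * (α + 1)) (S - (n + d * (α + 1))) z 1 -
      homogeneousPart ω π F (n + d * α) (S - (n + d * α)) z 1 = defect ω π F d n S z := by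
  have hd := R.two_le
  have hn1 : ¬d ∣ 1 := fun h1 => by have := Nat.le_of_dvd one_pos h1; omega
  have h1 := hG.succ_sub_const hd hn (by
      obtain ⟨x, hx, hu⟩ := R.exists_unit hn1
      rw [pow_one] at hu
      exact ⟨x, hx, hu⟩) hS hS₀ hα (β := 0) (by omega) z
  rw [h1, defect, mul_zero, zero_add, add_zero, mul_one]

lemma sub_eq_nsmul_defect (h : IsTeich (p ^ g) d r ω π)
    (R : ResidueData p g d r h.conjAut ρ (h.unit p))
    (hG : GradedCocycle h.conjAut d n (homogeneousPart (p := p) ω π F))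
    (hn : n + d = d * m₀ + 1) {S : ℕ} (hS : d ∣ S) (hS₀ : 2 * n + 2 * (d * m₀) ≤ S) {α : ℕ}
    (hα : n + d * α + n ≤ S) (z : UnrRing p ω) :
    homogeneousPart ω π F (n + d * α) (S - (n + d * α)) z 1 -
      homogeneousPart ω π F n (S - n) z 1 = α • defect ω π F d n S z := by
  induction α with
  | zero => simp
  | succ α ih =>
    rw [succ_nsmul, ← ih (by rw [mul_add] at hα; omega),
      ← h.succ_sub_eq_defect R hG hn hS hS₀ hα]
    abel

/-- An equation for `π^d` gives relations between the defects in different degrees. -/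
lemma sum_nsmul_defect (h : IsTeich (p ^ g) d r ω π)
    (R : ResidueData p g d r h.conjAut ρ (h.unit p)) (hT : IsTraceSpace d ω π T)
    (hy : cyclicTrace h.conjAut d y = 1) {ζ : D}
    (hF : LevelCocycle (level T (‖π‖ ^ n)) ζ F)
    (hG : GradedCocycle h.conjAut d n (homogeneousPart (p := p) ω π F))
    (hn : n + d = d * m₀ + 1) {S : ℕ} (hS : d ∣ S) (hS₀ : 2 * n + 2 * (d * m₀) ≤ S)
    {c : ℕ → UnrRing p ω} (hc : ∑ i ∈ range (e + 1), emb p ω (c i) * π ^ (d * i) = 0)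
    (z : UnrRing p ω) :
    ∑ i ∈ range (e + 1), i • defect ω π F d n (S + d * i) (c i * z) = 0 := by
  have hd := R.two_le
  have hnd : ∀ i, ¬d ∣ n + d * i := fun i => not_dvd_of_add_eq hd hn rfl
  have hn0 : ¬d ∣ n := by simpa using hnd 0
  have hSn : d ∣ n + (S - n) := by rwa [Nat.add_sub_cancel' (by omega)]
  have hbd : ¬d ∣ S - n := GradedCocycle.not_dvd_right hn0 hSn
  have hbd' : ∀ i, ¬d ∣ S - n + d * i := fun i h1 =>
    hbd ((Nat.dvd_add_left (dvd_mul_right d i)).1 h1)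
  have hmem : ∀ {a : ℕ} (w : UnrRing p ω), n ≤ a → ¬d ∣ a →
      emb p ω w * π ^ a ∈ level T (‖π‖ ^ n) := fun w ha had =>
    h.emb_mul_pow_mem hT hy ⟨ha, fun h' => absurd h' had⟩
  have h1 : ∀ i ∈ range (e + 1), i • defect ω π F d n (S + d * i) (c i * z) =
      homogeneousPart ω π F (n + d * i) (S - n) (c i * z) 1 -
        homogeneousPart ω π F n (S - n + d * i) (c i * z) 1 := fun i _ => by
    rw [← h.sub_eq_nsmul_defect R hG hn (hS.add (dvd_mul_right d i)) (by omega) (by omega)]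
    congr 2 <;> omega
  rw [sum_congr rfl h1, sum_sub_distrib]
  have h2 : ∑ i ∈ range (e + 1), homogeneousPart ω π F (n + d * i) (S - n) (c i * z) 1 = 0 := by
    simp only [homogeneousPart]
    rw [← hF.sum_left (hmem 1 (by omega) hbd) _ _ fun i => hmem _ (by omega) (hnd i)]
    have h3 : ∑ i ∈ range (e + 1), emb p ω (c i * z) * π ^ (n + d * i) =
        (∑ i ∈ range (e + 1), emb p ω (c i) * π ^ (d * i)) * (emb p ω z * π ^ n) := by
      rw [sum_mul]
      refine sum_congr rfl fun i _ => ?_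
      have hcm := h.commute_uniformizer_zpow (a := ((d * i : ℕ) : ℤ))
        (by exact_mod_cast dvd_mul_right d i) (emb p ω z * π ^ n)
      rw [zpow_natCast] at hcm
      rw [mul_assoc, hcm.eq, map_mul, pow_add]
      simp only [mul_assoc]
    rw [h3, hc, zero_mul, hF.zero_left (hmem 1 (by omega) hbd)]
  have h4 : ∑ i ∈ range (e + 1), homogeneousPart ω π F n (S - n + d * i) (c i * z) 1 = 0 := by
    have h5 : ∀ i ∈ range (e + 1), homogeneousPart ω π F n (S - n + d * i) (c i * z) 1 =
        F (emb p ω z * π ^ n) (π ^ (S - n) * (emb p ω (c i) * π ^ (d * i))) := fun i _ => by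
      rw [hG.balanced (c i) le_rfl (by omega) hn0 (by
        rw [← add_assoc]; exact hSn.add (dvd_mul_right d i)), mul_one, homogeneousPart,
        h.emb_conjAut_pow_mul, pow_add, mul_assoc]
      congr 2
      have hcm := h.commute_uniformizer_zpow (a := ((d * i : ℕ) : ℤ))
        (by exact_mod_cast dvd_mul_right d i) (emb p ω (c i))
      rw [zpow_natCast] at hcm
      exact hcm.eq
    rw [sum_congr rfl h5, ← hF.sum_right (hmem z le_rfl hn0) _ _ fun i => ?_]
    · rw [← mul_sum, hc, mul_zero, hF.zero_right (hmem z le_rfl hn0)]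
    · rw [← mul_assoc, ← h.emb_conjAut_pow_mul, mul_assoc, ← pow_add]
      exact hmem _ (by omega) (hbd' i)
  rw [h2, h4, sub_zero]

/-- The defect as a function on the elements of weight zero. -/
lemma exists_defect_extension (h : IsTeich (p ^ g) d r ω π)
    (R : ResidueData p g d r h.conjAut ρ (h.unit p)) (hT : IsTraceSpace d ω π T)
    {ζ : D} (hF : LevelCocycle (level T (‖π‖ ^ n)) ζ F)
    (hG : GradedCocycle h.conjAut d n (homogeneousPart (p := p) ω π F))
    (hn : n + d = d * m₀ + 1) {S : ℕ} (hS : d ∣ S) (hS₀ : 2 * n + 2 * (d * m₀) ≤ S) :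
    ∃ Z : D → A, (∀ X Y, Commute X ω → Commute Y ω → ‖X‖ ≤ ‖π‖ ^ S → ‖Y‖ ≤ ‖π‖ ^ S →
        Z (X + Y) = Z X + Z Y) ∧
      ∀ i z, Z (emb p ω z * π ^ (S + d * i)) = defect ω π F d n (S + d * i) z := by
  have hd := R.two_le
  have hnd : ∀ i, ¬d ∣ n + d * i := fun i => not_dvd_of_add_eq hd hn rfl
  have hn0 : ¬d ∣ n := by simpa using hnd 0
  have hm₀ : d ≤ d * m₀ := by
    rcases Nat.eq_zero_or_pos m₀ with rfl | h1
    · omega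
    · exact Nat.le_mul_of_pos_right d h1
  have hb : n ≤ S - (n + d) := by omega
  have hpn : 0 ≤ ‖π‖ ^ n := pow_nonneg (norm_nonneg _) _
  have hSnd : d ∣ n + d + (S - (n + d)) := by rwa [Nat.add_sub_cancel' (by omega)]
  have hnd1 : ¬d ∣ n + d := by simpa using hnd 1
  have hbd : ¬d ∣ S - (n + d) := GradedCocycle.not_dvd_right hnd1 hSnd
  have hbd' : ¬d ∣ S - n := fun h1 => hn0 (by
    have h2 : d ∣ (S - n) + n := by rwa [Nat.sub_add_cancel (by omega)]
    exact (Nat.dvd_add_right h1).1 h2)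
  have hmemb : ∀ {b : ℕ}, n ≤ b → ¬d ∣ b → π ^ b ∈ level T (‖π‖ ^ n) := fun {b} hb hbd => by
    rw [mem_level hpn]
    refine ⟨?_, by rw [norm_pow]; exact pow_le_pow_of_le_one (norm_nonneg _) h.norm_lt_one.le hb⟩
    have := h.mul_zpow_mem hT (Commute.one_left ω) (a := (b : ℤ)) (by rwa [Int.natCast_dvd_natCast])
    rwa [one_mul, zpow_natCast] at this
  have hmemY : ∀ {b : ℕ} {Y : D}, Commute Y ω → ‖Y‖ ≤ ‖π‖ ^ S → b + n ≤ S → ¬d ∣ b →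
      Y * π ^ (-(b : ℤ)) ∈ level T (‖π‖ ^ n) := fun {b Y} hY hYn hb hbd => by
    rw [mem_level hpn]
    refine ⟨h.mul_zpow_mem hT hY (by rwa [dvd_neg, Int.natCast_dvd_natCast]), ?_⟩
    rw [norm_mul, norm_zpow, zpow_neg, zpow_natCast, ← div_eq_mul_inv,
      div_le_iff₀ (pow_pos h.norm_pos _), ← pow_add]
    exact hYn.trans (pow_le_pow_of_le_one (norm_nonneg _) h.norm_lt_one.le (by omega))
  refine ⟨fun Y => F (Y * π ^ (-((S - (n + d) : ℕ) : ℤ))) (π ^ (S - (n + d))) -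
    F (Y * π ^ (-((S - n : ℕ) : ℤ))) (π ^ (S - n)), ?_, ?_⟩
  · intro X Y hX hY hXn hYn
    dsimp only
    rw [add_mul, add_mul, hF.add_left (hmemY hX hXn (by omega) hbd) (hmemY hY hYn (by omega) hbd)
      (hmemb hb hbd), hF.add_left (hmemY hX hXn (by omega) hbd') (hmemY hY hYn (by omega) hbd')
      (hmemb (by omega) hbd')]
    abel
  · intro i z
    have h1 := h.succ_sub_eq_defect R hG hn (hS.add (dvd_mul_right d i)) (by omega) (α := i)
      (by rw [mul_add]; omega) z
    rw [← h1]
    have hpow : ∀ b : ℕ, b ≤ S → emb p ω z * π ^ (S + d * i) * π ^ (-(b : ℤ)) =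
        emb p ω z * π ^ (S + d * i - b) := fun b hb => by
      rw [mul_assoc, ← zpow_natCast, ← zpow_natCast, ← zpow_add₀ h.ne_zero]
      congr 2
      omega
    simp only [homogeneousPart, map_one, one_mul]
    have e0 : n + d * (i + 1) = n + d + d * i := by rw [mul_add]; omega
    have e1 : S + d * i - (S - (n + d)) = n + d + d * i := by omega
    have e2 : S + d * i - (n + d + d * i) = S - (n + d) := by omega
    have e3 : S + d * i - (S - n) = n + d * i := by omega
    have e4 : S + d * i - (n + d * i) = S - n := by omega
    rw [hpow _ (by omega), hpow _ (by omega), e0, e1, e2, e3, e4]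

/-- The defect is killed by a multiple of the different. -/
lemma nsmul_defect_eq_zero (h : IsTeich (p ^ g) d r ω π)
    (R : ResidueData p g d r h.conjAut ρ (h.unit p)) (hT : IsTraceSpace d ω π T)
    (hy : cyclicTrace h.conjAut d y = 1) {ζ : D} (hA : ∀ x : A, p ^ s • x = 0)
    (hF : LevelCocycle (level T (‖π‖ ^ n)) ζ F)
    (hG : GradedCocycle h.conjAut d n (homogeneousPart (p := p) ω π F))
    (hn : n + d = d * m₀ + 1) (he0 : 0 < e) (he : ‖(p : D)‖ = ‖π‖ ^ (d * e)) {S : ℕ} (hS : d ∣ S)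
    (hS₀ : 2 * n + 2 * (d * m₀) ≤ S) (z : UnrRing p ω) :
    p ^ (padicValNat p e + 1) • defect ω π F d n S z = 0 := by
  obtain ⟨c, hc, hcn⟩ := h.exists_equation (p := p) he0 he
  obtain ⟨Z, hZadd, hZ⟩ := h.exists_defect_extension R hT hF hG hn hS hS₀
  set X : D := ∑ i ∈ range (e + 1), emb p ω (i * c i) * π ^ (d * i) with hX
  have hpj : (p : D) ^ (padicValNat p e + 1) ≠ 0 := pow_ne_zero _ (natCast_prime_ne_zero D p)
  have hX0 : X ≠ 0 := by
    rw [← norm_ne_zero_iff]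
    exact ((norm_pos_iff.2 hpj).trans_le hcn).ne'
  have hcomm : ∀ i, Commute (π ^ (d * i)) ω := fun i => h.commute_pow (dvd_mul_right _ _)
  have hXω : Commute X ω := commute_sum fun i _ => (emb_commute_root _).mul_left (hcomm i)
  have hX1 : ‖X‖ ≤ 1 := norm_sum_le_of_forall zero_le_one fun i _ =>
    (h.norm_emb_mul_le _ _).trans (pow_le_one₀ (norm_nonneg _) h.norm_lt_one.le)
  let W : AddSubgroup D :=
    { carrier := {Y | Commute Y ω ∧ ‖Y‖ ≤ ‖π‖ ^ S}
      add_mem' := fun ha hb => ⟨ha.1.add_left hb.1, norm_add_le_of_le_max ha.2 hb.2⟩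
      zero_mem' := ⟨Commute.zero_left _, by
        rw [norm_zero]; exact pow_nonneg (norm_nonneg _) _⟩
      neg_mem' := fun {x} ha => ⟨ha.1.neg_left, by rw [norm_neg]; exact ha.2⟩ }
  have hWm : ∀ {Y}, Y ∈ W ↔ Commute Y ω ∧ ‖Y‖ ≤ ‖π‖ ^ S := Iff.rfl
  let ZW : W →+ A := AddMonoidHom.mk' (fun Y => Z Y) fun a b => hZadd _ _ a.2.1 b.2.1 a.2.2 b.2.2
  have hZW : ∀ Y (hY : Y ∈ W), ZW ⟨Y, hY⟩ = Z Y := fun _ _ => rfl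
  have hXmem : ∀ {Y}, Y ∈ W → X * Y ∈ W := fun {Y} hY =>
    ⟨hXω.mul_left hY.1, by
      rw [norm_mul]; exact (mul_le_of_le_one_left (norm_nonneg _) hX1).trans hY.2⟩
  have hemb : ∀ i (z : UnrRing p ω), emb p ω z * π ^ (S + d * i) ∈ W := fun i z =>
    ⟨(emb_commute_root z).mul_left (h.commute_pow (hS.add (dvd_mul_right _ _))),
      (h.norm_emb_mul_le _ _).trans
        (pow_le_pow_of_le_one (norm_nonneg _) h.norm_lt_one.le (Nat.le_add_right _ _))⟩
  have hXemb : ∀ j (z : UnrRing p ω), Z (X * (emb p ω z * π ^ (S + d * j))) = 0 := by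
    intro j z
    have h1 := h.sum_nsmul_defect R hT hy hF hG hn (hS.add (dvd_mul_right d j)) (by omega) hc z
    have h2 : X * (emb p ω z * π ^ (S + d * j)) =
        ∑ i ∈ range (e + 1), i • (emb p ω (c i * z) * π ^ (S + d * (j + i))) := by
      rw [hX, sum_mul]
      refine sum_congr rfl fun i _ => ?_
      have hcm := h.commute_uniformizer_zpow (a := ((d * i : ℕ) : ℤ))
        (by exact_mod_cast dvd_mul_right d i) (emb p ω z * π ^ (S + d * j))
      rw [zpow_natCast] at hcm
      rw [mul_assoc, hcm.eq, map_mul, map_natCast, nsmul_eq_mul, map_mul, mul_add, ← add_assoc,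
        pow_add _ (S + d * j)]
      simp only [mul_assoc]
    have h3 := map_sum ZW (fun i => i • (⟨_, hemb (j + i) (c i * z)⟩ : W)) (range (e + 1))
    have h4 : ∑ i ∈ range (e + 1), i • (⟨_, hemb (j + i) (c i * z)⟩ : W) =
        ⟨_, hXmem (hemb j z)⟩ := Subtype.ext (by
      rw [AddSubgroup.val_finsetSum]
      exact (sum_congr rfl fun i _ => rfl).trans h2.symm)
    rw [h4, hZW] at h3
    rw [h3, ← h1]
    refine sum_congr rfl fun i _ => ?_
    rw [map_nsmul, hZW, hZ, mul_add, ← add_assoc]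
  have hXW : ∀ Y (hY : Y ∈ W), Z (X * Y) = 0 := by
    intro Y hY
    obtain ⟨S', rfl⟩ := hS
    have key : ∀ M : ℕ, ∃ Y' ∈ W, ‖Y'‖ ≤ ‖π‖ ^ (d * S' + d * M) ∧ Z (X * Y) = Z (X * Y') :=
      fun M => by
        induction M with
        | zero => exact ⟨Y, hY, hY.2, rfl⟩
        | succ M ih =>
          obtain ⟨Y', hY', hYn, hE⟩ := ih
          obtain ⟨z, hz⟩ := h.exists_emb_sub_le (p := p) hY'.1 (k := ((S' + M : ℕ) : ℤ)) (by
            rw [← Nat.cast_mul, zpow_natCast, mul_add]; exact hYn)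
          rw [← Nat.cast_mul, zpow_natCast, mul_add] at hz
          have hz' : ‖Y' - emb p ω z * π ^ (d * S' + d * M)‖ ≤ ‖π‖ ^ (d * S' + d * (M + 1)) := by
            refine hz.trans (le_of_eq ?_)
            rw [← zpow_natCast]
            congr 1
            push_cast
            ring
          have hmem := W.sub_mem hY' (hemb M z)
          refine ⟨_, hmem, hz', ?_⟩
          rw [hE]
          have h5 : Z (X * Y' - X * (emb p ω z * π ^ (d * S' + d * M))) =
              Z (X * Y') - Z (X * (emb p ω z * π ^ (d * S' + d * M))) :=
            map_sub ZW ⟨_, hXmem hY'⟩ ⟨_, hXmem (hemb M z)⟩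
          rw [hXemb, sub_zero] at h5
          rw [← h5, mul_sub]
    obtain ⟨Y', hY', hYn, hE⟩ := key (e * s)
    have hps : (p : D) ^ s ≠ 0 := pow_ne_zero s (natCast_prime_ne_zero D p)
    have hmem : ((p : D) ^ s)⁻¹ * Y' ∈ W := by
      refine ⟨(((Nat.cast_commute p ω).pow_left s).inv_left₀).mul_left hY'.1, ?_⟩
      rw [norm_mul, norm_inv, norm_pow, he, ← pow_mul, mul_comm, ← div_eq_mul_inv,
        div_le_iff₀ (pow_pos h.norm_pos _), ← pow_add, mul_assoc]
      exact hYn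
    have h6 : X * Y' = p ^ s • (X * (((p : D) ^ s)⁻¹ * Y')) := by
      rw [nsmul_eq_mul, Nat.cast_pow, ← mul_assoc _ X, ((Nat.cast_commute p X).pow_left s).eq,
        mul_assoc, mul_inv_cancel_left₀ hps]
    have h7 : Z (X * Y') = p ^ s • Z (X * (((p : D) ^ s)⁻¹ * Y')) := by
      have : Z (p ^ s • (X * (((p : D) ^ s)⁻¹ * Y'))) = p ^ s • Z (X * (((p : D) ^ s)⁻¹ * Y')) :=
        map_nsmul ZW (p ^ s) ⟨_, hXmem hmem⟩
      rw [← this, h6]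
    rw [hE, h7, hA]
  have hfin : X⁻¹ * (p ^ (padicValNat p e + 1) • (emb p ω z * π ^ (S + d * 0))) ∈ W := by
    have h8 := W.nsmul_mem (hemb 0 z) (p ^ (padicValNat p e + 1))
    refine ⟨hXω.inv_left₀.mul_left h8.1, ?_⟩
    rw [nsmul_eq_mul, Nat.cast_pow, norm_mul, norm_mul, norm_inv, ← mul_assoc, inv_mul_eq_div]
    exact (mul_le_of_le_one_left (norm_nonneg _)
      ((div_le_one (norm_pos_iff.2 hX0)).2 hcn)).trans (hemb 0 z).2
  have h9 := hXW _ hfin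
  rw [mul_inv_cancel_left₀ hX0] at h9
  have h10 : Z (p ^ (padicValNat p e + 1) • (emb p ω z * π ^ (S + d * 0))) =
      p ^ (padicValNat p e + 1) • Z (emb p ω z * π ^ (S + d * 0)) :=
    map_nsmul ZW (p ^ (padicValNat p e + 1)) ⟨_, hemb 0 z⟩
  rw [hZ, h9, mul_zero, add_zero] at h10
  exact h10.symm

end Defect

end IsTeich

end HomogeneousParts

section Primitives

open Finset UnrRing

variable {D : Type u} [NormedDivisionRing D] [IsUltrametricDist D]
variable {p : ℕ} [hp : Fact p.Prime] [NormedAlgebra ℚ_[p] D]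
variable [Algebra ℤ_[p] D] [IsScalarTower ℤ_[p] ℚ_[p] D]
variable {A : Type*} [AddCommGroup A]

namespace IsTeich

variable {d r g e s n m₀ : ℕ} {ω π : D} {T : Submodule ℚ_[p] D} {F : D → D → A}
  {k : Type*} [Field k] {ρ : UnrRing p ω →+* k} {y : UnrRing p ω}

lemma periodic (h : IsTeich (p ^ g) d r ω π)
    (R : ResidueData p g d r h.conjAut ρ (h.unit p)) (hT : IsTraceSpace d ω π T)
    (hy : cyclicTrace h.conjAut d y = 1) (hA : ∀ x : A, p ^ s • x = 0)
    (hF : LevelCocycle (level T (‖π‖ ^ n)) (ω ^ ((p ^ g) ^ r - 1)) F)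
    (hn : n + d = d * m₀ + 1) (he0 : 0 < e) (he : ‖(p : D)‖ = ‖π‖ ^ (d * e)) :
    GradedCocycle.Periodic h.conjAut d n m₀
      (fun a b w v => p ^ (padicValNat p e + 1) • homogeneousPart (p := p) ω π F a b w v)
      (h.hilbert y) := by
  have hG := h.gradedCocycle R hT hy hA hF
  refine
    { hG.nsmul (p ^ (padicValNat p e + 1)) with
      two_le := R.two_le
      n_add := hn
      exists_unit := fun a ha => R.exists_unit ha
      sub_inv_apply := fun x hx => h.hilbert_sub hy hx
      exists_trace_eq_one := ⟨y, hy⟩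
      periodic := fun {a b} z ha hna hnb hab hS => ?_ }
  have hn1 : n ≡ 1 [MOD d] := by
    have h1 : n + d ≡ 1 [MOD d] := by rw [hn]; simp [Nat.ModEq]
    exact (show n ≡ n + d [MOD d] by simp [Nat.ModEq]).trans h1
  obtain ⟨α, hα⟩ := (Nat.modEq_iff_dvd' hna).1 (hn1.trans ha.symm)
  obtain rfl : a = n + d * α := by omega
  have e1 : n + d * (α + 1) = n + d * α + d := by ring
  have h1 := h.succ_sub_eq_defect R hG hn hab hS (α := α) (by omega) z
  have h2 := h.nsmul_defect_eq_zero R hT hy hA hF hG hn he0 he hab hS z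
  have e2 : n + d * α + d + b - (n + d * α) = b + d := by omega
  rwa [← h1, e1, smul_sub, sub_eq_zero, Nat.add_sub_cancel_left, e2] at h2

/-- A multiple of the restriction of `F` to a high level is a coboundary. -/
theorem exists_primitive (h : IsTeich (p ^ g) d r ω π)
    (R : ResidueData p g d r h.conjAut ρ (h.unit p)) (hT : IsTraceSpace d ω π T)
    (hA : ∀ x : A, p ^ s • x = 0)
    (hF : LevelCocycle (level T (‖π‖ ^ n)) (ω ^ ((p ^ g) ^ r - 1)) F)
    (hn : n + d = d * m₀ + 1) (he0 : 0 < e) (he : ‖(p : D)‖ = ‖π‖ ^ (d * e)) {l : ℕ}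
    (hl : n + d * m₀ ≤ l) :
    ∃ θ : D → A, (∀ x ∈ level T (‖π‖ ^ l), ∀ x' ∈ level T (‖π‖ ^ l), θ (x + x') = θ x + θ x') ∧
      ∀ x ∈ level T (‖π‖ ^ l), ∀ x' ∈ level T (‖π‖ ^ l),
        p ^ (padicValNat p e + 1) • F x x' = θ (x * x' - x' * x) := by
  obtain ⟨y, hy⟩ := R.exists_trace_eq_one
  have hd := R.two_le
  have hP := h.periodic R hT hy hA hF hn he0 he
  set j := padicValNat p e + 1
  have hm₀ : d ≤ d * m₀ := by
    rcases Nat.eq_zero_or_pos m₀ with rfl | h1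
    · omega
    · exact Nat.le_mul_of_pos_right d h1
  obtain ⟨b₀, hb₀⟩ : ∃ b₀, b₀ = d * m₀ - 1 := ⟨_, rfl⟩
  have hbd : ¬d ∣ b₀ := fun h1 => by
    have h2 : d ∣ b₀ + 1 := by rw [hb₀, Nat.sub_add_cancel (by omega)]; exact dvd_mul_right _ _
    have := Nat.le_of_dvd one_pos ((Nat.dvd_add_right h1).1 h2)
    omega
  have hpos : ∀ k : ℕ, 0 ≤ ‖π‖ ^ k := pow_nonneg (norm_nonneg _)
  have hle : ∀ {a b : ℕ}, a ≤ b → ‖π‖ ^ b ≤ ‖π‖ ^ a := fun hab =>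
    pow_le_pow_of_le_one (norm_nonneg _) h.norm_lt_one.le hab
  have hmemb : π ^ b₀ ∈ level T (‖π‖ ^ n) := by
    have := h.emb_mul_pow_mem hT hy (w := (1 : UnrRing p ω)) (n := n) (a := b₀)
      ⟨by omega, fun h' => absurd h' hbd⟩
    rwa [map_one, one_mul] at this
  have hlev : ∀ {x}, x ∈ level T (‖π‖ ^ l) → x ∈ level T (‖π‖ ^ n) := fun {x} hx => by
    rw [mem_level (hpos _)] at hx ⊢
    exact ⟨hx.1, hx.2.trans (hle (by omega))⟩
  have hlie : ∀ {x x'}, x ∈ level T (‖π‖ ^ l) → x' ∈ level T (‖π‖ ^ l) →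
      x * x' - x' * x ∈ level T (‖π‖ ^ l) := fun {x x'} hx hx' => by
    rw [mem_level (hpos _)] at hx hx' ⊢
    have hx1 : ‖x‖ ≤ 1 := hx.2.trans (pow_le_one₀ (norm_nonneg _) h.norm_lt_one.le)
    refine ⟨hT.lie_mem x x', norm_sub_le_of_le_max ?_ ?_⟩
    · rw [norm_mul]
      exact (mul_le_of_le_one_left (norm_nonneg _) hx1).trans hx'.2
    · rw [norm_mul]
      exact (mul_le_of_le_one_right (norm_nonneg _) hx1).trans hx'.2
  set φ : D →+ D := (AddMonoidHom.mulRight (π ^ (-(b₀ : ℤ)))).comp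
    ((h.hilbertExt y).comp (weightZero ω ((p ^ g) ^ d - 1))) with hφ
  have hφa : ∀ x, φ x =
      h.hilbertExt y (weightZero ω ((p ^ g) ^ d - 1) x) * π ^ (-(b₀ : ℤ)) := fun _ => rfl
  have hφm : ∀ {x}, x ∈ level T (‖π‖ ^ l) → φ x ∈ level T (‖π‖ ^ n) := fun {x} hx => by
    rw [mem_level (hpos _)] at hx ⊢
    refine ⟨h.mul_zpow_mem hT (h.commute_hilbertExt y (h.commute_weightZero x))
      (by rwa [dvd_neg, Int.natCast_dvd_natCast]), ?_⟩
    rw [hφa, norm_mul, norm_zpow, zpow_neg, zpow_natCast, ← div_eq_mul_inv,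
      div_le_iff₀ (pow_pos h.norm_pos _), ← pow_add]
    exact ((h.norm_hilbertExt_le y _).trans (h.norm_weightZero_le x)).trans
      (hx.2.trans (hle (by omega)))
  set θ : D → A := fun x => p ^ j • F (φ x) (π ^ b₀) with hθ
  have hadd : ∀ x ∈ level T (‖π‖ ^ l), ∀ x' ∈ level T (‖π‖ ^ l), θ (x + x') = θ x + θ x' :=
    fun x hx x' hx' => by
      rw [hθ]
      dsimp only
      rw [map_add, hF.add_left (hφm hx) (hφm hx') hmemb, smul_add]
  refine ⟨θ, hadd, ?_⟩
  have hhom : ∀ {a b : ℕ} {w v : UnrRing p ω}, Adm h.conjAut d l a w → Adm h.conjAut d l b v →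
      p ^ j • F (emb p ω w * π ^ a) (emb p ω v * π ^ b) =
        θ (emb p ω w * π ^ a * (emb p ω v * π ^ b) - emb p ω v * π ^ b * (emb p ω w * π ^ a)) := by
    intro a b w v hw hv
    have hla := hw.1
    have hlb := hv.1
    rw [hθ]
    dsimp only
    rw [h.emb_mul_mul, h.emb_mul_mul, add_comm b a, ← sub_mul, ← map_sub, hφa]
    set z := w * (h.conjAut ^ a) v - v * (h.conjAut ^ b) w with hz
    by_cases hab : d ∣ a + b
    · have h1 := hP.eq_coboundary hl hw hv hab
      simp only [homogeneousPart] at h1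
      rw [h1, ← hz, ← hb₀, map_one, one_mul,
        h.weightZero_of_commute ((emb_commute_root z).mul_left (h.commute_pow hab)),
        h.hilbertExt_emb y z hab, mul_assoc, ← zpow_natCast π (a + b), ← zpow_add₀ h.ne_zero,
        ← zpow_natCast π (a + b - b₀), Nat.cast_sub (by omega), sub_eq_add_neg]
    · have hw' : Adm h.conjAut d n a w := ⟨by omega, hw.2⟩
      have hv' : Adm h.conjAut d n b v := ⟨by omega, hv.2⟩
      have h1 := hP.eq_zero hw' hv' hab
      simp only [homogeneousPart] at h1
      rw [h1, ← zpow_natCast π (a + b), h.weightZero_mul_zpow (emb_commute_root z)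
        (by rwa [Int.natCast_dvd_natCast]), map_zero, zero_mul, hF.zero_left hmemb, smul_zero]
  have hstep : ∀ {x'} (_ : x' ∈ level T (‖π‖ ^ l)),
      (∀ a w, Adm h.conjAut d l a w → p ^ j • F (emb p ω w * π ^ a) x' =
        θ (emb p ω w * π ^ a * x' - x' * (emb p ω w * π ^ a))) →
      ∀ x ∈ level T (‖π‖ ^ l), p ^ j • F x x' = θ (x * x' - x' * x) := by
    intro x' hx' hE x hx
    have := h.level_eq_zero hT hy he hA (l := l)
      (AddMonoidHom.mk' (fun x : level T (‖π‖ ^ l) => p ^ j • F x x' - θ (x * x' - x' * x))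
        fun x₁ x₂ => by
          have h1 : ((x₁ + x₂ : level T (‖π‖ ^ l)) : D) * x' - x' * (x₁ + x₂ : level T (‖π‖ ^ l)) =
              (x₁ * x' - x' * x₁) + (x₂ * x' - x' * x₂) := by
            rw [AddSubgroup.coe_add, add_mul, mul_add]
            abel
          rw [h1, hadd _ (hlie x₁.2 hx') _ (hlie x₂.2 hx'), AddSubgroup.coe_add,
            hF.add_left (hlev x₁.2) (hlev x₂.2) (hlev hx'), smul_add]
          abel) (fun a w hw => sub_eq_zero.2 (hE a w hw)) ⟨x, hx⟩
    exact sub_eq_zero.1 this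
  have hθneg : ∀ x ∈ level T (‖π‖ ^ l), θ (-x) = -θ x := fun x hx => by
    rw [hθ]
    dsimp only
    rw [map_neg, ← smul_neg]
    congr 1
    exact map_neg (hF.homLeft hmemb) ⟨_, hφm hx⟩
  intro x hx x' hx'
  refine hstep hx' (fun a w hw => ?_) x hx
  have hmw := h.emb_mul_pow_mem hT hy hw
  rw [hF.antisymm (hlev hmw) (hlev hx'), smul_neg,
    hstep hmw (fun b v hv => hhom hv hw) x' hx', ← hθneg _ (hlie hx' hmw), neg_sub]

end IsTeich

end Primitives

section Splittings

open Finset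

variable {D : Type u} [NormedDivisionRing D] [IsUltrametricDist D]
variable {F : Type v} [Field F] [Algebra F D]

namespace IsTeich

variable {q d r : ℕ} {ω π : D}

variable (F) in
/-- The centralizer of `ω` as a field. -/
lemma exists_centralizer [FiniteDimensional F D] (h : IsTeich q d r ω π) :
    ∃ (K : Type u) (_ : Field K) (_ : Algebra F K) (ι : K →ₐ[F] D),
      ∀ x, Commute x ω ↔ ∃ z, ι z = x := by
  let S := Subalgebra.centralizer F {ω}
  have hS : ∀ x, x ∈ S ↔ Commute x ω := fun x => by
    rw [Subalgebra.mem_centralizer_iff]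
    simp only [Set.mem_singleton_iff, forall_eq]
    exact ⟨fun h1 => h1.symm, fun h1 => h1.symm⟩
  let : CommRing S :=
    { (inferInstance : Ring S) with
      mul_comm := fun x y =>
        Subtype.ext (h.commute_of_commute_root ((hS x).1 x.2) ((hS y).1 y.2)) }
  refine ⟨S, fieldOfFiniteDimensional F S, inferInstance, S.val, fun x => ?_⟩
  rw [← hS]
  exact ⟨fun hx => ⟨⟨x, hx⟩, rfl⟩, fun ⟨z, hz⟩ => hz ▸ z.2⟩

variable {K : Type w} [Field K] [Algebra F K] {ι : K →ₐ[F] D}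

lemma exists_coord (h : IsTeich q d r ω π) (hι : ∀ x, Commute x ω ↔ ∃ z, ι z = x) :
    ∃ κ : D →ₗ[F] K, ∀ x, ι (κ x) = weightZero ω (q ^ d - 1) x := by
  have hinj : Function.Injective ι := ι.toRingHom.injective
  choose κ hκ using fun x => (hι _).1 (h.commute_weightZero x)
  refine ⟨{ toFun := κ, map_add' := fun x y => hinj ?_, map_smul' := fun c x => hinj ?_ }, hκ⟩
  · rw [map_add, hκ, hκ, hκ, map_add]
  · rw [RingHom.id_apply, map_smul, hκ, hκ, Algebra.smul_def, Algebra.smul_def,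
      weightZero_mul _ (Algebra.commutes c ω)]

lemma weightZero_pow (h : IsTeich q d r ω π) (i j : Fin d) :
    weightZero ω (q ^ d - 1) (π⁻¹ ^ (i : ℕ) * π ^ (j : ℕ)) = if i = j then 1 else 0 := by
  have h1 : π⁻¹ ^ (i : ℕ) * π ^ (j : ℕ) = 1 * π ^ ((j : ℤ) - (i : ℤ)) := by
    rw [one_mul, inv_pow, ← zpow_natCast, ← zpow_natCast, ← zpow_neg, ← zpow_add₀ h.ne_zero,
      neg_add_eq_sub]
  rw [h1]
  split_ifs with hij
  · rw [hij, h.weightZero_mul_zpow_of_dvd (Commute.one_left ω) (by simp), sub_self, zpow_zero,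
      one_mul]
  · refine h.weightZero_mul_zpow (Commute.one_left ω) fun hdvd => hij ?_
    have := Int.eq_zero_of_abs_lt_dvd hdvd (by rw [abs_lt]; omega)
    exact Fin.ext (by omega)

variable [Algebra.IsCentral F D]

lemma exists_algebraMap_eq (h : IsTeich q d r ω π) {x : D} (hω : Commute x ω)
    (hπ : Commute x π) : ∃ a, algebraMap F D a = x := by
  obtain ⟨a, ha⟩ := (Algebra.IsCentral.mem_center_iff F).1
    (Subalgebra.mem_center_iff.2 fun y => ((h.commute_of_forall hω hπ y).eq).symm)
  exact ⟨a, ha.symm⟩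

lemma finrank_centralizer [FiniteDimensional F D] (h : IsTeich q d r ω π)
    (hι : ∀ x, Commute x ω ↔ ∃ z, ι z = x) : Module.finrank F K = d := by
  have hinj : Function.Injective ι := ι.toRingHom.injective
  have : FiniteDimensional F K := FiniteDimensional.of_injective ι.toLinearMap hinj
  have hc : ∀ z, Commute (ι z) ω := fun z => (hι _).2 ⟨z, rfl⟩
  have hconj : ∀ x, Commute x ω → Commute (π * x * π⁻¹) ω := fun x hx => by
    have h1 := h.commute_weightZero (π * x * π⁻¹)
    obtain ⟨k, hk⟩ : ∃ k, ι k = ω := (hι ω).1 (Commute.refl ω)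
    have h2 : π * ω * π⁻¹ = ω ^ q ^ r := by
      rw [h.mul_eq, mul_inv_cancel_right₀ h.ne_zero]
    have h3 : Commute (π * x * π⁻¹) (ω ^ q ^ r) := by
      rw [← h2, commute_iff_eq]
      have h4 : ∀ a b : D, π * a * π⁻¹ * (π * b * π⁻¹) = π * (a * b) * π⁻¹ := fun a b => by
        rw [mul_assoc (π * a), mul_assoc π b, inv_mul_cancel_left₀ h.ne_zero]
        simp only [mul_assoc]
      rw [h4, h4, hx.eq]
    have h5 : (ω ^ q ^ r) ^ (q ^ r) ^ (d - 1) = ω := by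
      rw [← pow_mul, ← pow_succ', Nat.sub_add_cancel h.pos]
      exact (h.root_pow_eq_iff d).2 dvd_rfl
    rw [← h5]
    exact h3.pow_right _
  choose τ hτ using fun z => (hι _).1 (hconj _ (hc z))
  have hmul : ∀ a b : D, π * a * π⁻¹ * (π * b * π⁻¹) = π * (a * b) * π⁻¹ := fun a b => by
    rw [mul_assoc (π * a), mul_assoc π b, inv_mul_cancel_left₀ h.ne_zero]
    simp only [mul_assoc]
  let f : K →ₐ[F] K :=
    { toFun := τ
      map_one' := hinj (by rw [hτ, map_one, mul_one, mul_inv_cancel₀ h.ne_zero])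
      map_mul' := fun a b => hinj (by rw [hτ, map_mul, map_mul, hτ, hτ, hmul])
      map_zero' := hinj (by rw [hτ, map_zero, mul_zero, zero_mul])
      map_add' := fun a b => hinj (by rw [hτ, map_add, map_add, hτ, hτ, mul_add, add_mul])
      commutes' := fun a => hinj (by
        rw [hτ, AlgHom.commutes, ← Algebra.commutes, mul_inv_cancel_right₀ h.ne_zero]) }
  have hfb : Function.Bijective f :=
    ⟨f.toRingHom.injective, LinearMap.surjective_of_injective (f := f.toLinearMap)
      f.toRingHom.injective⟩
  let φ : K ≃ₐ[F] K := AlgEquiv.ofBijective f hfb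
  have hφ : ∀ z, ι (φ z) = π * ι z * π⁻¹ := hτ
  have hφi : ∀ (i : ℕ) z, ι ((φ ^ i) z) = π ^ i * ι z * (π ^ i)⁻¹ := fun i z => by
    induction i with
    | zero => simp
    | succ i ih =>
      rw [pow_succ', AlgEquiv.mul_apply, hφ, ih, pow_succ', mul_inv_rev]
      simp only [mul_assoc]
  have hφd : φ ^ d = 1 := AlgEquiv.ext fun z => hinj (by
    rw [hφi, (h.commute_uniformizer_pow _).eq, mul_inv_cancel_right₀ (pow_ne_zero d h.ne_zero)]
    rfl)
  have hord : orderOf φ = d := by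
    refine Nat.dvd_antisymm (orderOf_dvd_of_pow_eq_one hφd) ?_
    obtain ⟨k, hk⟩ : ∃ k, ι k = ω := (hι ω).1 (Commute.refl ω)
    have h1 := hφi (orderOf φ) k
    rw [pow_orderOf_eq_one, hk, h.pow_mul_root,
      mul_inv_cancel_right₀ (pow_ne_zero _ h.ne_zero)] at h1
    refine (h.root_pow_eq_iff _).1 (h1.symm.trans ?_)
    exact hk
  have hfix : IntermediateField.fixedField (Subgroup.zpowers φ) = ⊥ := by
    rw [eq_bot_iff]
    intro z hz
    rw [IntermediateField.mem_fixedField_iff] at hz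
    have h1 := hz φ (Subgroup.mem_zpowers φ)
    have h2 : Commute (ι z) π := by
      have h3 := hφ z
      rw [h1, eq_mul_inv_iff_mul_eq₀ h.ne_zero] at h3
      exact h3
    obtain ⟨a, ha⟩ := h.exists_algebraMap_eq (F := F) (hc z) h2
    rw [IntermediateField.mem_bot]
    exact ⟨a, hinj (by rw [AlgHom.commutes, ha])⟩
  have h1 := IntermediateField.finrank_fixedField_eq_card (Subgroup.zpowers φ)
  rw [hfix, IntermediateField.finrank_bot', Nat.card_zpowers, hord] at h1
  exact h1

theorem finrank_eq [FiniteDimensional F D] (h : IsTeich q d r ω π) :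
    Module.finrank F D = d ^ 2 := by
  obtain ⟨K, _, _, ι, hι⟩ := h.exists_centralizer F
  obtain ⟨κ, hκ⟩ := h.exists_coord hι
  have hinj : Function.Injective ι := ι.toRingHom.injective
  have : FiniteDimensional F K := FiniteDimensional.of_injective ι.toLinearMap hinj
  let f : D →ₗ[F] (Fin d → K) := LinearMap.pi fun i =>
    κ.comp (LinearMap.mulLeft F (π⁻¹ ^ (i : ℕ)))
  have hf : ∀ x i, ι (f x i) = weightZero ω (q ^ d - 1) (π⁻¹ ^ (i : ℕ) * x) := fun x i => hκ _
  have hfb : Function.Bijective f := by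
    constructor
    · rw [injective_iff_map_eq_zero]
      intro x hx
      rw [← h.sum_weightZero x, Finset.sum_range]
      refine sum_eq_zero fun i _ => ?_
      rw [← hf, hx, Pi.zero_apply, map_zero, mul_zero]
    · intro z
      refine ⟨∑ j : Fin d, π ^ (j : ℕ) * ι (z j), funext fun i => hinj ?_⟩
      rw [hf, mul_sum, map_sum, sum_eq_single i]
      · rw [← mul_assoc, weightZero_mul' _ ((hι _).2 ⟨_, rfl⟩), h.weightZero_pow, if_pos rfl,
          one_mul]
      · intro j _ hj
        rw [← mul_assoc, weightZero_mul' _ ((hι _).2 ⟨_, rfl⟩), h.weightZero_pow,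
          if_neg hj.symm, zero_mul]
      · simp
  rw [(LinearEquiv.ofBijective f hfb).finrank_eq, Module.finrank_pi_fintype,
    sum_const, card_univ, Fintype.card_fin, h.finrank_centralizer hι, smul_eq_mul, sq]

theorem divDegree_eq [FiniteDimensional F D] (h : IsTeich q d r ω π) : divDegree F D = d := by
  rw [divDegree, h.finrank_eq, sq, Nat.sqrt_eq]

variable (F) in
/-- The representation of `D` on the right vector space `D` over the centralizer of `ω`. -/
theorem exists_splitting [FiniteDimensional F D] (h : IsTeich q d r ω π) :
    ∃ φ : D →ₐ[F] Matrix (Fin d) (Fin d) (AlgebraicClosure F),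
      ∀ x, Commute x ω → (φ x).trace = 0 → ∑ i ∈ range d, π⁻¹ ^ i * x * π ^ i = 0 := by
  obtain ⟨K, _, _, ι, hι⟩ := h.exists_centralizer F
  obtain ⟨κ, hκ⟩ := h.exists_coord hι
  have hinj : Function.Injective ι := ι.toRingHom.injective
  have : FiniteDimensional F K := FiniteDimensional.of_injective ι.toLinearMap hinj
  let M : D →ₗ[F] Matrix (Fin d) (Fin d) K :=
    { toFun := fun x => Matrix.of fun i j => κ (π⁻¹ ^ (i : ℕ) * x * π ^ (j : ℕ))
      map_add' := fun x y => by
        ext i j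
        simp only [Matrix.of_apply, Matrix.add_apply, mul_add, add_mul, map_add]
      map_smul' := fun c x => by
        ext i j
        simp only [Matrix.of_apply, Matrix.smul_apply, RingHom.id_apply, mul_smul_comm,
          smul_mul_assoc, map_smul] }
  have hM : ∀ x i j, ι (M x i j) =
      weightZero ω (q ^ d - 1) (π⁻¹ ^ (i : ℕ) * x * π ^ (j : ℕ)) := fun x i j => hκ _
  have hM1 : M 1 = 1 := by
    ext i j
    apply hinj
    rw [hM, mul_one, h.weightZero_pow, Matrix.one_apply]
    split_ifs <;> simp
  have hMmul : ∀ x y, M (x * y) = M x * M y := by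
    intro x y
    ext i k
    apply hinj
    rw [hM, Matrix.mul_apply, map_sum]
    conv_lhs => rw [← mul_assoc, mul_assoc, ← h.sum_weightZero (y * π ^ (k : ℕ))]
    rw [mul_sum, map_sum, Finset.sum_range]
    refine sum_congr rfl fun j _ => ?_
    rw [← mul_assoc, weightZero_mul' _ (h.commute_weightZero _), map_mul ι, hM, hM, ← mul_assoc]
  let φ : D →ₐ[F] Matrix (Fin d) (Fin d) (AlgebraicClosure F) :=
    (AlgHom.mapMatrix (IsAlgClosed.lift : K →ₐ[F] AlgebraicClosure F)).comp
      (AlgHom.ofLinearMap M hM1 hMmul)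
  refine ⟨φ, fun x hx hφ => ?_⟩
  have h1 : (φ x).trace = (IsAlgClosed.lift : K →ₐ[F] AlgebraicClosure F) (M x).trace := by
    rw [Matrix.trace, Matrix.trace, map_sum]
    rfl
  rw [h1, map_eq_zero] at hφ
  have h2 := congrArg ι hφ
  rw [map_zero, Matrix.trace, map_sum] at h2
  rw [← h2, Finset.sum_range]
  refine sum_congr rfl fun i _ => ?_
  rw [Matrix.diag_apply, hM, h.weightZero_of_commute (h.commute_conj_inv hx i)]

theorem sum_conj_eq_zero [FiniteDimensional F D] (h : IsTeich q d r ω π) {x : D}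
    (hx : x ∈ trdZero F D) (hc : Commute x ω) : ∑ i ∈ range d, π ^ i * x * (π ^ i)⁻¹ = 0 := by
  have hd := h.divDegree_eq (F := F)
  have h0 := h.ne_zero
  have hsum : ∑ i ∈ range d, π⁻¹ ^ i * x * π ^ i = 0 := by
    obtain ⟨φ, hφ⟩ := h.exists_splitting F
    refine hφ x hc ?_
    clear hφ
    subst hd
    exact hx φ
  have h1 : π ^ (d - 1) * (∑ i ∈ range d, π⁻¹ ^ i * x * π ^ i) * (π ^ (d - 1))⁻¹ = 0 := by
    rw [hsum, mul_zero, zero_mul]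
  rw [mul_sum, sum_mul, ← sum_range_reflect] at h1
  rw [← h1]
  refine sum_congr rfl fun i hi => ?_
  rw [mem_range] at hi
  obtain ⟨j, hj⟩ : ∃ j, d - 1 = i + j := ⟨d - 1 - i, by omega⟩
  rw [hj, Nat.add_sub_cancel_left, pow_add, mul_inv_rev, inv_pow]
  simp only [mul_assoc]
  rw [mul_inv_cancel_left₀ (pow_ne_zero j h0), mul_inv_cancel_left₀ (pow_ne_zero j h0)]

end IsTeich

end Splittings

section BaseField

open Finset

variable {D : Type u} [NormedDivisionRing D] [IsUltrametricDist D]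
variable {p : ℕ} [hp : Fact p.Prime] [NormedAlgebra ℚ_[p] D] [FiniteDimensional ℚ_[p] D]
variable {F : Type v} [Field F] [Algebra F D] [Algebra.IsCentral F D]
  [Algebra ℚ_[p] F] [FiniteDimensional ℚ_[p] F] [IsScalarTower ℚ_[p] F D]

lemma divAbs_le_one_iff_norm (hdiv : ∀ x : D, divAbs p x ≤ 1 ↔ ‖x‖ ≤ 1) (x : F) :
    divAbs p x ≤ 1 ↔ ‖algebraMap F D x‖ ≤ 1 := by
  rw [← hdiv, divAbs_le_one_iff, divAbs_le_one_iff,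
    ← minpoly.algHom_eq (IsScalarTower.toAlgHom ℚ_[p] F D)
      (IsScalarTower.toAlgHom ℚ_[p] F D).toRingHom.injective x]
  rfl

lemma divAbs_lt_one_iff_norm (hdiv : ∀ x : D, divAbs p x ≤ 1 ↔ ‖x‖ ≤ 1) (x : F) :
    divAbs p x < 1 ↔ ‖algebraMap F D x‖ < 1 := by
  rcases eq_or_ne x 0 with rfl | hx
  · rw [divAbs_zero, map_zero, norm_zero]
  have h1 : divAbs p x * divAbs p x⁻¹ = 1 := by
    rw [← divAbs_mul, mul_inv_cancel₀ hx, divAbs_one]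
  have h2 : 0 < divAbs p x := (divAbs_nonneg p x).lt_of_ne fun h0 => hx ((divAbs_eq_zero p).1 h0.symm)
  have h3 : 0 < ‖algebraMap F D x‖ := norm_pos_iff.2 ((map_ne_zero _).2 hx)
  have h4 := divAbs_le_one_iff_norm hdiv x⁻¹
  rw [eq_inv_of_mul_eq_one_right h1, map_inv₀, norm_inv, inv_le_one₀ h2, inv_le_one₀ h3] at h4
  rw [← not_le, h4, not_le]

namespace IsTeich

variable {q d r : ℕ} {ω π : D}

lemma ramIndex_spec (h : IsTeich q d r ω π) (hdiv : ∀ x : D, divAbs p x ≤ 1 ↔ ‖x‖ ≤ 1) :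
    0 < ramIndex p F ∧ ‖(p : D)‖ = ‖π‖ ^ (d * ramIndex p F) := by
  obtain ⟨k, hk⟩ := h.exists_norm_eq_of_commute (Nat.cast_commute p ω) (natCast_prime_ne_zero D p)
  have hd : (0 : ℤ) < d := by exact_mod_cast h.pos
  have hk0 : 0 < k := by
    by_contra hcon
    have h1 := norm_natCast_prime_lt_one D p
    rw [hk] at h1
    exact absurd h1 (not_lt.2 (one_le_zpow_of_nonpos₀ h.norm_pos h.norm_lt_one.le
      (by nlinarith)))
  lift k to ℕ using hk0.le
  have hk1 : ‖(p : D)‖ = ‖π‖ ^ (d * k) := by exact_mod_cast hk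
  obtain ⟨ϖ, hϖ⟩ := h.exists_algebraMap_eq (F := F) (h.commute_uniformizer_pow ω)
    (h.commute_uniformizer_pow π)
  have hϖ1 : divAbs p ϖ < 1 := by
    rw [divAbs_lt_one_iff_norm hdiv, hϖ, norm_pow]
    exact pow_lt_one₀ (norm_nonneg _) h.norm_lt_one h.pos.ne'
  let P : ringOfInt p F := ⟨ϖ, hϖ1.le⟩
  have hP0 : ϖ ≠ 0 := by
    rintro rfl
    rw [map_zero] at hϖ
    exact pow_ne_zero d h.ne_zero hϖ.symm
  have hmax : maxIdeal p F = Ideal.span {P} := by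
    apply le_antisymm
    · intro x hx
      have hx1 : ‖algebraMap F D x‖ < 1 := (divAbs_lt_one_iff_norm hdiv _).1 hx
      have hx2 := h.norm_le_of_lt_of_commute (Algebra.commutes (x : F) ω) (k := 0) (by
        simpa using hx1)
      rw [Ideal.mem_span_singleton]
      refine ⟨⟨ϖ⁻¹ * x, ?_⟩, Subtype.ext (mul_inv_cancel_left₀ hP0 _).symm⟩
      change divAbs p (ϖ⁻¹ * (x : F)) ≤ 1
      rw [divAbs_le_one_iff_norm hdiv, map_mul, map_inv₀, hϖ, norm_mul, norm_inv, norm_pow,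
        inv_mul_eq_div, div_le_one (pow_pos h.norm_pos _)]
      exact_mod_cast (by simpa using hx2)
    · rw [Ideal.span_singleton_le_iff_mem]
      exact hϖ1
  have hset : {j : ℕ | ((p : ℕ) : ringOfInt p F) ∈ maxIdeal p F ^ j} = Set.Iic k := by
    ext j
    rw [Set.mem_ofPred_eq, hmax, Ideal.span_singleton_pow, Ideal.mem_span_singleton, Set.mem_Iic]
    have hpow : ∀ j : ℕ, algebraMap F D (ϖ ^ j) = π ^ (d * j) := fun j => by
      rw [map_pow, hϖ, ← pow_mul]
    constructor
    · rintro ⟨z, hz⟩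
      have hz1 : (p : F) = ϖ ^ j * z := congrArg Subtype.val hz
      have hz2 : ‖algebraMap F D (z : F)‖ ≤ 1 := (divAbs_le_one_iff_norm hdiv _).1 z.2
      have hz3 := congrArg (fun x => ‖algebraMap F D x‖) hz1
      simp only [map_natCast, map_mul, hpow, norm_mul, norm_pow] at hz3
      have hz4 : ‖π‖ ^ (d * k) ≤ ‖π‖ ^ (d * j) := by
        rw [← hk1, hz3]
        exact mul_le_of_le_one_right (pow_nonneg (norm_nonneg _) _) hz2
      rw [pow_le_pow_iff_right_of_lt_one₀ h.norm_pos h.norm_lt_one] at hz4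
      exact Nat.le_of_mul_le_mul_left hz4 h.pos
    · intro hj
      refine ⟨⟨(ϖ ^ j)⁻¹ * p, ?_⟩,
        Subtype.ext (mul_inv_cancel_left₀ (pow_ne_zero j hP0) _).symm⟩
      change divAbs p ((ϖ ^ j)⁻¹ * (p : F)) ≤ 1
      rw [divAbs_le_one_iff_norm hdiv, map_mul, map_inv₀, hpow, map_natCast, norm_mul, norm_inv,
        norm_pow, hk1, inv_mul_eq_div, div_le_one (pow_pos h.norm_pos _)]
      exact pow_le_pow_of_le_one (norm_nonneg _) h.norm_lt_one.le (Nat.mul_le_mul_left d hj)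
  have : ramIndex p F = k := by rw [ramIndex, hset, csSup_Iic]
  rw [this]
  exact ⟨by exact_mod_cast hk0, hk1⟩

lemma residueCard_eq_three {ω π : D} (h : IsTeich 3 2 r ω π)
    (hdiv : ∀ x : D, divAbs p x ≤ 1 ↔ ‖x‖ ≤ 1) : residueCard p F = 3 := by
  have hmem : ∀ x : ringOfInt p F, x ∈ maxIdeal p F ↔ ‖algebraMap F D x‖ < 1 := fun x =>
    divAbs_lt_one_iff_norm hdiv _
  have hω8 : ω ^ 8 = 1 := h.pow_eq_one
  have hω4 : ω ^ 4 = -1 := by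
    have h1 : (ω ^ 4 - 1) * (ω ^ 4 + 1) = 0 := by
      rw [sub_mul, mul_add, ← pow_add, hω8, mul_one, one_mul]
      abel
    rcases mul_eq_zero.1 h1 with h2 | h2
    · have := h.norm_sub_one 4 (by norm_num)
      rw [h2, norm_zero] at this
      exact absurd this zero_ne_one
    · exact eq_neg_of_add_eq_zero_left h2
  have hodd : Odd r := by
    rw [← Nat.not_even_iff_odd, even_iff_two_dvd]
    intro h2
    have := Nat.dvd_gcd h2 (dvd_refl 2)
    rw [h.coprime] at this
    exact absurd this (by norm_num)
  have h2n : ‖(2 : D)‖ = 1 := by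
    have h8 : ‖((3 ^ 2 - 1 : ℕ) : D)‖ = 1 := h.norm_natCast
    have : ((3 ^ 2 - 1 : ℕ) : D) = 2 ^ 3 := by norm_num
    rw [this, norm_pow] at h8
    exact (pow_eq_one_iff_of_nonneg (norm_nonneg _) (by norm_num)).1 h8
  have hres : ∀ x : F, ‖algebraMap F D x‖ ≤ 1 → ‖algebraMap F D x‖ < 1 ∨
      ‖algebraMap F D x - 1‖ < 1 ∨ ‖algebraMap F D x + 1‖ < 1 := by
    intro x hx
    rcases h.lt_or_exists _ hx with h1 | ⟨i, hi⟩
    · exact Or.inl h1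
    right
    have hconj : ‖algebraMap F D x - ω ^ (3 ^ r * i)‖ < 1 := by
      have e1 : π * (algebraMap F D x - ω ^ i) = (algebraMap F D x - ω ^ (3 ^ r * i)) * π := by
        have e2 : π * ω ^ i = ω ^ (3 ^ r * i) * π := by
          clear hi
          induction i with
          | zero => simp
          | succ i ih =>
            rw [pow_succ, ← mul_assoc, ih, mul_assoc, h.mul_eq, ← mul_assoc, ← pow_add, mul_add,
              mul_one]
        rw [mul_sub, sub_mul, e2, Algebra.commutes]
      have e3 := congrArg norm e1
      rw [norm_mul, norm_mul, mul_comm ‖π‖] at e3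
      rwa [← mul_right_cancel₀ h.norm_pos.ne' e3]
    have hle : i ≤ 3 ^ r * i := Nat.le_mul_of_pos_left i (by positivity)
    have hdvd : 8 ∣ 3 ^ r * i - i := by
      by_contra hcon
      have e4 := h.norm_sub_one (3 ^ r * i - i) hcon
      have e5 : ω ^ (3 ^ r * i) - ω ^ i = ω ^ i * (ω ^ (3 ^ r * i - i) - 1) := by
        rw [mul_sub, ← pow_add, mul_one, Nat.add_sub_cancel' hle]
      have e6 : ‖ω ^ (3 ^ r * i) - ω ^ i‖ < 1 := by
        have := norm_sub_le_of_le_max (x := algebraMap F D x - ω ^ i)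
          (y := algebraMap F D x - ω ^ (3 ^ r * i)) (le_max_left _ _) (le_max_right _ _)
        rw [sub_sub_sub_cancel_left] at this
        exact this.trans_lt (max_lt hi hconj)
      rw [e5, norm_mul, norm_pow, h.norm_root, one_pow, one_mul, e4] at e6
      exact lt_irrefl _ e6
    have h4i : 4 ∣ i := by
      obtain ⟨m, rfl⟩ := hodd
      have e7 : 3 ^ (2 * m + 1) % 8 = 3 := by
        rw [pow_succ, pow_mul, Nat.mul_mod, Nat.pow_mod]
        norm_num
      have e8 : 3 ^ (2 * m + 1) = 8 * (3 ^ (2 * m + 1) / 8) + 3 := by omega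
      rw [e8, add_mul, mul_assoc] at hdvd
      omega
    obtain ⟨m, rfl⟩ := h4i
    rw [pow_mul, hω4] at hi
    rcases neg_one_pow_eq_or D m with h5 | h5
    · rw [h5] at hi; exact Or.inl hi
    · rw [h5, sub_neg_eq_add] at hi; exact Or.inr hi
  have hcast : ∀ k : ℕ, algebraMap F D (((k : ℕ) : ringOfInt p F) : F) = k := fun k => by
    rw [Subring.coe_natCast, map_natCast]
  let f : Fin 3 → ringOfInt p F ⧸ maxIdeal p F := fun i =>
    Ideal.Quotient.mk _ (((i : ℕ) : ringOfInt p F) - 1)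
  have hf : Function.Bijective f := by
    constructor
    · intro i j hij
      have h1 := Ideal.Quotient.eq.1 hij
      rw [hmem] at h1
      have h2 : algebraMap F D ((((i : ℕ) : ringOfInt p F) - 1 - (((j : ℕ) : ringOfInt p F) - 1) :
          ringOfInt p F) : F) = ((i : ℕ) : D) - ((j : ℕ) : D) := by
        rw [sub_sub_sub_cancel_right, AddSubgroupClass.coe_sub, map_sub]
        rw [hcast, hcast]
      rw [h2] at h1
      fin_cases i <;> fin_cases j <;> first | rfl | (exfalso; norm_num [h2n] at h1)
    · intro z
      obtain ⟨x, rfl⟩ := Ideal.Quotient.mk_surjective z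
      rcases hres x ((divAbs_le_one_iff_norm hdiv _).1 x.2) with h1 | h1 | h1
      · refine ⟨1, Ideal.Quotient.eq.2 ?_⟩
        rw [hmem]
        simpa using h1
      · refine ⟨2, Ideal.Quotient.eq.2 ?_⟩
        rw [hmem, ← norm_neg]
        have : -(algebraMap F D ((((2 : Fin 3) : ℕ) : ringOfInt p F) - 1 - x : ringOfInt p F)) =
            algebraMap F D x - 1 := by
          rw [AddSubgroupClass.coe_sub, AddSubgroupClass.coe_sub, map_sub, map_sub, hcast]
          norm_num
        rwa [this]
      · refine ⟨0, Ideal.Quotient.eq.2 ?_⟩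
        rw [hmem, ← norm_neg]
        have : -(algebraMap F D ((((0 : Fin 3) : ℕ) : ringOfInt p F) - 1 - x : ringOfInt p F)) =
            algebraMap F D x + 1 := by
          rw [AddSubgroupClass.coe_sub, AddSubgroupClass.coe_sub, map_sub, map_sub, hcast]
          norm_num
        rwa [this]
  rw [residueCard, ← Nat.card_eq_of_bijective f hf, Nat.card_eq_fintype_card, Fintype.card_fin]

end IsTeich

end BaseField

section TraceZero

open Finset UnrRing

variable {D : Type u} [NormedDivisionRing D] [IsUltrametricDist D]
variable {p : ℕ} [hp : Fact p.Prime] [NormedAlgebra ℚ_[p] D] [FiniteDimensional ℚ_[p] D]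
variable [Algebra ℤ_[p] D] [IsScalarTower ℤ_[p] ℚ_[p] D]
variable {F : Type v} [Field F] [Algebra F D] [Algebra.IsCentral F D]
  [Algebra ℚ_[p] F] [FiniteDimensional ℚ_[p] F] [IsScalarTower ℚ_[p] F D]

namespace IsTeich

variable {q g d r : ℕ} {ω π : D}

lemma isTraceSpace [FiniteDimensional F D] (h : IsTeich q d r ω π) :
    IsTraceSpace d ω π ((trdZero F D).restrictScalars ℚ_[p]) where
  lie_mem := lie_mem_trdZero F
  sum_conj _ hw hc := h.sum_conj_eq_zero (F := F) hw hc

lemma frobeniusData (h : IsTeich (p ^ g) d r ω π) (hg : 0 < g)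
    (hdiv : ∀ x : D, divAbs p x ≤ 1 ↔ ‖x‖ ≤ 1) (hp3 : 3 ≤ p)
    (hpd : ¬(p = 3 ∧ d = 2 ∧ residueCard p F = 3)) (hd : 2 ≤ d) : FrobeniusData p g d r where
  prime := hp.out
  three_le := hp3
  g_pos := hg
  two_le := hd
  coprime := h.coprime
  ne := by
    rintro ⟨rfl, hpg⟩
    refine hpd ⟨?_, rfl, (hpg ▸ h).residueCard_eq_three hdiv⟩
    exact le_antisymm (hpg ▸ Nat.le_self_pow hg.ne' p) hp3

variable (F) in
lemma exists_mem_SL1 (h : IsTeich q d r ω π) :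
    ∃ ζ : SL1 F D, ((ζ : Dˣ) : D) = ω ^ (q ^ r - 1) := by
  let u : Dˣ := Units.mk0 π h.ne_zero
  let v : Dˣ := Units.mk0 ω h.root_ne_zero
  refine ⟨⟨u * v * u⁻¹ * v⁻¹, fun φ => ?_⟩, ?_⟩
  · have hinv : ∀ x : Dˣ, (φ (x : D)).det * (φ ((x⁻¹ : Dˣ) : D)).det = 1 := fun x => by
      rw [← Matrix.det_mul, ← map_mul, Units.mul_inv, map_one, Matrix.det_one]
    rw [Units.val_mul, Units.val_mul, Units.val_mul, map_mul, map_mul, map_mul, Matrix.det_mul,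
      Matrix.det_mul, Matrix.det_mul]
    linear_combination (φ (v : D)).det * (φ ((v⁻¹ : Dˣ) : D)).det * hinv u + hinv v
  · have hq : q ^ r ≠ 0 := pow_ne_zero _ (by have := h.one_lt; omega)
    change π * ω * π⁻¹ * ω⁻¹ = _
    rw [h.mul_eq, mul_inv_cancel_right₀ h.ne_zero, ← div_eq_mul_inv,
      div_eq_iff h.root_ne_zero, ← pow_succ, Nat.sub_add_cancel (Nat.pos_of_ne_zero hq)]

/-- If `d = 1`, there are no nonzero elements of trace zero. -/
lemma eq_zero_of_mem_trdZero [FiniteDimensional F D] (h : IsTeich q 1 r ω π) {x : D}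
    (hx : x ∈ trdZero F D) : x = 0 := by
  have h1 : Commute ω π := by simpa using (h.commute_uniformizer_pow ω).symm
  simpa using h.sum_conj_eq_zero hx (h.commute_of_forall (Commute.refl ω) h1 x).symm

end IsTeich

/-- Cocycles on the Lie algebra of elements of trace zero which are invariant under an element of
finite order become coboundaries, up to a bounded power of `p`, after restriction. -/
theorem exists_invariant_primitive [ProperSpace D] (hdiv : ∀ x : D, divAbs p x ≤ 1 ↔ ‖x‖ ≤ 1)
    (hp3 : 3 ≤ p) (hpd : ¬(p = 3 ∧ divDegree F D = 2 ∧ residueCard p F = 3)) {π₀ : D}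
    (h0 : π₀ ≠ 0) (h1 : ‖π₀‖ < 1) (hle : ∀ x : D, ‖x‖ < 1 → ‖x‖ ≤ ‖π₀‖) {n l : ℕ}
    (hn : n ≡ 1 [MOD divDegree F D]) (hl : l ≡ 1 [MOD divDegree F D]) (hnl : 2 * n < l) :
    ‖(p : D)‖ = ‖π₀‖ ^ (divDegree F D * ramIndex p F) ∧
    ∃ (ζ : SL1 F D) (N : ℕ), ¬p ∣ N ∧ ((ζ : Dˣ) : D) ^ N = 1 ∧
      ∀ (A : Type w) [AddCommGroup A] (s : ℕ) (f : D → D → A), (∀ x : A, p ^ s • x = 0) →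
        LevelCocycle (level ((trdZero F D).restrictScalars ℚ_[p]) (‖π₀‖ ^ n)) ((ζ : Dˣ) : D) f →
        ∃ θ : D → A, (∀ x ∈ level ((trdZero F D).restrictScalars ℚ_[p]) (‖π₀‖ ^ l),
            ∀ x' ∈ level ((trdZero F D).restrictScalars ℚ_[p]) (‖π₀‖ ^ l),
              θ (x + x') = θ x + θ x') ∧
          ∀ x ∈ level ((trdZero F D).restrictScalars ℚ_[p]) (‖π₀‖ ^ l),
            ∀ x' ∈ level ((trdZero F D).restrictScalars ℚ_[p]) (‖π₀‖ ^ l),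
              p ^ (padicValNat p (ramIndex p F) + 1) • f x x' = θ (x * x' - x' * x) := by
  have : FiniteDimensional F D := FiniteDimensional.right ℚ_[p] F D
  obtain ⟨g, d, r, ω, π, hg, hππ₀, h⟩ := exists_isTeich (p := p) h0 h1 hle
  have hd : divDegree F D = d := h.divDegree_eq
  obtain ⟨he0, he⟩ := h.ramIndex_spec (F := F) hdiv
  rw [hd] at hpd hn hl ⊢
  rw [← hππ₀]
  refine ⟨he, ?_⟩
  obtain ⟨ζ, hζ⟩ := h.exists_mem_SL1 F
  refine ⟨ζ, (p ^ g) ^ d - 1, ?_, ?_, fun A _ s f hA hf => ?_⟩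
  · intro hdvd
    have h2 : p ∣ (p ^ g) ^ d := by
      rw [← pow_mul]
      exact dvd_pow_self p (Nat.mul_pos hg h.pos).ne'
    have h3 := h.one_lt_pow
    have h4 := (Nat.dvd_sub_iff_right (by omega) h2).1 hdvd
    exact hp.out.one_lt.ne' (Nat.dvd_one.1 h4)
  · rw [hζ, ← pow_mul, mul_comm, pow_mul, h.pow_eq_one, one_pow]
  · rw [hζ] at hf
    rcases (show d = 1 ∨ 2 ≤ d by have := h.pos; omega) with rfl | hd2
    · refine ⟨0, fun _ _ _ _ => (add_zero _).symm, fun x hx x' hx' => ?_⟩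
      have hzero : ∀ x ∈ level ((trdZero F D).restrictScalars ℚ_[p]) (‖π‖ ^ l), x = 0 :=
        fun x hx => h.eq_zero_of_mem_trdZero (F := F)
          ((mem_level (pow_nonneg (norm_nonneg _) _)).1 hx).1
      rw [hzero x hx, hzero x' hx', hf.zero_left (zero_mem _), smul_zero]
      rfl
    · have hn1 : 1 ≤ n := by
        rcases Nat.eq_zero_or_pos n with rfl | h2
        · have := (Nat.modEq_iff_dvd' (zero_le_one)).1 hn
          have := Nat.le_of_dvd one_pos this
          omega
        · exact h2
      obtain ⟨t, ht⟩ := (Nat.modEq_iff_dvd' hn1).1 hn.symm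
      obtain ⟨t', ht'⟩ := (Nat.modEq_iff_dvd' (show 1 ≤ l by omega)).1 hl.symm
      obtain ⟨_, _, _, R⟩ := h.exists_residueData (p := p) (h.frobeniusData hg hdiv hp3 hpd hd2)
      refine h.exists_primitive (m₀ := t + 1) R h.isTraceSpace hA hf ?_ he0 he ?_
      · rw [mul_add]; omega
      · have h2 : t * 2 < t' := by
          by_contra hcon
          have := Nat.mul_le_mul_left d (not_lt.1 hcon)
          have h3 : d * (t * 2) = 2 * (d * t) := by ring
          omega
        have h3 := Nat.mul_le_mul_left d h2
        have h4 : d * (t * 2 + 1) = d * t + d * t + d := by ring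
        rw [Nat.succ_eq_add_one, h4] at h3
        rw [mul_add]
        omega

end TraceZero

section EquivariantSections

open Finset

variable {R : Type w} [CommRing R] {A : Type v} [AddCommGroup A] [Module R A]
  {H : Type u} [LieRing H] [LieAlgebra R H] {G : Type*} [Group G]

lemma LieAction.sum_conj_pow {L : Type*} [LieRing L] [LieAlgebra R L] (ρ : LieAction G R H)
    (τ : LieAction G R L) (s : H →ₗ[R] L) {g : G} {N : ℕ} (hg : g ^ N = 1) (h : H) :
    ∑ i ∈ range N, τ.act (g ^ i) (s (ρ.act (g⁻¹ ^ i) (ρ.act g h))) =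
      τ.act g (∑ i ∈ range N, τ.act (g ^ i) (s (ρ.act (g⁻¹ ^ i) h))) := by
  have h1 := sum_range_succ (fun i => τ.act (g ^ i) (s (ρ.act (g⁻¹ ^ i) (ρ.act g h)))) N
  rw [sum_range_succ', inv_pow g N, hg, inv_one, pow_zero, pow_zero] at h1
  rw [← add_right_cancel h1, map_sum]
  refine sum_congr rfl fun i _ => ?_
  rw [← τ.mul_act, ← ρ.mul_act, ← pow_succ', pow_succ g⁻¹, mul_assoc, inv_mul_cancel, mul_one]

/-- An equivariant central extension of a projective Lie algebra has a linear section that is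
equivariant for a given element of finite order invertible in `R`. -/
lemma CentralExtension.exists_equivariant_section [Module.Projective R H]
    (E : CentralExtension R A H) {ρ : LieAction G R H} {τ : LieAction G R E.L}
    (hτ : ∀ g x, E.proj (τ.act g x) = ρ.act g (E.proj x)) {g : G} {N : ℕ} (hg : g ^ N = 1)
    (hN : IsUnit (N : R)) :
    ∃ s : H →ₗ[R] E.L, (∀ h, E.proj (s h) = h) ∧ ∀ h, s (ρ.act g h) = τ.act g (s h) := by
  obtain ⟨s₀, hs₀⟩ := Module.projective_lifting_property E.proj.toLinearMap LinearMap.id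
    E.proj_surjective
  have hs₀' : ∀ h, E.proj (s₀ h) = h := fun h => LinearMap.congr_fun hs₀ h
  obtain ⟨c, hc⟩ := hN.exists_left_inv
  let s : H →ₗ[R] E.L := c • ∑ i ∈ range N,
    (τ.act (g ^ i)).toLinearMap ∘ₗ s₀ ∘ₗ (ρ.act (g⁻¹ ^ i)).toLinearMap
  have hs : ∀ h, s h = c • ∑ i ∈ range N, τ.act (g ^ i) (s₀ (ρ.act (g⁻¹ ^ i) h)) := fun h => by
    simp only [s, LinearMap.smul_apply, LinearMap.sum_apply]
    rfl
  refine ⟨s, fun h => ?_, fun h => ?_⟩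
  · rw [hs, map_smul, map_sum]
    have h1 : ∀ i ∈ range N, E.proj (τ.act (g ^ i) (s₀ (ρ.act (g⁻¹ ^ i) h))) = h := fun i _ => by
      rw [hτ, hs₀', ← ρ.mul_act, inv_pow, mul_inv_cancel, ρ.one_act]
    rw [sum_congr rfl h1, sum_const, card_range, ← Nat.cast_smul_eq_nsmul R, smul_smul, hc,
      one_smul]
  · rw [hs, hs, LieAction.sum_conj_pow ρ τ s₀ hg, map_smul]

end EquivariantSections

section Lattices

variable {D : Type u} [NormedDivisionRing D]
variable {p : ℕ} [hp : Fact p.Prime] [NormedAlgebra ℚ_[p] D] [FiniteDimensional ℚ_[p] D]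
variable [Algebra ℤ_[p] D] [IsScalarTower ℤ_[p] ℚ_[p] D]

/-- Bounded `ℤ_p`-submodules of `D` are finitely generated. -/
lemma finite_of_norm_le_one (M : Submodule ℤ_[p] D) (hM : ∀ x ∈ M, ‖x‖ ≤ 1) :
    Module.Finite ℤ_[p] M := by
  let b := Module.finBasis ℚ_[p] D
  let f := LinearMap.toContinuousLinearMap b.equivFun.toLinearMap
  obtain ⟨k, hk⟩ : ∃ k : ℕ, ‖f‖ ≤ (p : ℝ) ^ k :=
    (pow_unbounded_of_one_lt ‖f‖ (by exact_mod_cast hp.out.one_lt)).imp fun _ h => h.le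
  have hb : ∀ (x : M) i, ‖(p : ℚ_[p]) ^ k * b.equivFun (x : D) i‖ ≤ 1 := fun x i => by
    have h1 : ‖b.equivFun (x : D) i‖ ≤ (p : ℝ) ^ k :=
      (norm_le_pi_norm (b.equivFun (x : D)) i).trans ((f.le_opNorm x).trans
        ((mul_le_of_le_one_right (norm_nonneg _) (hM x x.2)).trans hk))
    have h2 : (0 : ℝ) < (p : ℝ) ^ k := pow_pos (by exact_mod_cast hp.out.pos) k
    rw [norm_mul, norm_pow, Padic.norm_p, inv_pow, inv_mul_eq_div, div_le_one h2]
    exact h1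
  let φ : M →ₗ[ℤ_[p]] (Fin (Module.finrank ℚ_[p] D) → ℤ_[p]) :=
    { toFun := fun x i => ⟨_, hb x i⟩
      map_add' := fun x y => funext fun i => Subtype.ext (by
        change (p : ℚ_[p]) ^ k * b.equivFun ((x : D) + y) i =
          (p : ℚ_[p]) ^ k * b.equivFun (x : D) i + (p : ℚ_[p]) ^ k * b.equivFun (y : D) i
        rw [map_add, Pi.add_apply, mul_add])
      map_smul' := fun c x => funext fun i => Subtype.ext (by
        change (p : ℚ_[p]) ^ k * b.equivFun (c • (x : D)) i =
          (c : ℚ_[p]) * ((p : ℚ_[p]) ^ k * b.equivFun (x : D) i)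
        rw [← IsScalarTower.algebraMap_smul ℚ_[p] c (x : D), map_smul, Pi.smul_apply, smul_eq_mul,
          mul_left_comm]
        rfl) }
  refine Module.Finite.of_injective φ ?_
  rw [injective_iff_map_eq_zero]
  intro x hx
  have h1 : ∀ i, (p : ℚ_[p]) ^ k * b.equivFun (x : D) i = 0 := fun i =>
    congrArg Subtype.val (congrFun hx i)
  have hp0 : (p : ℚ_[p]) ^ k ≠ 0 := pow_ne_zero k (Nat.cast_ne_zero.2 hp.out.ne_zero)
  apply Subtype.ext
  apply b.equivFun.injective
  rw [Submodule.coe_zero, map_zero]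
  exact funext fun i => (mul_eq_zero.1 (h1 i)).resolve_left hp0

lemma free_of_norm_le_one (M : Submodule ℤ_[p] D) (hM : ∀ x ∈ M, ‖x‖ ≤ 1) :
    Module.Free ℤ_[p] M := by
  have := finite_of_norm_le_one M hM
  have : Module.IsTorsionFree ℤ_[p] D := Module.IsTorsionFree.trans_faithfulSMul ℤ_[p] ℚ_[p] D
  exact Module.free_of_finite_type_torsion_free'

end Lattices

section DivNorm

variable (p : ℕ) [hp : Fact p.Prime] (D : Type u) [DivisionRing D] [Algebra ℚ_[p] D]
  [FiniteDimensional ℚ_[p] D]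

/-- The norm on `D` extending the norm of `ℚ_p`. -/
noncomputable def divNorm : AddGroupNorm D where
  toFun x := divAbs p x ^ ((Module.finrank ℚ_[p] D : ℝ)⁻¹)
  map_zero' := by
    have h0 : Module.finrank ℚ_[p] D ≠ 0 := Module.finrank_pos.ne'
    rw [divAbs_zero, Real.zero_rpow (inv_ne_zero (Nat.cast_ne_zero.2 h0))]
  add_le' x y := by
    have h0 : (0 : ℝ) ≤ (Module.finrank ℚ_[p] D : ℝ)⁻¹ := by positivity
    rcases le_max_iff.1 (divAbs_add_le p x y) with h | h
    · exact (Real.rpow_le_rpow (divAbs_nonneg p _) h h0).trans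
        (le_add_of_nonneg_right (Real.rpow_nonneg (divAbs_nonneg p _) _))
    · exact (Real.rpow_le_rpow (divAbs_nonneg p _) h h0).trans
        (le_add_of_nonneg_left (Real.rpow_nonneg (divAbs_nonneg p _) _))
  neg' x := by rw [divAbs_neg]
  eq_zero_of_map_eq_zero' x hx := by
    rw [Real.rpow_eq_zero_iff_of_nonneg (divAbs_nonneg p x)] at hx
    exact (divAbs_eq_zero p).1 hx.1

lemma divNorm_pow (x : D) : divNorm p D x ^ Module.finrank ℚ_[p] D = divAbs p x := by
  change (divAbs p x ^ ((Module.finrank ℚ_[p] D : ℝ)⁻¹)) ^ Module.finrank ℚ_[p] D = _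
  rw [Real.rpow_inv_natCast_pow (divAbs_nonneg p x) Module.finrank_pos.ne']

lemma divNorm_mul (x y : D) : divNorm p D (x * y) = divNorm p D x * divNorm p D y := by
  refine (pow_left_inj₀ (apply_nonneg _ _) (mul_nonneg (apply_nonneg _ _) (apply_nonneg _ _))
    (Module.finrank_pos (R := ℚ_[p]) (M := D)).ne').1 ?_
  rw [mul_pow, divNorm_pow, divNorm_pow, divNorm_pow, divAbs_mul]

lemma divNorm_algebraMap (c : ℚ_[p]) : divNorm p D (algebraMap ℚ_[p] D c) = ‖c‖ := by
  refine (pow_left_inj₀ (apply_nonneg _ _) (norm_nonneg _)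
    (Module.finrank_pos (R := ℚ_[p]) (M := D)).ne').1 ?_
  rw [divNorm_pow, divAbs_algebraMap]

/-- `D` as a normed division ring. -/
@[reducible] noncomputable def divNormedDivisionRing : NormedDivisionRing D where
  toNorm := ⟨divNorm p D⟩
  toDivisionRing := ‹DivisionRing D›
  toMetricSpace := (divNorm p D).toNormedAddCommGroup.toMetricSpace
  dist_eq x y := by with_reducible_and_instances rfl
  norm_mul x y := by
    have := divNorm_mul p D x y
    with_reducible_and_instances exact this

lemma norm_eq_divNorm (x : D) : (divNormedDivisionRing p D).norm x = divNorm p D x := rfl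

/-- `D` as a normed algebra. -/
@[reducible] noncomputable def divNormedAlgebra :
    letI := divNormedDivisionRing p D
    NormedAlgebra ℚ_[p] D :=
  letI := divNormedDivisionRing p D
  { toAlgebra := ‹Algebra ℚ_[p] D›
    norm_smul_le := fun c x => by
      have h1 := norm_mul (algebraMap ℚ_[p] D c) x
      rw [norm_eq_divNorm p D (algebraMap ℚ_[p] D c), divNorm_algebraMap] at h1
      rw [Algebra.smul_def, h1] }

end DivNorm

section CongruenceSubalgebras

variable {p : ℕ} [hp : Fact p.Prime] {F : Type v} [Field F] [Algebra ℚ_[p] F]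
  [FiniteDimensional ℚ_[p] F] {D : Type u} [DivisionRing D] [Algebra F D] [Algebra.IsCentral F D]
  [Algebra ℚ_[p] D] [IsScalarTower ℚ_[p] F D] [FiniteDimensional ℚ_[p] D] [Algebra ℤ_[p] D]
  [IsScalarTower ℤ_[p] ℚ_[p] D]

lemma divNorm_le_iff {x y : D} : divNorm p D x ≤ divNorm p D y ↔ divAbs p x ≤ divAbs p y := by
  rw [← divNorm_pow, ← divNorm_pow, pow_le_pow_iff_left₀ (apply_nonneg _ _) (apply_nonneg _ _)
    Module.finrank_pos.ne']

/-- Invariant cocycles on `𝔤_n` become coboundaries on `𝔤_l`, up to a bounded power of `p`. -/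
theorem exists_invariant_primitive_gAlg (π : DivUniformizer p D)
    (hp3 : 3 ≤ p) (hpd : ¬(p = 3 ∧ divDegree F D = 2 ∧ residueCard p F = 3)) {n l : ℕ}
    (hn : n ≡ 1 [MOD divDegree F D]) (hl : l ≡ 1 [MOD divDegree F D]) (hnl : 2 * n < l) :
    divAbs p (p : D) = divAbs p π.val ^ (divDegree F D * ramIndex p F) ∧
    Module.Free ℤ_[p] (gAlg F π n) ∧
    ∃ (ζ : SL1 F D) (N : ℕ), ¬p ∣ N ∧ ζ ^ N = 1 ∧
      ∀ (A : Type w) [AddCommGroup A] (s : ℕ) (f : D → D → A), (∀ x : A, p ^ s • x = 0) →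
        LevelCocycle (gAlg F π n).toSubmodule.toAddSubgroup ((ζ : Dˣ) : D) f →
        ∃ θ : D → A, (∀ x ∈ gAlg F π l, ∀ x' ∈ gAlg F π l, θ (x + x') = θ x + θ x') ∧
          ∀ x ∈ gAlg F π l, ∀ x' ∈ gAlg F π l,
            p ^ (padicValNat p (ramIndex p F) + 1) • f x x' = θ (x * x' - x' * x) := by
  let _ : NormedDivisionRing D := divNormedDivisionRing p D
  let _ : NormedAlgebra ℚ_[p] D := divNormedAlgebra p D
  have hle : ∀ x y : D, ‖x‖ ≤ ‖y‖ ↔ divAbs p x ≤ divAbs p y := fun x y => divNorm_le_iff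
  have hlt : ∀ x y : D, ‖x‖ < ‖y‖ ↔ divAbs p x < divAbs p y := fun x y => by
    rw [← not_le, hle, not_le]
  have h1 : ∀ x : D, divAbs p x ≤ 1 ↔ ‖x‖ ≤ 1 := fun x => by
    have := (hle x 1).symm
    rwa [norm_one, divAbs_one] at this
  have h1' : ∀ x : D, divAbs p x < 1 ↔ ‖x‖ < 1 := fun x => by
    have := (hlt x 1).symm
    rwa [norm_one, divAbs_one] at this
  have : IsUltrametricDist D :=
    IsUltrametricDist.isUltrametricDist_of_forall_norm_add_le_max_norm fun x y => by
      rcases le_max_iff.1 (divAbs_add_le p x y) with h | h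
      · exact le_max_of_le_left ((hle _ _).2 h)
      · exact le_max_of_le_right ((hle _ _).2 h)
  have : ProperSpace D := FiniteDimensional.proper ℚ_[p] D
  have hπ1 : ‖π.val‖ < 1 := (h1' _).1 ((π.mem_iff _).2 ⟨1, one_mem _, (mul_one _).symm⟩)
  have hπ : ∀ x : D, ‖x‖ < 1 → ‖x‖ ≤ ‖π.val‖ := fun x hx => by
    obtain ⟨y, hy, rfl⟩ := (π.mem_iff x).1 ((h1' x).2 hx)
    rw [norm_mul]
    exact mul_le_of_le_one_right (norm_nonneg _) ((h1 y).1 hy)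
  have hmem : ∀ {k : ℕ} {x : D}, x ∈ gAlg F π k ↔
      x ∈ level ((trdZero F D).restrictScalars ℚ_[p]) (‖π.val‖ ^ k) := fun {k x} => by
    rw [mem_level (pow_nonneg (norm_nonneg _) _), ← norm_pow, hle, divAbs_pow, ← mem_primePow]
    exact and_comm
  have hlev : ∀ k : ℕ, level ((trdZero F D).restrictScalars ℚ_[p]) (‖π.val‖ ^ k) =
      (gAlg F π k).toSubmodule.toAddSubgroup := fun k => AddSubgroup.ext fun x => hmem.symm
  obtain ⟨he, ζ, N, hN, hζ, H⟩ := exists_invariant_primitive.{u, v, w} (p := p) (F := F) h1 hp3 hpd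
    π.val_ne_zero hπ1 hπ hn hl hnl
  refine ⟨?_, free_of_norm_le_one (gAlg F π n).toSubmodule fun x hx => ?_, ζ, N, hN, ?_, ?_⟩
  · rw [← norm_pow] at he
    rw [← divAbs_pow]
    exact le_antisymm ((hle _ _).1 he.le) ((hle _ _).1 he.ge)
  · exact ((mem_level (pow_nonneg (norm_nonneg _) _)).1 (hmem.1 hx)).2.trans
      (pow_le_one₀ (norm_nonneg _) hπ1.le)
  · exact Subtype.ext (Units.ext hζ)
  · intro A _ s f hA hf
    rw [← hlev] at hf
    obtain ⟨θ, hθ, hθ'⟩ := H A s f hA hf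
    exact ⟨θ, fun x hx x' hx' => hθ x (hmem.1 hx) x' (hmem.1 hx'),
      fun x hx x' hx' => hθ' x (hmem.1 hx) x' (hmem.1 hx')⟩

lemma exists_eq_nsmul_of_mem_gAlg {π : DivUniformizer p D} {d e l m k : ℕ}
    (he : divAbs p (p : D) = divAbs p π.val ^ (d * e)) (hm : l + k * d * e ≤ m) {x : D}
    (hx : x ∈ gAlg F π m) : ∃ y ∈ gAlg F π l, x = p ^ k • y := by
  have hp0 : (p : D) ^ k ≠ 0 := by
    have h1 : (p : D) = algebraMap ℚ_[p] D p := (map_natCast _ _).symm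
    rw [h1]
    exact pow_ne_zero k ((map_ne_zero _).2 (Nat.cast_ne_zero.2 hp.out.ne_zero))
  have hxy : x = p ^ k • (((p : D) ^ k)⁻¹ * x) := by
    rw [nsmul_eq_mul, Nat.cast_pow, mul_inv_cancel_left₀ hp0]
  refine ⟨((p : D) ^ k)⁻¹ * x, ⟨?_, ?_⟩, hxy⟩
  · have h1 := mem_primePow.1 hx.1
    have hpos : 0 < divAbs p ((p : D) ^ k) :=
      (divAbs_nonneg p _).lt_of_ne fun h0 => hp0 ((divAbs_eq_zero p).1 h0.symm)
    rw [mem_primePow]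
    refine le_of_mul_le_mul_left ?_ hpos
    rw [← divAbs_mul, mul_inv_cancel_left₀ hp0, divAbs_pow, he, ← pow_mul, ← pow_add]
    refine h1.trans (pow_le_pow_of_le_one (divAbs_nonneg p _) π.divAbs_le_one ?_)
    calc d * e * k + l = l + k * d * e := by ring
      _ ≤ m := hm
  · have h1 : ((p : D) ^ k)⁻¹ * x = ((p : F) ^ k)⁻¹ • x := by
      rw [Algebra.smul_def, map_inv₀, map_pow, map_natCast]
    rw [h1]
    exact (trdZero F D).smul_mem _ hx.2

end CongruenceSubalgebras

section Assembly

variable {p : ℕ} [hp : Fact p.Prime]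

lemma CyclicMod.pow_smul_eq_zero (s : ℕ) (x : CyclicMod p s) : p ^ s • x = 0 := by
  obtain ⟨y, rfl⟩ := Ideal.Quotient.mk_surjective x
  rw [← map_nsmul, Ideal.Quotient.eq_zero_iff_mem, nsmul_eq_mul, Nat.cast_pow]
  exact Ideal.mul_mem_right _ _ (Ideal.mem_span_singleton_self _)

/-- Additive maps to `ℤ/p^s` are `ℤ_p`-linear. -/
lemma CyclicMod.map_smul {s : ℕ} {M : Type*} [AddCommGroup M] [Module ℤ_[p] M]
    (φ : M →+ CyclicMod p s) (c : ℤ_[p]) (x : M) : φ (c • x) = c • φ x := by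
  obtain ⟨b, hb⟩ := Ideal.mem_span_singleton.1 (PadicInt.appr_spec s c)
  have hc : c = (c.appr s : ℤ_[p]) + (p ^ s : ℕ) * b := by
    rw [Nat.cast_pow, ← hb]
    ring
  rw [hc, add_smul, add_smul, mul_smul, mul_smul, Nat.cast_smul_eq_nsmul, Nat.cast_smul_eq_nsmul,
    Nat.cast_smul_eq_nsmul, Nat.cast_smul_eq_nsmul, map_add, map_nsmul, map_nsmul,
    pow_smul_eq_zero, pow_smul_eq_zero]

lemma PadicInt.isUnit_natCast_of_not_dvd {N : ℕ} (hN : ¬p ∣ N) : IsUnit (N : ℤ_[p]) := by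
  rw [PadicInt.isUnit_iff]
  refine le_antisymm (PadicInt.norm_le_one _) (not_lt.1 fun h => hN ?_)
  have := (PadicInt.norm_int_lt_one_iff_dvd (p := p) (N : ℤ)).1 (by exact_mod_cast h)
  exact_mod_cast this

variable {F : Type v} [Field F] {D : Type u} [DivisionRing D] [Algebra F D]
  [Algebra ℚ_[p] D] [FiniteDimensional ℚ_[p] D] [Algebra ℤ_[p] D] [IsScalarTower ℤ_[p] ℚ_[p] D]
  [Algebra ℚ_[p] F] [IsScalarTower ℚ_[p] F D]

open Classical in
/-- The extension by zero of a bilinear map on `𝔤_n` to `D`. -/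
noncomputable def extendByZero {π : DivUniformizer p D} {n : ℕ} {A : Type*} [AddCommGroup A]
    [Module ℤ_[p] A] (f : gAlg F π n →ₗ[ℤ_[p]] gAlg F π n →ₗ[ℤ_[p]] A) (x y : D) : A :=
  if h : x ∈ gAlg F π n ∧ y ∈ gAlg F π n then f ⟨x, h.1⟩ ⟨y, h.2⟩ else 0

lemma extendByZero_coe {π : DivUniformizer p D} {n : ℕ} {A : Type*} [AddCommGroup A]
    [Module ℤ_[p] A] (f : gAlg F π n →ₗ[ℤ_[p]] gAlg F π n →ₗ[ℤ_[p]] A) {x y : D}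
    (hx : x ∈ gAlg F π n) (hy : y ∈ gAlg F π n) : extendByZero f x y = f ⟨x, hx⟩ ⟨y, hy⟩ :=
  dif_pos ⟨hx, hy⟩

lemma levelCocycle_extendByZero {π : DivUniformizer p D} {n : ℕ} {A : Type*} [AddCommGroup A]
    [Module ℤ_[p] A] {f : gAlg F π n →ₗ[ℤ_[p]] gAlg F π n →ₗ[ℤ_[p]] A} (ζ : SL1 F D)
    (hf : ∀ u, f u u = 0) (hfj : ∀ u v w, f ⁅u, v⁆ w + f ⁅v, w⁆ u + f ⁅w, u⁆ v = 0)
    (hfζ : ∀ u v, f ((conjAction F π n).act ζ u) ((conjAction F π n).act ζ v) = f u v) :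
    LevelCocycle (gAlg F π n).toSubmodule.toAddSubgroup ((ζ : Dˣ) : D) (extendByZero f) where
  add_left {x x' y} hx hx' hy := by
    rw [extendByZero_coe f (add_mem hx hx') hy, extendByZero_coe f hx hy,
      extendByZero_coe f hx' hy, ← LinearMap.add_apply, ← map_add]
    rfl
  antisymm {x y} hx hy := by
    rw [extendByZero_coe f hx hy, extendByZero_coe f hy hx]
    have h1 := hf (⟨x, hx⟩ + ⟨y, hy⟩)
    rw [map_add f, LinearMap.add_apply, map_add, map_add, hf, hf, zero_add, add_zero] at h1
    exact eq_neg_of_add_eq_zero_left h1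
  jacobi {x y z} hx hy hz := by
    change extendByZero f ⁅x, y⁆ z + extendByZero f ⁅y, z⁆ x + extendByZero f ⁅z, x⁆ y = 0
    rw [extendByZero_coe f ((gAlg F π n).lie_mem hx hy) hz,
      extendByZero_coe f ((gAlg F π n).lie_mem hy hz) hx,
      extendByZero_coe f ((gAlg F π n).lie_mem hz hx) hy]
    exact hfj ⟨x, hx⟩ ⟨y, hy⟩ ⟨z, hz⟩
  conj {x y} hx hy := by
    have h1 : ∀ z (hz : z ∈ gAlg F π n), ((ζ : Dˣ) : D) * z * ((ζ : Dˣ) : D)⁻¹ =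
        ((conjAction F π n).act ζ ⟨z, hz⟩ : D) := fun z hz => by
      rw [← Units.val_inv_eq_inv_val]
      rfl
    rw [h1 x hx, h1 y hy, extendByZero_coe f (Subtype.property _) (Subtype.property _),
      extendByZero_coe f hx hy]
    exact hfζ _ _

/-- The cocycle of an equivariant central extension with an equivariant section is invariant. -/
lemma CentralExtension.cocycle_act {R : Type w} [CommRing R] {A : Type v} [AddCommGroup A]
    [Module R A] {H : Type u} [LieRing H] [LieAlgebra R H] {G : Type*} [Group G]
    {E : CentralExtension R A H} {ρ : LieAction G R H} {τ : LieAction G R E.L}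
    (hτ : ∀ g a, τ.act g (E.incl a) = E.incl a) {g : G} {s : H →ₗ[R] E.L}
    (hs : ∀ h, s (ρ.act g h) = τ.act g (s h)) {f : H →ₗ[R] H →ₗ[R] A}
    (hf : ∀ u v, E.incl (f u v) = ⁅s u, s v⁆ - s ⁅u, v⁆) (u v : H) :
    f (ρ.act g u) (ρ.act g v) = f u v := by
  apply E.incl_injective
  rw [hf, hs, hs, ← LieHom.map_lie, ← LieHom.map_lie, hs, ← map_sub, ← hf, hτ]

end Assembly

theorem theorem6p2 (p : ℕ) [Fact p.Prime]
    -- a `p`-adic field `F` and a finite-dimensional central division algebra `D` over `F`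
    (F : Type*) [Field F] [Algebra ℚ_[p] F] [FiniteDimensional ℚ_[p] F]
    (D : Type*) [DivisionRing D] [Algebra F D] [Algebra.IsCentral F D]
    [Algebra ℚ_[p] D] [IsScalarTower ℚ_[p] F D] [FiniteDimensional ℚ_[p] D]
    [Algebra ℤ_[p] D] [IsScalarTower ℤ_[p] ℚ_[p] D]
    (π : DivUniformizer p D) (s d e w n l : ℕ) (hd : d = divDegree F D) (he : e = ramIndex p F)
    (hw : w = padicValNat p e) (hp : 3 ≤ p) (hpd : ¬(p = 3 ∧ d = 2 ∧ residueCard p F = 3))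
    (hn : n ≡ 1 [MOD d]) (hl : l ≡ 1 [MOD d]) (hnl : 2 * n < l)
    (c : LieH2 ℤ_[p] (CyclicMod p s) (gAlg F π n)) (hc : c.IsEquivariant (conjAction F π n))
    (c₁ : LieH2 ℤ_[p] (CyclicMod p s) (gAlg F π l))
    (hc₁ : c₁ = LieH2.restrict (gAlg_antitone F π (show n ≤ l by omega)) c) :
    (0 < addOrderOf c₁ ∧ addOrderOf c₁ ≤ p ^ (w + 1)) ∧
      ∀ m : ℕ, l + (w + 1) * d * e ≤ m →
        ∃ c₂ : LieH2 ℤ_[p] (CyclicMod p s) (gAlg F π l ⧸ gIdeal F π l m),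
          (0 < addOrderOf c₂ ∧ addOrderOf c₂ ≤ p ^ (w + 1)) ∧
            LieH2.inflate (gIdeal F π l m) c₂ = c₁ := by
  subst hd he hw
  obtain ⟨hpe, hfree, ζ, N, hN, hζ, H⟩ := exists_invariant_primitive_gAlg π hp hpd hn hl hnl
  obtain ⟨E, ⟨τ, hτ, hτ'⟩, rfl⟩ := hc
  obtain ⟨σ, hσ, hσζ⟩ := E.exists_equivariant_section hτ' hζ
    (PadicInt.isUnit_natCast_of_not_dvd hN)
  obtain ⟨f, r, hf, hf0, hfj, hr, hrf⟩ := E.exists_cocycle σ hσ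
  obtain ⟨θ, hθ, hθf⟩ := H (CyclicMod p s) s (extendByZero f) (CyclicMod.pow_smul_eq_zero s)
    (levelCocycle_extendByZero ζ hf0 hfj (CentralExtension.cocycle_act hτ hσζ hf))
  set j := padicValNat p (ramIndex p F) + 1
  have hle : n ≤ l := by omega
  have hgle := gAlg_antitone F π hle
  let θ' : gAlg F π l →+ CyclicMod p s :=
    AddMonoidHom.mk' (fun x => θ x) fun x y => hθ x x.2 y y.2
  let E' := CentralExtension.pullback (LieSubalgebra.inclusion hgle) E
  let t : E'.L →ₗ[ℤ_[p]] CyclicMod p s :=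
    { toFun := fun z => p ^ j • r z.1.1 - θ' z.1.2
      map_add' := fun x y => by
        change p ^ j • r (x.1.1 + y.1.1) - θ' (x.1.2 + y.1.2) = _
        rw [map_add, map_add, smul_add]
        abel
      map_smul' := fun a x => by
        change p ^ j • r (a • x.1.1) - θ' (a • x.1.2) = a • (p ^ j • r x.1.1 - θ' x.1.2)
        rw [map_smul, CyclicMod.map_smul, smul_sub, smul_comm] }
  have ht : ∀ a, t (E'.incl a) = p ^ j • a := fun a => by
    change p ^ j • r (E.incl a) - θ' 0 = _
    rw [hr, map_zero, sub_zero]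
  have ht' : ∀ x y : E'.L, t ⁅x, y⁆ = 0 := fun x y => by
    change p ^ j • r ⁅x.1.1, y.1.1⁆ - θ (⁅x.1.2, y.1.2⁆ : gAlg F π l) = 0
    have h1 := hθf x.1.2 x.1.2.2 y.1.2 y.1.2.2
    rw [extendByZero_coe f (hgle x.1.2.2) (hgle y.1.2.2)] at h1
    have hx : E.proj x.1.1 = ⟨x.1.2, hgle x.1.2.2⟩ := x.2
    have hy : E.proj y.1.1 = ⟨y.1.2, hgle y.1.2.2⟩ := y.2
    rw [hrf, hx, hy, h1]
    exact sub_self _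
  have hord : ∀ {M : Type _} [AddCommGroup M] (x : M), p ^ j • x = 0 →
      0 < addOrderOf x ∧ addOrderOf x ≤ p ^ j := fun x hx =>
    have hpos : 0 < p ^ j := pow_pos (by omega) j
    have h1 := addOrderOf_dvd_of_nsmul_eq_zero hx
    ⟨Nat.pos_of_dvd_of_pos h1 hpos, Nat.le_of_dvd hpos h1⟩
  have hc₁' : c₁ = LieH2.mk E' := hc₁
  rw [hc₁']
  refine ⟨hord _ (E'.nsmul_mk_eq_zero (p ^ j) t ht ht'), fun m hm => ?_⟩
  obtain ⟨c₂, hc₂, hc₂'⟩ := E'.exists_inflate_eq (p ^ j) t ht ht' (gIdeal F π l m)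
    (fun x hx => by
      obtain ⟨y, hy, hxy⟩ := exists_eq_nsmul_of_mem_gAlg hpe hm hx
      exact ⟨⟨y, hy⟩, Subtype.ext hxy⟩)
    (fun x hx => by
      have hp0 : (p : ℚ_[p]) ^ j ≠ 0 :=
        pow_ne_zero j (Nat.cast_ne_zero.2 (Fact.out : p.Prime).ne_zero)
      have h1 : p ^ j • (x : D) = 0 := congrArg Subtype.val hx
      rw [← Nat.cast_smul_eq_nsmul ℚ_[p], Nat.cast_pow, smul_eq_zero] at h1
      exact Subtype.ext (h1.resolve_left hp0))
  exact ⟨c₂, hord _ hc₂, hc₂'⟩
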